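/- **Setting.** Let $V$ be a finite-dimensional simple real Jordan algebra with unit $e$, $L(x)$ multiplication by $x$, $P(x)=2L(x)^2-L(x^2)$, $P(x,y)=L(x)L(y)+L(y)L(x)-L(xy)$, $n=\dim V$, rank $r$, Jordan trace $\mathrm{tr}(x)=\frac rn\mathrm{Tr}\,L(x)$ and trace form $\tau(x,y)=\mathrm{tr}(xy)$. Let $\vartheta$ be a Cartan involution, i.e. an involutive automorphism such that $(x|y)=\tau(x,\vartheta y)$ is positive definite, and assume that the fixed algebra $V^+=\{x:\vartheta x=x\}$ is simple. Let $r_0$ be the rank of $V^+$, $c_1,\dots,c_{r_0}$ a Jordan frame of $V^+$ (orthogonal primitive idempotents with sum $e$), $V_{ij}=\{x: c_kx=\frac{\delta_{ik}+\delta_{jk}}2x\ \forall k\}$, $e_V=\dim V_{11}-1$, $d=\dim V_{12}$, $d_0=\dim(V_{12}\cap V^+)$ (with $d=d_0=0$ if $r_0=1$), and $$\nu=\min(d,2d_0)-d_0-e_V-1,\qquad \lambda_1=\frac{r_0d}{2r},\qquad |x|=\sqrt{r/r_0}\,(x|x)^{1/2}.$$ Let $\mathrm{Str}(V)$ be the group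 of $g\in GL(V)$ for which there is $h\in GL(V)$ with $P(gx)=gP(x)h$ for all $x$; let $L$ be its identity component, $\mathfrak l$ its Lie algebra, $K_L=\{g\in L: g^*=g^{-1}\}$ (adjoint with respect to $(\cdot|\cdot)$), and $\mathcal O=L\cdot c_1$. For $\lambda=\lambda_1$ if $r_0>1$, and any $\lambda>0$ if $r_0=1$, let $d\mu_\lambda$ be the measure on $\mathcal O$ with $$\int_{\mathcal O}f\,d\mu_\lambda=\int_{K_L}\int_0^\infty f(utc_1)\,t^{\lambda r-1}\,dt\,du,$$ $du$ being the normalized Haar measure. The conformal algebra $\mathfrak g=\{(u,T,v):u,v\in V,\ T\in\mathfrak l\}$ acts on $C^\infty(\mathcal O)$ by $$d\pi_\lambda(u,0,0)\psi(x)=i(x|u)\psi(x),\quad d\pi_\lambda(0,T,0)\psi(x)=D_{T^*x}\psi(x)+\tfrac{r\lambda}{2n}\mathrm{Tr}(T^*)\psi(x),\quad d\pi_\lambda(0,0,-v)\psi(x)=\tfrac1i(\mathcal B_\lambda\psi(x)|v),$$ where $\mathcal B_\lambda=\sum_{\alpha,\beta}P(\bar e_\alpha,\bar e_\beta)x\,\partial_\alpha\partial_\beta+\lambda\sum_\alpha\bar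 e_\alpha\partial_\alpha$ is the Bessel operator ($(e_\alpha)$ a basis of $V$, $(\bar e_\alpha)$ its $\tau$-dual basis), which is tangential to $\mathcal O$. Let $K_\alpha$ be the $K$-Bessel function, $\widetilde K_\alpha(z)=(z/2)^{-\alpha}K_\alpha(z)$, $\sigma=r\lambda$ if $r_0=1$, and $$\psi_0(x)=\widetilde K_{\nu/2}(|x|)\ (r_0>1),\qquad \psi_0(x)=\widetilde K_{(\nu+\sigma)/2}(|x|)\ (r_0=1),\qquad W=d\pi_\lambda(U(\mathfrak g))\psi_0\subseteq C^\infty(\mathcal O).$$ Let $\mathbb C[\mathcal O]_{\ge k}$ be the space of restrictions to $\mathcal O$ of sums of homogeneous complex polynomials on $V$ of degree $\ge k$, and $\widetilde K_\alpha\otimes\mathbb C[\mathcal O]_{\ge k}$ the space of functions $x\mapsto\widetilde K_\alpha(|x|)\varphi(x)$ on $\mathcal O$ with $\varphi\in\mathbb C[\mathcal O]_{\ge k}$. For $p\ge1,\ q\ge0$ let $\mathbb R^{p,q}=\mathbb R\times\mathbb R^{p-1}\times\mathbb R^{q}$ with product $(a,u)(b,v)=(ab+\beta(u,v),av+bu)$,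 where $\beta$ is minus the standard form on $\mathbb R^{p-1}$ plus the standard form on $\mathbb R^q$. The sums below are sums of subspaces of functions on $\mathcal O$ (not necessarily direct). **Proposition.** (a) If $r\ge3$, then with $\lambda=\lambda_1$ $$W\subseteq\sum_{\ell=0}^\infty\widetilde K_{\frac\nu2+\ell}\otimes\mathbb C[\mathcal O]_{\ge2\ell}\subseteq L^2(\mathcal O,d\mu_{\lambda_1}).$$ (b) If $V\cong\mathbb R^{p,q}$ with $p,q\ge2$ and $p+q$ even, then with $\lambda=\lambda_1$ $$W\subseteq\sum_{\ell=0}^\infty\ \sum_{k=0}^{|p-q|/2}\widetilde K_{\frac\nu2+k+\ell}\otimes\mathbb C[\mathcal O]_{\ge k+2\ell}\subseteq L^2(\mathcal O,d\mu_{\lambda_1}).$$ (c) If $V\cong\mathbb R^{k,0}$ with $k\ge1$, then $\nu=-k$, and for every $\lambda>0$, with $\sigma=r\lambda$, $$W\subseteq\sum_{\ell=0}^\infty\widetilde K_{\frac{\nu+\sigma}2+\ell}\otimes\mathbb C[\mathcal O]_{\ge2\ell},$$ and $W\subseteq L^2(\mathcal O,d\mu_\lambda)$ if and only if $\sigma\in(0,2k)$.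 (d) If $r_0=1$, then for every $\lambda>0$, with $\sigma=r\lambda$, $W\subseteq L^2(\mathcal O,d\mu_\lambda)$ if and only if $\sigma\in(0,-2\nu)$. -/

import Mathlib

open MeasureTheory Module
open scoped InnerProductSpace ContDiff

noncomputable section

namespace MinRep

/-- A (unital, real) Jordan algebra structure on a real vector space `V`: a commutative bilinear
product with unit satisfying the Jordan identity `(x y) (x x) = x (y (x x))`
(the identity of Mathlib's `IsCommJordan`). -/
structure JordanAlgebra (V : Type*) [AddCommGroup V] [Module ℝ V] where
  mul : V →ₗ[ℝ] V →ₗ[ℝ] V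
  one : V
  mul_comm : ∀ x y, mul x y = mul y x
  jordan : ∀ x y, mul (mul x y) (mul x x) = mul x (mul y (mul x x))
  one_mul : ∀ x, mul one x = x

namespace JordanAlgebra

section Algebra

variable {V : Type*} [AddCommGroup V] [Module ℝ V] (J : JordanAlgebra V)

/-- Multiplication operator `L(x)`. -/
def L (x : V) : V →ₗ[ℝ] V := J.mul x

/-- Quadratic representation `P(x) = 2 L(x)² - L(x²)`. -/
def P (x : V) : V →ₗ[ℝ] V := (2 : ℝ) • (J.L x ∘ₗ J.L x) - J.L (J.mul x x)

/-- Polarized quadratic representation `P(x,y) = L(x)L(y) + L(y)L(x) - L(xy)`. -/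
def P₂ (x y : V) : V →ₗ[ℝ] V := J.L x ∘ₗ J.L y + J.L y ∘ₗ J.L x - J.L (J.mul x y)

/-- The subalgebra `ℝ[x]` spanned by the powers `e, x, x², …`. Its dimension is the degree of
the minimal polynomial of `x`. -/
def powerSpan (x : V) : Submodule ℝ V :=
  Submodule.span ℝ (Set.range fun k : ℕ => ((J.L x) ^ k) J.one)

/-- The rank: the degree of a generic minimal polynomial, i.e. the largest degree of the minimal
polynomial of an element. -/
def rank : ℕ := sSup (Set.range fun x : V => finrank ℝ (J.powerSpan x))

/-- The Jordan trace `tr(x) = (r/n) Tr L(x)`. -/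
def tr (x : V) : ℝ := (J.rank : ℝ) / (finrank ℝ V : ℝ) * LinearMap.trace ℝ V (J.L x)

/-- The trace form `τ(x,y) = tr(xy)`. -/
def τ (x y : V) : ℝ := J.tr (J.mul x y)

/-- `V` is simple: nonzero, with nondegenerate trace form, and without nontrivial ideals. -/
def IsSimple : Prop :=
  Nontrivial V ∧ (∀ x, (∀ y, J.τ x y = 0) → x = 0) ∧
    ∀ I : Submodule ℝ V, (∀ x, ∀ y ∈ I, J.mul x y ∈ I) → I = ⊥ ∨ I = ⊤

/-- The Jordan product on `ℝ^{p,q} = ℝ × W`, `W = ℝ^{p-1} × ℝ^q` (`p ≥ 1`):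
`(a,u)(b,v) = (ab + β(u,v), av + bu)`, where `β` is minus the standard form on `ℝ^{p-1}`
plus the standard form on `ℝ^q`. -/
def rpqMul {m q : ℕ} (x y : ℝ × (Fin m → ℝ) × (Fin q → ℝ)) : ℝ × (Fin m → ℝ) × (Fin q → ℝ) :=
  (x.1 * y.1 + (-(∑ i, x.2.1 i * y.2.1 i) + ∑ j, x.2.2 j * y.2.2 j),
    x.1 • y.2 + y.1 • x.2)

/-- `V` is isomorphic to the Jordan algebra `ℝ^{p,q}`, `p ≥ 1`. -/
def IsRpq (p q : ℕ) : Prop :=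
  1 ≤ p ∧ ∃ Φ : V ≃ₗ[ℝ] ℝ × (Fin (p - 1) → ℝ) × (Fin q → ℝ),
    ∀ x y, Φ (J.mul x y) = rpqMul (Φ x) (Φ y)

/-- The Jordan algebra structure of a unital subalgebra. -/
def sub (S : Submodule ℝ V) (h1 : J.one ∈ S) (hm : ∀ x ∈ S, ∀ y ∈ S, J.mul x y ∈ S) :
    JordanAlgebra S where
  mul := LinearMap.mk₂ ℝ (fun x y : S => (⟨J.mul x y, hm x x.2 y y.2⟩ : S))
    (fun x y z => by ext; simp) (fun a x y => by ext; simp)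
    (fun x y z => by ext; simp) (fun a x y => by ext; simp)
  one := ⟨J.one, h1⟩
  mul_comm x y := by ext; simpa using J.mul_comm x y
  jordan x y := by ext; simpa using J.jordan x y
  one_mul x := by ext; simpa using J.one_mul x

theorem P_one (y : V) : J.P J.one y = y := by
  have h : J.mul J.one = LinearMap.id := LinearMap.ext J.one_mul
  simp [P, L, h, two_smul]

theorem P_smul (t : ℝ) (x y : V) : J.P (t • x) y = t • J.P x (t • y) := by
  simp only [P, L, map_smul, LinearMap.smul_apply, LinearMap.sub_apply, LinearMap.comp_apply,
    smul_sub, smul_smul]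
  congr 2
  ring

end Algebra

section Euclid

variable {V : Type*} [NormedAddCommGroup V] [InnerProductSpace ℝ V]

/-- A Cartan involution `ϑ` of `V`: an involutive automorphism such that `τ(x, ϑ y)` is positive
definite. Here `V` is taken with the inner product `(x|y) = τ(x, ϑ y)`. -/
structure CartanInvolution (J : JordanAlgebra V) where
  toFun : V →ₗ[ℝ] V
  invol : ∀ x, toFun (toFun x) = x
  map_mul : ∀ x y, toFun (J.mul x y) = J.mul (toFun x) (toFun y)
  inner_eq : ∀ x y, ⟪x, y⟫_ℝ = J.τ x (toFun y)

variable (J : JordanAlgebra V) (ϑ : CartanInvolution J)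

theorem CartanInvolution.map_one : ϑ.toFun J.one = J.one := by
  have h := ϑ.map_mul J.one (ϑ.toFun J.one)
  rw [J.one_mul, ϑ.invol, J.mul_comm, J.one_mul] at h
  exact h.symm

/-- The fixed space `V⁺` of `ϑ`. -/
def plusSpace : Submodule ℝ V := LinearMap.eqLocus ϑ.toFun LinearMap.id

/-- The euclidean Jordan subalgebra `V⁺`. -/
def plus : JordanAlgebra (plusSpace J ϑ) :=
  J.sub (plusSpace J ϑ) (CartanInvolution.map_one J ϑ) (by
    intro x hx y hy
    change ϑ.toFun _ = _
    change ϑ.toFun x = x at hx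
    change ϑ.toFun y = y at hy
    rw [ϑ.map_mul, hx, hy]
    rfl)

/-- The split rank `r₀`. -/
def splitRank : ℕ := (plus J ϑ).rank

/-- A Jordan frame `c₁, …, c_{r₀}` in `V⁺`: orthogonal primitive idempotents with sum `e`. -/
structure IsJordanFrame (c : Fin (splitRank J ϑ) → V) : Prop where
  mem : ∀ i, c i ∈ plusSpace J ϑ
  idem : ∀ i, J.mul (c i) (c i) = c i
  ne_zero : ∀ i, c i ≠ 0
  primitive : ∀ i, ∀ a ∈ plusSpace J ϑ, ∀ b ∈ plusSpace J ϑ, J.mul a a = a → J.mul b b = b →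
    c i = a + b → a = 0 ∨ b = 0
  orth : ∀ i j, i ≠ j → J.mul (c i) (c j) = 0
  sum : ∑ i, c i = J.one

variable (c : Fin (splitRank J ϑ) → V)

/-- The Peirce space `V_{ij} = {x : L(c_k) x = ((δ_ik + δ_jk)/2) x for all k}`. -/
def peirce (i j : Fin (splitRank J ϑ)) : Submodule ℝ V :=
  ⨅ k, LinearMap.ker (J.L (c k) -
    ((((if i = k then 1 else 0) + (if j = k then 1 else 0)) / 2 : ℝ)) • LinearMap.id)

/-- The first idempotent `c₁` of the frame (`r₀ ≥ 1` for nonzero `V`). -/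
def c₁ : V := if h : 0 < splitRank J ϑ then c ⟨0, h⟩ else 0

/-- `d = dim V₁₂` (and `d = 0` if `r₀ = 1`). -/
def dConst : ℕ :=
  if h : 1 < splitRank J ϑ then
    finrank ℝ (peirce J ϑ c ⟨0, Nat.lt_trans Nat.zero_lt_one h⟩ ⟨1, h⟩) else 0

/-- `d₀ = dim (V₁₂ ∩ V⁺)` (and `d₀ = 0` if `r₀ = 1`). -/
def d₀Const : ℕ :=
  if h : 1 < splitRank J ϑ then
    finrank ℝ ↥(peirce J ϑ c ⟨0, Nat.lt_trans Nat.zero_lt_one h⟩ ⟨1, h⟩ ⊓ plusSpace J ϑ) else 0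

/-- `e`, where `e + 1 = dim V₁₁`. -/
def eConst : ℤ :=
  if h : 0 < splitRank J ϑ then (finrank ℝ (peirce J ϑ c ⟨0, h⟩ ⟨0, h⟩) : ℤ) - 1 else 0

/-- `ν = min(d, 2 d₀) - d₀ - e - 1`. -/
def ν : ℤ :=
  min (dConst J ϑ c : ℤ) (2 * (d₀Const J ϑ c : ℤ)) - (d₀Const J ϑ c : ℤ) - eConst J ϑ c - 1

/-- `λ₁ = r₀ d / (2 r)`, the minimal nonzero discrete Wallach point if `r₀ > 1`. -/
def lam₁ : ℝ := (splitRank J ϑ : ℝ) * (dConst J ϑ c : ℝ) / (2 * (J.rank : ℝ))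

/-- The normalized length `|x| = √(r/r₀) ‖x‖`, with `‖x‖² = (x|x)`. -/
def absV (x : V) : ℝ := Real.sqrt ((J.rank : ℝ) / (splitRank J ϑ : ℝ)) * ‖x‖

end Euclid

section Group

variable {V : Type*} [NormedAddCommGroup V] [InnerProductSpace ℝ V]

theorem apply_inv (g : (V →L[ℝ] V)ˣ) (x : V) :
    (g : V →L[ℝ] V) (((g⁻¹ : (V →L[ℝ] V)ˣ) : V →L[ℝ] V) x) = x :=
  congrArg (fun f : V →L[ℝ] V => f x) (Units.mul_inv g)

theorem inv_apply (g : (V →L[ℝ] V)ˣ) (x : V) :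
    ((g⁻¹ : (V →L[ℝ] V)ˣ) : V →L[ℝ] V) ((g : V →L[ℝ] V) x) = x :=
  congrArg (fun f : V →L[ℝ] V => f x) (Units.inv_mul g)

/-- The structure group `Str(V)`: all `g ∈ GL(V)` such that there is `h ∈ GL(V)` with
`P(g x) = g P(x) h` for all `x`. -/
def Str (J : JordanAlgebra V) : Subgroup (V →L[ℝ] V)ˣ where
  carrier := {g | ∃ h : (V →L[ℝ] V)ˣ, ∀ x y : V,
    J.P ((g : V →L[ℝ] V) x) y = (g : V →L[ℝ] V) (J.P x ((h : V →L[ℝ] V) y))}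
  one_mem' := ⟨1, fun x y => by simp⟩
  mul_mem' := by
    rintro g g' ⟨h, hh⟩ ⟨h', hh'⟩
    exact ⟨h' * h, fun x y => by simp [hh, hh']⟩
  inv_mem' := by
    rintro g ⟨h, hh⟩
    refine ⟨h⁻¹, fun x y => ?_⟩
    have h1 := hh (((g⁻¹ : (V →L[ℝ] V)ˣ) : V →L[ℝ] V) x) (((h⁻¹ : (V →L[ℝ] V)ˣ) : V →L[ℝ] V) y)
    rw [apply_inv, apply_inv] at h1
    rw [h1, inv_apply]

/-- The identity component `L = Str(V)₀`. -/
def Lgrp (J : JordanAlgebra V) : Subgroup (V →L[ℝ] V)ˣ :=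
  (Subgroup.connectedComponentOfOne (Str J)).map (Str J).subtype

/-- The Lie algebra `𝔩 = 𝔰𝔱𝔯(V)` of `Str(V)`: all `T` with `exp(tT) ∈ Str(V)` for all real `t`. -/
def strAlg (J : JordanAlgebra V) : Set (V →L[ℝ] V) :=
  {T | ∀ t : ℝ, ∃ g ∈ Str J, (g : V →L[ℝ] V) = NormedSpace.exp (t • T)}

/-- The maximal compact subgroup `K_L` of `L`: all `g ∈ L` with `g* = g⁻¹`, where `g*` is the
adjoint with respect to `(·|·)`. -/
def KL (J : JordanAlgebra V) : Subgroup (V →L[ℝ] V)ˣ where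
  carrier := {g | g ∈ Lgrp J ∧ ∀ x y : V, ⟪(g : V →L[ℝ] V) x, (g : V →L[ℝ] V) y⟫_ℝ = ⟪x, y⟫_ℝ}
  one_mem' := ⟨one_mem _, fun x y => by simp⟩
  mul_mem' := by
    rintro g g' ⟨h, hh⟩ ⟨h', hh'⟩
    exact ⟨mul_mem h h', fun x y => by simp [hh, hh']⟩
  inv_mem' := by
    rintro g ⟨h, hh⟩
    refine ⟨inv_mem h, fun x y => ?_⟩
    rw [← hh, apply_inv, apply_inv]

/-- The orbit `L · a`. -/
def orbit (J : JordanAlgebra V) (a : V) : Set V := {x | ∃ g ∈ Lgrp J, x = (g : V →L[ℝ] V) a}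

instance (J : JordanAlgebra V) : MeasurableSpace (KL J) := borel _
instance (J : JordanAlgebra V) : BorelSpace (KL J) := ⟨rfl⟩

theorem scalar_mem_Lgrp (J : JordanAlgebra V) (t : ℝ) (ht : 0 < t) :
    ∃ g ∈ Lgrp J, (g : V →L[ℝ] V) = t • (1 : V →L[ℝ] V) := by
  let f : Set.Ioi (0 : ℝ) → Str J := fun s =>
    ⟨⟨(s : ℝ) • (1 : V →L[ℝ] V), (s : ℝ)⁻¹ • (1 : V →L[ℝ] V),
      by rw [smul_mul_smul_comm, mul_inv_cancel₀ (ne_of_gt s.2)]; simp,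
      by rw [smul_mul_smul_comm, inv_mul_cancel₀ (ne_of_gt s.2)]; simp⟩,
     ⟨⟨(s : ℝ) • (1 : V →L[ℝ] V), (s : ℝ)⁻¹ • (1 : V →L[ℝ] V),
      by rw [smul_mul_smul_comm, mul_inv_cancel₀ (ne_of_gt s.2)]; simp,
      by rw [smul_mul_smul_comm, inv_mul_cancel₀ (ne_of_gt s.2)]; simp⟩,
      fun x y => by simpa using J.P_smul s x y⟩⟩
  have hf : Continuous f := by
    refine Continuous.subtype_mk ?_ _
    rw [Units.continuous_iff]
    constructor
    · exact continuous_subtype_val.smul continuous_const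
    · exact (continuous_subtype_val.inv₀ fun s => ne_of_gt s.2).smul continuous_const
  have h1 : f ⟨1, Set.mem_Ioi.2 one_pos⟩ = 1 := by
    apply Subtype.ext
    apply Units.ext
    simp [f]
  have : PreconnectedSpace (Set.Ioi (0 : ℝ)) :=
    isPreconnected_iff_preconnectedSpace.1 isPreconnected_Ioi
  have hpre : IsPreconnected (Set.range f) := isPreconnected_range hf
  have hmem : f ⟨t, ht⟩ ∈ connectedComponent (1 : Str J) :=
    hpre.subset_connectedComponent ⟨_, h1⟩ ⟨_, rfl⟩
  exact ⟨(f ⟨t, ht⟩ : (V →L[ℝ] V)ˣ), ⟨f ⟨t, ht⟩, hmem, rfl⟩, rfl⟩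

theorem polar_mem_orbit (J : JordanAlgebra V) (a : V) (u : KL J) (t : Set.Ioi (0 : ℝ)) :
    ((u : (V →L[ℝ] V)ˣ) : V →L[ℝ] V) ((t : ℝ) • a) ∈ orbit J a := by
  obtain ⟨g, hg, h⟩ := scalar_mem_Lgrp J t t.2
  exact ⟨u * g, mul_mem u.2.1 hg, by simp [h]⟩

variable [FiniteDimensional ℝ V]

theorem continuous_P {X : Type*} [TopologicalSpace X] (J : JordanAlgebra V) {f g : X → V}
    (hf : Continuous f) (hg : Continuous g) : Continuous fun x => J.P (f x) (g x) := by
  let m : V →ₗ[ℝ] (V →L[ℝ] V) := (LinearMap.toContinuousLinearMap).toLinearMap ∘ₗ J.mul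
  have hm : ∀ {a b : X → V}, Continuous a → Continuous b →
      Continuous fun x => J.mul (a x) (b x) := by
    intro a b ha hb
    exact ((LinearMap.continuous_of_finiteDimensional m).comp ha).clm_apply hb
  have : (fun x => J.P (f x) (g x)) =
      fun x => (2 : ℝ) • J.mul (f x) (J.mul (f x) (g x)) - J.mul (J.mul (f x) (f x)) (g x) := by
    funext x
    simp [P, L]
  rw [this]
  exact ((hm hf (hm hf hg)).const_smul _).sub (hm (hm hf hf) hg)

theorem isClosed_Str (J : JordanAlgebra V) : IsClosed (Str J : Set (V →L[ℝ] V)ˣ) := by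
  have key : (Str J : Set (V →L[ℝ] V)ˣ) =
      {g : (V →L[ℝ] V)ˣ | (∀ x y : V, J.P ((g : V →L[ℝ] V) x) y = (g : V →L[ℝ] V) (J.P x
          (((g⁻¹ : (V →L[ℝ] V)ˣ) : V →L[ℝ] V) (J.P ((g : V →L[ℝ] V) J.one) y)))) ∧
        (∀ y : V, (g : V →L[ℝ] V) (J.P (((g⁻¹ : (V →L[ℝ] V)ˣ) : V →L[ℝ] V) J.one)
          (((g⁻¹ : (V →L[ℝ] V)ˣ) : V →L[ℝ] V) (J.P ((g : V →L[ℝ] V) J.one) y))) = y) ∧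
        (∀ y : V, ((g⁻¹ : (V →L[ℝ] V)ˣ) : V →L[ℝ] V) (J.P ((g : V →L[ℝ] V) J.one)
          ((g : V →L[ℝ] V) (J.P (((g⁻¹ : (V →L[ℝ] V)ˣ) : V →L[ℝ] V) J.one) y))) = y)} := by
    ext g
    constructor
    · rintro ⟨h, hh⟩
      have e1 : ∀ y, (h : V →L[ℝ] V) y =
          ((g⁻¹ : (V →L[ℝ] V)ˣ) : V →L[ℝ] V) (J.P ((g : V →L[ℝ] V) J.one) y) := by
        intro y
        rw [hh, J.P_one, inv_apply]
      have e2 : ∀ y, (g : V →L[ℝ] V) (J.P (((g⁻¹ : (V →L[ℝ] V)ˣ) : V →L[ℝ] V) J.one)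
          ((h : V →L[ℝ] V) y)) = y := by
        intro y
        rw [← hh, apply_inv, J.P_one]
      refine ⟨fun x y => by rw [← e1, hh], fun y => by rw [← e1, e2], fun y => ?_⟩
      have e3 := e2 (((h⁻¹ : (V →L[ℝ] V)ˣ) : V →L[ℝ] V) y)
      rw [apply_inv] at e3
      rw [← e1, e3, apply_inv]
    · rintro ⟨h1, h2, h3⟩
      exact ⟨⟨((g⁻¹ : (V →L[ℝ] V)ˣ) : V →L[ℝ] V) *
          LinearMap.toContinuousLinearMap (J.P ((g : V →L[ℝ] V) J.one)),
        (g : V →L[ℝ] V) *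
          LinearMap.toContinuousLinearMap (J.P (((g⁻¹ : (V →L[ℝ] V)ˣ) : V →L[ℝ] V) J.one)),
        by ext y; exact h3 y, by ext y; exact h2 y⟩, fun x y => h1 x y⟩
  have cv : ∀ {f : (V →L[ℝ] V)ˣ → V}, Continuous f →
      Continuous fun g : (V →L[ℝ] V)ˣ => (g : V →L[ℝ] V) (f g) := fun hf =>
    Units.continuous_val.clm_apply hf
  have ci : ∀ {f : (V →L[ℝ] V)ˣ → V}, Continuous f →
      Continuous fun g : (V →L[ℝ] V)ˣ => ((g⁻¹ : (V →L[ℝ] V)ˣ) : V →L[ℝ] V) (f g) := fun hf =>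
    (Units.continuous_val.comp continuous_inv).clm_apply hf
  have cc : ∀ y : V, Continuous fun _ : (V →L[ℝ] V)ˣ => y := fun y => continuous_const
  rw [key]
  simp only [Set.ofPred_and, Set.ofPred_forall]
  refine IsClosed.inter ?_ (IsClosed.inter ?_ ?_)
  · exact isClosed_iInter fun x => isClosed_iInter fun y => isClosed_eq
      (continuous_P J (cv (cc x)) (cc y))
      (cv (continuous_P J (cc x) (ci (continuous_P J (cv (cc _)) (cc y)))))
  · exact isClosed_iInter fun y => isClosed_eq
      (cv (continuous_P J (ci (cc _)) (ci (continuous_P J (cv (cc _)) (cc y))))) (cc y)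
  · exact isClosed_iInter fun y => isClosed_eq
      (ci (continuous_P J (cv (cc _)) (cv (continuous_P J (ci (cc _)) (cc y))))) (cc y)

theorem isClosed_Lgrp (J : JordanAlgebra V) : IsClosed (Lgrp J : Set (V →L[ℝ] V)ˣ) := by
  have h : IsClosed ((Subgroup.connectedComponentOfOne (Str J) : Subgroup (Str J)) :
      Set (Str J)) := isClosed_connectedComponent
  have := (isClosed_Str J).isClosedEmbedding_subtypeVal.isClosedMap _ h
  exact this

theorem isClosed_KL (J : JordanAlgebra V) : IsClosed (KL J : Set (V →L[ℝ] V)ˣ) := by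
  have : (KL J : Set (V →L[ℝ] V)ˣ) = (Lgrp J : Set (V →L[ℝ] V)ˣ) ∩
      ⋂ x : V, ⋂ y : V, {g : (V →L[ℝ] V)ˣ | ⟪(g : V →L[ℝ] V) x, (g : V →L[ℝ] V) y⟫_ℝ = ⟪x, y⟫_ℝ} := by
    ext g
    simp only [Set.mem_inter_iff, Set.mem_iInter]
    rfl
  rw [this]
  exact (isClosed_Lgrp J).inter (isClosed_iInter fun x => isClosed_iInter fun y => isClosed_eq
    ((Units.continuous_val.clm_apply continuous_const).inner
      (Units.continuous_val.clm_apply continuous_const)) continuous_const)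

instance compactSpace_KL (J : JordanAlgebra V) : CompactSpace (KL J) := by
  have : ProperSpace (V →L[ℝ] V) := FiniteDimensional.proper_real _
  have hb : ∀ g ∈ KL J, ‖(g : V →L[ℝ] V)‖ ≤ 1 := by
    intro g hg
    refine ContinuousLinearMap.opNorm_le_bound _ zero_le_one fun x => ?_
    have := hg.2 x x
    rw [real_inner_self_eq_norm_sq, real_inner_self_eq_norm_sq] at this
    rw [_root_.one_mul]
    exact le_of_eq ((sq_eq_sq₀ (norm_nonneg _) (norm_nonneg _)).1 this)
  have hc : IsCompact ((Metric.closedBall (0 : V →L[ℝ] V) 1) ×ˢ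
      (MulOpposite.unop ⁻¹' (Metric.closedBall (0 : V →L[ℝ] V) 1))) :=
    (isCompact_closedBall _ _).prod
      (MulOpposite.opHomeomorph.symm.isClosedEmbedding.isCompact_preimage
        (isCompact_closedBall _ _))
  have hpre := (Units.isClosedEmbedding_embedProduct (α := V →L[ℝ] V)).isCompact_preimage hc
  refine isCompact_iff_compactSpace.1 (hpre.of_isClosed_subset (isClosed_KL J) ?_)
  intro g hg
  refine ⟨?_, ?_⟩
  · simpa using hb g hg
  · simpa using hb g⁻¹ (inv_mem hg)

/-- The normalized Haar measure `du` of the compact group `K_L`. -/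
def haarKL (J : JordanAlgebra V) : Measure (KL J) := Measure.haarMeasure ⊤

end Group

section Module

variable {V : Type*} [NormedAddCommGroup V] [InnerProductSpace ℝ V] [FiniteDimensional ℝ V]
variable (J : JordanAlgebra V) (ϑ : CartanInvolution J) (c : Fin (splitRank J ϑ) → V)

/-- The minimal nonzero orbit `𝒪 = L · c₁`. -/
def 𝒪 : Set V := orbit J (c₁ J ϑ c)

/-- The equivariant measure `dμ_lam` on `𝒪`:
`∫ f dμ_lam = ∫_{K_L} ∫_0^∞ f(u t c₁) t^(lam r - 1) dt du`. -/
def μ [MeasurableSpace V] (lam : ℝ) : Measure (𝒪 J ϑ c) :=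
  Measure.map
    (fun z : KL J × Set.Ioi (0 : ℝ) =>
      (⟨((z.1 : (V →L[ℝ] V)ˣ) : V →L[ℝ] V) ((z.2 : ℝ) • c₁ J ϑ c),
        polar_mem_orbit J (c₁ J ϑ c) z.1 z.2⟩ : 𝒪 J ϑ c))
    ((haarKL J).prod
      ((Measure.comap Subtype.val (volume : Measure ℝ)).withDensity
        fun t => ENNReal.ofReal ((t : ℝ) ^ (lam * (J.rank : ℝ) - 1))))

/-- A set of functions on `𝒪` is contained in `L²(𝒪, dμ_lam)`. -/
def SubsetL2 [MeasurableSpace V] (lam : ℝ) (M : Submodule ℂ (𝒪 J ϑ c → ℂ)) : Prop :=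
  ∀ ψ ∈ M, MemLp ψ 2 (μ J ϑ c lam)

/-- For `v ∈ V`, the scalar operator `(𝓑_lam Ψ | v)` where `𝓑_lam` is the Bessel operator
`𝓑_lam Ψ = ∑ ∂_α ∂_β Ψ · P(ē_α, ē_β) x + lam ∑ ∂_α Ψ · ē_α`. Here `(e_α)` is orthonormal for
`(x|y) = τ(x, ϑ y)`, so that the dual basis with respect to `τ` is `ē_α = ϑ e_α`. -/
def besselOp (lam : ℝ) (v : V) (Ψ : V → ℂ) (x : V) : ℂ :=
  let b := stdOrthonormalBasis ℝ V
  (∑ i, ∑ j, ((⟪J.P₂ (ϑ.toFun (b i)) (ϑ.toFun (b j)) x, v⟫_ℝ : ℝ) : ℂ) *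
      fderiv ℝ (fun y => fderiv ℝ Ψ y (b j)) x (b i)) +
    (lam : ℂ) * ∑ i, ((⟪ϑ.toFun (b i), v⟫_ℝ : ℝ) : ℂ) * fderiv ℝ Ψ x (b i)

/-- The action `dπ_lam(u, T, v)` of the element `(u, T, v)` of the conformal algebra
`𝔤 = V ⊕ 𝔰𝔱𝔯(V) ⊕ V` as a differential operator in the ambient space:
`(u,0,0)` acts by `i (x|u) Ψ(x)`, `(0,T,0)` by `D_{T* x} Ψ(x) + (r lam / 2n) Tr(T*) Ψ(x)`, and
`(0,0,-v)` by `(1/i) (𝓑_lam Ψ(x) | v)`. -/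
def dπ (lam : ℝ) (u : V) (T : V →L[ℝ] V) (v : V) (Ψ : V → ℂ) (x : V) : ℂ :=
  let Tad : V →ₗ[ℝ] V := LinearMap.adjoint (T : V →ₗ[ℝ] V)
  Complex.I * ((⟪x, u⟫_ℝ : ℝ) : ℂ) * Ψ x +
    (fderiv ℝ Ψ x (Tad x) +
      (((J.rank : ℝ) * lam / (2 * (finrank ℝ V : ℝ)) * LinearMap.trace ℝ V Tad : ℝ) : ℂ) * Ψ x) +
    1 / Complex.I * besselOp J ϑ lam (-v) Ψ x

/-- `Ψ` is a smooth extension of the function `ψ` on `𝒪` to an open neighbourhood of `𝒪`. -/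
def IsSmoothExtension (ψ : 𝒪 J ϑ c → ℂ) (Ψ : V → ℂ) : Prop :=
  ∃ U : Set V, IsOpen U ∧ 𝒪 J ϑ c ⊆ U ∧ ContDiffOn ℝ ∞ Ψ U ∧ ∀ x : 𝒪 J ϑ c, Ψ x = ψ x

/-- `K_α(z) = ∫_0^∞ exp(-z cosh t) cosh(α t) dt`, `z > 0`. -/
def besselK (α z : ℝ) : ℝ :=
  ∫ t in Set.Ioi (0 : ℝ), Real.exp (-z * Real.cosh t) * Real.cosh (α * t)

/-- The renormalized `K`-Bessel function `K̃_α(z) = (z/2)^(-α) K_α(z)`. -/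
def besselKt (α z : ℝ) : ℝ := (z / 2) ^ (-α) * besselK α z

/-- The radial function `K̃_α(|x|)` on `𝒪`. -/
def radial (α : ℝ) : 𝒪 J ϑ c → ℂ := fun x => ((besselKt α (absV J ϑ x) : ℝ) : ℂ)

/-- `ψ₀ = K̃_{ν/2}(|x|)` if `r₀ > 1`, and `ψ₀ = K̃_{(ν+σ)/2}(|x|)`, `σ = r lam`, if `r₀ = 1`. -/
def ψ₀ (lam : ℝ) : 𝒪 J ϑ c → ℂ :=
  if 1 < splitRank J ϑ then radial J ϑ c ((ν J ϑ c : ℝ) / 2)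
  else radial J ϑ c (((ν J ϑ c : ℝ) + (J.rank : ℝ) * lam) / 2)

/-- `W = dπ_lam(U(𝔤)) ψ₀`: the smallest complex space of functions on `𝒪` which contains `ψ₀` and
is stable under `dπ_lam(X)`, `X ∈ 𝔤`. The Bessel operators being tangential to `𝒪`, the
function `dπ_lam(X) ψ` on `𝒪` is computed with any smooth extension `Ψ` of `ψ`. -/
def W (lam : ℝ) : Submodule ℂ (𝒪 J ϑ c → ℂ) :=
  sInf {M | ψ₀ J ϑ c lam ∈ M ∧ ∀ ψ ∈ M, ∀ Ψ : V → ℂ, IsSmoothExtension J ϑ c ψ Ψ →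
    ∀ (u : V), ∀ T ∈ strAlg J, ∀ (v : V), (fun x : 𝒪 J ϑ c => dπ J ϑ lam u T v Ψ x) ∈ M}

/-- `ℂ[𝒪]_{≥ k}`: restrictions to `𝒪` of sums of homogeneous polynomials on `V` (with complex
coefficients) of degree `≥ k`. -/
def polyGE (k : ℕ) : Submodule ℂ (𝒪 J ϑ c → ℂ) :=
  Submodule.span ℂ {f | ∃ m, k ≤ m ∧ ∃ p : MvPolynomial (Fin (finrank ℝ V)) ℂ,
    p.IsHomogeneous m ∧ ∀ x : 𝒪 J ϑ c,
      f x = MvPolynomial.eval (fun i => (((stdOrthonormalBasis ℝ V).repr (x : V) i : ℝ) : ℂ)) p}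

/-- `K̃_α ⊗ ℂ[𝒪]_{≥ k}`: the functions `K̃_α(|x|) φ(x)` with `φ ∈ ℂ[𝒪]_{≥ k}`. -/
def KtPoly (α : ℝ) (k : ℕ) : Submodule ℂ (𝒪 J ϑ c → ℂ) :=
  (polyGE J ϑ c k).map (LinearMap.mulLeft ℂ (radial J ϑ c α))

end Module

end JordanAlgebra

end MinRep

end

/-! The module `W` arises from `ψ₀` by three kinds of operators: multiplication by linear forms,
linear vector fields from the structure algebra, and Bessel operators. Commuting a Bessel operator
past one of the first two kinds yields only operators of these kinds and Bessel operators again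
(`besselOp_inner_mul`, `besselOp_D`). Hence, if the Bessel operators map a set `W₀` of functions
into the space `Gen` that `W₀` generates under the first two kinds, they preserve this space
(`Gen.besselOp`). Any space of functions on the orbit that contains `W₀` and is stable under linear
forms and vector fields then contains `W` (`IsJordanFrame.W_le`). The sums of spaces `K̃_β ⊗ ℂ[𝒪]_{≥
m}` are stable: as a function of `z²`, the derivative of `K̃_β` is `-K̃_{β+1}/4`, and `|x|²` has a
quadratic derivative along a linear field, so the order rises by one and the degree by two.

The action is computed with arbitrary smooth extensions, so the Bessel operators must annihilate, on
the orbit, functions vanishing there (`besselOp_eq_zero`). At the base point the structure algebra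
controls all derivatives in the directions `V₁ + V_{1/2}`. The second-order part then collapses to a
first derivative in a `V₀` direction, with coefficient given by a trace over `V_{1/2}`; this trace
is exactly `λ₁` times the Jordan trace (`halfTrace_id`). The polar decomposition `𝒪 = K ℝ₊ c₁`
(`exists_polar`) carries the result to the whole orbit. It comes from maximizing `(kx|c₁)` over a
compact group: at a maximum `kx = a c₁ + w` with `w ∈ V₀`, and the rank of the quadratic
representation forces `w = 0`.

What remains is to find `W₀`. If `d = 2 d₀`, the symbol of the Bessel operator has an explicit trace
on the orbit, and the recurrence of the Bessel functions shows that the operator in direction `v`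
multiplies `ψ₀` by `(x|ϑv)` (`besselOp_besselSq`). This covers split rank one, where `d = d₀ = 0`.
In rank at least three a dimension count leaves only one other case, `ϑ = id` (`dichotomy`). Then `ν
= -1`, the function `K̃_{-1/2}(|x|)` is a multiple of `e^{-tr x}` on the orbit, and its Bessel
derivatives are computed directly (`besselOp_expTr`).

For `ℝ^{p,q}` with `p, q ≥ 2` the orbit lies in a null cone, where `|x|²` is a multiple of `‖πx‖²`
for a projection `π` of rank `min(p,q)`. Take for `W₀` the functions `K̃_{ν/2+k}(|πx|) φ(πx)`,
suitably scaled, with `φ` harmonic of degree `k ≤ |p-q|/2`. A Bessel operator produces a linear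
multiple of such a function plus terms of degrees `k ± 1`, and the coefficient of the raising term
is proportional to `|p-q| - 2k`. As `p + q` is even, it vanishes exactly at the top degree.

Square integrability is a radial question: near zero `K̃_β(z)²` is of size `z^{-4 max(β,0)}` up to
an arbitrarily small power, and it decays exponentially, so `4 max(β,0) < λr + 2m` suffices
(`subsetL2_iSup`). In split rank one, when `σ ≥ 2 dim V`, already `ψ₀` fails to be square
integrable. -/

noncomputable section

set_option linter.unusedSectionVars false

namespace MinRep.JordanAlgebra

/-! ### Jordan identities and the polarized quadratic representation. -/

section Identities

variable {V : Type*} [AddCommGroup V] [Module ℝ V] (J : JordanAlgebra V)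

/-- The full linearization of the Jordan identity. -/
theorem jordan_lin (x y z a : V) :
    J.mul (J.mul x a) (J.mul y z) + J.mul (J.mul y a) (J.mul z x) + J.mul (J.mul z a) (J.mul x y) =
      J.mul x (J.mul a (J.mul y z)) + J.mul y (J.mul a (J.mul z x)) +
        J.mul z (J.mul a (J.mul x y)) := by
  have h1 := J.jordan (x + y + z) a
  have h2 := J.jordan (x + y) a
  have h3 := J.jordan (y + z) a
  have h4 := J.jordan (x + z) a
  have h5 := J.jordan x a
  have h6 := J.jordan y a
  have h7 := J.jordan z a
  simp only [map_add, LinearMap.add_apply, J.mul_comm y x, J.mul_comm z y, J.mul_comm z x]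
    at h1 h2 h3 h4 h5 h6 h7 ⊢
  linear_combination (norm := module) (1 / 2 : ℝ) • h1 - (1 / 2 : ℝ) • h2 - (1 / 2 : ℝ) • h3
    - (1 / 2 : ℝ) • h4 + (1 / 2 : ℝ) • h5 + (1 / 2 : ℝ) • h6 + (1 / 2 : ℝ) • h7

/-- `[L(x), L(a)]` is a derivation. -/
theorem inner_deriv (x a y t : V) :
    J.mul x (J.mul a (J.mul y t)) - J.mul a (J.mul x (J.mul y t)) =
      J.mul (J.mul x (J.mul a y) - J.mul a (J.mul x y)) t +
        J.mul y (J.mul x (J.mul a t) - J.mul a (J.mul x t)) := by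
  have h1 := J.jordan_lin x y t a
  have h2 := J.jordan_lin a y t x
  rw [J.mul_comm (J.mul x (J.mul a y) - J.mul a (J.mul x y)) t]
  simp only [map_sub, J.mul_comm t x, J.mul_comm a x, J.mul_comm t a, J.mul_comm y a,
    J.mul_comm y x, J.mul_comm (J.mul a t) (J.mul x y),
    J.mul_comm (J.mul x t) (J.mul a y)] at h1 h2 ⊢
  linear_combination (norm := module) h2 - h1

/-- `L(a)` acts as a derivation of the polarized quadratic representation. -/
theorem P₂_mul (a x z y : V) :
    J.P₂ (J.mul a x) z y + J.P₂ x (J.mul a z) y = J.mul a (J.P₂ x z y) + J.P₂ x z (J.mul a y) := by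
  have h1 := J.jordan_lin x z y a
  have h2 := J.inner_deriv x a z y
  have h3 := J.inner_deriv z a x y
  have h4 := J.inner_deriv a y x z
  simp only [P₂, L, LinearMap.add_apply, LinearMap.sub_apply, LinearMap.comp_apply, map_add,
    map_sub, J.mul_comm] at h1 h2 h3 h4 ⊢
  linear_combination (norm := module) h1 + h2 + h3 + h4

theorem P₂_comm (x y : V) : J.P₂ x y = J.P₂ y x := by
  simp only [P₂, J.mul_comm x y, add_comm]

theorem P₂_self (x : V) : J.P₂ x x = J.P x := by
  simp only [P₂, P, two_smul]

theorem P₂_add_left (x y z w : V) : J.P₂ (x + y) z w = J.P₂ x z w + J.P₂ y z w := by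
  simp only [P₂, L, LinearMap.add_apply, LinearMap.sub_apply, LinearMap.comp_apply, map_add]
  abel

theorem P₂_smul_left (t : ℝ) (y z w : V) : J.P₂ (t • y) z w = t • J.P₂ y z w := by
  simp only [P₂, L, LinearMap.add_apply, LinearMap.sub_apply, LinearMap.comp_apply, map_smul,
    LinearMap.smul_apply]
  module

theorem P₂_add_right (x y z w : V) : J.P₂ z (x + y) w = J.P₂ z x w + J.P₂ z y w := by
  rw [P₂_comm, P₂_add_left, P₂_comm, P₂_comm (x := y)]

theorem mul_one' (x : V) : J.mul x J.one = x := by rw [J.mul_comm, J.one_mul]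

/-- The quadratic representation is the diagonal of its polarization. -/
theorem P_add (x y z : V) : J.P (x + y) z = J.P x z + J.P y z + (2 : ℝ) • J.P₂ x y z := by
  rw [← P₂_self, P₂_add_left, P₂_add_right, P₂_add_right, P₂_self, P₂_self, P₂_comm _ y x]
  module

/-- The Lie algebra `L(V) + Der(V)` of the structure group. -/
def IsStrLie (A : V →ₗ[ℝ] V) : Prop :=
  ∃ (a : V) (D : V →ₗ[ℝ] V),
    (∀ x y, D (J.mul x y) = J.mul (D x) y + J.mul x (D y)) ∧ A = J.mul a + D

/-- The operator `a □ w`. -/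
def box (a w : V) : V →ₗ[ℝ] V := J.mul (J.mul a w) + (J.mul w ∘ₗ J.mul a - J.mul a ∘ₗ J.mul w)

theorem isStrLie_mul (a : V) : J.IsStrLie (J.mul a) := ⟨a, 0, by simp, by simp⟩

theorem isStrLie_comm (a w : V) : J.IsStrLie (J.mul w ∘ₗ J.mul a - J.mul a ∘ₗ J.mul w) :=
  ⟨0, J.mul w ∘ₗ J.mul a - J.mul a ∘ₗ J.mul w, fun x y => by simpa using J.inner_deriv w a x y,
    by simp⟩

theorem isStrLie_box (a w : V) : J.IsStrLie (J.box a w) :=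
  ⟨_, _, fun x y => by simpa using J.inner_deriv w a x y, rfl⟩

theorem P₂_deriv {D : V →ₗ[ℝ] V} (hD : ∀ x y, D (J.mul x y) = J.mul (D x) y + J.mul x (D y))
    (x z y : V) : J.P₂ (D x) z y + J.P₂ x (D z) y = D (J.P₂ x z y) - J.P₂ x z (D y) := by
  simp only [P₂, L, LinearMap.add_apply, LinearMap.sub_apply, LinearMap.comp_apply, map_add,
    map_sub, hD]
  abel

/-! ### Peirce rules for a single idempotent. -/

section Peirce

variable {J} {c : V} (hc : J.mul c c = c)
include hc

/-- The linearized Jordan identity with three entries equal to `c`; it confines the eigenvalues of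
`L(c)` to `0`, `1/2`, `1`. -/
theorem peirce_cubic (x : V) :
    (2 : ℝ) • J.mul c (J.mul c (J.mul c x)) - (3 : ℝ) • J.mul c (J.mul c x) + J.mul c x = 0 := by
  have h := J.jordan_lin c c x c
  rw [J.mul_comm x c, hc, hc, J.mul_comm (J.mul c x) c, J.mul_comm x c] at h
  linear_combination (norm := module) (-1 : ℝ) • h

theorem mul_comm_of_one {x : V} (hx : J.mul c x = x) (y : V) :
    J.mul c (J.mul x y) = J.mul x (J.mul c y) := by
  have h := J.jordan_lin c c x y
  simp only [J.mul_comm x c, hc, hx] at h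
  simp only [J.mul_comm] at h ⊢
  linear_combination (norm := module) (-1 : ℝ) • h

theorem mul_comm_of_zero {x : V} (hx : J.mul c x = 0) (y : V) :
    J.mul c (J.mul x y) = J.mul x (J.mul c y) := by
  have h := J.jordan_lin c c x y
  simp only [J.mul_comm x c, hc, hx, map_zero] at h
  simp only [J.mul_comm] at h ⊢
  linear_combination (norm := module) h

/-- Since `L(c)² = L(c)` holds on the product, it has no `V_{1/2}` component: `V_{1/2} · V_{1/2} ⊆
V₁ + V₀`. -/
theorem half_mul_half {x y : V} (hx : J.mul c x = (1 / 2 : ℝ) • x)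
    (hy : J.mul c y = (1 / 2 : ℝ) • y) : J.mul c (J.mul c (J.mul x y)) = J.mul c (J.mul x y) := by
  have h := J.jordan_lin x y c c
  simp only [J.mul_comm x c, J.mul_comm y c, hc, hx, hy, map_smul, LinearMap.smul_apply] at h
  simp only [J.mul_comm] at h ⊢
  linear_combination (norm := module) (-1 : ℝ) • h

/-- On `V_{1/2}` the map `w ↦ 2L(w)` is a Jordan homomorphism from `V₀` into the symmetrized algebra
of endomorphisms. The next lemma is the analogue for `V₁`. -/
theorem mul_mul_half_of_zero {w w' y : V} (hw : J.mul c w = 0) (hw' : J.mul c w' = 0)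
    (hy : J.mul c y = (1 / 2 : ℝ) • y) :
    J.mul (J.mul w w') y = J.mul w (J.mul w' y) + J.mul w' (J.mul w y) := by
  have h := J.jordan_lin w w' y c
  have h1 := mul_comm_of_zero hc hw y
  have h2 := mul_comm_of_zero hc hw' y
  have h3 := mul_comm_of_zero hc hw w'
  rw [hw', map_zero] at h3
  rw [hy, map_smul] at h1 h2
  simp only [J.mul_comm w c, J.mul_comm w' c, J.mul_comm y c, hw, hw', hy, h3, h1, h2, map_smul,
    map_zero, LinearMap.zero_apply, LinearMap.smul_apply, J.mul_comm y w] at h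
  rw [J.mul_comm y] at h
  linear_combination (norm := module) (2 : ℝ) • h

theorem mul_mul_half_of_one {w w' y : V} (hw : J.mul c w = w) (hw' : J.mul c w' = w')
    (hy : J.mul c y = (1 / 2 : ℝ) • y) :
    J.mul (J.mul w w') y = J.mul w (J.mul w' y) + J.mul w' (J.mul w y) := by
  have h := J.jordan_lin w w' y c
  have h1 := mul_comm_of_one hc hw y
  have h2 := mul_comm_of_one hc hw' y
  have h3 := mul_comm_of_one hc hw w'
  rw [hw'] at h3
  rw [hy, map_smul] at h1 h2
  simp only [J.mul_comm w c, J.mul_comm w' c, J.mul_comm y c, hw, hw', hy, h3, h1, h2, map_smul,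
    LinearMap.smul_apply, J.mul_comm y w] at h
  rw [J.mul_comm y] at h
  linear_combination (norm := module) (-2 : ℝ) • h

end Peirce

/-- The projection onto `V₁(c)`. -/
def pOne (c : V) : V →ₗ[ℝ] V := (2 : ℝ) • (J.mul c ∘ₗ J.mul c) - J.mul c

/-- The projection onto `V_{1/2}(c)`. -/
def pHalf (c : V) : V →ₗ[ℝ] V := (4 : ℝ) • (J.mul c - J.mul c ∘ₗ J.mul c)

/-- The projection onto `V₀(c)`. -/
def pZero (c : V) : V →ₗ[ℝ] V :=
  LinearMap.id - (3 : ℝ) • J.mul c + (2 : ℝ) • (J.mul c ∘ₗ J.mul c)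

theorem p_sum (c x : V) : J.pOne c x + J.pHalf c x + J.pZero c x = x := by
  simp only [pOne, pHalf, pZero, LinearMap.add_apply, LinearMap.sub_apply, LinearMap.smul_apply,
    LinearMap.comp_apply, LinearMap.id_apply]
  module

section Peirce

variable {J} {c : V}

theorem pOne_of_one {x : V} (hx : J.mul c x = x) : J.pOne c x = x := by
  simp only [pOne, LinearMap.sub_apply, LinearMap.smul_apply, LinearMap.comp_apply, hx]; module

theorem pOne_of_half {x : V} (hx : J.mul c x = (1 / 2 : ℝ) • x) : J.pOne c x = 0 := by
  simp only [pOne, LinearMap.sub_apply, LinearMap.smul_apply, LinearMap.comp_apply, hx, map_smul]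
  module

theorem pHalf_of_half {x : V} (hx : J.mul c x = (1 / 2 : ℝ) • x) : J.pHalf c x = x := by
  simp only [pHalf, LinearMap.sub_apply, LinearMap.smul_apply, LinearMap.comp_apply, hx, map_smul]
  module

theorem pZero_of_one {x : V} (hx : J.mul c x = x) : J.pZero c x = 0 := by
  simp only [pZero, LinearMap.sub_apply, LinearMap.add_apply, LinearMap.smul_apply,
    LinearMap.comp_apply, hx, LinearMap.id_apply]; module

theorem pZero_of_half {x : V} (hx : J.mul c x = (1 / 2 : ℝ) • x) : J.pZero c x = 0 := by
  simp only [pZero, LinearMap.sub_apply, LinearMap.add_apply, LinearMap.smul_apply,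
    LinearMap.comp_apply, hx, LinearMap.id_apply, map_smul]; module

theorem pZero_of_zero {x : V} (hx : J.mul c x = 0) : J.pZero c x = x := by
  simp only [pZero, LinearMap.sub_apply, LinearMap.add_apply, LinearMap.smul_apply,
    LinearMap.comp_apply, hx, LinearMap.id_apply, map_zero]; module

variable (hc : J.mul c c = c)
include hc

theorem mul_pOne (x : V) : J.mul c (J.pOne c x) = J.pOne c x := by
  have h := peirce_cubic hc x
  simp only [pOne, LinearMap.sub_apply, LinearMap.smul_apply, LinearMap.comp_apply, map_sub,
    map_smul]
  linear_combination (norm := module) h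

theorem mul_pHalf (x : V) : J.mul c (J.pHalf c x) = (1 / 2 : ℝ) • J.pHalf c x := by
  have h := peirce_cubic hc x
  simp only [pHalf, LinearMap.sub_apply, LinearMap.smul_apply, LinearMap.comp_apply, map_sub,
    map_smul]
  linear_combination (norm := module) (-2 : ℝ) • h

theorem mul_pZero (x : V) : J.mul c (J.pZero c x) = 0 := by
  have h := peirce_cubic hc x
  simp only [pZero, LinearMap.sub_apply, LinearMap.add_apply, LinearMap.smul_apply,
    LinearMap.comp_apply, LinearMap.id_apply, map_sub, map_smul, map_add]
  linear_combination (norm := module) h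

/-- `L(w)` preserves `V_{1/2}(c)` if `w ∈ V₀(c)`. -/
theorem zero_mul_half {w y : V} (hw : J.mul c w = 0) (hy : J.mul c y = (1 / 2 : ℝ) • y) :
    J.mul c (J.mul w y) = (1 / 2 : ℝ) • J.mul w y := by
  rw [mul_comm_of_zero hc hw, hy, map_smul]

theorem one_mul_half {w y : V} (hw : J.mul c w = w) (hy : J.mul c y = (1 / 2 : ℝ) • y) :
    J.mul c (J.mul w y) = (1 / 2 : ℝ) • J.mul w y := by
  rw [mul_comm_of_one hc hw, hy, map_smul]

/-- `L(c)` commutes with both `L(w)` and `L(y)`, so the product is an eigenvector of `L(c)` for the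
eigenvalues `0` and `1` at once. -/
theorem one_mul_zero {w y : V} (hw : J.mul c w = w) (hy : J.mul c y = 0) : J.mul w y = 0 := by
  have h1 := mul_comm_of_one hc hw y
  have h2 := mul_comm_of_zero hc hy w
  rw [hy, map_zero] at h1
  rw [hw, J.mul_comm y w] at h2
  rw [← h2, h1]

theorem zero_mul_zero {w y : V} (hw : J.mul c w = 0) (hy : J.mul c y = 0) :
    J.mul c (J.mul w y) = 0 := by
  rw [mul_comm_of_zero hc hw, hy, map_zero]

theorem one_mul_one {w y : V} (hw : J.mul c w = w) (hy : J.mul c y = y) :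
    J.mul c (J.mul w y) = J.mul w y := by
  rw [mul_comm_of_one hc hw, hy]

end Peirce

/-! ### Associativity of the trace form. -/

section Trace

/-- `L([L(x), L(a)] y) = [[L(x), L(a)], L(y)]`. -/
theorem L_inner_deriv (x a y : V) :
    J.mul (J.mul x (J.mul a y) - J.mul a (J.mul x y)) =
      (J.mul x ∘ₗ J.mul a - J.mul a ∘ₗ J.mul x) ∘ₗ J.mul y -
        J.mul y ∘ₗ (J.mul x ∘ₗ J.mul a - J.mul a ∘ₗ J.mul x) := by
  ext t
  have := J.inner_deriv x a y t
  simp only [LinearMap.sub_apply, LinearMap.comp_apply]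
  rw [this]
  abel

/-- Multiplication by `[L(x), L(a)] y` is itself a commutator of operators, hence has trace zero. -/
theorem tr_inner_deriv (x a y : V) :
    J.tr (J.mul x (J.mul a y)) = J.tr (J.mul a (J.mul x y)) := by
  have h := congrArg (LinearMap.trace ℝ V) (J.L_inner_deriv x a y)
  have h' : LinearMap.trace ℝ V ((J.mul x ∘ₗ J.mul a - J.mul a ∘ₗ J.mul x) ∘ₗ J.mul y) =
      LinearMap.trace ℝ V (J.mul y ∘ₗ (J.mul x ∘ₗ J.mul a - J.mul a ∘ₗ J.mul x)) :=
    LinearMap.trace_mul_comm ℝ _ _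
  rw [map_sub, map_sub, map_sub, h', sub_self] at h
  unfold tr L
  rw [sub_eq_zero.1 h]

theorem tr_add (x y : V) : J.tr (x + y) = J.tr x + J.tr y := by
  simp only [tr, L, map_add, mul_add]

theorem tr_smul (t : ℝ) (x : V) : J.tr (t • x) = t * J.tr x := by
  simp only [tr, L, map_smul, smul_eq_mul]; ring

theorem τ_comm (x y : V) : J.τ x y = J.τ y x := by rw [τ, τ, J.mul_comm]

theorem τ_add_left (x y z : V) : J.τ (x + y) z = J.τ x z + J.τ y z := by
  simp only [τ, map_add, LinearMap.add_apply, tr_add]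

theorem τ_smul_left (t : ℝ) (x z : V) : J.τ (t • x) z = t * J.τ x z := by
  simp only [τ, map_smul, LinearMap.smul_apply, tr_smul]

theorem τ_add_right (x y z : V) : J.τ z (x + y) = J.τ z x + J.τ z y := by
  simp only [τ, map_add, tr_add]

theorem τ_smul_right (t : ℝ) (x z : V) : J.τ z (t • x) = t * J.τ z x := by
  simp only [τ, map_smul, tr_smul]

theorem τ_mul (x y z : V) : J.τ (J.mul x y) z = J.τ y (J.mul x z) := by
  have := J.tr_inner_deriv z x y
  have h2 := J.tr_inner_deriv x y z
  unfold τ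
  rw [J.mul_comm _ z, this, J.mul_comm z y, h2]

end Trace

end Identities
end MinRep.JordanAlgebra

namespace MinRep.JordanAlgebra

/-! ### Adjoints with respect to the Cartan inner product. -/

section Cartan

variable {V : Type*} [NormedAddCommGroup V] [InnerProductSpace ℝ V]
variable {J : JordanAlgebra V} (ϑ : CartanInvolution J)

theorem CartanInvolution.τ_eq_inner (x y : V) : J.τ x y = ⟪x, ϑ.toFun y⟫_ℝ := by
  rw [ϑ.inner_eq, ϑ.invol]

theorem CartanInvolution.τ_left (x y : V) : J.τ (ϑ.toFun x) y = J.τ x (ϑ.toFun y) := by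
  rw [← ϑ.inner_eq, τ_comm, ← ϑ.inner_eq, real_inner_comm]

theorem CartanInvolution.inner_left (x y : V) : ⟪ϑ.toFun x, y⟫_ℝ = ⟪x, ϑ.toFun y⟫_ℝ := by
  rw [ϑ.inner_eq, ϑ.inner_eq, ϑ.τ_left]

theorem CartanInvolution.inner_mul (a x y : V) :
    ⟪J.mul a x, y⟫_ℝ = ⟪x, J.mul (ϑ.toFun a) y⟫_ℝ := by
  rw [ϑ.inner_eq, τ_mul, ϑ.inner_eq, ϑ.map_mul, ϑ.invol]

theorem CartanInvolution.map_P₂ (x y z : V) :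
    ϑ.toFun (J.P₂ x y z) = J.P₂ (ϑ.toFun x) (ϑ.toFun y) (ϑ.toFun z) := by
  simp only [P₂, L, LinearMap.add_apply, LinearMap.sub_apply, LinearMap.comp_apply, map_add,
    map_sub, ϑ.map_mul]

theorem CartanInvolution.map_P (x z : V) :
    ϑ.toFun (J.P x z) = J.P (ϑ.toFun x) (ϑ.toFun z) := by
  rw [← P₂_self, ϑ.map_P₂, P₂_self]

/-- The trace form of `P(a, b) x` and `w` in terms of the box operator. -/
theorem τ_P₂ (J : JordanAlgebra V) (a b x w : V) : J.τ (J.P₂ a b x) w = J.τ b (J.box a w x) := by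
  simp only [P₂, L, box, LinearMap.add_apply, LinearMap.sub_apply, LinearMap.comp_apply]
  have e1 : J.τ (J.mul a (J.mul b x)) w = J.τ b (J.mul x (J.mul a w)) := by
    rw [τ_mul, J.mul_comm b x, τ_mul]
  have e2 : J.τ (J.mul b (J.mul a x)) w = J.τ b (J.mul w (J.mul a x)) := by
    rw [J.mul_comm b, τ_mul, J.mul_comm]
  have e3 : J.τ (J.mul (J.mul a b) x) w = J.τ b (J.mul a (J.mul w x)) := by
    rw [J.mul_comm, τ_mul, τ_mul, J.mul_comm x w]
  have h (s t u : V) : J.τ b (s + (t - u)) = J.τ b s + J.τ b t - J.τ b u := by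
    rw [sub_eq_add_neg, ← neg_one_smul ℝ u, τ_add_right, τ_add_right, τ_smul_right]; ring
  have h' (s t u : V) : J.τ (s + t - u) w = J.τ s w + J.τ t w - J.τ u w := by
    rw [sub_eq_add_neg, ← neg_one_smul ℝ u, τ_add_left, τ_add_left, τ_smul_left]; ring
  rw [h, h', e1, e2, e3, J.mul_comm (J.mul a w) x]

/-- For a derivation, `L(Dx) = [D, L(x)]` is a commutator. -/
theorem tr_deriv [FiniteDimensional ℝ V] {D : V →ₗ[ℝ] V}
    (hD : ∀ x y, D (J.mul x y) = J.mul (D x) y + J.mul x (D y)) (x : V) : J.tr (D x) = 0 := by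
  have h : J.mul (D x) = D ∘ₗ J.mul x - J.mul x ∘ₗ D := by
    ext y; simp [hD]
  have h' : LinearMap.trace ℝ V (D ∘ₗ J.mul x) = LinearMap.trace ℝ V (J.mul x ∘ₗ D) :=
    LinearMap.trace_mul_comm ℝ _ _
  rw [tr, L, h, map_sub, h', sub_self, mul_zero]

theorem inner_deriv_eq [FiniteDimensional ℝ V] {D : V →ₗ[ℝ] V}
    (hD : ∀ x y, D (J.mul x y) = J.mul (D x) y + J.mul x (D y)) (x y : V) :
    ⟪D x, y⟫_ℝ = ⟪x, -ϑ.toFun (D (ϑ.toFun y))⟫_ℝ := by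
  have := J.tr_deriv hD (J.mul x (ϑ.toFun y))
  rw [hD, tr_add] at this
  rw [inner_neg_right, ϑ.inner_eq, ϑ.inner_eq, ϑ.invol]
  unfold τ
  linarith

variable [FiniteDimensional ℝ V]

theorem IsStrLie.adjoint_eq {a : V} {D : V →ₗ[ℝ] V}
    (hD : ∀ x y, D (J.mul x y) = J.mul (D x) y + J.mul x (D y)) :
    LinearMap.adjoint (J.mul a + D) =
      J.mul (ϑ.toFun a) + -(ϑ.toFun ∘ₗ D ∘ₗ ϑ.toFun) := by
  symm
  rw [LinearMap.eq_adjoint_iff]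
  intro x y
  rw [real_inner_comm, LinearMap.add_apply, LinearMap.add_apply, inner_add_right, inner_add_right,
    real_inner_comm _ x, real_inner_comm _ x, inner_deriv_eq ϑ hD, ϑ.inner_mul]
  simp

theorem IsStrLie.adjoint (ϑ : CartanInvolution J) {A : V →ₗ[ℝ] V} (hA : J.IsStrLie A) : J.IsStrLie (LinearMap.adjoint A) := by
  obtain ⟨a, D, hD, rfl⟩ := hA
  refine ⟨ϑ.toFun a, -(ϑ.toFun ∘ₗ D ∘ₗ ϑ.toFun), fun x y => ?_, IsStrLie.adjoint_eq ϑ hD⟩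
  simp [ϑ.map_mul, hD, ϑ.invol, add_comm]

/-- Elements of the Lie algebra of the structure group act on the quadratic representation. -/
theorem IsStrLie.P₂_eq {A : V →ₗ[ℝ] V} (hA : J.IsStrLie A) (x z y : V) :
    J.P₂ (A x) z y + J.P₂ x (A z) y =
      A (J.P₂ x z y) + J.P₂ x z (ϑ.toFun (LinearMap.adjoint A (ϑ.toFun y))) := by
  obtain ⟨a, D, hD, rfl⟩ := hA
  have h1 := J.P₂_mul a x z y
  have h2 := J.P₂_deriv hD x z y
  rw [IsStrLie.adjoint_eq ϑ hD]
  simp only [LinearMap.add_apply, LinearMap.neg_apply, LinearMap.comp_apply, ϑ.invol, map_add,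
    map_neg, P₂_add_left, P₂_add_right, ϑ.map_mul]
  linear_combination (norm := module) h1 + h2

end Cartan

/-! ### Linear flows and the Lie algebra of the structure group. -/

section Calculus

variable {V : Type*} [NormedAddCommGroup V] [InnerProductSpace ℝ V] [FiniteDimensional ℝ V]
variable (J : JordanAlgebra V)

/-- The product as a continuous bilinear map. -/
def mulCLM : V →L[ℝ] V →L[ℝ] V :=
  LinearMap.toContinuousLinearMap
    ((LinearMap.toContinuousLinearMap : (V →ₗ[ℝ] V) ≃ₗ[ℝ] (V →L[ℝ] V)).toLinearMap ∘ₗ J.mul)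

theorem mulCLM_apply (x y : V) : J.mulCLM x y = J.mul x y := rfl

theorem hasDerivAt_mul {f g : ℝ → V} {f' g' : V} {t : ℝ} (hf : HasDerivAt f f' t)
    (hg : HasDerivAt g g' t) :
    HasDerivAt (fun s => J.mul (f s) (g s)) (J.mul f' (g t) + J.mul (f t) g') t :=
  (J.mulCLM.hasFDerivAt.comp_hasDerivAt t hf).clm_apply hg

theorem hasDerivAt_P₂ {f g h : ℝ → V} {f' g' h' : V} {t : ℝ} (hf : HasDerivAt f f' t)
    (hg : HasDerivAt g g' t) (hh : HasDerivAt h h' t) :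
    HasDerivAt (fun s => J.P₂ (f s) (g s) (h s))
      (J.P₂ f' (g t) (h t) + J.P₂ (f t) g' (h t) + J.P₂ (f t) (g t) h') t := by
  have := ((J.hasDerivAt_mul hf (J.hasDerivAt_mul hg hh)).add
    (J.hasDerivAt_mul hg (J.hasDerivAt_mul hf hh))).sub
    (J.hasDerivAt_mul (J.hasDerivAt_mul hf hg) hh)
  refine this.congr_deriv ?_
  simp only [P₂, L, LinearMap.add_apply, LinearMap.sub_apply, LinearMap.comp_apply, map_add]
  abel

/-- The flow `exp(tA)` of a linear vector field. -/
def flow (A : V →L[ℝ] V) (t : ℝ) : V →L[ℝ] V := NormedSpace.exp (t • A)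

theorem flow_zero (A : V →L[ℝ] V) : flow A 0 = 1 := by
  rw [flow, zero_smul, NormedSpace.exp_zero]

theorem hasDerivAt_flow (A : V →L[ℝ] V) (t : ℝ) : HasDerivAt (flow A) (A * flow A t) t :=
  hasDerivAt_exp_smul_const' A t

theorem hasDerivAt_flow' (A : V →L[ℝ] V) (t : ℝ) : HasDerivAt (flow A) (flow A t * A) t :=
  hasDerivAt_exp_smul_const A t

theorem hasDerivAt_flow_apply (A : V →L[ℝ] V) (x : V) (t : ℝ) :
    HasDerivAt (fun s => flow A s x) (A (flow A t x)) t := by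
  simpa using (hasDerivAt_flow A t).clm_apply (hasDerivAt_const t x)

theorem flow_mul_neg (A : V →L[ℝ] V) (t : ℝ) : flow A t * flow A (-t) = 1 := by
  let _ : NormedAlgebra ℚ (V →L[ℝ] V) := NormedAlgebra.restrictScalars ℚ ℝ _
  rw [flow, flow, ← NormedSpace.exp_add_of_commute, ← add_smul, add_neg_cancel, zero_smul,
    NormedSpace.exp_zero]
  rw [neg_smul]
  exact (Commute.refl _).neg_right

theorem flow_neg_mul (A : V →L[ℝ] V) (t : ℝ) : flow A (-t) * flow A t = 1 := by
  simpa using flow_mul_neg A (-t)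

theorem flow_neg_apply (A : V →L[ℝ] V) (t : ℝ) (x : V) : flow A (-t) (flow A t x) = x :=
  congrArg (fun f : V →L[ℝ] V => f x) (flow_neg_mul A t)

theorem flow_apply_neg (A : V →L[ℝ] V) (t : ℝ) (x : V) : flow A t (flow A (-t) x) = x :=
  congrArg (fun f : V →L[ℝ] V => f x) (flow_mul_neg A t)

/-- The flow as a unit. -/
def flowUnit (A : V →L[ℝ] V) (t : ℝ) : (V →L[ℝ] V)ˣ :=
  ⟨flow A t, flow A (-t), flow_mul_neg A t, flow_neg_mul A t⟩

theorem continuous_flow (A : V →L[ℝ] V) : Continuous (flow A) :=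
  continuous_iff_continuousAt.2 fun t => (hasDerivAt_flow A t).continuousAt

theorem continuous_flowUnit (A : V →L[ℝ] V) : Continuous (flowUnit A) := by
  rw [Units.continuous_iff]
  exact ⟨continuous_flow A, (continuous_flow A).comp continuous_neg⟩

theorem flowUnit_zero (A : V →L[ℝ] V) : flowUnit A 0 = 1 := Units.ext (flow_zero A)

/-- An operator whose exponentials lie in the structure group belongs to `L(V) + Der(V)`. -/
theorem isStrLie_of_mem_strAlg {T : V →L[ℝ] V} (hT : T ∈ strAlg J) :
    J.IsStrLie (T : V →ₗ[ℝ] V) := by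
  -- The companion `h` of `g` is eliminated by evaluating the defining relation at the unit: `h =
  -- g⁻¹ P(g e)`.
  have key : ∀ (t : ℝ) (x y : V), J.P (flow T t x) y =
      flow T t (J.P x (flow T (-t) (J.P (flow T t J.one) y))) := by
    intro t x y
    obtain ⟨g, ⟨h, hh⟩, hg⟩ := hT t
    have hg' : (g : V →L[ℝ] V) = flow T t := hg
    rw [hg'] at hh
    rw [hh J.one y, P_one, flow_neg_apply, hh]
  -- Differentiation of `key` at time zero.
  have der : ∀ x y : V, (2 : ℝ) • J.P₂ (T x) x y =
      T (J.P x y) + J.P x ((2 : ℝ) • J.P₂ (T J.one) J.one y - T y) := by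
    intro x y
    have hx := hasDerivAt_flow_apply T x 0
    have ho := hasDerivAt_flow_apply T J.one 0
    have hd : HasDerivAt (fun t : ℝ => flow T (-t)) (-T) 0 := by
      have h1 : HasDerivAt (flow T) T (-(0 : ℝ)) := by
        simpa [flow_zero] using hasDerivAt_flow T (-(0 : ℝ))
      simpa [Function.comp_def] using h1.scomp (0 : ℝ) (hasDerivAt_neg (0 : ℝ))
    have h1 := J.hasDerivAt_P₂ hx hx (hasDerivAt_const (0 : ℝ) y)
    have h2 := hd.clm_apply (J.hasDerivAt_P₂ ho ho (hasDerivAt_const (0 : ℝ) y))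
    have h3 := (hasDerivAt_flow T 0).clm_apply
      (J.hasDerivAt_P₂ (hasDerivAt_const (0 : ℝ) x) (hasDerivAt_const (0 : ℝ) x) h2)
    have e : (fun t => J.P₂ (flow T t x) (flow T t x) y) = fun t => flow T t
        (J.P₂ x x (flow T (-t) (J.P₂ (flow T t J.one) (flow T t J.one) y))) := by
      funext t
      simp only [P₂_self]
      exact key t x y
    rw [e] at h1
    have := h1.unique h3
    have z1 : ∀ z w, J.P₂ 0 z w = 0 := fun z w => by
      simpa using J.P₂_smul_left 0 0 z w
    have z2 : ∀ z w, J.P₂ z 0 w = 0 := fun z w => by rw [P₂_comm, z1]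
    have n0 : flow T (-0) = 1 := by rw [neg_zero, flow_zero]
    simp only [n0, one_apply_eq_self, flow_zero, mul_one, P₂_self, P_one, z1, z2,
      map_zero, add_zero, zero_add, neg_apply] at this
    rw [P₂_comm _ x, P₂_comm _ J.one] at this
    rw [two_smul, two_smul, this, sub_eq_neg_add]
  -- Polarizing `der` between `x` and the unit turns the quadratic relation into one about products.
  have lin : ∀ x y : V, J.mul (T x) y - J.mul (J.mul (T J.one) x) y =
      (T (J.mul x y) - J.mul x (T y)) -
        (J.mul (T J.one) (J.mul x y) - J.mul x (J.mul (T J.one) y)) := by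
    intro x y
    have d1 := der (x + J.one) y
    have d2 := der x y
    have d3 := der J.one y
    have po : ∀ z w, J.P₂ z J.one w = J.mul z w := fun z w => by
      simp only [P₂, L, LinearMap.add_apply, LinearMap.sub_apply, LinearMap.comp_apply, J.one_mul,
        mul_one']
      abel
    simp only [P_add, P_one, map_add, P₂_add_left, P₂_add_right, po, map_smul] at d1 d2 d3
    have ex : J.P₂ (T J.one) x y = J.mul (T J.one) (J.mul x y) + J.mul x (J.mul (T J.one) y) -
      J.mul (J.mul (T J.one) x) y := rfl
    rw [ex] at d1
    simp only [map_sub, map_smul, LinearMap.add_apply] at d1 d2 d3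
    linear_combination (norm := module) (1 / 2 : ℝ) • d1 - (1 / 2 : ℝ) • d2 - (1 / 2 : ℝ) • d3
  -- The multiplication part is read off at the unit, since derivations kill it; `lin` says that the
  -- rest is a derivation.
  refine ⟨T J.one, (T : V →ₗ[ℝ] V) - J.mul (T J.one), fun x y => ?_, by simp⟩
  have := lin x y
  simp only [LinearMap.sub_apply, ContinuousLinearMap.coe_coe, map_sub]
  linear_combination (norm := module) (-1 : ℝ) • this

variable {J} (ϑ : CartanInvolution J)

/-- The operator dual to `A` with respect to `τ`. -/
def sharp (A : V →L[ℝ] V) : V →L[ℝ] V :=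
  LinearMap.toContinuousLinearMap
    (ϑ.toFun ∘ₗ LinearMap.adjoint (A : V →ₗ[ℝ] V) ∘ₗ ϑ.toFun)

theorem sharp_apply (A : V →L[ℝ] V) (x : V) :
    sharp ϑ A x = ϑ.toFun (LinearMap.adjoint (A : V →ₗ[ℝ] V) (ϑ.toFun x)) := rfl

/-- By `IsStrLie.P₂_eq` the curve `exp(-tA) P(exp(tA)x) exp(-tS) y`, with `S` the `τ`-dual of `A`,
has zero derivative. This is the converse passage, from `L(V) + Der(V)` to the structure group. -/
theorem flow_P {A : V →L[ℝ] V} (hA : J.IsStrLie (A : V →ₗ[ℝ] V)) (t : ℝ) (x y : V) :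
    J.P (flow A t x) y = flow A t (J.P x (flow (sharp ϑ A) t y)) := by
  have hA' := hA.P₂_eq ϑ
  simp only [ContinuousLinearMap.coe_coe, ← sharp_apply] at hA'
  set S := sharp ϑ A
  have hd : ∀ (B : V →L[ℝ] V) (s : ℝ),
      HasDerivAt (fun t : ℝ => flow B (-t)) (-(flow B (-s) * B)) s := by
    intro B s
    simpa [Function.comp_def] using (hasDerivAt_flow' B (-s)).scomp s (hasDerivAt_neg s)
  have hd' : ∀ (B : V →L[ℝ] V) (s : ℝ),
      HasDerivAt (fun t : ℝ => flow B (-t)) (-(B * flow B (-s))) s := by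
    intro B s
    simpa [Function.comp_def] using (hasDerivAt_flow B (-s)).scomp s (hasDerivAt_neg s)
  have hc : ∀ y s, HasDerivAt (fun t => flow A (-t)
      (J.P₂ (flow A t x) (flow A t x) (flow S (-t) y))) 0 s := by
    intro y s
    have hx := hasDerivAt_flow_apply A x s
    have h2 : HasDerivAt (fun t => flow S (-t) y) (-(S (flow S (-s) y))) s := by
      simpa using (hd' S s).clm_apply (hasDerivAt_const s y)
    refine ((hd A s).clm_apply (J.hasDerivAt_P₂ hx hx h2)).congr_deriv ?_
    rw [hA']
    simp [P₂_self]
  have h := is_const_of_deriv_eq_zero (fun s => (hc (flow S t y) s).differentiableAt)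
    (fun s => (hc (flow S t y) s).deriv) t 0
  simp only [flow_neg_apply, neg_zero, flow_zero, one_apply_eq_self, P₂_self] at h
  rw [← h, flow_apply_neg]

theorem flowUnit_mem_Str (ϑ : CartanInvolution J) {A : V →L[ℝ] V} (hA : J.IsStrLie (A : V →ₗ[ℝ] V)) (t : ℝ) :
    flowUnit A t ∈ Str J :=
  ⟨flowUnit (sharp ϑ A) t, fun x y => flow_P ϑ hA t x y⟩

/-- The one-parameter group is a connected set through the identity. -/
theorem flowUnit_mem_Lgrp (ϑ : CartanInvolution J) {A : V →L[ℝ] V} (hA : J.IsStrLie (A : V →ₗ[ℝ] V)) (t : ℝ) :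
    flowUnit A t ∈ Lgrp J := by
  let f : ℝ → Str J := fun s => ⟨flowUnit A s, flowUnit_mem_Str ϑ hA s⟩
  have hf : Continuous f := (continuous_flowUnit A).subtype_mk _
  have h1 : f 0 = 1 := Subtype.ext (flowUnit_zero A)
  have hmem : f t ∈ connectedComponent (1 : Str J) :=
    (isPreconnected_range hf).subset_connectedComponent ⟨_, h1⟩ ⟨_, rfl⟩
  exact ⟨f t, hmem, rfl⟩

theorem flow_mem_orbit (ϑ : CartanInvolution J) {A : V →L[ℝ] V} (hA : J.IsStrLie (A : V →ₗ[ℝ] V)) (t : ℝ) {a x : V}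
    (hx : x ∈ orbit J a) : flow A t x ∈ orbit J a := by
  obtain ⟨g, hg, rfl⟩ := hx
  exact ⟨flowUnit A t * g, mul_mem (flowUnit_mem_Lgrp ϑ hA t) hg, rfl⟩

theorem inner_flow {A : V →L[ℝ] V} (hA : ∀ x y, ⟪A x, y⟫_ℝ = -⟪x, A y⟫_ℝ) (t : ℝ) (x y : V) :
    ⟪flow A t x, flow A t y⟫_ℝ = ⟪x, y⟫_ℝ := by
  have hd : ∀ s, HasDerivAt (fun s => ⟪flow A s x, flow A s y⟫_ℝ) 0 s := by
    intro s
    refine ((hasDerivAt_flow_apply A x s).inner ℝ (hasDerivAt_flow_apply A y s)).congr_deriv ?_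
    rw [hA]; ring
  simpa [flow_zero] using is_const_of_deriv_eq_zero (fun s => (hd s).differentiableAt)
    (fun s => (hd s).deriv) t 0

end Calculus

end MinRep.JordanAlgebra

namespace MinRep.JordanAlgebra

/-! ### Jordan frames of `V⁺` and their Peirce spaces. -/

section Frame

variable {V : Type*} [NormedAddCommGroup V] [InnerProductSpace ℝ V] [FiniteDimensional ℝ V]
variable {J : JordanAlgebra V} {ϑ : CartanInvolution J}

theorem mem_plusSpace {x : V} : x ∈ plusSpace J ϑ ↔ ϑ.toFun x = x := Iff.rfl

theorem inner_mul_of_plus {a : V} (ha : ϑ.toFun a = a) (x y : V) :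
    ⟪J.mul a x, y⟫_ℝ = ⟪x, J.mul a y⟫_ℝ := by
  rw [ϑ.inner_mul, ha]

theorem inner_mul_of_minus {a : V} (ha : ϑ.toFun a = -a) (x y : V) :
    ⟪J.mul a x, y⟫_ℝ = -⟪x, J.mul a y⟫_ℝ := by
  rw [ϑ.inner_mul, ha]; simp

theorem continuous_mul {X : Type*} [TopologicalSpace X] (J : JordanAlgebra V) {f g : X → V}
    (hf : Continuous f) (hg : Continuous g) : Continuous fun x => J.mul (f x) (g x) :=
  (J.mulCLM.continuous.comp hf).clm_apply hg

/-- For a primitive idempotent `c` of the euclidean Jordan algebra `V⁺`, the Peirce space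
`V₁(c) ∩ V⁺` is spanned by `c`. -/
theorem eq_smul_of_primitive {c : V} (hθ : ϑ.toFun c = c) (hcc : J.mul c c = c) (hc0 : c ≠ 0)
    (hprim : ∀ a ∈ plusSpace J ϑ, ∀ b ∈ plusSpace J ϑ, J.mul a a = a → J.mul b b = b →
      c = a + b → a = 0 ∨ b = 0)
    {x : V} (hx : J.mul c x = x) (hxθ : ϑ.toFun x = x) : ∃ t : ℝ, x = t • c := by
  let A : Submodule ℝ V := LinearMap.eqLocus (J.mul c) LinearMap.id ⊓ plusSpace J ϑ
  have memA : ∀ {y}, y ∈ A ↔ J.mul c y = y ∧ ϑ.toFun y = y := Iff.rfl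
  have hcA : c ∈ A := ⟨hcc, hθ⟩
  have mulA : ∀ {y z}, y ∈ A → z ∈ A → J.mul y z ∈ A := by
    intro y z hy hz
    refine ⟨one_mul_one hcc hy.1 hz.1, ?_⟩
    change ϑ.toFun _ = _
    rw [ϑ.map_mul, memA.1 hy |>.2, memA.1 hz |>.2]; rfl
  -- Idempotents of `A = V₁(c) ∩ V⁺` are found as critical points of this cubic form on the unit
  -- sphere, which replaces a spectral theorem.
  let f : V → ℝ := fun y => ⟪J.mul y y, y⟫_ℝ
  have hf : Continuous f := (continuous_mul J continuous_id continuous_id).inner continuous_id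
  have hS : IsCompact (Metric.sphere (0 : V) 1 ∩ (A : Set V)) :=
    (isCompact_sphere 0 1).inter_right A.closed_of_finiteDimensional
  have hcn : 0 < ‖c‖ := norm_pos_iff.2 hc0
  obtain ⟨x₀, ⟨hx1, hxA⟩, hmax⟩ := hS.exists_isMaxOn
    ⟨‖c‖⁻¹ • c, by simp [norm_smul, hcn.ne'], A.smul_mem _ hcA⟩ hf.continuousOn
  have hx1 : ‖x₀‖ = 1 := by simpa using hx1
  have hxA : x₀ ∈ A := hxA
  set M := f x₀ with hM
  have hfs : ∀ (s : ℝ) (y : V), f (s • y) = s ^ 3 * f y := by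
    intro s y
    simp only [f, map_smul, LinearMap.smul_apply, inner_smul_left, inner_smul_right]
    simp; ring
  have hle : ∀ y ∈ A, f y ≤ M * ‖y‖ ^ 3 := by
    intro y hy
    rcases eq_or_ne y 0 with rfl | h0
    · simp [f]
    have hyn : 0 < ‖y‖ := norm_pos_iff.2 h0
    have h1 : f (‖y‖⁻¹ • y) ≤ M := hmax ⟨by simp [norm_smul, hyn.ne'], A.smul_mem _ hy⟩
    rw [hfs, inv_pow] at h1
    rwa [inv_mul_le_iff₀ (by positivity), _root_.mul_comm] at h1
  -- Squaring removes the odd power of the norm, so that the bound is polynomial and can be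
  -- differentiated along lines.
  have hsq : ∀ y ∈ A, f y ^ 2 ≤ M ^ 2 * (‖y‖ ^ 2) ^ 3 := by
    intro y hy
    have h1 := hle y hy
    have h2 := hle (-y) (A.neg_mem hy)
    rw [← neg_one_smul ℝ y, hfs, norm_smul] at h2
    simp only [norm_neg, norm_one, _root_.one_mul] at h2
    have : f y ^ 2 ≤ (M * ‖y‖ ^ 3) ^ 2 := sq_le_sq' (by linarith) h1
    calc f y ^ 2 ≤ _ := this
      _ = _ := by ring
  have hfc : f c = ‖c‖ ^ 2 := by simp only [f, hcc, real_inner_self_eq_norm_sq]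
  have hMpos : 0 < M := by
    have := hle c hcA
    rw [hfc] at this
    by_contra h
    have h2 : M * ‖c‖ ^ 3 ≤ 0 := mul_nonpos_of_nonpos_of_nonneg (not_lt.1 h) (by positivity)
    have h3 : 0 < ‖c‖ ^ 2 := by positivity
    linarith
  -- First-order condition at the maximizer `x₀`; it makes `x₀² = M x₀`, so `M⁻¹ x₀` is idempotent.
  have hcrit : ∀ y ∈ A, ⟪J.mul x₀ x₀, y⟫_ℝ = M * ⟪x₀, y⟫_ℝ := by
    intro y hy
    have hu : HasDerivAt (fun s : ℝ => x₀ + s • y) y 0 := by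
      simpa using ((hasDerivAt_id (0 : ℝ)).smul_const y).const_add x₀
    have h1 := (J.hasDerivAt_mul hu hu).inner ℝ hu
    have h2 := hu.norm_sq
    have h3 := ((h2.pow 3).const_mul (M ^ 2)).sub (h1.pow 2)
    have hmin : IsLocalMin (fun s : ℝ => M ^ 2 * (‖x₀ + s • y‖ ^ 2) ^ 3 -
        ⟪J.mul (x₀ + s • y) (x₀ + s • y), x₀ + s • y⟫_ℝ ^ 2) 0 := by
      refine Filter.Eventually.of_forall fun s => ?_
      have := hsq (x₀ + s • y) (A.add_mem hxA (A.smul_mem s hy))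
      have e0 : ⟪J.mul x₀ x₀, x₀⟫_ℝ = M := rfl
      simp only [zero_smul, add_zero, hx1, e0]
      simp only [f] at this
      linarith
    have h4 := hmin.hasDerivAt_eq_zero h3
    have e0 : ⟪J.mul x₀ x₀, x₀⟫_ℝ = M := rfl
    have e1 : ⟪J.mul x₀ y, x₀⟫_ℝ = ⟪J.mul x₀ x₀, y⟫_ℝ := by
      rw [inner_mul_of_plus (memA.1 hxA).2, real_inner_comm]
    simp only [zero_smul, add_zero, hx1, e0, J.mul_comm y x₀, inner_add_left, e1] at h4
    norm_num at h4
    have h5 : M * (M * ⟪x₀, y⟫_ℝ - ⟪J.mul x₀ x₀, y⟫_ℝ) = 0 := by linarith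
    rcases mul_eq_zero.1 h5 with h | h <;> linarith
  have hx2 : J.mul x₀ x₀ = M • x₀ := by
    have hd : J.mul x₀ x₀ - M • x₀ ∈ A := A.sub_mem (mulA hxA hxA) (A.smul_mem _ hxA)
    have := hcrit _ hd
    rw [← real_inner_smul_left, ← sub_eq_zero, ← inner_sub_left, inner_self_eq_zero] at this
    exact sub_eq_zero.1 this
  have hpi : J.mul (M⁻¹ • x₀) (M⁻¹ • x₀) = M⁻¹ • x₀ := by
    rw [map_smul, map_smul, LinearMap.smul_apply, hx2, smul_smul, smul_smul]
    congr 1; field_simp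
  have hpA : M⁻¹ • x₀ ∈ A := A.smul_mem _ hxA
  have hx00 : x₀ ≠ 0 := by rintro rfl; simp at hx1
  -- Primitivity leaves only the trivial splitting of `c` into `M⁻¹ x₀` and its complement, so `c`
  -- itself maximizes.
  have hcx : c = M⁻¹ • x₀ := by
    have hq : J.mul (c - M⁻¹ • x₀) (c - M⁻¹ • x₀) = c - M⁻¹ • x₀ := by
      have h1 := (memA.1 hpA).1
      have h2 : J.mul (M⁻¹ • x₀) c = M⁻¹ • x₀ := by rw [J.mul_comm, h1]
      simp only [map_sub, LinearMap.sub_apply, hcc, h1, hpi, h2]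
      abel
    rcases hprim (M⁻¹ • x₀) hpA.2 (c - M⁻¹ • x₀) (A.sub_mem hcA hpA).2 hpi hq (by abel) with h | h
    · exact absurd h (smul_ne_zero (inv_ne_zero hMpos.ne') hx00)
    · exact sub_eq_zero.1 h
  have hMc : M * ‖c‖ = 1 := by
    rw [hcx, norm_smul, hx1, Real.norm_of_nonneg (inv_nonneg.2 hMpos.le)]
    field_simp
  refine ⟨⟪c, x⟫_ℝ / ‖c‖ ^ 2, ?_⟩
  by_contra hne
  set y := x - (⟪c, x⟫_ℝ / ‖c‖ ^ 2) • c with hy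
  have hy0 : y ≠ 0 := fun h => hne (sub_eq_zero.1 h)
  have hyA : y ∈ A := A.sub_mem ⟨hx, hxθ⟩ (A.smul_mem _ hcA)
  have hcy : ⟪c, y⟫_ℝ = 0 := by
    rw [hy, inner_sub_right, inner_smul_right, real_inner_self_eq_norm_sq]
    field_simp; ring
  have hyn : 0 < ‖y‖ := norm_pos_iff.2 hy0
  have hexp : ∀ s : ℝ, f (c + s • y) = ‖c‖ ^ 2 + 3 * s ^ 2 * ‖y‖ ^ 2 + s ^ 3 * f y := by
    intro s
    have e1 : J.mul c y = y := (memA.1 hyA).1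
    have e2 : ⟪J.mul y y, c⟫_ℝ = ‖y‖ ^ 2 := by
      rw [inner_mul_of_plus (memA.1 hyA).2, J.mul_comm, e1, real_inner_self_eq_norm_sq]
    simp only [f, map_add, map_smul, LinearMap.add_apply, LinearMap.smul_apply, inner_add_left,
      inner_add_right, inner_smul_left, inner_smul_right, hcc, J.mul_comm y c, e1, e2, hcy,
      real_inner_comm c y, real_inner_self_eq_norm_sq]
    simp; ring
  have hnorm : ∀ s : ℝ, ‖c + s • y‖ ^ 2 = ‖c‖ ^ 2 + s ^ 2 * ‖y‖ ^ 2 := by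
    intro s
    rw [norm_add_sq_real, inner_smul_right, hcy, norm_smul, Real.norm_eq_abs, mul_pow, sq_abs]
    ring
  have hM2 : M ^ 2 * ‖c‖ ^ 2 = 1 := by rw [← mul_pow, hMc, one_pow]
  -- A vector `y` of `A` orthogonal to `c` beats the maximum: for `sy` as long as `c`, `f(c + sy) ≥
  -- 4‖c‖²`, whereas the bound allows only `f² ≤ 8‖c‖⁴`.
  have main : ∀ s : ℝ, s ^ 2 * ‖y‖ ^ 2 = ‖c‖ ^ 2 → 0 ≤ s ^ 3 * f y → False := by
    intro s hs hsf
    have h1 := hsq (c + s • y) (A.add_mem hcA (A.smul_mem s hyA))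
    rw [hexp, hnorm, hs, mul_assoc, hs] at h1
    have h3 : M ^ 2 * (‖c‖ ^ 2 + ‖c‖ ^ 2) ^ 3 = 8 * (‖c‖ ^ 2) ^ 2 := by
      linear_combination 8 * (‖c‖ ^ 2) ^ 2 * hM2
    rw [h3] at h1
    have hpos : 0 < ‖c‖ ^ 2 := by positivity
    nlinarith
  have hs2 : (‖c‖ / ‖y‖) ^ 2 * ‖y‖ ^ 2 = ‖c‖ ^ 2 := by field_simp
  rcases le_total 0 (f y) with h | h
  · exact main (‖c‖ / ‖y‖) hs2 (by positivity)
  · refine main (-(‖c‖ / ‖y‖)) (by rw [neg_sq, hs2]) ?_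
    have : 0 ≤ (‖c‖ / ‖y‖) ^ 3 := by positivity
    nlinarith


theorem finrank_le_of_mapsTo {S T : Submodule ℝ V} (f : V →ₗ[ℝ] V) (h : ∀ x ∈ S, f x ∈ T)
    (hi : ∀ x ∈ S, f x = 0 → x = 0) : finrank ℝ S ≤ finrank ℝ T := by
  refine LinearMap.finrank_le_finrank_of_injective (f := f.restrict h) ?_
  rw [← LinearMap.ker_eq_bot, LinearMap.ker_eq_bot']
  intro x hx
  exact Subtype.ext (hi x x.2 (congrArg Subtype.val hx))

variable {c : Fin (splitRank J ϑ) → V} (hc : IsJordanFrame J ϑ c)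
include hc

namespace IsJordanFrame

theorem line {i : Fin (splitRank J ϑ)} {x : V} (hx : J.mul (c i) x = x) (hxθ : ϑ.toFun x = x) :
    ∃ t : ℝ, x = t • c i :=
  eq_smul_of_primitive (hc.mem i) (hc.idem i) (hc.ne_zero i) (hc.primitive i) hx hxθ

theorem theta (i) : ϑ.toFun (c i) = c i := hc.mem i

theorem sum_mul (x : V) : ∑ i, J.mul (c i) x = x := by
  rw [← LinearMap.sum_apply, ← map_sum, hc.sum, J.one_mul]

theorem mul_comm' (i j) (x : V) : J.mul (c i) (J.mul (c j) x) = J.mul (c j) (J.mul (c i) x) := by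
  rcases eq_or_ne i j with rfl | h
  · rfl
  · exact mul_comm_of_zero (hc.idem i) (hc.orth i j h) x

theorem norm_sq (i) : ‖c i‖ ^ 2 = J.tr (c i) := by
  rw [← real_inner_self_eq_norm_sq, ϑ.inner_eq, hc.theta, τ, hc.idem]

theorem tr_pos (i) : 0 < J.tr (c i) := by
  rw [← hc.norm_sq]
  have := norm_pos_iff.2 (hc.ne_zero i)
  positivity

theorem eq_zero_of_one {i k} (h : k ≠ i) {x : V} (hx : J.mul (c i) x = x) :
    J.mul (c k) x = 0 := by
  rw [J.mul_comm]
  exact one_mul_zero (hc.idem i) hx (hc.orth i k h.symm)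

/-- For the idempotent `c_i + c_j` the element `x` lies in `V₁` and `c_k` in `V₀`. -/
theorem eq_zero_of_half {i j k} (hij : i ≠ j) (hki : k ≠ i) (hkj : k ≠ j) {x : V}
    (hi : J.mul (c i) x = (1 / 2 : ℝ) • x) (hj : J.mul (c j) x = (1 / 2 : ℝ) • x) :
    J.mul (c k) x = 0 := by
  have h1 : J.mul (c i + c j) (c i + c j) = c i + c j := by
    simp [hc.idem, hc.orth i j hij, hc.orth j i hij.symm]
  have h2 : J.mul (c i + c j) x = x := by
    rw [map_add, LinearMap.add_apply, hi, hj]; module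
  rw [J.mul_comm]
  exact one_mul_zero h1 h2 (by simp [hc.orth i k hki.symm, hc.orth j k hkj.symm])

theorem mem_peirce_self {i} {x : V} : x ∈ peirce J ϑ c i i ↔ J.mul (c i) x = x := by
  simp only [peirce, Submodule.mem_iInf, LinearMap.mem_ker, LinearMap.sub_apply, L,
    LinearMap.smul_apply, LinearMap.id_apply, sub_eq_zero]
  constructor
  · intro h
    simpa using h i
  · intro h k
    rcases eq_or_ne i k with rfl | hk
    · simpa using h
    · simp [hk, hc.eq_zero_of_one hk.symm h]

theorem mem_peirce_of_ne {i j} (hij : i ≠ j) {x : V} : x ∈ peirce J ϑ c i j ↔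
    J.mul (c i) x = (1 / 2 : ℝ) • x ∧ J.mul (c j) x = (1 / 2 : ℝ) • x := by
  simp only [peirce, Submodule.mem_iInf, LinearMap.mem_ker, LinearMap.sub_apply, L,
    LinearMap.smul_apply, LinearMap.id_apply, sub_eq_zero]
  constructor
  · intro h
    refine ⟨?_, ?_⟩
    · simpa [hij.symm] using h i
    · simpa [hij] using h j
  · rintro ⟨h1, h2⟩ k
    rcases eq_or_ne i k with rfl | hik
    · simpa [hij.symm] using h1
    rcases eq_or_ne j k with rfl | hjk
    · simpa [hij] using h2
    · simp [hik, hjk, hc.eq_zero_of_half hij hik.symm hjk.symm h1 h2]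

theorem peirce_symm (i j) : peirce J ϑ c i j = peirce J ϑ c j i := by
  rcases eq_or_ne i j with rfl | h
  · rfl
  · ext x
    rw [hc.mem_peirce_of_ne h, hc.mem_peirce_of_ne h.symm, and_comm]

/-- Squares of elements of `V_{ij}` which are homogeneous with respect to `ϑ`. -/
theorem sq_of_mem {i j} (hij : i ≠ j) {x : V} (hx : x ∈ peirce J ϑ c i j)
    (hθ : ϑ.toFun (J.mul x x) = J.mul x x) : ∃ a : ℝ, J.mul x x = a • (c i + c j) ∧
      2 * a * J.tr (c i) = J.τ x x ∧ 2 * a * J.tr (c j) = J.τ x x := by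
  obtain ⟨h1, h2⟩ := (hc.mem_peirce_of_ne hij).1 hx
  have hsum : J.mul (c i) (J.mul x x) + J.mul (c j) (J.mul x x) = J.mul x x := by
    conv_rhs => rw [← hc.sum_mul (J.mul x x)]
    rw [← Finset.sum_subset (Finset.subset_univ {i, j}), Finset.sum_pair hij]
    intro k _ hk
    simp only [Finset.mem_insert, Finset.mem_singleton, not_or] at hk
    have := hc.eq_zero_of_half hij hk.1 hk.2 h1 h2
    exact zero_mul_zero (hc.idem k) this this
  obtain ⟨a, ha⟩ := hc.line (half_mul_half (hc.idem i) h1 h1)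
    (by rw [ϑ.map_mul, hθ, hc.theta])
  obtain ⟨b, hb⟩ := hc.line (half_mul_half (hc.idem j) h2 h2)
    (by rw [ϑ.map_mul, hθ, hc.theta])
  rw [ha, hb] at hsum
  have ta : 2 * a * J.tr (c i) = J.τ x x := by
    have : J.τ (J.mul (c i) (J.mul x x)) (c i) = 1 / 2 * J.τ x x := by
      rw [τ_mul, hc.idem, τ_mul, J.mul_comm x, h1, τ_smul_right]
    rw [ha, τ_smul_left, τ, hc.idem] at this
    linarith
  have tb : 2 * b * J.tr (c j) = J.τ x x := by
    have : J.τ (J.mul (c j) (J.mul x x)) (c j) = 1 / 2 * J.τ x x := by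
      rw [τ_mul, hc.idem, τ_mul, J.mul_comm x, h2, τ_smul_right]
    rw [hb, τ_smul_left, τ, hc.idem] at this
    linarith
  -- The Jordan identity for `x` and `c_i` reduces to `(a - b) x = 0`; for `x = 0` both coefficients
  -- vanish by the trace relations.
  have hab : a = b := by
    have hJ := J.jordan x (c i)
    rw [J.mul_comm x (c i), h1, ha, ← hsum] at hJ
    simp only [map_add, map_smul, LinearMap.smul_apply, J.mul_comm x (c i), J.mul_comm x (c j), h1,
      h2] at hJ
    have hz : (a - b) • x = 0 := by linear_combination (norm := module) (-4 : ℝ) • hJ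
    rcases smul_eq_zero.1 hz with h | h
    · linarith
    · subst h
      have z : J.τ (0 : V) 0 = 0 := by simpa using J.τ_smul_left 0 0 0
      rw [z] at ta tb
      have p1 := hc.tr_pos i
      have p2 := hc.tr_pos j
      have : a = 0 := by
        rcases mul_eq_zero.1 ta with h | h
        · linarith
        · linarith
      have : b = 0 := by
        rcases mul_eq_zero.1 tb with h | h
        · linarith
        · linarith
      linarith
  subst hab
  exact ⟨a, by rw [← hsum, smul_add], ta, tb⟩

theorem sq_of_plus {i j} (hij : i ≠ j) {x : V} (hx : x ∈ peirce J ϑ c i j)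
    (hθ : ϑ.toFun x = x) : ∃ a : ℝ, J.mul x x = a • (c i + c j) ∧
      2 * a * J.tr (c i) = ‖x‖ ^ 2 ∧ 2 * a * J.tr (c j) = ‖x‖ ^ 2 := by
  have := hc.sq_of_mem hij hx (by rw [ϑ.map_mul, hθ])
  rwa [ϑ.τ_eq_inner, hθ, real_inner_self_eq_norm_sq] at this

theorem sq_of_minus {i j} (hij : i ≠ j) {x : V} (hx : x ∈ peirce J ϑ c i j)
    (hθ : ϑ.toFun x = -x) : ∃ a : ℝ, J.mul x x = a • (c i + c j) ∧
      2 * a * J.tr (c i) = -‖x‖ ^ 2 ∧ 2 * a * J.tr (c j) = -‖x‖ ^ 2 := by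
  have := hc.sq_of_mem hij hx (by rw [ϑ.map_mul, hθ]; simp)
  rwa [ϑ.τ_eq_inner, hθ, inner_neg_right, real_inner_self_eq_norm_sq] at this

theorem mul_mem_peirce {i j k} (hij : i ≠ j) (hki : k ≠ i) (hkj : k ≠ j) {w x : V}
    (hw : w ∈ peirce J ϑ c i j) (hx : x ∈ peirce J ϑ c k i) : J.mul w x ∈ peirce J ϑ c k j := by
  obtain ⟨w1, w2⟩ := (hc.mem_peirce_of_ne hij).1 hw
  obtain ⟨x1, x2⟩ := (hc.mem_peirce_of_ne hki).1 hx
  have w0 := hc.eq_zero_of_half hij hki hkj w1 w2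
  have x0 := hc.eq_zero_of_half hki hkj.symm hij.symm x1 x2
  rw [hc.mem_peirce_of_ne hkj]
  refine ⟨zero_mul_half (hc.idem k) w0 x1, ?_⟩
  have := mul_mul_half_of_zero (hc.idem k) (hc.orth k j hkj) w0 x1
  rw [x0, map_zero, add_zero, w2] at this
  simpa using this.symm

/-- On `V_{1/2}(c_k)` one has `2L(w)² = L(w²)` because `w ∈ V₀(c_k)`, and `L(c_i + c_j)` is `1/2` on
`V_{ki}`. -/
theorem mul_mul_of_sq {i j k} (hij : i ≠ j) (hki : k ≠ i) (hkj : k ≠ j) {w x : V} {a : ℝ}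
    (hw : w ∈ peirce J ϑ c i j) (hx : x ∈ peirce J ϑ c k i) (ha : J.mul w w = a • (c i + c j)) :
    J.mul w (J.mul w x) = (a / 4) • x := by
  obtain ⟨w1, w2⟩ := (hc.mem_peirce_of_ne hij).1 hw
  obtain ⟨x1, x2⟩ := (hc.mem_peirce_of_ne hki).1 hx
  have w0 := hc.eq_zero_of_half hij hki hkj w1 w2
  have x0 := hc.eq_zero_of_half hki hkj.symm hij.symm x1 x2
  have := mul_mul_half_of_zero (hc.idem k) w0 w0 x1
  rw [ha, map_smul, map_add, LinearMap.smul_apply, LinearMap.add_apply, x2, x0] at this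
  linear_combination (norm := module) (-1 / 2 : ℝ) • this

/-- Elements even or odd under `ϑ` have squares `a(c_i + c_j)` with `a ≠ 0`, so `L(w)²` is a nonzero
scalar on `V_{ki}`. This injectivity is behind all comparisons of Peirce dimensions. -/
theorem mul_ne_zero' {i j k} (hij : i ≠ j) (hki : k ≠ i) (hkj : k ≠ j) {w x : V}
    (hw : w ∈ peirce J ϑ c i j) (hwθ : ϑ.toFun w = w ∨ ϑ.toFun w = -w) (hw0 : w ≠ 0)
    (hx : x ∈ peirce J ϑ c k i) (h0 : J.mul w x = 0) : x = 0 := by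
  have hn : 0 < ‖w‖ ^ 2 := by have := norm_pos_iff.2 hw0; positivity
  obtain ⟨a, ha, ha0⟩ : ∃ a : ℝ, J.mul w w = a • (c i + c j) ∧ a ≠ 0 := by
    rcases hwθ with h | h
    · obtain ⟨a, ha, h1, -⟩ := hc.sq_of_plus hij hw h
      exact ⟨a, ha, by rintro rfl; linarith⟩
    · obtain ⟨a, ha, h1, -⟩ := hc.sq_of_minus hij hw h
      exact ⟨a, ha, by rintro rfl; linarith⟩
  have h1 := hc.mul_mul_of_sq hij hki hkj hw hx ha
  rw [h0, map_zero] at h1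
  exact (smul_eq_zero.1 h1.symm).resolve_left (div_ne_zero ha0 (by norm_num))

/-- If `V⁺` is simple, all the spaces `V_{ij} ∩ V⁺` are nonzero. -/
theorem exists_mem_plus (hs : (plus J ϑ).IsSimple) {i j} (hij : i ≠ j) :
    ∃ w ∈ peirce J ϑ c i j, ϑ.toFun w = w ∧ w ≠ 0 := by
  classical
  by_contra hcon
  -- The indices linked to `i`. If `j` is not among them, the idempotent `s` summing the linked
  -- `c_k` generates a proper ideal of `V⁺`.
  let S : Finset (Fin (splitRank J ϑ)) := Finset.univ.filter fun k =>
    k = i ∨ ∃ w ∈ peirce J ϑ c i k, ϑ.toFun w = w ∧ w ≠ 0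
  have hiS : i ∈ S := by simp [S]
  have hjS : j ∉ S := by
    simp only [S, Finset.mem_filter, Finset.mem_univ, true_and, not_or]
    exact ⟨hij.symm, hcon⟩
  set s := ∑ k ∈ S, c k with hsdef
  have hin : ∀ k ∈ S, J.mul s (c k) = c k := by
    intro k hk
    rw [hsdef, map_sum, LinearMap.sum_apply, Finset.sum_eq_single_of_mem k hk, hc.idem]
    exact fun l _ hl => hc.orth l k hl
  have hout : ∀ k ∉ S, J.mul s (c k) = 0 := by
    intro k hk
    rw [hsdef, map_sum, LinearMap.sum_apply]
    exact Finset.sum_eq_zero fun l hl => hc.orth l k (by rintro rfl; exact hk hl)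
  have hss : J.mul s s = s := by
    conv_lhs => rw [hsdef, map_sum, ← hsdef]
    exact Finset.sum_congr rfl hin
  have hsθ : ϑ.toFun s = s := by
    rw [hsdef, map_sum]
    exact Finset.sum_congr rfl fun k _ => hc.theta k
  -- `V_{1/2}(s) ∩ V⁺` is made of Peirce components joining a linked index to an unlinked one, and
  -- these vanish.
  have hhalf : ∀ u, ϑ.toFun u = u → J.mul s u = (1 / 2 : ℝ) • u → u = 0 := by
    intro u huθ hu
    -- Otherwise multiplication by an element linking `i` and `k` would carry this component
    -- injectively into `V_{il}`, linking `l` as well.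
    have hz : ∀ k ∈ S, ∀ l ∉ S, J.mul (c l) (J.mul (c k) u) = 0 := by
      intro k hk l hl
      have hkl : k ≠ l := by rintro rfl; exact hl hk
      have e1 := mul_mul_half_of_one hss (hin k hk) (hin k hk) hu
      rw [hc.idem] at e1
      have e2 := mul_mul_half_of_zero hss (hout l hl) (hout l hl)
        (one_mul_half hss (hin k hk) hu)
      rw [hc.idem] at e2
      have m1 : J.mul (c l) (J.mul (c k) u) ∈ peirce J ϑ c k l := by
        rw [hc.mem_peirce_of_ne hkl]
        constructor
        · rw [hc.mul_comm' k l]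
          have : J.mul (c k) (J.mul (c k) u) = (1 / 2 : ℝ) • J.mul (c k) u := by
            linear_combination (norm := module) (-1 / 2 : ℝ) • e1
          rw [this, map_smul]
        · linear_combination (norm := module) (-1 / 2 : ℝ) • e2
      have m2 : ϑ.toFun (J.mul (c l) (J.mul (c k) u)) = J.mul (c l) (J.mul (c k) u) := by
        rw [ϑ.map_mul, ϑ.map_mul, huθ, hc.theta, hc.theta]
      by_contra hv
      apply hl
      simp only [S, Finset.mem_filter, Finset.mem_univ, true_and] at hk ⊢
      rcases hk with rfl | ⟨w, hw, hwθ, hw0⟩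
      · exact Or.inr ⟨_, m1, m2, hv⟩
      · rcases eq_or_ne k i with rfl | hki
        · exact Or.inr ⟨_, m1, m2, hv⟩
        rcases eq_or_ne l i with rfl | hli
        · exact Or.inl rfl
        right
        rw [hc.peirce_symm] at hw m1
        refine ⟨J.mul w (J.mul (c l) (J.mul (c k) u)), ?_, ?_, ?_⟩
        · rw [hc.peirce_symm]
          exact hc.mul_mem_peirce hki hkl.symm hli hw m1
        · rw [ϑ.map_mul, m2, hwθ]
        · exact fun h => hv (hc.mul_ne_zero' hki hkl.symm hli hw (Or.inl hwθ) hw0 m1 h)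
    have h1 : ∑ l, J.mul (c l) (J.mul s u) = ∑ l ∈ S, J.mul (c l) (J.mul s u) := by
      symm
      refine Finset.sum_subset (Finset.subset_univ _) fun l _ hl => ?_
      conv_lhs => rw [hsdef, map_sum, LinearMap.sum_apply, map_sum]
      exact Finset.sum_eq_zero fun k hk => hz k hk l hl
    rw [hc.sum_mul, ← LinearMap.sum_apply, ← map_sum, ← hsdef, hu, map_smul, hu] at h1
    have : (1 / 4 : ℝ) • u = 0 := by linear_combination (norm := module) h1
    exact (smul_eq_zero.1 this).resolve_left (by norm_num)
  -- `V₁(s) ∩ V⁺` is an ideal, as no half-space is left; it contains `c_i` but not the unit.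
  let I : Submodule ℝ (plusSpace J ϑ) :=
    (LinearMap.eqLocus (J.mul s) LinearMap.id).comap (plusSpace J ϑ).subtype
  have memI : ∀ x : plusSpace J ϑ, x ∈ I ↔ J.mul s x = (x : V) := fun x => Iff.rfl
  have hI := hs.2.2 I (by
    intro x y hy
    rw [memI] at hy ⊢
    have hxθ : ϑ.toFun (x : V) = x := x.2
    have h0 := hhalf (J.pHalf s x) (by simp [pHalf, ϑ.map_mul, hxθ, hsθ]) (mul_pHalf hss _)
    have hx := J.p_sum s (x : V)
    rw [h0, add_zero] at hx
    change J.mul s (J.mul (x : V) y) = J.mul (x : V) y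
    have z : J.mul (J.pZero s (x : V)) y = 0 := by
      rw [J.mul_comm]; exact one_mul_zero hss hy (mul_pZero hss _)
    rw [← hx, map_add, LinearMap.add_apply, z, add_zero]
    exact one_mul_one hss (mul_pOne hss _) hy)
  rcases hI with h | h
  · have : (⟨c i, hc.mem i⟩ : plusSpace J ϑ) ∈ I := (memI _).2 (hin i hiS)
    rw [h, Submodule.mem_bot] at this
    exact hc.ne_zero i (congrArg Subtype.val this)
  · have : (⟨J.one, CartanInvolution.map_one J ϑ⟩ : plusSpace J ϑ) ∈ I := by rw [h]; trivial
    have h1 := (memI _).1 this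
    rw [mul_one'] at h1
    have h2 := hout j hjS
    simp only at h1
    rw [h1, J.one_mul] at h2
    exact hc.ne_zero j h2

end IsJordanFrame

end Frame

end MinRep.JordanAlgebra

namespace MinRep.JordanAlgebra

/-! ### Equal multiplicities in a frame and traces over `V_{1/2}`. -/

section FrameTraces

variable {V : Type*} [NormedAddCommGroup V] [InnerProductSpace ℝ V] [FiniteDimensional ℝ V]
variable {J : JordanAlgebra V} {ϑ : CartanInvolution J}

theorem one_ne_zero' [Nontrivial V] (J : JordanAlgebra V) : J.one ≠ 0 := by
  intro h
  obtain ⟨x, hx⟩ := exists_ne (0 : V)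
  apply hx
  rw [← J.one_mul x, h, map_zero, LinearMap.zero_apply]

theorem tr_one [Nontrivial V] (J : JordanAlgebra V) : J.tr J.one = J.rank := by
  have h : J.L J.one = LinearMap.id := LinearMap.ext J.one_mul
  have hn : (finrank ℝ V : ℝ) ≠ 0 := Nat.cast_ne_zero.2 (finrank_pos).ne'
  rw [tr, h, LinearMap.trace_id, div_mul_cancel₀ _ hn]

theorem rank_pos [Nontrivial V] (ϑ : CartanInvolution J) : (0 : ℝ) < J.rank := by
  have h : ⟪J.one, J.one⟫_ℝ = J.rank := by
    rw [ϑ.inner_eq, ϑ.map_one, τ, J.one_mul, tr_one]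
  rw [← h, real_inner_self_eq_norm_sq]
  have := norm_pos_iff.2 J.one_ne_zero'
  positivity

theorem tr_eq_inner (ϑ : CartanInvolution J) (x : V) : J.tr x = ⟪J.one, x⟫_ℝ := by
  rw [ϑ.inner_eq, ← ϑ.τ_left, ϑ.map_one, τ, J.one_mul]

theorem tr_theta (ϑ : CartanInvolution J) (x : V) : J.tr (ϑ.toFun x) = J.tr x := by
  rw [tr_eq_inner ϑ, tr_eq_inner ϑ, ← ϑ.inner_left, ϑ.map_one]

/-- The eigenspace of `ϑ` for the eigenvalue `-1`. -/
def minusSpace (J : JordanAlgebra V) (ϑ : CartanInvolution J) : Submodule ℝ V :=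
  LinearMap.eqLocus ϑ.toFun (-LinearMap.id)

theorem mem_minusSpace {x : V} : x ∈ minusSpace J ϑ ↔ ϑ.toFun x = -x := Iff.rfl

theorem theta_add (x : V) : ϑ.toFun (x + ϑ.toFun x) = x + ϑ.toFun x := by
  rw [map_add, ϑ.invol, add_comm]

theorem theta_sub (x : V) : ϑ.toFun (x - ϑ.toFun x) = -(x - ϑ.toFun x) := by
  rw [map_sub, ϑ.invol, neg_sub]

theorem half_add_half (x : V) :
    (1 / 2 : ℝ) • (x + ϑ.toFun x) + (1 / 2 : ℝ) • (x - ϑ.toFun x) = x := by module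

theorem finrank_plus_add_minus (S : Submodule ℝ V) (hS : ∀ x ∈ S, ϑ.toFun x ∈ S) :
    finrank ℝ ↥(S ⊓ plusSpace J ϑ) + finrank ℝ ↥(S ⊓ minusSpace J ϑ) = finrank ℝ S := by
  rw [← Submodule.finrank_sup_add_finrank_inf_eq]
  have h1 : (S ⊓ plusSpace J ϑ) ⊓ (S ⊓ minusSpace J ϑ) = ⊥ := by
    rw [eq_bot_iff]
    rintro x ⟨⟨-, h1⟩, ⟨-, h2⟩⟩
    have h1 : ϑ.toFun x = x := h1
    have h2 : ϑ.toFun x = -x := h2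
    rw [h1] at h2
    change x = 0
    linear_combination (norm := module) (1 / 2 : ℝ) • h2
  have h2 : (S ⊓ plusSpace J ϑ) ⊔ (S ⊓ minusSpace J ϑ) = S := by
    refine le_antisymm (sup_le inf_le_left inf_le_left) fun x hx => ?_
    rw [← half_add_half (ϑ := ϑ) x]
    refine Submodule.add_mem_sup ⟨S.smul_mem _ (S.add_mem hx (hS x hx)), ?_⟩
      ⟨S.smul_mem _ (S.sub_mem hx (hS x hx)), ?_⟩
    · exact (plusSpace J ϑ).smul_mem _ (theta_add x)
    · exact (minusSpace J ϑ).smul_mem _ (theta_sub x)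
  rw [h1, h2, finrank_bot, add_zero]

variable {c : Fin (splitRank J ϑ) → V} (hc : IsJordanFrame J ϑ c)
include hc

namespace IsJordanFrame

theorem splitRank_pos [Nontrivial V] : 0 < splitRank J ϑ := by
  by_contra h
  have h0 : splitRank J ϑ = 0 := by omega
  have := hc.sum
  have he : IsEmpty (Fin (splitRank J ϑ)) := by rw [h0]; infer_instance
  rw [Finset.univ_eq_empty, Finset.sum_empty] at this
  exact J.one_ne_zero' this.symm

theorem peirce_theta (i j) : ∀ x ∈ peirce J ϑ c i j, ϑ.toFun x ∈ peirce J ϑ c i j := by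
  intro x hx
  simp only [peirce, Submodule.mem_iInf, LinearMap.mem_ker, LinearMap.sub_apply, L,
    LinearMap.smul_apply, LinearMap.id_apply, sub_eq_zero] at hx ⊢
  intro k
  have := congrArg ϑ.toFun (hx k)
  rwa [ϑ.map_mul, hc.theta, map_smul] at this

/-- A nonzero `w ∈ V_{ij} ∩ V⁺` with `w² = a(c_i + c_j)` gives `2a tr(c_i) = ‖w‖² = 2a tr(c_j)`. -/
theorem tr_eq_tr (hs : (plus J ϑ).IsSimple) (i j) : J.tr (c i) = J.tr (c j) := by
  rcases eq_or_ne i j with rfl | hij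
  · rfl
  obtain ⟨w, hw, hwθ, hw0⟩ := hc.exists_mem_plus hs hij
  obtain ⟨a, -, h1, h2⟩ := hc.sq_of_plus hij hw hwθ
  have hn : 0 < ‖w‖ ^ 2 := by have := norm_pos_iff.2 hw0; positivity
  have ha : a ≠ 0 := by rintro rfl; linarith
  have : 2 * a * (J.tr (c i) - J.tr (c j)) = 0 := by linarith
  rcases mul_eq_zero.1 this with h | h
  · exact absurd h (by simpa using ha)
  · linarith

theorem tr_eq [Nontrivial V] (hs : (plus J ϑ).IsSimple) (i) :
    J.tr (c i) = (J.rank : ℝ) / splitRank J ϑ := by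
  have h1 : J.tr J.one = ∑ k, J.tr (c k) := by
    rw [tr_eq_inner ϑ]
    conv_lhs => rw [← hc.sum, inner_sum]
    rw [hc.sum]
    exact Finset.sum_congr rfl fun k _ => (tr_eq_inner ϑ _).symm
  rw [tr_one, Finset.sum_congr rfl fun k _ => hc.tr_eq_tr hs k i] at h1
  simp only [Finset.sum_const, Finset.card_univ, Fintype.card_fin, nsmul_eq_mul] at h1
  have : (0 : ℝ) < splitRank J ϑ := Nat.cast_pos.2 hc.splitRank_pos
  rw [h1]
  field_simp

/-- Multiplication by a nonzero element of `V_{jk} ∩ V⁺` embeds `V_{ij}` into `V_{ik}` and commutes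
with `ϑ`. -/
theorem finrank_peirce_le (hs : (plus J ϑ).IsSimple) {i j k} (hij : i ≠ j) (hik : i ≠ k) :
    finrank ℝ (peirce J ϑ c i j) ≤ finrank ℝ (peirce J ϑ c i k) ∧
    finrank ℝ ↥(peirce J ϑ c i j ⊓ plusSpace J ϑ) ≤
      finrank ℝ ↥(peirce J ϑ c i k ⊓ plusSpace J ϑ) := by
  rcases eq_or_ne j k with rfl | hjk
  · exact ⟨le_rfl, le_rfl⟩
  obtain ⟨w, hw, hwθ, hw0⟩ := hc.exists_mem_plus hs hjk
  refine ⟨finrank_le_of_mapsTo (J.mul w) (fun x hx => hc.mul_mem_peirce hjk hij hik hw hx)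
    fun x hx h0 => hc.mul_ne_zero' hjk hij hik hw (Or.inl hwθ) hw0 hx h0,
    finrank_le_of_mapsTo (J.mul w) (fun x hx =>
      ⟨hc.mul_mem_peirce hjk hij hik hw hx.1, ?_⟩)
    fun x hx h0 => hc.mul_ne_zero' hjk hij hik hw (Or.inl hwθ) hw0 hx.1 h0⟩
  change ϑ.toFun _ = _
  have : ϑ.toFun x = x := hx.2
  rw [ϑ.map_mul, hwθ, this]; rfl

theorem finrank_peirce_eq (hs : (plus J ϑ).IsSimple) {i j k l} (hij : i ≠ j) (hkl : k ≠ l) :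
    finrank ℝ (peirce J ϑ c i j) = finrank ℝ (peirce J ϑ c k l) ∧
    finrank ℝ ↥(peirce J ϑ c i j ⊓ plusSpace J ϑ) =
      finrank ℝ ↥(peirce J ϑ c k l ⊓ plusSpace J ϑ) := by
  have e : ∀ {i j k}, i ≠ j → i ≠ k →
      finrank ℝ (peirce J ϑ c i j) = finrank ℝ (peirce J ϑ c i k) ∧
      finrank ℝ ↥(peirce J ϑ c i j ⊓ plusSpace J ϑ) =
        finrank ℝ ↥(peirce J ϑ c i k ⊓ plusSpace J ϑ) := fun h1 h2 =>
    ⟨le_antisymm (hc.finrank_peirce_le hs h1 h2).1 (hc.finrank_peirce_le hs h2 h1).1,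
      le_antisymm (hc.finrank_peirce_le hs h1 h2).2 (hc.finrank_peirce_le hs h2 h1).2⟩
  rcases eq_or_ne i k with rfl | hik
  · exact e hij hkl
  · have h1 := e hij hik
    rw [hc.peirce_symm i k] at h1
    have h2 := e hik.symm hkl
    exact ⟨h1.1.trans h2.1, h1.2.trans h2.2⟩

theorem finrank_eq_dConst (hs : (plus J ϑ).IsSimple) {i j} (hij : i ≠ j) :
    finrank ℝ (peirce J ϑ c i j) = dConst J ϑ c ∧
    finrank ℝ ↥(peirce J ϑ c i j ⊓ plusSpace J ϑ) = d₀Const J ϑ c := by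
  have h : 1 < splitRank J ϑ := by
    have h1 := i.2
    have h2 := j.2
    have h3 : (i : ℕ) ≠ j := fun h => hij (Fin.ext h)
    omega
  rw [dConst, d₀Const, dif_pos h, dif_pos h]
  exact hc.finrank_peirce_eq hs hij (by simp)

theorem d₀Const_pos (hs : (plus J ϑ).IsSimple) (h : 1 < splitRank J ϑ) : 0 < d₀Const J ϑ c := by
  have hij : (⟨0, Nat.lt_trans Nat.zero_lt_one h⟩ : Fin (splitRank J ϑ)) ≠ ⟨1, h⟩ := by simp
  obtain ⟨w, hw, hwθ, hw0⟩ := hc.exists_mem_plus hs hij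
  rw [← (hc.finrank_eq_dConst hs hij).2, finrank_pos_iff]
  exact ⟨⟨⟨w, hw, hwθ⟩, 0, fun h => hw0 (congrArg Subtype.val h)⟩⟩

theorem d₀Const_le (c : Fin (splitRank J ϑ) → V) : d₀Const J ϑ c ≤ dConst J ϑ c := by
  rw [dConst, d₀Const]
  split_ifs
  · exact Submodule.finrank_mono inf_le_left
  · exact le_rfl

/-- For `u ∈ V_{1/2}(c_i)` the components in `V_{ij}` are `2 c_j u`. -/
theorem mul_mem_of_half {i j} (hij : i ≠ j) {u : V} (hu : J.mul (c i) u = (1 / 2 : ℝ) • u) :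
    J.mul (c j) u ∈ peirce J ϑ c i j := by
  rw [hc.mem_peirce_of_ne hij]
  refine ⟨zero_mul_half (hc.idem i) (hc.orth i j hij) hu, ?_⟩
  have := mul_mul_half_of_zero (hc.idem i) (hc.orth i j hij) (hc.orth i j hij) hu
  rw [hc.idem] at this
  linear_combination (norm := module) (-1 / 2 : ℝ) • this

theorem half_eq_zero {i} {u : V} (hu : J.mul (c i) u = (1 / 2 : ℝ) • u)
    (h : ∀ j, j ≠ i → J.mul (c j) u = 0) : u = 0 := by
  have h1 := hc.sum_mul u
  rw [Finset.sum_eq_single_of_mem i (Finset.mem_univ i) fun j _ hj => h j hj, hu] at h1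
  have : (1 / 2 : ℝ) • u = 0 := by linear_combination (norm := module) (-1 : ℝ) • h1
  exact (smul_eq_zero.1 this).resolve_left (by norm_num)

theorem inner_pHalf (i) (x y : V) : ⟪J.pHalf (c i) x, y⟫_ℝ = ⟪x, J.pHalf (c i) y⟫_ℝ := by
  simp only [pHalf, LinearMap.sub_apply, LinearMap.smul_apply, LinearMap.comp_apply,
    inner_sub_left, inner_sub_right, real_inner_smul_left, real_inner_smul_right,
    inner_mul_of_plus (hc.theta i)]

theorem inner_pZero (i) (x y : V) : ⟪J.pZero (c i) x, y⟫_ℝ = ⟪x, J.pZero (c i) y⟫_ℝ := by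
  simp only [pZero, LinearMap.sub_apply, LinearMap.smul_apply, LinearMap.comp_apply,
    inner_sub_left, inner_sub_right, real_inner_smul_left, real_inner_smul_right,
    LinearMap.add_apply, inner_add_left, inner_add_right, LinearMap.id_apply,
    inner_mul_of_plus (hc.theta i)]

theorem inner_pOne (i) (x y : V) : ⟪J.pOne (c i) x, y⟫_ℝ = ⟪x, J.pOne (c i) y⟫_ℝ := by
  simp only [pOne, LinearMap.sub_apply, LinearMap.smul_apply, LinearMap.comp_apply,
    inner_sub_left, inner_sub_right, real_inner_smul_left, real_inner_smul_right,
    inner_mul_of_plus (hc.theta i)]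

theorem theta_pHalf (i) (x : V) : ϑ.toFun (J.pHalf (c i) x) = J.pHalf (c i) (ϑ.toFun x) := by
  simp [pHalf, ϑ.map_mul, hc.theta]

theorem theta_pOne (i) (x : V) : ϑ.toFun (J.pOne (c i) x) = J.pOne (c i) (ϑ.toFun x) := by
  simp [pOne, ϑ.map_mul, hc.theta]

/-- Associative `ϑ`-invariant linear forms on `V₀(c_i)` are multiples of the trace. -/
theorem linearForm_eq (i) (f : V →ₗ[ℝ] ℝ) (K : ℝ) (hfθ : ∀ x, f (ϑ.toFun x) = f x)
    (hf : ∀ u v w, J.mul (c i) u = 0 → J.mul (c i) v = 0 → J.mul (c i) w = 0 → ϑ.toFun u = u →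
      ϑ.toFun v = v → ϑ.toFun w = w → f (J.mul u (J.mul w v) - J.mul w (J.mul u v)) = 0)
    (hfc : ∀ j, j ≠ i → f (c j) = K * J.tr (c j)) {w : V} (hw : J.mul (c i) w = 0) :
    f w = K * J.tr w := by
  -- The form is represented by a vector; the aim is that its `V₀` part `z` equals `K(e - c_i)`.
  obtain ⟨z', hz'⟩ : ∃ z', ∀ x, f x = ⟪z', x⟫_ℝ :=
    ⟨(InnerProductSpace.toDual ℝ V).symm (LinearMap.toContinuousLinearMap f), fun x => by simp⟩
  have hcz := mul_pZero (hc.idem i) z'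
  have hz : ∀ x, J.mul (c i) x = 0 → f x = ⟪J.pZero (c i) z', x⟫_ℝ := fun x hx => by
    rw [hc.inner_pZero, pZero_of_zero hx, hz']
  set z := J.pZero (c i) z'
  have hzθ : ϑ.toFun z = z := by
    have h0 : J.mul (c i) (ϑ.toFun z) = 0 := by
      have := congrArg ϑ.toFun hcz
      rwa [ϑ.map_mul, hc.theta, map_zero] at this
    have h1 : ∀ x, J.mul (c i) x = 0 → ⟪ϑ.toFun z - z, x⟫_ℝ = 0 := by
      intro x hx
      have hx' : J.mul (c i) (ϑ.toFun x) = 0 := by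
        have := congrArg ϑ.toFun hx
        rwa [ϑ.map_mul, hc.theta, map_zero] at this
      rw [inner_sub_left, ϑ.inner_left, ← hz _ hx', ← hz _ hx, hfθ, sub_self]
    have := h1 (ϑ.toFun z - z) (by rw [map_sub, h0, hcz, sub_self])
    exact sub_eq_zero.1 (inner_self_eq_zero.1 this)
  -- With `q = [L(u), L(w)] z`, the invariance of the form applied to `v = q` reads `⟪q, q⟫ = 0`.
  have hcomm : ∀ u w, J.mul (c i) u = 0 → J.mul (c i) w = 0 → ϑ.toFun u = u → ϑ.toFun w = w →
      J.mul u (J.mul w z) = J.mul w (J.mul u z) := by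
    intro u w hu hw huθ hwθ
    set q := J.mul u (J.mul w z) - J.mul w (J.mul u z) with hq
    have hq0 : J.mul (c i) q = 0 := by
      rw [hq, map_sub, zero_mul_zero (hc.idem i) hu (zero_mul_zero (hc.idem i) hw hcz),
        zero_mul_zero (hc.idem i) hw (zero_mul_zero (hc.idem i) hu hcz), sub_self]
    have hqθ : ϑ.toFun q = q := by
      rw [hq, map_sub]; simp only [ϑ.map_mul, huθ, hwθ, hzθ]
    have h1 := hf u q w hu hq0 hw huθ hqθ hwθ
    have e0 : J.mul (c i) (J.mul u (J.mul w q) - J.mul w (J.mul u q)) = 0 := by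
      rw [map_sub, zero_mul_zero (hc.idem i) hu (zero_mul_zero (hc.idem i) hw hq0),
        zero_mul_zero (hc.idem i) hw (zero_mul_zero (hc.idem i) hu hq0), sub_self]
    rw [hz _ e0, inner_sub_right, ← inner_mul_of_plus huθ, ← inner_mul_of_plus hwθ,
      ← inner_mul_of_plus hwθ, ← inner_mul_of_plus huθ, ← inner_sub_left, ← neg_sub, ← hq,
      inner_neg_left, neg_eq_zero, inner_self_eq_zero] at h1
    exact sub_eq_zero.1 h1
  -- Applying `hcomm` to `c_j` and the `V_{1/2}(c_j)` part `y` of `z` and pairing with `c_j` gives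
  -- `⟪z, y⟫/2 = ⟪z, y⟫/4`; hence `y = 0`, and `c_j z` is a multiple of `c_j`.
  have hj : ∀ j, j ≠ i → J.mul (c j) z = K • c j := by
    intro j hji
    have hyi : J.mul (c i) (J.pHalf (c j) z) = 0 := by
      simp only [pHalf, LinearMap.sub_apply, LinearMap.smul_apply, LinearMap.comp_apply, map_sub,
        map_smul, hc.mul_comm' i j, hcz, map_zero, sub_zero, smul_zero]
    have hyj := mul_pHalf (hc.idem j) z
    have hyθ : ϑ.toFun (J.pHalf (c j) z) = J.pHalf (c j) z := by rw [hc.theta_pHalf, hzθ]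
    have hyy : ⟪J.pHalf (c j) z, J.pHalf (c j) z⟫_ℝ = ⟪z, J.pHalf (c j) z⟫_ℝ := by
      rw [hc.inner_pHalf, pHalf_of_half hyj]
    set y := J.pHalf (c j) z with hy
    have h1 := hcomm (c j) y (hc.orth i j hji.symm) hyi (hc.theta j) hyθ
    have h2 := congrArg (fun x => ⟪x, c j⟫_ℝ) h1
    simp only [inner_mul_of_plus (hc.theta j), inner_mul_of_plus hyθ, hc.idem, J.mul_comm y (c j),
      hyj, real_inner_smul_right, map_smul] at h2
    rw [real_inner_comm] at hyy
    have hy0 : y = 0 := by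
      rw [← inner_self_eq_zero (𝕜 := ℝ), hyy]
      linarith
    have h3 : J.mul (c j) (J.mul (c j) z) = J.mul (c j) z := by
      rw [hy] at hy0
      simp only [pHalf, LinearMap.sub_apply, LinearMap.smul_apply, LinearMap.comp_apply] at hy0
      rcases smul_eq_zero.1 hy0 with h | h
      · norm_num at h
      · exact (sub_eq_zero.1 h).symm
    obtain ⟨a, ha⟩ := hc.line h3 (by rw [ϑ.map_mul, hzθ, hc.theta])
    have h4 := hfc j hji
    rw [hz _ (hc.orth i j hji.symm)] at h4
    have h5 : ⟪z, c j⟫_ℝ = a * J.tr (c j) := by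
      conv_lhs => rw [← hc.idem j]
      rw [← inner_mul_of_plus (hc.theta j), ha, real_inner_smul_left, real_inner_self_eq_norm_sq,
        hc.norm_sq]
    rw [h5] at h4
    rw [ha, mul_right_cancel₀ (hc.tr_pos j).ne' h4]
  have hzsum : z = K • (J.one - c i) := by
    rw [← hc.sum_mul z, ← Finset.add_sum_erase _ _ (Finset.mem_univ i), hcz, zero_add,
      Finset.sum_congr rfl fun j hj' => hj j (Finset.ne_of_mem_erase hj'), ← Finset.smul_sum,
      ← hc.sum, ← Finset.add_sum_erase _ c (Finset.mem_univ i), add_sub_cancel_left]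
  rw [hz _ hw, hzsum, real_inner_smul_left, inner_sub_left, ← tr_eq_inner ϑ]
  have : ⟪c i, w⟫_ℝ = 0 := by
    rw [← hc.idem i, inner_mul_of_plus (hc.theta i), hw, inner_zero_right]
  rw [this, sub_zero]

/-- The trace forms `w ↦ Tr(S L(w) h)`, `h` the projection onto `V_{1/2}(c_i)`. -/
def halfTrace (J : JordanAlgebra V) (S : V →ₗ[ℝ] V) (a : V) : V →ₗ[ℝ] ℝ where
  toFun w := LinearMap.trace ℝ V (S ∘ₗ J.mul w ∘ₗ J.pHalf a)
  map_add' x y := by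
    rw [map_add, LinearMap.add_comp, LinearMap.comp_add, map_add]
  map_smul' t x := by
    rw [map_smul, LinearMap.smul_comp, LinearMap.comp_smul, map_smul]; rfl

/-- The derivation `D = [L(u), L(w)]` commutes with `S` and with the projection to `V_{1/2}`, so its
action on `v` becomes a commutator of operators, which has trace zero. Thus `linearForm_eq` applies,
and only the values on the frame matter. -/
theorem halfTrace_eq (i) (S : V →ₗ[ℝ] V) (K : ℝ) (hSθ : ∀ x, S (ϑ.toFun x) = ϑ.toFun (S x))
    (hS : ∀ u x, ϑ.toFun u = u → S (J.mul u x) = J.mul u (S x))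
    (hfc : ∀ j, j ≠ i → halfTrace J S (c i) (c j) = K * J.tr (c j)) {w : V}
    (hw : J.mul (c i) w = 0) : halfTrace J S (c i) w = K * J.tr w := by
  refine hc.linearForm_eq i _ K (fun x => ?_) (fun u v w hu hv hw huθ hvθ hwθ => ?_) hfc hw
  · change LinearMap.trace ℝ V _ = LinearMap.trace ℝ V _
    have e : S ∘ₗ J.mul (ϑ.toFun x) ∘ₗ J.pHalf (c i) =
        (ϑ.toFun * (S ∘ₗ J.mul x ∘ₗ J.pHalf (c i))) * ϑ.toFun := by
      ext y
      simp only [LinearMap.comp_apply, Module.End.mul_apply]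
      rw [← hc.theta_pHalf, ← hSθ, ϑ.map_mul, ϑ.invol]
    rw [e, LinearMap.trace_mul_comm, ← mul_assoc]
    congr 1
    ext y
    simp [ϑ.invol]
  · change LinearMap.trace ℝ V _ = 0
    have hD : ∀ x, J.pHalf (c i) (J.mul u (J.mul w x) - J.mul w (J.mul u x)) =
        J.mul u (J.mul w (J.pHalf (c i) x)) - J.mul w (J.mul u (J.pHalf (c i) x)) := by
      intro x
      simp only [pHalf, LinearMap.sub_apply, LinearMap.smul_apply, LinearMap.comp_apply, map_sub,
        map_smul, mul_comm_of_zero (hc.idem i) hu, mul_comm_of_zero (hc.idem i) hw]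
    let D : Module.End ℝ V := J.mul u ∘ₗ J.mul w - J.mul w ∘ₗ J.mul u
    let F : Module.End ℝ V := S ∘ₗ J.mul v ∘ₗ J.pHalf (c i)
    have e : S ∘ₗ J.mul (J.mul u (J.mul w v) - J.mul w (J.mul u v)) ∘ₗ J.pHalf (c i) =
        D * F - F * D := by
      ext x
      have := J.inner_deriv u w v (J.pHalf (c i) x)
      simp only [D, F, LinearMap.comp_apply, LinearMap.sub_apply, Module.End.mul_apply, hD]
      rw [← hS _ _ hwθ, ← hS _ _ huθ, ← hS _ _ huθ, ← hS _ _ hwθ, ← map_sub, ← map_sub, this]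
      congr 1
      abel
    rw [e, map_sub, LinearMap.trace_mul_comm, sub_self]

theorem isProj_peirce {i j} (hij : i ≠ j) :
    LinearMap.IsProj (peirce J ϑ c i j) ((2 : ℝ) • (J.mul (c j) ∘ₗ J.pHalf (c i))) := by
  refine ⟨fun x => Submodule.smul_mem _ _ (hc.mul_mem_of_half hij (mul_pHalf (hc.idem i) x)),
    fun x hx => ?_⟩
  obtain ⟨h1, h2⟩ := (hc.mem_peirce_of_ne hij).1 hx
  simp only [LinearMap.smul_apply, LinearMap.comp_apply, pHalf_of_half h1, h2]
  module

theorem isProj_theta {S : Submodule ℝ V} {p : V →ₗ[ℝ] V} (h : LinearMap.IsProj S p)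
    (hS : ∀ x ∈ S, ϑ.toFun x ∈ S) :
    LinearMap.IsProj (S ⊓ plusSpace J ϑ) ((1 / 2 : ℝ) • (p + ϑ.toFun ∘ₗ p)) := by
  refine ⟨fun x => ⟨?_, ?_⟩, ?_⟩
  · exact S.smul_mem _ (S.add_mem (h.map_mem x) (hS _ (h.map_mem x)))
  · exact (plusSpace J ϑ).smul_mem _ (theta_add (p x))
  · rintro x ⟨h1, h2⟩
    have h2 : ϑ.toFun x = x := h2
    simp only [LinearMap.smul_apply, LinearMap.add_apply, LinearMap.comp_apply, h.map_id x h1, h2]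
    module

theorem trace_theta_proj {S : Submodule ℝ V} {p : V →ₗ[ℝ] V} (h : LinearMap.IsProj S p)
    (hS : ∀ x ∈ S, ϑ.toFun x ∈ S) :
    LinearMap.trace ℝ V (ϑ.toFun ∘ₗ p) =
      2 * (finrank ℝ ↥(S ⊓ plusSpace J ϑ) : ℝ) - finrank ℝ S := by
  have h1 := (hc.isProj_theta h hS).trace
  rw [map_smul, map_add, h.trace, smul_eq_mul] at h1
  linarith

/-- The origin of the Wallach point: `2L(c_j)` projects `V_{1/2}(c_i)` onto `V_{ij}`, so the value
at `c_j` is `d/2`, while `tr(c_j) = r/r₀`. -/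
theorem halfTrace_id [Nontrivial V] (hs : (plus J ϑ).IsSimple) (i) {w : V}
    (hw : J.mul (c i) w = 0) :
    halfTrace J LinearMap.id (c i) w = lam₁ J ϑ c * J.tr w := by
  refine hc.halfTrace_eq i LinearMap.id _ (fun _ => rfl) (fun _ _ _ => rfl) (fun j hj => ?_) hw
  have h := (hc.isProj_peirce hj.symm).trace
  rw [map_smul, (hc.finrank_eq_dConst hs hj.symm).1, smul_eq_mul] at h
  have h1 : halfTrace J LinearMap.id (c i) (c j) = dConst J ϑ c / 2 := by
    rw [← h]
    change LinearMap.trace ℝ V (J.mul (c j) ∘ₗ J.pHalf (c i)) = _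
    ring
  have r1 := rank_pos ϑ
  have r2 : (0 : ℝ) < splitRank J ϑ := Nat.cast_pos.2 hc.splitRank_pos
  rw [h1, hc.tr_eq hs, lam₁]
  field_simp

/-- The trace of `ϑ` on `V_{ij}` is `2d₀ - d`. -/
theorem halfTrace_theta [Nontrivial V] (hs : (plus J ϑ).IsSimple)
    (hd : dConst J ϑ c = 2 * d₀Const J ϑ c) (i) {w : V} (hw : J.mul (c i) w = 0) :
    halfTrace J ϑ.toFun (c i) w = 0 := by
  rw [hc.halfTrace_eq i ϑ.toFun 0 (fun _ => rfl) (fun u x hu => by rw [ϑ.map_mul, hu])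
    (fun j hj => ?_) hw, zero_mul]
  have h := hc.trace_theta_proj (hc.isProj_peirce hj.symm) (hc.peirce_theta i j)
  rw [(hc.finrank_eq_dConst hs hj.symm).1, (hc.finrank_eq_dConst hs hj.symm).2, hd,
    LinearMap.comp_smul, map_smul, smul_eq_mul] at h
  push_cast at h
  change LinearMap.trace ℝ V (ϑ.toFun ∘ₗ J.mul (c j) ∘ₗ J.pHalf (c i)) = _
  linarith

theorem isProj_pOne (i) : LinearMap.IsProj (peirce J ϑ c i i) (J.pOne (c i)) :=
  ⟨fun x => hc.mem_peirce_self.2 (mul_pOne (hc.idem i) x),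
    fun _ hx => pOne_of_one (hc.mem_peirce_self.1 hx)⟩

theorem finrank_diag_plus (i) : finrank ℝ ↥(peirce J ϑ c i i ⊓ plusSpace J ϑ) = 1 := by
  refine finrank_eq_one (⟨c i, hc.mem_peirce_self.2 (hc.idem i), hc.mem i⟩) ?_ ?_
  · exact fun h => hc.ne_zero i (congrArg Subtype.val h)
  · rintro ⟨x, hx1, hx2⟩
    obtain ⟨t, rfl⟩ := hc.line (hc.mem_peirce_self.1 hx1) hx2
    exact ⟨t, rfl⟩

end IsJordanFrame

end FrameTraces

end MinRep.JordanAlgebra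

namespace MinRep.JordanAlgebra

/-! ### Rank at least three: `d = 2 d₀` or `V` is euclidean. -/

section Dichotomy

variable {V : Type*} [NormedAddCommGroup V] [InnerProductSpace ℝ V] [FiniteDimensional ℝ V]
variable {J : JordanAlgebra V} {ϑ : CartanInvolution J}

theorem rank_le_two (h : ∀ x, ∃ a b : ℝ, J.mul x x = a • x + b • J.one) : J.rank ≤ 2 := by
  classical
  refine csSup_le (Set.range_nonempty _) ?_
  rintro _ ⟨x, rfl⟩
  have hle : J.powerSpan x ≤ Submodule.span ℝ (({J.one, x} : Finset V) : Set V) := by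
    refine Submodule.span_le.2 ?_
    rintro _ ⟨k, rfl⟩
    have hmap : ∀ y ∈ Submodule.span ℝ (({J.one, x} : Finset V) : Set V),
        J.L x y ∈ Submodule.span ℝ (({J.one, x} : Finset V) : Set V) := by
      intro y hy
      rw [Finset.coe_pair, Submodule.mem_span_pair] at hy
      obtain ⟨s, t, rfl⟩ := hy
      obtain ⟨a, b, hab⟩ := h x
      rw [Finset.coe_pair, Submodule.mem_span_pair]
      refine ⟨t * b, s + t * a, ?_⟩
      simp only [L, map_add, map_smul, hab, mul_one']
      module
    induction k with
    | zero => exact Submodule.subset_span (by simp)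
    | succ k ih => simp only [pow_succ', Module.End.mul_apply]; exact hmap _ ih
  refine (Submodule.finrank_mono hle).trans ((finrank_span_finset_le_card _).trans ?_)
  exact Finset.card_le_two

variable {c : Fin (splitRank J ϑ) → V} (hc : IsJordanFrame J ϑ c)
include hc

namespace IsJordanFrame

theorem eq_one_of_splitRank (h : splitRank J ϑ = 1) (i) : c i = J.one := by
  rw [← hc.sum]
  have : Subsingleton (Fin (splitRank J ϑ)) := by rw [h]; infer_instance
  exact (Fintype.sum_subsingleton c i).symm

/-- Here `V⁺ = ℝe`, and the square of a `ϑ`-odd element is even, so every element satisfies a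
quadratic equation. -/
theorem rank_le_two_of_splitRank (h : splitRank J ϑ = 1) : J.rank ≤ 2 := by
  refine rank_le_two fun x => ?_
  have i : Fin (splitRank J ϑ) := ⟨0, by omega⟩
  have hi := hc.eq_one_of_splitRank h i
  obtain ⟨t, ht⟩ := hc.line (i := i) (x := (1 / 2 : ℝ) • (x + ϑ.toFun x)) (by rw [hi, J.one_mul])
    (by rw [map_smul, theta_add])
  set y := (1 / 2 : ℝ) • (x - ϑ.toFun x) with hy
  have hyθ : ϑ.toFun y = -y := by rw [hy, map_smul, theta_sub, smul_neg]
  obtain ⟨s, hs⟩ := hc.line (i := i) (x := J.mul y y) (by rw [hi, J.one_mul])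
    (by rw [ϑ.map_mul, hyθ]; simp)
  have hx := half_add_half (ϑ := ϑ) x
  rw [ht, ← hy, hi] at hx
  rw [hi] at hs
  refine ⟨2 * t, s - t ^ 2, ?_⟩
  rw [← hx]
  simp only [map_add, map_smul, LinearMap.add_apply, LinearMap.smul_apply, J.one_mul, mul_one', hs]
  module

/-- `y²` is a nonzero multiple of `c_i`, since `⟪y², c_i⟫ = -‖y‖²`, and `2L(y)² = L(y²)` on
`V_{ij}`. -/
theorem mul_diag_ne_zero {i j} (hij : i ≠ j) {y x : V} (hy : y ∈ peirce J ϑ c i i)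
    (hyθ : ϑ.toFun y = -y) (hy0 : y ≠ 0) (hx : x ∈ peirce J ϑ c i j) (h0 : J.mul y x = 0) :
    x = 0 := by
  obtain ⟨h1, h2⟩ := (hc.mem_peirce_of_ne hij).1 hx
  have hy1 := hc.mem_peirce_self.1 hy
  obtain ⟨b, hb⟩ := hc.line (one_mul_one (hc.idem i) hy1 hy1) (by rw [ϑ.map_mul, hyθ]; simp)
  have h3 := mul_mul_half_of_one (hc.idem i) hy1 hy1 h1
  rw [h0, map_zero, hb, map_smul, LinearMap.smul_apply, h1, add_zero, smul_smul] at h3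
  refine (smul_eq_zero.1 h3).resolve_left fun hb0 => hy0 ?_
  have hb0 : b = 0 := by linarith
  have h4 : ⟪y, y⟫_ℝ = 0 := by
    have : ⟪J.mul y y, c i⟫_ℝ = -⟪y, y⟫_ℝ := by
      rw [inner_mul_of_minus hyθ, J.mul_comm, hy1]
    rw [hb, hb0, zero_smul, inner_zero_left] at this
    linarith
  exact inner_self_eq_zero.1 h4

theorem mul_diag_mem {i j} (hij : i ≠ j) {y x : V} (hy : y ∈ peirce J ϑ c i i)
    (hx : x ∈ peirce J ϑ c i j) : J.mul y x ∈ peirce J ϑ c i j := by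
  obtain ⟨h1, h2⟩ := (hc.mem_peirce_of_ne hij).1 hx
  have hy1 := hc.mem_peirce_self.1 hy
  rw [hc.mem_peirce_of_ne hij]
  refine ⟨one_mul_half (hc.idem i) hy1 h1, ?_⟩
  rw [mul_comm_of_zero (hc.idem j) (hc.eq_zero_of_one hij.symm hy1), h2, map_smul]

theorem finrank_minus (hs : (plus J ϑ).IsSimple) {i j} (hij : i ≠ j) :
    d₀Const J ϑ c + finrank ℝ ↥(peirce J ϑ c i j ⊓ minusSpace J ϑ) = dConst J ϑ c := by
  rw [← (hc.finrank_eq_dConst hs hij).1, ← (hc.finrank_eq_dConst hs hij).2]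
  exact finrank_plus_add_minus _ (hc.peirce_theta i j)

theorem mul_swap {y x : V} (hy : ϑ.toFun y = -y) :
    (x ∈ plusSpace J ϑ → J.mul y x ∈ minusSpace J ϑ) ∧
      (x ∈ minusSpace J ϑ → J.mul y x ∈ plusSpace J ϑ) := by
  simp only [mem_plusSpace, mem_minusSpace]
  constructor <;> intro h <;> rw [ϑ.map_mul, hy, h] <;> simp

/-- Multiplication by `y` exchanges the even and odd parts of `V_{ij}` injectively. -/
theorem d_eq_of_diag (hs : (plus J ϑ).IsSimple) (h1 : 1 < splitRank J ϑ) {i} {y : V}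
    (hy : y ∈ peirce J ϑ c i i) (hyθ : ϑ.toFun y = -y) (hy0 : y ≠ 0) :
    dConst J ϑ c = 2 * d₀Const J ϑ c := by
  have : Nontrivial (Fin (splitRank J ϑ)) := Fin.nontrivial_iff_two_le.2 h1
  obtain ⟨j, hij⟩ := exists_ne i
  have a1 := finrank_le_of_mapsTo (S := peirce J ϑ c i j ⊓ plusSpace J ϑ)
    (T := peirce J ϑ c i j ⊓ minusSpace J ϑ) (J.mul y)
    (fun x hx => ⟨hc.mul_diag_mem hij.symm hy hx.1, (hc.mul_swap hyθ).1 hx.2⟩)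
    (fun x hx h0 => hc.mul_diag_ne_zero hij.symm hy hyθ hy0 hx.1 h0)
  have a2 := finrank_le_of_mapsTo (S := peirce J ϑ c i j ⊓ minusSpace J ϑ)
    (T := peirce J ϑ c i j ⊓ plusSpace J ϑ) (J.mul y)
    (fun x hx => ⟨hc.mul_diag_mem hij.symm hy hx.1, (hc.mul_swap hyθ).2 hx.2⟩)
    (fun x hx h0 => hc.mul_diag_ne_zero hij.symm hy hyθ hy0 hx.1 h0)
  have a3 := hc.finrank_minus hs hij.symm
  have a4 := (hc.finrank_eq_dConst hs hij.symm).2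
  omega

/-- With a third index `k`, multiplication by `y` maps each parity of `V_{ki}` injectively into the
opposite parity of `V_{kj}`. -/
theorem d_eq_of_offdiag (hs : (plus J ϑ).IsSimple) (h1 : 2 < splitRank J ϑ) {i j} (hij : i ≠ j)
    {y : V} (hy : y ∈ peirce J ϑ c i j) (hyθ : ϑ.toFun y = -y) (hy0 : y ≠ 0) :
    dConst J ϑ c = 2 * d₀Const J ϑ c := by
  obtain ⟨k, hk⟩ : ∃ k, k ∉ ({i, j} : Finset (Fin (splitRank J ϑ))) := by
    by_contra h
    push Not at h
    have : Finset.univ ⊆ ({i, j} : Finset (Fin (splitRank J ϑ))) := fun x _ => h x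
    have := Finset.card_le_card this
    rw [Finset.card_univ, Fintype.card_fin] at this
    exact absurd (this.trans Finset.card_le_two) (by omega)
  simp only [Finset.mem_insert, Finset.mem_singleton, not_or] at hk
  have a1 := finrank_le_of_mapsTo (S := peirce J ϑ c k i ⊓ plusSpace J ϑ)
    (T := peirce J ϑ c k j ⊓ minusSpace J ϑ) (J.mul y)
    (fun x hx => ⟨hc.mul_mem_peirce hij hk.1 hk.2 hy hx.1, (hc.mul_swap hyθ).1 hx.2⟩)
    (fun x hx h0 => hc.mul_ne_zero' hij hk.1 hk.2 hy (Or.inr hyθ) hy0 hx.1 h0)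
  have a2 := finrank_le_of_mapsTo (S := peirce J ϑ c k i ⊓ minusSpace J ϑ)
    (T := peirce J ϑ c k j ⊓ plusSpace J ϑ) (J.mul y)
    (fun x hx => ⟨hc.mul_mem_peirce hij hk.1 hk.2 hy hx.1, (hc.mul_swap hyθ).2 hx.2⟩)
    (fun x hx h0 => hc.mul_ne_zero' hij hk.1 hk.2 hy (Or.inr hyθ) hy0 hx.1 h0)
  have a3 := hc.finrank_minus hs hk.1
  have a3' := hc.finrank_minus hs hk.2
  have a4 := (hc.finrank_eq_dConst hs hk.1).2
  have a5 := (hc.finrank_eq_dConst hs hk.2).2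
  omega

theorem theta_eq_of_diag {i} (h : ¬ ∃ y ∈ peirce J ϑ c i i, ϑ.toFun y = -y ∧ y ≠ 0) {x : V}
    (hx : J.mul (c i) x = x) : ϑ.toFun x = x := by
  by_contra hne
  refine h ⟨x - ϑ.toFun x, ?_, theta_sub x, fun h => hne (sub_eq_zero.1 h).symm⟩
  have : J.mul (c i) (ϑ.toFun x) = ϑ.toFun x := by
    conv_rhs => rw [← hx, ϑ.map_mul, hc.theta]
  rw [hc.mem_peirce_self, map_sub, hx, this]

/-- In rank at least three, either `d = 2 d₀` or `V` is euclidean. -/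
theorem dichotomy (hs : (plus J ϑ).IsSimple) (hV : Nontrivial V) (hr : 3 ≤ J.rank) :
    1 < splitRank J ϑ ∧ (dConst J ϑ c = 2 * d₀Const J ϑ c ∨ ∀ x, ϑ.toFun x = x) := by
  have hpos := hc.splitRank_pos
  have h1 : 1 < splitRank J ϑ := by
    by_contra h
    have := hc.rank_le_two_of_splitRank (by omega)
    omega
  refine ⟨h1, ?_⟩
  by_cases hd : ∃ i, ∃ y ∈ peirce J ϑ c i i, ϑ.toFun y = -y ∧ y ≠ 0
  · obtain ⟨i, y, hy, hyθ, hy0⟩ := hd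
    exact Or.inl (hc.d_eq_of_diag hs h1 hy hyθ hy0)
  have hd' : ∀ i, ¬ ∃ y ∈ peirce J ϑ c i i, ϑ.toFun y = -y ∧ y ≠ 0 := fun i h => hd ⟨i, h⟩
  by_cases ho : ∃ i j, i ≠ j ∧ ∃ y ∈ peirce J ϑ c i j, ϑ.toFun y = -y ∧ y ≠ 0
  · obtain ⟨i, j, hij, y, hy, hyθ, hy0⟩ := ho
    by_cases h2 : 2 < splitRank J ϑ
    · exact Or.inl (hc.d_eq_of_offdiag hs h2 hij hy hyθ hy0)
    -- The remaining case is `r₀ = 2` with both `V_{ii}` equal to `ℝc_i`; then every element is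
    -- quadratic over the unit and the rank is at most two.
    exfalso
    have htwo : splitRank J ϑ = 2 := by omega
    have hsum : ∀ f : Fin (splitRank J ϑ) → V, ∑ k, f k = f i + f j := by
      intro f
      rw [← Finset.sum_pair hij]
      symm
      refine Finset.sum_subset (Finset.subset_univ _) fun k _ hk => ?_
      simp only [Finset.mem_insert, Finset.mem_singleton, not_or] at hk
      have a1 := k.2
      have a2 := i.2
      have a3 := j.2
      have b1 : (k : ℕ) ≠ i := fun h => hk.1 (Fin.ext h)
      have b2 : (k : ℕ) ≠ j := fun h => hk.2 (Fin.ext h)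
      have b3 : (i : ℕ) ≠ j := fun h => hij (Fin.ext h)
      omega
    have hone : J.one = c i + c j := by rw [← hc.sum, hsum]
    have hle : J.rank ≤ 2 := by
      refine rank_le_two fun x => ?_
      have dj : ∀ u, J.mul (c j) u = u - J.mul (c i) u := fun u => by
        rw [eq_sub_iff_add_eq', ← LinearMap.add_apply, ← map_add, ← hone, J.one_mul]
      obtain ⟨α, hα⟩ := hc.line (mul_pOne (hc.idem i) x)
        (hc.theta_eq_of_diag (hd' i) (mul_pOne (hc.idem i) x))
      have hz0 := mul_pZero (hc.idem i) x
      have hzj : J.mul (c j) (J.pZero (c i) x) = J.pZero (c i) x := by rw [dj, hz0, sub_zero]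
      obtain ⟨β, hβ⟩ := hc.line hzj (hc.theta_eq_of_diag (hd' j) hzj)
      have hu := mul_pHalf (hc.idem i) x
      have hx := J.p_sum (c i) x
      set u := J.pHalf (c i) x
      have huj : J.mul (c j) u = (1 / 2 : ℝ) • u := by rw [dj, hu]; module
      have huij : u ∈ peirce J ϑ c i j := (hc.mem_peirce_of_ne hij).2 ⟨hu, huj⟩
      have e1 := hc.theta_eq_of_diag (hd' i) (half_mul_half (hc.idem i) hu hu)
      have e2 := hc.theta_eq_of_diag (hd' j) (half_mul_half (hc.idem j) huj huj)
      have huθ : ϑ.toFun (J.mul u u) = J.mul u u := by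
        have := dj (J.mul u u)
        rw [eq_sub_iff_add_eq'] at this
        rw [← this, map_add, e1, e2]
      obtain ⟨a, ha, -⟩ := hc.sq_of_mem hij huij huθ
      rw [hα, hβ] at hx
      refine ⟨α + β, a - α * β, ?_⟩
      rw [← hx, hone]
      simp only [map_add, map_smul, LinearMap.add_apply, LinearMap.smul_apply, hc.idem, ha,
        hc.orth i j hij, hc.orth j i hij.symm, J.mul_comm u (c i), J.mul_comm u (c j), hu, huj]
      module
    omega
  -- No Peirce space contains a nonzero odd element, so the odd part of every `x` vanishes.
  · right
    intro x
    rw [← sub_eq_zero, ← neg_eq_zero, neg_sub]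
    have hyθ := theta_sub (ϑ := ϑ) x
    set y := x - ϑ.toFun x
    have hall : ∀ i, J.mul (c i) y = 0 := by
      intro i
      have h1 : J.pOne (c i) y = 0 := by
        by_contra h
        exact hd' i ⟨_, hc.mem_peirce_self.2 (mul_pOne (hc.idem i) y),
          by rw [hc.theta_pOne, hyθ, map_neg], h⟩
      have h2 : J.pHalf (c i) y = 0 := by
        have hu := mul_pHalf (hc.idem i) y
        refine hc.half_eq_zero hu fun j hj => ?_
        by_contra h
        exact ho ⟨i, j, hj.symm, _, hc.mul_mem_of_half hj.symm hu,
          by rw [ϑ.map_mul, hc.theta, hc.theta_pHalf, hyθ]; simp, h⟩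
      have h3 := J.p_sum (c i) y
      rw [h1, h2, zero_add, zero_add] at h3
      rw [← h3]
      exact mul_pZero (hc.idem i) y
    rw [← hc.sum_mul y]
    exact Finset.sum_eq_zero fun i _ => hall i

end IsJordanFrame

end Dichotomy

end MinRep.JordanAlgebra

namespace MinRep.JordanAlgebra

/-! ### Polar decomposition of the minimal orbit. -/

section Polar

variable {V : Type*} [NormedAddCommGroup V] [InnerProductSpace ℝ V] [FiniteDimensional ℝ V]
variable {J : JordanAlgebra V} {ϑ : CartanInvolution J}

/-- The orthogonal elements `k` of `L` with `P(kx) = k P(x) ϑ k⁻¹ ϑ`. -/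
def IsCompactElt (ϑ : CartanInvolution J) (k : (V →L[ℝ] V)ˣ) : Prop :=
  k ∈ KL J ∧ ∀ x y : V, J.P ((k : V →L[ℝ] V) x) y = (k : V →L[ℝ] V) (J.P x
    (ϑ.toFun (((k⁻¹ : (V →L[ℝ] V)ˣ) : V →L[ℝ] V) (ϑ.toFun y))))

theorem IsCompactElt.one : IsCompactElt ϑ (1 : (V →L[ℝ] V)ˣ) :=
  ⟨one_mem _, fun x y => by simp [ϑ.invol]⟩

theorem IsCompactElt.mul {k k' : (V →L[ℝ] V)ˣ} (h : IsCompactElt ϑ k) (h' : IsCompactElt ϑ k') :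
    IsCompactElt ϑ (k * k') :=
  ⟨mul_mem h.1 h'.1, fun x y => by simp [h.2, h'.2, ϑ.invol]⟩

theorem IsCompactElt.inv {k : (V →L[ℝ] V)ˣ} (h : IsCompactElt ϑ k) : IsCompactElt ϑ k⁻¹ := by
  refine ⟨inv_mem h.1, fun x y => ?_⟩
  have := h.2 (((k⁻¹ : (V →L[ℝ] V)ˣ) : V →L[ℝ] V) x)
    (ϑ.toFun ((k : V →L[ℝ] V) (ϑ.toFun y)))
  rw [apply_inv, ϑ.invol, inv_apply, ϑ.invol] at this
  rw [inv_inv, this, inv_apply]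

theorem IsCompactElt.inner {k : (V →L[ℝ] V)ˣ} (h : IsCompactElt ϑ k) (x y : V) :
    ⟪(k : V →L[ℝ] V) x, (k : V →L[ℝ] V) y⟫_ℝ = ⟪x, y⟫_ℝ := h.1.2 x y

theorem IsCompactElt.inner' {k : (V →L[ℝ] V)ˣ} (h : IsCompactElt ϑ k) (x y : V) :
    ⟪(k : V →L[ℝ] V) x, y⟫_ℝ = ⟪x, ((k⁻¹ : (V →L[ℝ] V)ˣ) : V →L[ℝ] V) y⟫_ℝ := by
  rw [← h.inner x, apply_inv]

theorem IsCompactElt.norm {k : (V →L[ℝ] V)ˣ} (h : IsCompactElt ϑ k) (x : V) :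
    ‖(k : V →L[ℝ] V) x‖ = ‖x‖ := by
  rw [← sq_eq_sq₀ (norm_nonneg _) (norm_nonneg _), ← real_inner_self_eq_norm_sq,
    ← real_inner_self_eq_norm_sq, h.inner]

/-- For skew `A` the `τ`-dual of `A` is `-ϑAϑ`, so the companion of `exp(tA)` in the structure group
is `ϑ exp(-tA) ϑ`. -/
theorem isCompactElt_flow {A : V →L[ℝ] V} (hA : J.IsStrLie (A : V →ₗ[ℝ] V))
    (hs : ∀ x y, ⟪A x, y⟫_ℝ = -⟪x, A y⟫_ℝ) (t : ℝ) : IsCompactElt ϑ (flowUnit A t) := by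
  refine ⟨⟨flowUnit_mem_Lgrp ϑ hA t, inner_flow hs t⟩, fun x y => ?_⟩
  have hadj : ∀ x, LinearMap.adjoint (A : V →ₗ[ℝ] V) x = -A x := by
    intro x
    refine ext_inner_right ℝ fun y => ?_
    rw [LinearMap.adjoint_inner_left, inner_neg_left, hs, neg_neg]; rfl
  have key : ∀ s y, flow (sharp ϑ A) s (ϑ.toFun y) = ϑ.toFun (flow A (-s) y) := by
    intro s y
    let Θ : V →L[ℝ] V := LinearMap.toContinuousLinearMap ϑ.toFun
    have hΘ : ∀ z, Θ z = ϑ.toFun z := fun z => rfl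
    have hd : ∀ s, HasDerivAt (fun s => flow (sharp ϑ A) (-s) (Θ (flow A (-s) y))) 0 s := by
      intro s
      have n := hasDerivAt_neg s
      have h1 : HasDerivAt (fun s => flow A (-s) y) (-(A (flow A (-s) y))) s := by
        simpa [Function.comp_def] using (hasDerivAt_flow_apply A y (-s)).scomp s n
      have h2 : HasDerivAt (fun s => flow (sharp ϑ A) (-s))
          (-(flow (sharp ϑ A) (-s) * sharp ϑ A)) s := by
        simpa [Function.comp_def] using (hasDerivAt_flow' (sharp ϑ A) (-s)).scomp s n
      refine (h2.clm_apply (Θ.hasFDerivAt.comp_hasDerivAt s h1)).congr_deriv ?_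
      simp [hΘ, sharp_apply, ϑ.invol, hadj]
    have := is_const_of_deriv_eq_zero (fun s => (hd s).differentiableAt) (fun s => (hd s).deriv) s 0
    simp only [neg_zero, flow_zero, one_apply_eq_self, hΘ] at this
    rw [← this, flow_apply_neg]
  change J.P (flow A t x) y = flow A t (J.P x (ϑ.toFun (flow A (-t) (ϑ.toFun y))))
  rw [flow_P ϑ hA, ← key, ϑ.invol]

theorem isClosed_isCompactElt (ϑ : CartanInvolution J) :
    IsClosed {k : KL J | IsCompactElt ϑ (k : (V →L[ℝ] V)ˣ)} := by
  have hθ : Continuous ϑ.toFun := ϑ.toFun.continuous_of_finiteDimensional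
  have e : {k : KL J | IsCompactElt ϑ (k : (V →L[ℝ] V)ˣ)} = ⋂ x : V, ⋂ y : V, {k : KL J |
      J.P (((k : (V →L[ℝ] V)ˣ) : V →L[ℝ] V) x) y = ((k : (V →L[ℝ] V)ˣ) : V →L[ℝ] V) (J.P x
        (ϑ.toFun ((((k : (V →L[ℝ] V)ˣ)⁻¹ : (V →L[ℝ] V)ˣ) : V →L[ℝ] V) (ϑ.toFun y))))} := by
    ext k
    simp only [Set.mem_iInter, Set.mem_ofPred_eq]
    exact ⟨fun h => h.2, fun h => ⟨k.2, h⟩⟩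
  rw [e]
  have cv : Continuous fun k : KL J => ((k : (V →L[ℝ] V)ˣ) : V →L[ℝ] V) :=
    Units.continuous_val.comp continuous_subtype_val
  have ci : Continuous fun k : KL J =>
      (((k : (V →L[ℝ] V)ˣ)⁻¹ : (V →L[ℝ] V)ˣ) : V →L[ℝ] V) :=
    Units.continuous_val.comp (continuous_inv.comp continuous_subtype_val)
  exact isClosed_iInter fun x => isClosed_iInter fun y => isClosed_eq
    (continuous_P J (cv.clm_apply continuous_const) continuous_const)
    (cv.clm_apply (continuous_P J continuous_const
      (hθ.comp (ci.clm_apply continuous_const))))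

theorem isCompact_isCompactElt (ϑ : CartanInvolution J) :
    IsCompact {k : KL J | IsCompactElt ϑ (k : (V →L[ℝ] V)ˣ)} :=
  (isClosed_isCompactElt ϑ).isCompact

variable {c : Fin (splitRank J ϑ) → V} (hc : IsJordanFrame J ϑ c)
include hc

namespace IsJordanFrame

theorem P_frame (i) (x : V) : J.P (c i) x = J.pOne (c i) x := by
  simp [P, pOne, L, hc.idem]

theorem lam₁_pos [Nontrivial V] (hs : (plus J ϑ).IsSimple) (h : 1 < splitRank J ϑ) :
    0 < lam₁ J ϑ c := by
  have h1 := rank_pos ϑ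
  have h2 : 0 < dConst J ϑ c := (hc.d₀Const_pos hs h).trans_le (hc.d₀Const_le c)
  rw [lam₁]
  positivity

/-- An element `a c_i + w`, `w ∈ V₀(c_i)`, of the orbit of `c_i` with `a ≠ 0` has `w = 0`. -/
theorem eq_zero_of_mem_orbit [Nontrivial V] (hs : (plus J ϑ).IsSimple) (i) {a : ℝ} (ha : a ≠ 0)
    {w : V} (hw : J.mul (c i) w = 0) (hx : a • c i + w ∈ orbit J (c i)) : w = 0 := by
  by_cases h1 : 1 < splitRank J ϑ
  swap
  · have : splitRank J ϑ = 1 := by have := hc.splitRank_pos; omega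
    rw [← J.one_mul w, ← hc.eq_one_of_splitRank this i, hw]
  obtain ⟨g, hg, hgx⟩ := hx
  obtain ⟨g', -, rfl⟩ := hg
  obtain ⟨h, hh⟩ := g'.2
  change a • c i + w = ((g' : (V →L[ℝ] V)ˣ) : V →L[ℝ] V) (c i) at hgx
  set g : (V →L[ℝ] V)ˣ := (g' : (V →L[ℝ] V)ˣ)
  set x := a • c i + w with hxd
  have hPx : ∀ y, J.P x y = (g : V →L[ℝ] V) (J.pOne (c i) ((h : V →L[ℝ] V) y)) := by
    intro y; rw [hgx, hh, hc.P_frame]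
  have hP1 : ∀ y, J.mul (c i) y = y → J.P x y = (a ^ 2) • y := by
    intro y hy
    have hwy : J.mul w y = 0 := by rw [J.mul_comm]; exact one_mul_zero (hc.idem i) hy hw
    have hwwy : J.mul (J.mul w w) y = 0 := by
      rw [J.mul_comm]; exact one_mul_zero (hc.idem i) hy (zero_mul_zero (hc.idem i) hw hw)
    simp only [P, L, hxd, map_add, map_smul, LinearMap.add_apply, LinearMap.smul_apply,
      LinearMap.sub_apply, LinearMap.comp_apply, hy, hwy, hwwy, hc.idem, hw, J.mul_comm w (c i),
      map_zero, LinearMap.zero_apply]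
    module
  have hPh : ∀ y, J.mul (c i) y = (1 / 2 : ℝ) • y → J.P x y = (2 * a) • J.mul w y := by
    intro y hy
    have h1 := mul_mul_half_of_zero (hc.idem i) hw hw hy
    have h2 := zero_mul_half (hc.idem i) hw hy
    simp only [P, L, hxd, map_add, map_smul, LinearMap.add_apply, LinearMap.smul_apply,
      LinearMap.sub_apply, LinearMap.comp_apply, hy, h1, h2, hc.idem, hw, J.mul_comm w (c i),
      map_zero, LinearMap.zero_apply]
    module
  -- `P(x)` is `a²` on `V₁(c_i)`. As `x` is in the orbit, `P(x)` has the rank of `P(c_i)`, so its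
  -- range is no larger than `V₁(c_i)`.
  have hle : peirce J ϑ c i i ≤ LinearMap.range (J.P x) := by
    intro y hy
    refine ⟨(a ^ 2)⁻¹ • y, ?_⟩
    rw [map_smul, hP1 y (hc.mem_peirce_self.1 hy), smul_smul, inv_mul_cancel₀ (pow_ne_zero 2 ha),
      one_smul]
  have hrange : peirce J ϑ c i i = LinearMap.range (J.P x) := by
    refine Submodule.eq_of_le_of_finrank_le hle ?_
    refine finrank_le_of_mapsTo (((g⁻¹ : (V →L[ℝ] V)ˣ) : V →L[ℝ] V) : V →ₗ[ℝ] V) ?_ ?_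
    · rintro _ ⟨y, rfl⟩
      rw [hPx, ContinuousLinearMap.coe_coe, inv_apply, hc.mem_peirce_self]
      exact mul_pOne (hc.idem i) _
    · intro y _ hy
      rw [← apply_inv g y]
      rw [ContinuousLinearMap.coe_coe] at hy
      rw [hy, map_zero]
  -- For such `y` the vector `P(x) y = 2a wy` lies in both `V_{1/2}` and `V₁`.
  have hwy : ∀ y, J.mul (c i) y = (1 / 2 : ℝ) • y → J.mul w y = 0 := by
    intro y hy
    have h1 : J.P x y ∈ peirce J ϑ c i i := by rw [hrange]; exact ⟨y, rfl⟩
    rw [hc.mem_peirce_self, hPh y hy, map_smul, zero_mul_half (hc.idem i) hw hy] at h1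
    have h2 : a • J.mul w y = 0 := by linear_combination (norm := module) (-1 : ℝ) • h1
    exact (smul_eq_zero.1 h2).resolve_left ha
  have hθw : J.mul (c i) (ϑ.toFun w) = 0 := by
    have := congrArg ϑ.toFun hw
    rwa [ϑ.map_mul, hc.theta, map_zero] at this
  -- The trace over `V_{1/2}` of `L(w · ϑw)` is `λ₁‖w‖²`, but this operator vanishes there.
  have h3 := hc.halfTrace_id hs i (zero_mul_zero (hc.idem i) hw hθw)
  have h4 : halfTrace J LinearMap.id (c i) (J.mul w (ϑ.toFun w)) = 0 := by
    change LinearMap.trace ℝ V (LinearMap.id ∘ₗ J.mul (J.mul w (ϑ.toFun w)) ∘ₗ J.pHalf (c i)) = 0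
    have : LinearMap.id ∘ₗ J.mul (J.mul w (ϑ.toFun w)) ∘ₗ J.pHalf (c i) = 0 := by
      ext y
      have hy := mul_pHalf (hc.idem i) y
      have := mul_mul_half_of_zero (hc.idem i) hw hθw hy
      rw [hwy _ hy, map_zero, hwy _ (zero_mul_half (hc.idem i) hθw hy), add_zero] at this
      simpa using this
    rw [this, map_zero]
  rw [h4] at h3
  have h5 : J.tr (J.mul w (ϑ.toFun w)) = ⟪w, w⟫_ℝ := (ϑ.inner_eq w w).symm
  rw [h5] at h3
  rcases mul_eq_zero.1 h3.symm with h | h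
  · exact absurd h (hc.lam₁_pos hs h1).ne'
  · exact inner_self_eq_zero.1 h

/-- Maximize `⟪kx, c_i⟫` over the compact set of admissible `k`. Stationarity along the skew
operators `L(z)`, `z` odd, and `[L(c_i), L(z)]`, `z` even, removes the `V_{1/2}` part and the odd
`V₁` part of `kx`. What is left is `a c_i + w` with `a > 0`, to which `eq_zero_of_mem_orbit`
applies. -/
theorem exists_polar_of_pos [Nontrivial V] (hs : (plus J ϑ).IsSimple) (i) {x : V}
    (hx : x ∈ orbit J (c i)) {k₀ : (V →L[ℝ] V)ˣ} (hk₀ : IsCompactElt ϑ k₀)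
    (hpos : 0 < ⟪(k₀ : V →L[ℝ] V) x, c i⟫_ℝ) :
    ∃ k, IsCompactElt ϑ k ∧ ∃ t : ℝ, 0 < t ∧ (k : V →L[ℝ] V) x = t • c i := by
  have cv : Continuous fun k : KL J => ⟪((k : (V →L[ℝ] V)ˣ) : V →L[ℝ] V) x, c i⟫_ℝ :=
    ((Units.continuous_val.comp continuous_subtype_val).clm_apply continuous_const).inner
      continuous_const
  obtain ⟨k, hk, hmax⟩ := (isCompact_isCompactElt ϑ).exists_isMaxOn ⟨⟨k₀, hk₀.1⟩, hk₀⟩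
    cv.continuousOn
  have hk : IsCompactElt ϑ (k : (V →L[ℝ] V)ˣ) := hk
  have hmax : ∀ k', IsCompactElt ϑ k' → ⟪(k' : V →L[ℝ] V) x, c i⟫_ℝ ≤
      ⟪((k : (V →L[ℝ] V)ˣ) : V →L[ℝ] V) x, c i⟫_ℝ := fun k' hk' =>
    hmax (show (⟨k', hk'.1⟩ : KL J) ∈ {k : KL J | IsCompactElt ϑ (k : (V →L[ℝ] V)ˣ)} from hk')
  obtain ⟨k, hkL⟩ := k
  simp only at hk hmax
  have hpos' := hpos.trans_le (hmax k₀ hk₀)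
  set y := (k : V →L[ℝ] V) x with hy
  have hyO : y ∈ orbit J (c i) := by
    obtain ⟨g, hg, rfl⟩ := hx
    exact ⟨k * g, mul_mem hkL.1 hg, rfl⟩
  have hcrit : ∀ A : V →ₗ[ℝ] V, J.IsStrLie A → (∀ x y, ⟪A x, y⟫_ℝ = -⟪x, A y⟫_ℝ) →
      ⟪A y, c i⟫_ℝ = 0 := by
    intro A hA hsk
    let A' : V →L[ℝ] V := LinearMap.toContinuousLinearMap A
    have h1 : IsLocalMax (fun t : ℝ => ⟪flow A' t y, c i⟫_ℝ) 0 := by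
      refine Filter.Eventually.of_forall fun t => ?_
      have : ⟪flow A' t y, c i⟫_ℝ ≤ ⟪y, c i⟫_ℝ :=
        hmax (flowUnit A' t * k) ((isCompactElt_flow hA hsk t).mul hk)
      simpa [flow_zero] using this
    have h2 := (hasDerivAt_flow_apply A' y 0).inner ℝ (hasDerivAt_const (0 : ℝ) (c i))
    have h3 := h1.hasDerivAt_eq_zero h2
    rw [inner_zero_right, zero_add, flow_zero] at h3
    exact h3
  have hm : ∀ z, ϑ.toFun z = -z → ⟪y, J.mul (c i) z⟫_ℝ = 0 := by
    intro z hz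
    have := hcrit (J.mul z) (J.isStrLie_mul z) (inner_mul_of_minus hz)
    rwa [inner_mul_of_minus hz, J.mul_comm, neg_eq_zero] at this
  have hp : ∀ z, ϑ.toFun z = z → ⟪y, J.pHalf (c i) z⟫_ℝ = 0 := by
    intro z hz
    have := hcrit _ (J.isStrLie_comm z (c i)) (fun u v => by
      simp only [LinearMap.sub_apply, LinearMap.comp_apply, inner_sub_left, inner_sub_right,
        inner_mul_of_plus hz, inner_mul_of_plus (hc.theta i)]
      ring)
    simp only [LinearMap.sub_apply, LinearMap.comp_apply, inner_sub_left, inner_mul_of_plus hz,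
      inner_mul_of_plus (hc.theta i), hc.idem, J.mul_comm z (c i)] at this
    simp only [pHalf, LinearMap.sub_apply, LinearMap.smul_apply, LinearMap.comp_apply,
      inner_smul_right, inner_sub_right]
    linarith
  have hθm := theta_sub (ϑ := ϑ) y
  have hθp := theta_add (ϑ := ϑ) y
  have hhalf : J.pHalf (c i) y = 0 := by
    have h1 : ⟪y, J.pHalf (c i) (y + ϑ.toFun y)⟫_ℝ = 0 := hp _ hθp
    have h2 : ⟪y, J.pHalf (c i) (y - ϑ.toFun y)⟫_ℝ = 0 := by
      have := hm (J.pHalf (c i) (y - ϑ.toFun y)) (by rw [hc.theta_pHalf, hθm, map_neg])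
      rw [mul_pHalf (hc.idem i), inner_smul_right] at this
      linarith
    have h3 : ⟪J.pHalf (c i) y, J.pHalf (c i) y⟫_ℝ = 0 := by
      rw [hc.inner_pHalf, pHalf_of_half (mul_pHalf (hc.idem i) y)]
      have e : y = (1 / 2 : ℝ) • (y + ϑ.toFun y) + (1 / 2 : ℝ) • (y - ϑ.toFun y) :=
        (half_add_half y).symm
      conv_lhs => rw [e, map_add, ← e, map_smul, map_smul, inner_add_right, inner_smul_right,
        inner_smul_right, h1, h2]
      simp
    exact inner_self_eq_zero.1 h3
  have hone : ϑ.toFun (J.pOne (c i) y) = J.pOne (c i) y := by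
    have hz : ϑ.toFun (J.pOne (c i) (y - ϑ.toFun y)) = -J.pOne (c i) (y - ϑ.toFun y) := by
      rw [hc.theta_pOne, hθm, map_neg]
    have h1 := hm _ hz
    rw [mul_pOne (hc.idem i)] at h1
    have h2 : ⟪ϑ.toFun y, J.pOne (c i) (y - ϑ.toFun y)⟫_ℝ = 0 := by
      rw [ϑ.inner_left, hz, inner_neg_right, h1, neg_zero]
    have h3 : ⟪J.pOne (c i) (y - ϑ.toFun y), J.pOne (c i) (y - ϑ.toFun y)⟫_ℝ = 0 := by
      rw [hc.inner_pOne, pOne_of_one (mul_pOne (hc.idem i) _), inner_sub_left, h1, h2, sub_zero]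
    have h4 := inner_self_eq_zero.1 h3
    rw [map_sub, sub_eq_zero, ← hc.theta_pOne] at h4
    exact h4.symm
  obtain ⟨a, ha⟩ := hc.line (mul_pOne (hc.idem i) y) hone
  have hsum := J.p_sum (c i) y
  have hz := mul_pZero (hc.idem i) y
  rw [hhalf, add_zero, ha] at hsum
  have hapos : 0 < a := by
    have h1 : ⟪y, c i⟫_ℝ = a * ‖c i‖ ^ 2 := by
      have : ⟪J.pZero (c i) y, c i⟫_ℝ = 0 := by
        rw [hc.inner_pZero, pZero_of_one (hc.idem i), inner_zero_right]
      rw [← hsum, inner_add_left, this, real_inner_smul_left, real_inner_self_eq_norm_sq, add_zero]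
    rw [h1, hc.norm_sq] at hpos'
    exact pos_of_mul_pos_left hpos' (hc.tr_pos i).le
  rw [← hsum] at hyO
  have hw := hc.eq_zero_of_mem_orbit hs i hapos.ne' hz hyO
  refine ⟨k, hk, a, hapos, ?_⟩
  rw [← hy, ← hsum, hw, add_zero]

/-- The polar decomposition of the minimal orbit. -/
theorem exists_polar [Nontrivial V] (hs : (plus J ϑ).IsSimple) (i) {x : V}
    (hx : x ∈ orbit J (c i)) :
    ∃ k, IsCompactElt ϑ k ∧ ∃ t : ℝ, 0 < t ∧ x = (k : V →L[ℝ] V) (t • c i) := by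
  suffices h : ∃ k, IsCompactElt ϑ k ∧ 0 < ⟪(k : V →L[ℝ] V) x, c i⟫_ℝ by
    obtain ⟨k, hk, hpos⟩ := h
    obtain ⟨k', hk', t, ht, h⟩ := hc.exists_polar_of_pos hs i hx hk hpos
    exact ⟨k'⁻¹, hk'.inv, t, ht, by rw [← h, inv_apply]⟩
  obtain ⟨g, hg, rfl⟩ := hx
  have cn := norm_pos_iff.2 (hc.ne_zero i)
  -- A connectedness argument: `U` is the open set of `g` for which `g c_i` can be rotated to
  -- positive position.
  let U : Set (V →L[ℝ] V)ˣ := ⋃ k ∈ {k | IsCompactElt ϑ k},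
    {g | 0 < ⟪(k : V →L[ℝ] V) ((g : V →L[ℝ] V) (c i)), c i⟫_ℝ}
  have hU : IsOpen U := by
    refine isOpen_biUnion fun k _ => isOpen_lt continuous_const ?_
    exact ((k : V →L[ℝ] V).continuous.comp
      (Units.continuous_val.clm_apply continuous_const)).inner continuous_const
  -- Equality in Cauchy–Schwarz, i.e. `g c_i` rotated onto the ray of `c_i`. Its projection is
  -- closed because `K_L` is compact.
  let F : Set ((V →L[ℝ] V)ˣ × KL J) := {p | IsCompactElt ϑ (p.2 : (V →L[ℝ] V)ˣ) ∧
    ‖(p.1 : V →L[ℝ] V) (c i)‖ * ‖c i‖ ≤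
      ⟪((p.2 : (V →L[ℝ] V)ˣ) : V →L[ℝ] V) ((p.1 : V →L[ℝ] V) (c i)), c i⟫_ℝ}
  have hF : IsClosed F := by
    have h2 : IsClosed {p : (V →L[ℝ] V)ˣ × KL J | ‖(p.1 : V →L[ℝ] V) (c i)‖ * ‖c i‖ ≤
        ⟪((p.2 : (V →L[ℝ] V)ˣ) : V →L[ℝ] V) ((p.1 : V →L[ℝ] V) (c i)), c i⟫_ℝ} := by
      refine isClosed_le ?_ ?_
      · exact ((Units.continuous_val.comp continuous_fst).clm_apply continuous_const).norm.mul
          continuous_const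
      · exact ((Units.continuous_val.comp (continuous_subtype_val.comp continuous_snd)).clm_apply
          ((Units.continuous_val.comp continuous_fst).clm_apply continuous_const)).inner
          continuous_const
    exact ((isClosed_isCompactElt ϑ).preimage continuous_snd).inter h2
  have hC : IsClosed (Prod.fst '' F) := isClosedMap_fst_of_compactSpace _ hF
  have hL : IsPreconnected (Lgrp J : Set (V →L[ℝ] V)ˣ) :=
    isPreconnected_connectedComponent.image _ continuous_subtype_val.continuousOn
  have hne : ∀ g : (V →L[ℝ] V)ˣ, 0 < ‖(g : V →L[ℝ] V) (c i)‖ := by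
    intro g
    refine norm_pos_iff.2 fun h => hc.ne_zero i ?_
    rw [← inv_apply g (c i), h, map_zero]
  have hCU : ∀ g ∈ Prod.fst '' F, g ∈ U := by
    rintro _ ⟨⟨g, k⟩, ⟨hk, h⟩, rfl⟩
    exact Set.mem_biUnion (show IsCompactElt ϑ (k : (V →L[ℝ] V)ˣ) from hk)
      (lt_of_lt_of_le (mul_pos (hne g) cn) h)
  have hUC : ∀ g ∈ Lgrp J, g ∈ U → g ∈ Prod.fst '' F := by
    -- On `L` the open condition implies the closed one by `exists_polar_of_pos`; so on the
    -- connected group `L` it holds everywhere or nowhere, and it holds at the identity.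
    intro g hg hgU
    simp only [U, Set.mem_iUnion] at hgU
    obtain ⟨k, hk, hpos⟩ := hgU
    obtain ⟨k', hk', t, ht, h⟩ := hc.exists_polar_of_pos hs i ⟨g, hg, rfl⟩ hk hpos
    refine ⟨⟨g, ⟨k', hk'.1⟩⟩, ⟨hk', ?_⟩, rfl⟩
    simp only
    rw [← hk'.norm, h, norm_smul, real_inner_smul_left, real_inner_self_eq_norm_sq,
      Real.norm_of_nonneg ht.le]
    exact le_of_eq (by ring)
  have := (isPreconnected_iff_subset_of_disjoint.1 hL) U (Prod.fst '' F)ᶜ hU hC.isOpen_compl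
    (fun g hg => by
      by_cases h : g ∈ U
      · exact Or.inl h
      · exact Or.inr fun h' => h (hCU g h'))
    (by
      rw [Set.eq_empty_iff_forall_notMem]
      rintro g ⟨hg, hgU, hgC⟩
      exact hgC (hUC g hg hgU))
  rcases this with h | h
  · have := h hg
    simp only [U, Set.mem_iUnion] at this
    obtain ⟨k, hk, hpos⟩ := this
    exact ⟨k, hk, hpos⟩
  · exfalso
    refine h (one_mem (Lgrp J)) ⟨⟨1, 1⟩, ⟨IsCompactElt.one, ?_⟩, rfl⟩
    simp [sq]

end IsJordanFrame

end Polar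

end MinRep.JordanAlgebra

namespace MinRep.JordanAlgebra

/-! ### Second and third derivatives of smooth functions. -/

section Hess

variable {V : Type*} [NormedAddCommGroup V] [InnerProductSpace ℝ V] [FiniteDimensional ℝ V]

/-- The second derivative `∂_a ∂_b Ψ (x)`. -/
def hess (Ψ : V → ℂ) (x a b : V) : ℂ := fderiv ℝ (fun y => fderiv ℝ Ψ y b) x a

theorem hess_eq_of_hasFDerivAt {U : Set V} (hU : IsOpen U) {Ψ : V → ℂ} {D : V → V →L[ℝ] ℂ}
    (hD : ∀ y ∈ U, HasFDerivAt Ψ (D y) y) {x b : V} (hx : x ∈ U) {H : V →L[ℝ] ℂ}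
    (hH : HasFDerivAt (fun y => D y b) H x) (a : V) : hess Ψ x a b = H a := by
  have : (fun y => fderiv ℝ Ψ y b) =ᶠ[nhds x] fun y => D y b := by
    filter_upwards [hU.mem_nhds hx] with y hy
    rw [(hD y hy).fderiv]
  rw [hess, this.fderiv_eq, hH.fderiv]

variable {U : Set V} (hU : IsOpen U) {Ψ : V → ℂ} (hΨ : ContDiffOn ℝ ∞ Ψ U)
include hU hΨ

theorem smooth_fderiv : ContDiffOn ℝ ∞ (fderiv ℝ Ψ) U :=
  hΨ.fderiv_of_isOpen hU (by simp)

theorem smooth_hasFDerivAt {x : V} (hx : x ∈ U) : HasFDerivAt Ψ (fderiv ℝ Ψ x) x :=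
  ((hΨ.contDiffAt (hU.mem_nhds hx)).differentiableAt (by simp)).hasFDerivAt

theorem smooth_hasFDerivAt₂ {x : V} (hx : x ∈ U) :
    HasFDerivAt (fderiv ℝ Ψ) (fderiv ℝ (fderiv ℝ Ψ) x) x :=
  (((smooth_fderiv hU hΨ).contDiffAt (hU.mem_nhds hx)).differentiableAt (by simp)).hasFDerivAt

theorem smooth_hasFDerivAt₃ {x : V} (hx : x ∈ U) :
    HasFDerivAt (fderiv ℝ (fderiv ℝ Ψ)) (fderiv ℝ (fderiv ℝ (fderiv ℝ Ψ)) x) x :=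
  ((((smooth_fderiv hU hΨ).fderiv_of_isOpen hU (m := ∞) (by simp)).contDiffAt
    (hU.mem_nhds hx)).differentiableAt (by simp)).hasFDerivAt

theorem hess_eq {x : V} (hx : x ∈ U) (a b : V) :
    hess Ψ x a b = fderiv ℝ (fderiv ℝ Ψ) x a b := by
  have := (smooth_hasFDerivAt₂ hU hΨ hx).clm_apply (hasFDerivAt_const b x)
  rw [hess, this.fderiv]
  simp

theorem snd_symm {x : V} (hx : x ∈ U) (a b : V) :
    fderiv ℝ (fderiv ℝ Ψ) x a b = fderiv ℝ (fderiv ℝ Ψ) x b a :=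
  (hΨ.contDiffAt (hU.mem_nhds hx)).isSymmSndFDerivAt
    (by rw [minSmoothness_of_isRCLikeNormedField]; exact WithTop.coe_le_coe.2 le_top) a b

theorem hess_symm {x : V} (hx : x ∈ U) (a b : V) : hess Ψ x a b = hess Ψ x b a := by
  rw [hess_eq hU hΨ hx, hess_eq hU hΨ hx, snd_symm hU hΨ hx]

theorem third_symm {x : V} (hx : x ∈ U) (a b z : V) :
    fderiv ℝ (fderiv ℝ (fderiv ℝ Ψ)) x a b z = fderiv ℝ (fderiv ℝ (fderiv ℝ Ψ)) x z a b := by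
  have h1 : ∀ h, fderiv ℝ (fderiv ℝ (fderiv ℝ Ψ)) x h b z =
      fderiv ℝ (fderiv ℝ (fderiv ℝ Ψ)) x h z b := by
    intro h
    have d := smooth_hasFDerivAt₃ hU hΨ hx
    have d1 := (d.clm_apply (hasFDerivAt_const b x)).clm_apply (hasFDerivAt_const z x)
    have d2 := (d.clm_apply (hasFDerivAt_const z x)).clm_apply (hasFDerivAt_const b x)
    have e : (fun y => fderiv ℝ (fderiv ℝ Ψ) y b z) =ᶠ[nhds x]
        fun y => fderiv ℝ (fderiv ℝ Ψ) y z b := by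
      filter_upwards [hU.mem_nhds hx] with y hy using snd_symm hU hΨ hy b z
    have := congrArg (fun f : V →L[ℝ] ℂ => f h) (d1.unique (d2.congr_of_eventuallyEq e))
    simpa using this
  rw [h1]
  exact congrArg (fun f : V →L[ℝ] ℂ => f b)
    (((smooth_fderiv hU hΨ).contDiffAt (hU.mem_nhds hx)).isSymmSndFDerivAt
      (by rw [minSmoothness_of_isRCLikeNormedField]; exact WithTop.coe_le_coe.2 le_top) a z)

/-- The derivative of `Ψ` along the linear vector field `A` is smooth. -/
theorem smooth_D (A : V →L[ℝ] V) : ContDiffOn ℝ ∞ (fun y => fderiv ℝ Ψ y (A y)) U :=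
  (smooth_fderiv hU hΨ).clm_apply A.contDiff.contDiffOn

theorem hasFDerivAt_D (A : V →L[ℝ] V) {x : V} (hx : x ∈ U) :
    HasFDerivAt (fun y => fderiv ℝ Ψ y (A y))
      ((fderiv ℝ Ψ x).comp A + (fderiv ℝ (fderiv ℝ Ψ) x).flip (A x)) x :=
  (smooth_hasFDerivAt₂ hU hΨ hx).clm_apply A.hasFDerivAt

theorem hess_D (A : V →L[ℝ] V) {x : V} (hx : x ∈ U) (a b : V) :
    hess (fun y => fderiv ℝ Ψ y (A y)) x a b =
      fderiv ℝ (fderiv ℝ Ψ) x a (A b) + (fderiv ℝ (fderiv ℝ (fderiv ℝ Ψ)) x a b (A x) +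
        fderiv ℝ (fderiv ℝ Ψ) x b (A a)) := by
  have d1 := (smooth_hasFDerivAt₂ hU hΨ hx).clm_apply (hasFDerivAt_const (A b) x)
  have d2 := ((smooth_hasFDerivAt₃ hU hΨ hx).clm_apply (hasFDerivAt_const b x)).clm_apply
    A.hasFDerivAt
  rw [hess_eq_of_hasFDerivAt hU (fun y hy => hasFDerivAt_D hU hΨ A hy) hx (d1.add d2)]
  simp
  ring

theorem hess_mul {Φ : V → ℂ} (hΦ : ContDiffOn ℝ ∞ Φ U) {x : V} (hx : x ∈ U) (a b : V) :
    hess (fun y => Φ y * Ψ y) x a b = Φ x * hess Ψ x a b + hess Φ x a b * Ψ x +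
      fderiv ℝ Φ x a * fderiv ℝ Ψ x b + fderiv ℝ Φ x b * fderiv ℝ Ψ x a := by
  have hD : ∀ y ∈ U, HasFDerivAt (fun y => Φ y * Ψ y) (Φ y • fderiv ℝ Ψ y + Ψ y • fderiv ℝ Φ y) y :=
    fun y hy => (smooth_hasFDerivAt hU hΦ hy).mul (smooth_hasFDerivAt hU hΨ hy)
  have d1 := (smooth_hasFDerivAt hU hΦ hx).mul
    ((smooth_hasFDerivAt₂ hU hΨ hx).clm_apply (hasFDerivAt_const b x))
  have d2 := (smooth_hasFDerivAt hU hΨ hx).mul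
    ((smooth_hasFDerivAt₂ hU hΦ hx).clm_apply (hasFDerivAt_const b x))
  have d3 : HasFDerivAt (fun y => (Φ y • fderiv ℝ Ψ y + Ψ y • fderiv ℝ Φ y) b) _ x := d1.add d2
  rw [hess_eq_of_hasFDerivAt hU hD hx d3, hess_eq hU hΨ hx, hess_eq hU hΦ hx]
  simp
  ring

theorem hess_add {Φ : V → ℂ} (hΦ : ContDiffOn ℝ ∞ Φ U) {x : V} (hx : x ∈ U) (a b : V) :
    hess (fun y => Φ y + Ψ y) x a b = hess Φ x a b + hess Ψ x a b := by
  have hD : ∀ y ∈ U, HasFDerivAt (fun y => Φ y + Ψ y) (fderiv ℝ Φ y + fderiv ℝ Ψ y) y :=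
    fun y hy => (smooth_hasFDerivAt hU hΦ hy).add (smooth_hasFDerivAt hU hΨ hy)
  have d1 := (smooth_hasFDerivAt₂ hU hΨ hx).clm_apply (hasFDerivAt_const b x)
  have d2 := (smooth_hasFDerivAt₂ hU hΦ hx).clm_apply (hasFDerivAt_const b x)
  have d3 : HasFDerivAt (fun y => (fderiv ℝ Φ y + fderiv ℝ Ψ y) b) _ x := d2.add d1
  rw [hess_eq_of_hasFDerivAt hU hD hx d3, hess_eq hU hΨ hx, hess_eq hU hΦ hx]
  simp

theorem hess_const_mul (z : ℂ) {x : V} (hx : x ∈ U) (a b : V) :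
    hess (fun y => z * Ψ y) x a b = z * hess Ψ x a b := by
  rw [hess_mul hU hΨ (contDiffOn_const (c := z)) hx]
  simp [hess]

theorem hess_comp (G : V →L[ℝ] V) {x : V} (hx : G x ∈ U) (a b : V) :
    hess (fun y => Ψ (G y)) x a b = hess Ψ (G x) (G a) (G b) := by
  have hD : ∀ y ∈ G ⁻¹' U, HasFDerivAt (fun y => Ψ (G y)) ((fderiv ℝ Ψ (G y)).comp G) y :=
    fun y hy => (smooth_hasFDerivAt hU hΨ hy).comp y G.hasFDerivAt
  have d := ((smooth_hasFDerivAt₂ hU hΨ hx).comp x G.hasFDerivAt).clm_apply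
    (hasFDerivAt_const (G b) x)
  rw [hess_eq_of_hasFDerivAt (hU.preimage G.continuous) hD (show x ∈ G ⁻¹' U from hx) d,
    hess_eq hU hΨ hx]
  simp

end Hess

/-! ### The Bessel operator and its commutators. -/

section Bessel

variable {V : Type*} [NormedAddCommGroup V] [InnerProductSpace ℝ V] [FiniteDimensional ℝ V]
variable {J : JordanAlgebra V} (ϑ : CartanInvolution J)

/-- The symmetric operator `b ↦ P(x, ϑ v) ϑ b`, the symbol of the Bessel operator. -/
def symb (x v : V) : V →ₗ[ℝ] V := J.P₂ x (ϑ.toFun v) ∘ₗ ϑ.toFun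

theorem symb_apply (x v b : V) : symb ϑ x v b = J.P₂ x (ϑ.toFun v) (ϑ.toFun b) := rfl

theorem symb_eq_box (x v b : V) : symb ϑ x v b = J.box (ϑ.toFun b) (ϑ.toFun v) x := by
  simp only [symb_apply, P₂, box, L, LinearMap.add_apply, LinearMap.sub_apply,
    LinearMap.comp_apply]
  rw [J.mul_comm x (J.mul (ϑ.toFun v) (ϑ.toFun b)), J.mul_comm (ϑ.toFun v) (ϑ.toFun b),
    J.mul_comm x (ϑ.toFun b), J.mul_comm (J.mul x (ϑ.toFun v)) (ϑ.toFun b),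
    J.mul_comm x (ϑ.toFun v)]
  abel

theorem inner_P₂ (x v a b : V) :
    ⟪J.P₂ (ϑ.toFun a) (ϑ.toFun b) x, v⟫_ℝ = ⟪symb ϑ x v a, b⟫_ℝ := by
  rw [ϑ.inner_eq, τ_P₂, ← symb_eq_box, τ_comm, ← ϑ.inner_eq]

theorem symb_symm (x v a b : V) : ⟪symb ϑ x v a, b⟫_ℝ = ⟪a, symb ϑ x v b⟫_ℝ := by
  rw [← inner_P₂, P₂_comm, inner_P₂, real_inner_comm]

theorem symb_add_left (x y v b : V) : symb ϑ (x + y) v b = symb ϑ x v b + symb ϑ y v b := by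
  rw [symb_apply, P₂_add_left]; rfl

theorem symb_smul_left (t : ℝ) (x v b : V) : symb ϑ (t • x) v b = t • symb ϑ x v b := by
  rw [symb_apply, P₂_smul_left]; rfl

/-- `IsStrLie.P₂_eq` rewritten for the symbol; this is what makes the commutator with a linear field
again a Bessel operator, in another direction. -/
theorem symb_commutator {A : V →ₗ[ℝ] V} (hA : J.IsStrLie A) (x v b : V) :
    A (symb ϑ x v b) + symb ϑ x v (LinearMap.adjoint A b) =
      symb ϑ (A x) v b + symb ϑ x (ϑ.toFun (A (ϑ.toFun v))) b := by
  have := hA.P₂_eq ϑ x (ϑ.toFun v) (ϑ.toFun b)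
  simp only [symb_apply, ϑ.invol] at this ⊢
  rw [this]

theorem sum_inner_smul {E : Type*} [AddCommGroup E] [Module ℝ E] (f : V →ₗ[ℝ] E) (x : V) :
    ∑ i, ⟪x, stdOrthonormalBasis ℝ V i⟫_ℝ • f (stdOrthonormalBasis ℝ V i) = f x := by
  conv_rhs => rw [← (stdOrthonormalBasis ℝ V).sum_repr' x, map_sum]
  exact Finset.sum_congr rfl fun i _ => by rw [map_smul, real_inner_comm]

theorem sum_inner_mul (f : V →L[ℝ] ℂ) (x : V) :
    ∑ i, ((⟪x, stdOrthonormalBasis ℝ V i⟫_ℝ : ℝ) : ℂ) * f (stdOrthonormalBasis ℝ V i) = f x := by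
  have := sum_inner_smul (f : V →ₗ[ℝ] ℂ) x
  simpa only [Complex.real_smul, ContinuousLinearMap.coe_coe] using this

/-- Moving an operator to the other slot in the trace of a bilinear map. -/
theorem sum_adjoint {E : Type*} [AddCommGroup E] [Module ℝ E] (B : V →ₗ[ℝ] V →ₗ[ℝ] E)
    (A : V →ₗ[ℝ] V) :
    ∑ j, B (A (stdOrthonormalBasis ℝ V j)) (stdOrthonormalBasis ℝ V j) =
      ∑ j, B (stdOrthonormalBasis ℝ V j) (LinearMap.adjoint A (stdOrthonormalBasis ℝ V j)) := by
  have h1 : ∀ j, B (A (stdOrthonormalBasis ℝ V j)) (stdOrthonormalBasis ℝ V j) =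
      ∑ i, ⟪A (stdOrthonormalBasis ℝ V j), stdOrthonormalBasis ℝ V i⟫_ℝ •
        B (stdOrthonormalBasis ℝ V i) (stdOrthonormalBasis ℝ V j) := fun j =>
    (sum_inner_smul (B.flip (stdOrthonormalBasis ℝ V j)) _).symm
  have h2 : ∀ i, B (stdOrthonormalBasis ℝ V i)
      (LinearMap.adjoint A (stdOrthonormalBasis ℝ V i)) =
      ∑ j, ⟪A (stdOrthonormalBasis ℝ V j), stdOrthonormalBasis ℝ V i⟫_ℝ •
        B (stdOrthonormalBasis ℝ V i) (stdOrthonormalBasis ℝ V j) := fun i => by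
    rw [← sum_inner_smul (B (stdOrthonormalBasis ℝ V i))]
    exact Finset.sum_congr rfl fun j _ => by rw [LinearMap.adjoint_inner_left, real_inner_comm]
  rw [Finset.sum_congr rfl fun j _ => h1 j, Finset.sum_comm, Finset.sum_congr rfl fun j _ => h2 j]

/-- Contracting one index of the double sum leaves the trace of the Hessian against the symmetric
operator `symb`. -/
theorem besselOp_eq (lam : ℝ) (v : V) (Ψ : V → ℂ) (x : V) :
    besselOp J ϑ lam v Ψ x = ∑ j, hess Ψ x (symb ϑ x v (stdOrthonormalBasis ℝ V j))
      (stdOrthonormalBasis ℝ V j) + (lam : ℂ) * fderiv ℝ Ψ x (ϑ.toFun v) := by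
  unfold besselOp
  simp only
  congr 1
  · rw [Finset.sum_comm]
    refine Finset.sum_congr rfl fun j _ => ?_
    rw [hess, ← sum_inner_mul]
    refine Finset.sum_congr rfl fun i _ => ?_
    rw [P₂_comm, inner_P₂, symb_symm, real_inner_comm]
  · congr 1
    rw [← sum_inner_mul]
    refine Finset.sum_congr rfl fun i _ => ?_
    rw [ϑ.inner_left, real_inner_comm]

variable {U : Set V} (hU : IsOpen U) {Ψ : V → ℂ} (hΨ : ContDiffOn ℝ ∞ Ψ U)
include hU hΨ

theorem besselOp_add {Φ : V → ℂ} (hΦ : ContDiffOn ℝ ∞ Φ U) (lam : ℝ) (v : V) {x : V}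
    (hx : x ∈ U) : besselOp J ϑ lam v (fun y => Φ y + Ψ y) x =
      besselOp J ϑ lam v Φ x + besselOp J ϑ lam v Ψ x := by
  have := ((smooth_hasFDerivAt hU hΦ hx).add (smooth_hasFDerivAt hU hΨ hx)).fderiv
  change fderiv ℝ (fun y => Φ y + Ψ y) x = _ at this
  rw [besselOp_eq, besselOp_eq, besselOp_eq, this]
  simp only [hess_add hU hΨ hΦ hx, Finset.sum_add_distrib, add_apply]
  ring

theorem besselOp_const_mul (z : ℂ) (lam : ℝ) (v : V) {x : V} (hx : x ∈ U) :
    besselOp J ϑ lam v (fun y => z * Ψ y) x = z * besselOp J ϑ lam v Ψ x := by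
  have := ((smooth_hasFDerivAt hU hΨ hx).const_mul z).fderiv
  rw [besselOp_eq, besselOp_eq, this]
  simp only [hess_const_mul hU hΨ z hx, mul_add, Finset.mul_sum, smul_apply,
    smul_eq_mul]
  ring

/-- The commutator of the Bessel operator with multiplication by a linear form. -/
theorem besselOp_inner_mul (lam : ℝ) (u v : V) {x : V} (hx : x ∈ U) :
    besselOp J ϑ lam v (fun y => ((⟪y, u⟫_ℝ : ℝ) : ℂ) * Ψ y) x =
      ((⟪x, u⟫_ℝ : ℝ) : ℂ) * besselOp J ϑ lam v Ψ x +
        2 * fderiv ℝ Ψ x (J.box (ϑ.toFun u) (ϑ.toFun v) x) +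
        (lam : ℂ) * ((⟪ϑ.toFun v, u⟫_ℝ : ℝ) : ℂ) * Ψ x := by
  let ℓ : V →L[ℝ] ℂ := Complex.ofRealCLM.comp ((innerSL ℝ).flip u)
  have hℓ : ∀ y, ℓ y = ((⟪y, u⟫_ℝ : ℝ) : ℂ) := fun y => rfl
  have hs : ContDiffOn ℝ ∞ (fun y => ((⟪y, u⟫_ℝ : ℝ) : ℂ)) U := ℓ.contDiff.contDiffOn
  have hd : ∀ y, HasFDerivAt (fun y => ((⟪y, u⟫_ℝ : ℝ) : ℂ)) ℓ y := fun y => ℓ.hasFDerivAt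
  have hh : ∀ a b, hess (fun y => ((⟪y, u⟫_ℝ : ℝ) : ℂ)) x a b = 0 := fun a b => by
    rw [hess_eq_of_hasFDerivAt isOpen_univ (fun y _ => hd y) (Set.mem_univ x)
      (hasFDerivAt_const _ _)]; rfl
  have hm : fderiv ℝ (fun y => ((⟪y, u⟫_ℝ : ℝ) : ℂ) * Ψ y) x = _ :=
    ((hd x).mul (smooth_hasFDerivAt hU hΨ hx)).fderiv
  rw [besselOp_eq, besselOp_eq, hm, ← symb_eq_box]
  simp only [hess_mul hU hΨ hs hx, hh, (hd x).fderiv, hℓ, Finset.sum_add_distrib, ← Finset.mul_sum,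
    zero_mul, add_zero, add_apply, smul_apply, smul_eq_mul, mul_add]
  have s1 : ∑ j, ((⟪symb ϑ x v (stdOrthonormalBasis ℝ V j), u⟫_ℝ : ℝ) : ℂ) *
      fderiv ℝ Ψ x (stdOrthonormalBasis ℝ V j) = fderiv ℝ Ψ x (symb ϑ x v u) := by
    rw [← sum_inner_mul]
    exact Finset.sum_congr rfl fun i _ => by rw [symb_symm, real_inner_comm]
  have s2 : ∑ j, ((⟪stdOrthonormalBasis ℝ V j, u⟫_ℝ : ℝ) : ℂ) *
      fderiv ℝ Ψ x (symb ϑ x v (stdOrthonormalBasis ℝ V j)) = fderiv ℝ Ψ x (symb ϑ x v u) := by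
    have := sum_inner_mul ((fderiv ℝ Ψ x).comp (LinearMap.toContinuousLinearMap (symb ϑ x v))) u
    simp only [ContinuousLinearMap.comp_apply, LinearMap.coe_toContinuousLinearMap'] at this
    rw [← this]
    exact Finset.sum_congr rfl fun i _ => by rw [real_inner_comm]
  rw [s1, s2]
  ring

/-- The Bessel operator as a smooth function. -/
theorem hasFDerivAt_besselOp (lam : ℝ) (v : V) {x : V} (hx : x ∈ U) (h : V) :
    fderiv ℝ (besselOp J ϑ lam v Ψ) x h =
      ∑ j, (fderiv ℝ (fderiv ℝ (fderiv ℝ Ψ)) x h (symb ϑ x v (stdOrthonormalBasis ℝ V j))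
          (stdOrthonormalBasis ℝ V j) +
        fderiv ℝ (fderiv ℝ Ψ) x (symb ϑ h v (stdOrthonormalBasis ℝ V j))
          (stdOrthonormalBasis ℝ V j)) +
      (lam : ℂ) * fderiv ℝ (fderiv ℝ Ψ) x h (ϑ.toFun v) := by
  let R : V → V →L[ℝ] V := fun b => LinearMap.toContinuousLinearMap
    { toFun := fun x => symb ϑ x v b
      map_add' := fun x y => symb_add_left ϑ x y v b
      map_smul' := fun t x => symb_smul_left ϑ t x v b }
  have hR : ∀ b x, R b x = symb ϑ x v b := fun b x => rfl
  have e : besselOp J ϑ lam v Ψ =ᶠ[nhds x] fun y => ∑ j, fderiv ℝ (fderiv ℝ Ψ) y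
      (R (stdOrthonormalBasis ℝ V j) y) (stdOrthonormalBasis ℝ V j) +
      (lam : ℂ) * fderiv ℝ Ψ y (ϑ.toFun v) := by
    filter_upwards [hU.mem_nhds hx] with y hy
    rw [besselOp_eq]
    simp only [hess_eq hU hΨ hy, hR]
  have d1 : ∀ j, HasFDerivAt (fun y => fderiv ℝ (fderiv ℝ Ψ) y
      (R (stdOrthonormalBasis ℝ V j) y) (stdOrthonormalBasis ℝ V j)) _ x := fun j =>
    ((smooth_hasFDerivAt₃ hU hΨ hx).clm_apply (R (stdOrthonormalBasis ℝ V j)).hasFDerivAt).clm_apply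
      (hasFDerivAt_const _ x)
  have d2 := ((smooth_hasFDerivAt₂ hU hΨ hx).clm_apply
    (hasFDerivAt_const (ϑ.toFun v) x)).const_mul (lam : ℂ)
  have d3 := (HasFDerivAt.fun_sum (u := Finset.univ) fun j _ => d1 j).add d2
  have d4 : HasFDerivAt (fun y => ∑ j, fderiv ℝ (fderiv ℝ Ψ) y
      (R (stdOrthonormalBasis ℝ V j) y) (stdOrthonormalBasis ℝ V j) +
      (lam : ℂ) * fderiv ℝ Ψ y (ϑ.toFun v)) _ x := d3
  rw [e.fderiv_eq, d4.fderiv]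
  simp [hR, add_comm]

/-- The commutator of the Bessel operator with an element of the Lie algebra of the structure
group. -/
theorem besselOp_D (lam : ℝ) (v : V) {A : V →L[ℝ] V} (hA : J.IsStrLie (A : V →ₗ[ℝ] V)) {x : V}
    (hx : x ∈ U) : besselOp J ϑ lam v (fun y => fderiv ℝ Ψ y (A y)) x =
      fderiv ℝ (besselOp J ϑ lam v Ψ) x (A x) +
        besselOp J ϑ lam (ϑ.toFun (A (ϑ.toFun v))) Ψ x := by
  rw [hasFDerivAt_besselOp ϑ hU hΨ lam v hx, besselOp_eq, besselOp_eq,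
    (hasFDerivAt_D hU hΨ A hx).fderiv]
  simp only [hess_D hU hΨ A hx, hess_eq hU hΨ hx, Finset.sum_add_distrib, ϑ.invol]
  let B : V →ₗ[ℝ] V →ₗ[ℝ] ℂ := LinearMap.mk₂ ℝ
    (fun a b => fderiv ℝ (fderiv ℝ Ψ) x (symb ϑ x v b) a)
    (fun a b c => by simp) (fun t a b => by simp) (fun a b c => by simp) (fun t a b => by simp)
  have hB : ∀ a b, B a b = fderiv ℝ (fderiv ℝ Ψ) x (symb ϑ x v b) a := fun a b => rfl
  have s1 := sum_adjoint B (A : V →ₗ[ℝ] V)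
  simp only [hB, ContinuousLinearMap.coe_coe] at s1
  rw [s1]
  -- With one `A` moved to the other slot as its adjoint, the two second-order terms match
  -- `symb_commutator`; the third-order terms agree by symmetry.
  have s2 : ∑ j, fderiv ℝ (fderiv ℝ Ψ) x (symb ϑ x v (LinearMap.adjoint (A : V →ₗ[ℝ] V)
        (stdOrthonormalBasis ℝ V j))) (stdOrthonormalBasis ℝ V j) +
      ∑ j, fderiv ℝ (fderiv ℝ Ψ) x (stdOrthonormalBasis ℝ V j)
        (A (symb ϑ x v (stdOrthonormalBasis ℝ V j))) =
      ∑ j, fderiv ℝ (fderiv ℝ Ψ) x (symb ϑ (A x) v (stdOrthonormalBasis ℝ V j))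
        (stdOrthonormalBasis ℝ V j) +
      ∑ j, fderiv ℝ (fderiv ℝ Ψ) x (symb ϑ x (ϑ.toFun (A (ϑ.toFun v)))
        (stdOrthonormalBasis ℝ V j)) (stdOrthonormalBasis ℝ V j) := by
    rw [← Finset.sum_add_distrib, ← Finset.sum_add_distrib]
    refine Finset.sum_congr rfl fun j _ => ?_
    rw [snd_symm hU hΨ hx _ (A _), ← add_apply, ← add_apply, ← map_add, ← map_add]
    have := symb_commutator ϑ hA x v (stdOrthonormalBasis ℝ V j)
    rw [ContinuousLinearMap.coe_coe] at this
    rw [← this, add_comm (symb ϑ x v _)]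
  have s3 : ∑ j, fderiv ℝ (fderiv ℝ (fderiv ℝ Ψ)) x (symb ϑ x v (stdOrthonormalBasis ℝ V j))
        (stdOrthonormalBasis ℝ V j) (A x) =
      ∑ j, fderiv ℝ (fderiv ℝ (fderiv ℝ Ψ)) x (A x) (symb ϑ x v (stdOrthonormalBasis ℝ V j))
        (stdOrthonormalBasis ℝ V j) :=
    Finset.sum_congr rfl fun j _ => third_symm hU hΨ hx _ _ _
  rw [s3]
  simp only [add_apply, ContinuousLinearMap.comp_apply, ContinuousLinearMap.flip_apply]
  rw [snd_symm hU hΨ hx (ϑ.toFun v) (A x)]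
  linear_combination s2

end Bessel

end MinRep.JordanAlgebra

/-! ### Tangency of the Bessel operators to the orbit. -/

namespace MinRep.JordanAlgebra

variable {V : Type*} [NormedAddCommGroup V] [InnerProductSpace ℝ V] [FiniteDimensional ℝ V]
variable {J : JordanAlgebra V} {ϑ : CartanInvolution J}

theorem IsCompactElt.map_P₂ {k : (V →L[ℝ] V)ˣ} (h : IsCompactElt ϑ k) (x y z : V) :
    (k : V →L[ℝ] V) (J.P₂ x y (ϑ.toFun z)) =
      J.P₂ ((k : V →L[ℝ] V) x) ((k : V →L[ℝ] V) y) (ϑ.toFun ((k : V →L[ℝ] V) z)) := by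
  have key : ∀ x, J.P ((k : V →L[ℝ] V) x) (ϑ.toFun ((k : V →L[ℝ] V) z)) =
      (k : V →L[ℝ] V) (J.P x (ϑ.toFun z)) := fun x => by
    rw [h.2, ϑ.invol, inv_apply]
  have h1 := J.P_add ((k : V →L[ℝ] V) x) ((k : V →L[ℝ] V) y) (ϑ.toFun ((k : V →L[ℝ] V) z))
  have h2 := congrArg (k : V →L[ℝ] V) (J.P_add x y (ϑ.toFun z))
  rw [← map_add, key, key, key] at h1
  rw [map_add, map_add, map_smul] at h2
  linear_combination (norm := module) (1 / 2 : ℝ) • h1 - (1 / 2 : ℝ) • h2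

theorem IsCompactElt.map_symb {k : (V →L[ℝ] V)ˣ} (h : IsCompactElt ϑ k) (x v b : V) :
    (k : V →L[ℝ] V) (symb ϑ x v b) = symb ϑ ((k : V →L[ℝ] V) x)
      (ϑ.toFun ((k : V →L[ℝ] V) (ϑ.toFun v))) ((k : V →L[ℝ] V) b) := by
  rw [symb_apply, symb_apply, ϑ.invol, h.map_P₂]

/-- Traces of bilinear maps are invariant under orthogonal maps. -/
theorem IsCompactElt.sum_map {k : (V →L[ℝ] V)ˣ} (h : IsCompactElt ϑ k) {E : Type*}
    [AddCommGroup E] [Module ℝ E] (B : V →ₗ[ℝ] V →ₗ[ℝ] E) :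
    ∑ j, B ((k : V →L[ℝ] V) (stdOrthonormalBasis ℝ V j))
        ((k : V →L[ℝ] V) (stdOrthonormalBasis ℝ V j)) =
      ∑ j, B (stdOrthonormalBasis ℝ V j) (stdOrthonormalBasis ℝ V j) := by
  have h1 := sum_adjoint (B.compl₂ ((k : V →L[ℝ] V) : V →ₗ[ℝ] V)) ((k : V →L[ℝ] V) : V →ₗ[ℝ] V)
  simp only [LinearMap.compl₂_apply, ContinuousLinearMap.coe_coe] at h1
  rw [h1]
  refine Finset.sum_congr rfl fun j _ => ?_
  congr 1
  refine ext_inner_left ℝ fun y => ?_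
  rw [← inv_apply k y, ← apply_inv k y, inv_apply, h.inner, LinearMap.adjoint_inner_right]
  rfl

section Tangent

variable {U : Set V} (hU : IsOpen U) {Ψ : V → ℂ} (hΨ : ContDiffOn ℝ ∞ Ψ U)
include hU hΨ

/-- The elements of the Lie algebra of the structure group are tangent to its orbits. -/
theorem fderiv_eq_zero_of_orbit (ϑ : CartanInvolution J) {a : V} (hO : orbit J a ⊆ U)
    (h0 : ∀ y ∈ orbit J a, Ψ y = 0) {A : V →L[ℝ] V} (hA : J.IsStrLie (A : V →ₗ[ℝ] V)) {x : V}
    (hx : x ∈ orbit J a) : fderiv ℝ Ψ x (A x) = 0 := by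
  have h1 := hasDerivAt_flow_apply A x 0
  rw [flow_zero] at h1
  have h2 : HasDerivAt (fun t => Ψ (flow A t x)) (fderiv ℝ Ψ x (A x)) 0 :=
    HasFDerivAt.comp_hasDerivAt 0 (by rw [flow_zero]; exact smooth_hasFDerivAt hU hΨ (hO hx)) h1
  have h3 : (fun t => Ψ (flow A t x)) = fun _ => 0 :=
    funext fun t => h0 _ (flow_mem_orbit ϑ hA t hx)
  rw [h3] at h2
  exact h2.unique (hasDerivAt_const 0 0)

/-- `AΨ` also vanishes on the orbit, so `B(AΨ) = 0` there; expanding it expresses a second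
derivative in tangent directions by a first derivative. -/
theorem fderiv_fderiv_of_orbit (ϑ : CartanInvolution J) {a : V} (hO : orbit J a ⊆ U)
    (h0 : ∀ y ∈ orbit J a, Ψ y = 0) {A B : V →L[ℝ] V} (hA : J.IsStrLie (A : V →ₗ[ℝ] V))
    (hB : J.IsStrLie (B : V →ₗ[ℝ] V)) {x : V} (hx : x ∈ orbit J a) :
    fderiv ℝ (fderiv ℝ Ψ) x (B x) (A x) = -fderiv ℝ Ψ x (A (B x)) := by
  have h := fderiv_eq_zero_of_orbit hU (smooth_D hU hΨ A) ϑ hO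
    (fun y hy => fderiv_eq_zero_of_orbit hU hΨ ϑ hO h0 hA hy) hB hx
  rw [(hasFDerivAt_D hU hΨ A (hO hx)).fderiv] at h
  simp only [add_apply, ContinuousLinearMap.comp_apply, ContinuousLinearMap.flip_apply] at h
  linear_combination h

end Tangent

namespace IsJordanFrame

variable {c : Fin (splitRank J ϑ) → V} (hc : IsJordanFrame J ϑ c)
include hc

theorem symb_of_zero (i) (v : V) {b : V} (hb : J.mul (c i) b = 0) : symb ϑ (c i) v b = 0 := by
  have hb' : J.mul (c i) (ϑ.toFun b) = 0 := by
    rw [← hc.theta i, ← ϑ.map_mul, hb, map_zero]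
  have := mul_comm_of_zero (hc.idem i) hb' (ϑ.toFun v)
  simp only [symb_apply, P₂, L, LinearMap.add_apply, LinearMap.sub_apply, LinearMap.comp_apply, hb',
    map_zero, add_zero]
  rw [J.mul_comm (ϑ.toFun v), this, J.mul_comm, sub_self]

/-- Of the three Peirce components of `ϑv`, those in `V₁` and `V_{1/2}` contribute nothing to the
block from `V_{1/2}` to itself. -/
theorem pHalf_symb (i) (v : V) {b : V} (hb : J.mul (c i) b = (1 / 2 : ℝ) • b) :
    J.pHalf (c i) (symb ϑ (c i) v b) = J.mul (ϑ.toFun b) (J.pZero (c i) (ϑ.toFun v)) := by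
  have hb' : J.mul (c i) (ϑ.toFun b) = (1 / 2 : ℝ) • ϑ.toFun b := by
    rw [← hc.theta i, ← ϑ.map_mul, hb, map_smul]
  set y := ϑ.toFun b
  set z := ϑ.toFun v
  have hi := hc.idem i
  have e : symb ϑ (c i) v b = J.P₂ (c i) (J.pOne (c i) z) y + J.P₂ (c i) (J.pHalf (c i) z) y +
      J.P₂ (c i) (J.pZero (c i) z) y := by
    rw [← P₂_add_right, ← P₂_add_right, p_sum]; rfl
  have h1 := one_mul_half hi (mul_pOne hi z) hb'
  have h0 := zero_mul_half hi (mul_pZero hi z) hb'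
  have hh := half_mul_half hi (mul_pHalf hi z) hb'
  have e1 : J.P₂ (c i) (J.pOne (c i) z) y = 0 := by
    simp only [P₂, L, LinearMap.add_apply, LinearMap.sub_apply, LinearMap.comp_apply, hb',
      mul_pOne hi z, h1, map_smul]
    module
  have e0 : J.P₂ (c i) (J.pZero (c i) z) y = J.mul y (J.pZero (c i) z) := by
    simp only [P₂, L, LinearMap.add_apply, LinearMap.sub_apply, LinearMap.comp_apply, hb',
      mul_pZero hi z, h0, map_smul, map_zero, LinearMap.zero_apply]
    rw [J.mul_comm y]
    module
  have e2 : J.pHalf (c i) (J.P₂ (c i) (J.pHalf (c i) z) y) = 0 := by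
    have hq := mul_pHalf hi z
    generalize J.pHalf (c i) z = q at hh hq ⊢
    simp only [P₂, L, LinearMap.add_apply, LinearMap.sub_apply, LinearMap.comp_apply, hb', hq,
      map_smul, LinearMap.smul_apply, add_sub_cancel_right, pHalf, hh, sub_self, smul_zero]
  rw [e, map_add, map_add, e1, e2, e0, map_zero, zero_add, zero_add]
  refine pHalf_of_half ?_
  rw [J.mul_comm y, h0]

theorem pZero_eq_zero (h : splitRank J ϑ = 1) (i) (x : V) : J.pZero (c i) x = 0 := by
  rw [hc.eq_one_of_splitRank h i]
  simp only [pZero, LinearMap.add_apply, LinearMap.sub_apply, LinearMap.id_apply,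
    LinearMap.smul_apply, LinearMap.comp_apply, J.one_mul]
  module

/-- On `V_{1/2}` the operator `L(ww')` is `L(w)L(w') + L(w')L(w)`, and the two summands have equal
trace. -/
theorem trace_mul_mul_pHalf [Nontrivial V] (hs : (plus J ϑ).IsSimple) (i) {w w' : V}
    (hw : J.mul (c i) w = 0) (hw' : J.mul (c i) w' = 0) :
    LinearMap.trace ℝ V (J.mul w ∘ₗ J.mul w' ∘ₗ J.pHalf (c i)) =
      lam₁ J ϑ c / 2 * J.tr (J.mul w w') := by
  have hi := hc.idem i
  have h1 := hc.halfTrace_id hs i (zero_mul_zero hi hw hw')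
  have e1 : J.mul (J.mul w w') ∘ₗ J.pHalf (c i) = J.mul w ∘ₗ J.mul w' ∘ₗ J.pHalf (c i) +
      J.mul w' ∘ₗ J.mul w ∘ₗ J.pHalf (c i) := by
    ext x
    exact mul_mul_half_of_zero hi hw hw' (mul_pHalf hi x)
  have e2 : J.mul w' ∘ₗ J.pHalf (c i) = J.pHalf (c i) ∘ₗ J.mul w' := by
    ext x
    simp only [pHalf, LinearMap.comp_apply, LinearMap.smul_apply, LinearMap.sub_apply, map_smul,
      map_sub, mul_comm_of_zero hi hw']
  have e3 : LinearMap.trace ℝ V (J.mul w ∘ₗ J.mul w' ∘ₗ J.pHalf (c i)) =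
      LinearMap.trace ℝ V (J.mul w' ∘ₗ J.mul w ∘ₗ J.pHalf (c i)) := by
    rw [e2]
    have e4 : J.mul w ∘ₗ J.pHalf (c i) = J.pHalf (c i) ∘ₗ J.mul w := by
      ext x
      simp only [pHalf, LinearMap.comp_apply, LinearMap.smul_apply, LinearMap.sub_apply, map_smul,
        map_sub, mul_comm_of_zero hi hw]
    rw [← LinearMap.comp_assoc, e4]
    have := LinearMap.trace_mul_cycle ℝ (J.pHalf (c i)) (J.mul w) (J.mul w')
    simp only [Module.End.mul_eq_comp] at this
    rw [this]
    rfl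
  have h2 : LinearMap.trace ℝ V (J.mul (J.mul w w') ∘ₗ J.pHalf (c i)) =
    lam₁ J ϑ c * J.tr (J.mul w w') := h1
  rw [e1, map_add, ← e3] at h2
  linarith

/-- The contraction of the product over `V_{1/2}` against `V₀`. -/
theorem pZero_sum [Nontrivial V] (hs : (plus J ϑ).IsSimple) (i) {z : V}
    (hz : J.mul (c i) z = 0) :
    J.pZero (c i) (∑ j, J.mul (J.pHalf (c i) (stdOrthonormalBasis ℝ V j))
      (J.mul (ϑ.toFun (J.pHalf (c i) (stdOrthonormalBasis ℝ V j))) z)) =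
      (lam₁ J ϑ c / 2) • z := by
  have hi := hc.idem i
  refine ext_inner_right ℝ fun w => ?_
  have hw := mul_pZero hi w
  have hθz : J.mul (c i) (ϑ.toFun z) = 0 := by
    rw [← hc.theta i, ← ϑ.map_mul, hz, map_zero]
  rw [hc.inner_pZero, sum_inner]
  have e : ∀ b : V, ⟪J.mul (J.pHalf (c i) b) (J.mul (ϑ.toFun (J.pHalf (c i) b)) z),
      J.pZero (c i) w⟫_ℝ = ⟪b, (J.pHalf (c i) ∘ₗ ϑ.toFun ∘ₗ
        (J.mul (ϑ.toFun z) ∘ₗ J.mul (J.pZero (c i) w) ∘ₗ J.pHalf (c i)) ∘ₗ ϑ.toFun) b⟫_ℝ := by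
    intro b
    simp only [LinearMap.comp_apply]
    rw [← hc.inner_pHalf, ← ϑ.inner_left, hc.theta_pHalf, ϑ.inner_mul, hc.theta_pHalf,
      J.mul_comm _ z, ϑ.inner_mul, J.mul_comm _ (J.pZero (c i) w)]
  rw [Finset.sum_congr rfl fun j _ => e _, ← LinearMap.trace_eq_sum_inner]
  have h1 := LinearMap.trace_mul_comm ℝ (J.pHalf (c i) ∘ₗ ϑ.toFun)
    ((J.mul (ϑ.toFun z) ∘ₗ J.mul (J.pZero (c i) w) ∘ₗ J.pHalf (c i)) ∘ₗ ϑ.toFun)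
  have h2 : ((J.mul (ϑ.toFun z) ∘ₗ J.mul (J.pZero (c i) w) ∘ₗ J.pHalf (c i)) ∘ₗ ϑ.toFun) *
      (J.pHalf (c i) ∘ₗ ϑ.toFun) =
      J.mul (ϑ.toFun z) ∘ₗ J.mul (J.pZero (c i) w) ∘ₗ J.pHalf (c i) := by
    ext x
    simp only [Module.End.mul_apply, LinearMap.comp_apply]
    rw [hc.theta_pHalf, ϑ.invol, pHalf_of_half (mul_pHalf hi x)]
  rw [h2] at h1
  rw [LinearMap.comp_assoc] at h1 ⊢
  change LinearMap.trace ℝ V ((J.pHalf (c i) ∘ₗ ϑ.toFun) * _) = _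
  rw [h1, hc.trace_mul_mul_pHalf hs i hθz hw, real_inner_smul_left]
  congr 1
  change J.τ (ϑ.toFun z) _ = _
  rw [ϑ.τ_left, ← ϑ.inner_eq, ← hc.inner_pZero, pZero_of_zero hz]

/-- The linear vector field of the Lie algebra of the structure group with value
`b₁ + b_{1/2}` at `c`. -/
theorem exists_vectorField (i) (b : V) : ∃ A : V →L[ℝ] V, J.IsStrLie (A : V →ₗ[ℝ] V) ∧
    A (c i) = J.pOne (c i) b + J.pHalf (c i) b ∧
    ∀ x, A x = J.mul (J.pOne (c i) b) x + (2 : ℝ) • J.mul (J.pHalf (c i) b) x := by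
  refine ⟨LinearMap.toContinuousLinearMap (J.mul (J.pOne (c i) b + (2 : ℝ) • J.pHalf (c i) b)),
    J.isStrLie_mul _, ?_, fun x => ?_⟩
  · change J.mul _ (c i) = _
    rw [J.mul_comm, map_add, map_smul, mul_pOne (hc.idem i), mul_pHalf (hc.idem i)]
    module
  · change J.mul _ x = _
    rw [map_add, map_smul]
    rfl

/-- The Bessel operator is tangential to the minimal orbit, at the base point. -/
theorem besselOp_base_eq_zero [Nontrivial V] (hs : (plus J ϑ).IsSimple) (i) {lam : ℝ}
    (hlam : 1 < splitRank J ϑ → lam = lam₁ J ϑ c) {U : Set V} (hU : IsOpen U)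
    (hO : orbit J (c i) ⊆ U) {Ψ : V → ℂ} (hΨ : ContDiffOn ℝ ∞ Ψ U)
    (h0 : ∀ y ∈ orbit J (c i), Ψ y = 0) (v : V) : besselOp J ϑ lam v Ψ (c i) = 0 := by
  have hi := hc.idem i
  have hcO : c i ∈ orbit J (c i) := ⟨1, one_mem _, rfl⟩
  set D := fderiv ℝ Ψ (c i) with hD
  -- `V₁ + V_{1/2}` consists of tangent directions at the base point, so only the `V₀` derivative of
  -- `Ψ` can survive.
  have hD1 : ∀ b, D (J.pOne (c i) b + J.pHalf (c i) b) = 0 := fun b => by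
    obtain ⟨A, hA, hAc, -⟩ := hc.exists_vectorField i b
    rw [← hAc]
    exact fderiv_eq_zero_of_orbit hU hΨ ϑ hO h0 hA hcO
  have hD0 : ∀ x, D x = D (J.pZero (c i) x) := fun x => by
    conv_lhs => rw [← J.p_sum (c i) x, map_add, hD1, zero_add]
  -- Only the product of the two `V_{1/2}` parts has a `V₀` component; the factor 2 is that of the
  -- field in `exists_vectorField`.
  have hD2 : ∀ a b, fderiv ℝ (fderiv ℝ Ψ) (c i) (J.pOne (c i) a + J.pHalf (c i) a)
      (J.pOne (c i) b + J.pHalf (c i) b) =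
        -2 * D (J.mul (J.pHalf (c i) b) (J.pHalf (c i) a)) := fun a b => by
    obtain ⟨A, hA, hAc, hA'⟩ := hc.exists_vectorField i a
    obtain ⟨B, hB, hBc, hB'⟩ := hc.exists_vectorField i b
    have := fderiv_fderiv_of_orbit hU hΨ ϑ hO h0 hB hA hcO
    rw [hAc, hBc, hB'] at this
    rw [this, ← hD]
    have z1 : J.pZero (c i) (J.mul (J.pOne (c i) b) (J.pOne (c i) a)) = 0 :=
      pZero_of_one (one_mul_one hi (mul_pOne hi b) (mul_pOne hi a))
    have z2 : J.pZero (c i) (J.mul (J.pOne (c i) b) (J.pHalf (c i) a)) = 0 :=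
      pZero_of_half (one_mul_half hi (mul_pOne hi b) (mul_pHalf hi a))
    have z3 : J.pZero (c i) (J.mul (J.pHalf (c i) b) (J.pOne (c i) a)) = 0 := by
      rw [J.mul_comm]
      exact pZero_of_half (one_mul_half hi (mul_pOne hi a) (mul_pHalf hi b))
    rw [hD0, hD0 (J.mul _ _)]
    simp only [map_add, map_smul, z1, z2, z3, zero_add]
    simp
  set R := symb ϑ (c i) v with hR
  have hπ : ∀ x, J.pOne (c i) x + J.pHalf (c i) x = x - J.pZero (c i) x := fun x =>
    eq_sub_of_add_eq (J.p_sum (c i) x)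
  -- The symbol at the base point kills `V₀` and, being symmetric, has range orthogonal to it; hence
  -- only tangential second derivatives occur.
  have hRz : ∀ x, R (J.pZero (c i) x) = 0 := fun x => hc.symb_of_zero i v (mul_pZero hi x)
  have hzR : ∀ x, J.pZero (c i) (R x) = 0 := fun x => by
    refine ext_inner_right ℝ fun y => ?_
    rw [hc.inner_pZero, hR, symb_symm, ← hR, hRz, inner_zero_right, inner_zero_left]
  let π : V →ₗ[ℝ] V := J.pOne (c i) + J.pHalf (c i)
  have adj : ∀ {T : V →ₗ[ℝ] V}, (∀ x y, ⟪T x, y⟫_ℝ = ⟪x, T y⟫_ℝ) → LinearMap.adjoint T = T :=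
    fun {T} h => ((LinearMap.eq_adjoint_iff T T).2 h).symm
  have hπadj : LinearMap.adjoint π = π := adj fun x y => by
    simp only [π, LinearMap.add_apply, inner_add_left, inner_add_right, hc.inner_pOne,
      hc.inner_pHalf]
  have hhadj : LinearMap.adjoint (J.pHalf (c i)) = J.pHalf (c i) := adj (hc.inner_pHalf i)
  let B : V →ₗ[ℝ] V →ₗ[ℝ] ℂ := LinearMap.mk₂ ℝ
    (fun a b => fderiv ℝ (fderiv ℝ Ψ) (c i) (R a) b)
    (fun a b c => by simp) (fun t a b => by simp) (fun a b c => by simp) (fun t a b => by simp)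
  have hB : ∀ a b, B a b = fderiv ℝ (fderiv ℝ Ψ) (c i) (R a) b := fun a b => rfl
  let F : V →ₗ[ℝ] V →ₗ[ℝ] ℂ := LinearMap.mk₂ ℝ (fun a b => D (J.mul b (J.pHalf (c i) (R a))))
    (fun a b c => by simp) (fun t a b => by simp) (fun a b c => by simp) (fun t a b => by simp)
  have hF : ∀ a b, F a b = D (J.mul b (J.pHalf (c i) (R a))) := fun a b => rfl
  have s1 := sum_adjoint B π
  rw [hπadj] at s1
  have e1 : ∀ b, B (π b) b = fderiv ℝ (fderiv ℝ Ψ) (c i) (R b) b := fun b => by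
    rw [hB]
    simp only [π, LinearMap.add_apply]
    rw [hπ, map_sub, hRz, sub_zero]
  have e2 : ∀ b, B b (π b) = -2 * F b (J.pHalf (c i) b) := fun b => by
    have : R b = J.pOne (c i) (R b) + J.pHalf (c i) (R b) := by rw [hπ, hzR, sub_zero]
    rw [hB, hF, this]
    simp only [π, LinearMap.add_apply]
    rw [hD2, ← this]
  have s2 := sum_adjoint F (J.pHalf (c i))
  rw [hhadj] at s2
  let F' : V →ₗ[ℝ] V →ₗ[ℝ] ℂ := LinearMap.mk₂ ℝ
    (fun a b => D (J.mul b (J.pHalf (c i) (R (J.pHalf (c i) a)))))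
    (fun a b c => by simp) (fun t a b => by simp) (fun a b c => by simp) (fun t a b => by simp)
  have hF' : ∀ a b, F' a b = D (J.mul b (J.pHalf (c i) (R (J.pHalf (c i) a)))) := fun a b => rfl
  have s3 := sum_adjoint F' (J.pHalf (c i))
  rw [hhadj] at s3
  have e3 : ∀ b, F' (J.pHalf (c i) b) b = F (J.pHalf (c i) b) b := fun b => by
    rw [hF, hF', pHalf_of_half (mul_pHalf hi b)]
  have e4 : ∀ b, F' b (J.pHalf (c i) b) = D (J.mul (J.pHalf (c i) b)
      (J.mul (ϑ.toFun (J.pHalf (c i) b)) (J.pZero (c i) (ϑ.toFun v)))) := fun b => by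
    rw [hF', hc.pHalf_symb i v (mul_pHalf hi b)]
  -- Projections are inserted and moved across the sum until it is the contraction of `pZero_sum`.
  have key : ∑ j, fderiv ℝ (fderiv ℝ Ψ) (c i) (R (stdOrthonormalBasis ℝ V j))
      (stdOrthonormalBasis ℝ V j) =
      -2 * D ((lam₁ J ϑ c / 2) • J.pZero (c i) (ϑ.toFun v)) := by
    rw [← hc.pZero_sum hs i (mul_pZero hi (ϑ.toFun v)), ← hD0, map_sum,
      ← Finset.sum_congr rfl fun j _ => e1 _, s1, Finset.sum_congr rfl fun j _ => e2 _,
      ← Finset.mul_sum, ← s2, ← Finset.sum_congr rfl fun j _ => e3 _, s3,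
      Finset.sum_congr rfl fun j _ => e4 _]
  rw [besselOp_eq]
  simp only [hess_eq hU hΨ (hO hcO)]
  rw [← hR, key, ← hD, hD0 (ϑ.toFun v)]
  -- The second-order term is `-λ₁` times the derivative along the `V₀` part of `ϑv` and cancels the
  -- first-order term. In split rank one `c_i = e`, so `V₀ = 0` and any `lam` works.
  by_cases h1 : 1 < splitRank J ϑ
  · rw [hlam h1, map_smul, Complex.real_smul]
    push_cast
    ring
  · rw [hc.pZero_eq_zero (by have := hc.splitRank_pos; omega)]
    simp

/-- The Bessel operator is tangential to the minimal orbit. -/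
theorem besselOp_eq_zero [Nontrivial V] (hs : (plus J ϑ).IsSimple) (i) {lam : ℝ}
    (hlam : 1 < splitRank J ϑ → lam = lam₁ J ϑ c) {U : Set V} (hU : IsOpen U)
    (hO : orbit J (c i) ⊆ U) {Ψ : V → ℂ} (hΨ : ContDiffOn ℝ ∞ Ψ U)
    (h0 : ∀ y ∈ orbit J (c i), Ψ y = 0) (v : V) {x : V} (hx : x ∈ orbit J (c i)) :
    besselOp J ϑ lam v Ψ x = 0 := by
  obtain ⟨k, hk, t, ht, rfl⟩ := hc.exists_polar hs i hx
  -- `G` preserves the orbit and carries the base point to `x`; pulling back along it multiplies the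
  -- Bessel operator by `t`, in a rotated direction.
  let G : V →L[ℝ] V := t • (k : V →L[ℝ] V)
  have hG : ∀ y, G y = (k : V →L[ℝ] V) (t • y) := fun y => by simp [G]
  have hGO : ∀ y ∈ orbit J (c i), G y ∈ orbit J (c i) := by
    rintro _ ⟨g, hg, rfl⟩
    obtain ⟨g', hg', e⟩ := scalar_mem_Lgrp J t ht
    exact ⟨k * (g' * g), mul_mem hk.1.1 (mul_mem hg' hg), by simp [hG, e]⟩
  have hU' := hU.preimage G.continuous
  have h := hc.besselOp_base_eq_zero hs i hlam hU' (fun y hy => hO (hGO y hy))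
    (hΨ.comp G.contDiff.contDiffOn (fun y hy => hy)) (fun y hy => h0 _ (hGO y hy))
    (ϑ.toFun (((k⁻¹ : (V →L[ℝ] V)ˣ) : V →L[ℝ] V) (ϑ.toFun v)))
  have hcO : c i ∈ orbit J (c i) := ⟨1, one_mem _, rfl⟩
  have hx' := hO hx
  rw [← hG] at hx' ⊢
  have hf : fderiv ℝ (Ψ ∘ G) (c i) = (fderiv ℝ Ψ (G (c i))).comp G :=
    ((smooth_hasFDerivAt hU hΨ hx').comp (c i) G.hasFDerivAt).fderiv
  rw [besselOp_eq, hf, ϑ.invol] at h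
  have hh : ∀ a b, hess (Ψ ∘ G) (c i) a b = hess Ψ (G (c i)) (G a) (G b) := fun a b =>
    hess_comp hU hΨ G hx' a b
  simp only [hh, hess_eq hU hΨ hx', ContinuousLinearMap.comp_apply] at h
  have e1 : ∀ b, G (symb ϑ (c i) (ϑ.toFun (((k⁻¹ : (V →L[ℝ] V)ˣ) : V →L[ℝ] V) (ϑ.toFun v))) b) =
      symb ϑ (G (c i)) v ((k : V →L[ℝ] V) b) := fun b => by
    rw [hG, map_smul, hk.map_symb, ϑ.invol, apply_inv, ϑ.invol, ← symb_smul_left, hG, map_smul]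
  have e2 : ∀ b, G b = t • (k : V →L[ℝ] V) b := fun b => rfl
  simp only [e1] at h
  simp only [e2 (stdOrthonormalBasis ℝ V _), e2 (_ : V)] at h
  let B : V →ₗ[ℝ] V →ₗ[ℝ] ℂ := LinearMap.mk₂ ℝ
    (fun a b => fderiv ℝ (fderiv ℝ Ψ) (G (c i)) (symb ϑ (G (c i)) v a) b)
    (fun a b c => by simp) (fun t a b => by simp) (fun a b c => by simp) (fun t a b => by simp)
  have s := hk.sum_map B
  have hB : ∀ a b, B a b = fderiv ℝ (fderiv ℝ Ψ) (G (c i)) (symb ϑ (G (c i)) v a) b :=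
    fun a b => rfl
  simp only [hB] at s
  rw [besselOp_eq]
  simp only [hess_eq hU hΨ hx']
  rw [← s]
  simp only [e2, map_smul, ← Finset.smul_sum, apply_inv] at h ⊢
  rw [Complex.real_smul, Complex.real_smul, mul_left_comm, ← mul_add] at h
  exact (mul_eq_zero.1 h).resolve_left (by exact_mod_cast ht.ne')

end IsJordanFrame

end MinRep.JordanAlgebra

/-! ### Spaces generated by linear forms and linear vector fields. -/

namespace MinRep.JordanAlgebra

variable {V : Type*} [NormedAddCommGroup V] [InnerProductSpace ℝ V] [FiniteDimensional ℝ V]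
variable {J : JordanAlgebra V} {ϑ : CartanInvolution J}

theorem smooth_inner (u : V) (U : Set V) :
    ContDiffOn ℝ ∞ (fun y : V => ((⟪y, u⟫_ℝ : ℝ) : ℂ)) U :=
  (Complex.ofRealCLM.contDiff.comp (contDiff_id.inner ℝ contDiff_const)).contDiffOn

theorem smooth_besselOp (ϑ : CartanInvolution J) {U : Set V} (hU : IsOpen U) {Ψ : V → ℂ}
    (hΨ : ContDiffOn ℝ ∞ Ψ U) (lam : ℝ) (v : V) : ContDiffOn ℝ ∞ (besselOp J ϑ lam v Ψ) U := by
  have h1 := smooth_fderiv hU hΨ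
  have h2 := smooth_fderiv hU hΨ |>.fderiv_of_isOpen hU (m := ∞) (by simp)
  have e : ∀ x ∈ U, besselOp J ϑ lam v Ψ x = ∑ j, fderiv ℝ (fderiv ℝ Ψ) x
      (LinearMap.toContinuousLinearMap (J.box (ϑ.toFun (stdOrthonormalBasis ℝ V j)) (ϑ.toFun v)) x)
      (stdOrthonormalBasis ℝ V j) + (lam : ℂ) * fderiv ℝ Ψ x (ϑ.toFun v) := by
    intro x hx
    rw [besselOp_eq]
    simp only [hess_eq hU hΨ hx, symb_eq_box]
    rfl
  refine ContDiffOn.congr ?_ e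
  exact (ContDiffOn.sum fun j _ => (h2.clm_apply (ContinuousLinearMap.contDiff _).contDiffOn).clm_apply
    contDiffOn_const).add (contDiffOn_const.mul (h1.clm_apply contDiffOn_const))

/-- The functions generated by `W₀` under linear combinations, multiplication by linear forms and
the linear vector fields of the Lie algebra of the structure group. -/
inductive Gen (J : JordanAlgebra V) (W₀ : Set (V → ℂ)) : (V → ℂ) → Prop
  | base {Ψ} (h : Ψ ∈ W₀) : Gen J W₀ Ψ
  | zero : Gen J W₀ fun _ => 0
  | add {Φ Ψ} (h : Gen J W₀ Φ) (h' : Gen J W₀ Ψ) : Gen J W₀ fun x => Φ x + Ψ x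
  | const_mul (z : ℂ) {Ψ} (h : Gen J W₀ Ψ) : Gen J W₀ fun x => z * Ψ x
  | inner_mul (u : V) {Ψ} (h : Gen J W₀ Ψ) : Gen J W₀ fun x => ((⟪x, u⟫_ℝ : ℝ) : ℂ) * Ψ x
  | deriv {A : V →L[ℝ] V} (hA : J.IsStrLie (A : V →ₗ[ℝ] V)) {Ψ} (h : Gen J W₀ Ψ) :
      Gen J W₀ fun x => fderiv ℝ Ψ x (A x)

theorem Gen.smooth {W₀ : Set (V → ℂ)} {U : Set V} (hU : IsOpen U)
    (hW : ∀ Ψ ∈ W₀, ContDiffOn ℝ ∞ Ψ U) {Ψ : V → ℂ} (h : Gen J W₀ Ψ) : ContDiffOn ℝ ∞ Ψ U := by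
  induction h with
  | base h => exact hW _ h
  | zero => exact contDiffOn_const
  | add _ _ h h' => exact h.add h'
  | const_mul z _ h => exact contDiffOn_const.mul h
  | inner_mul u _ h => exact (smooth_inner u U).mul h
  | deriv hA _ h => exact smooth_D hU h _

/-- Two smooth functions which agree on an orbit have the same derivatives along the Lie algebra
of the structure group. -/
theorem fderiv_congr_of_orbit (ϑ : CartanInvolution J) {a : V} {U : Set V} (hU : IsOpen U)
    (hO : orbit J a ⊆ U) {Φ Ψ : V → ℂ} (hΦ : ContDiffOn ℝ ∞ Φ U) (hΨ : ContDiffOn ℝ ∞ Ψ U)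
    (h : ∀ y ∈ orbit J a, Φ y = Ψ y) {A : V →L[ℝ] V} (hA : J.IsStrLie (A : V →ₗ[ℝ] V)) {x : V}
    (hx : x ∈ orbit J a) : fderiv ℝ Φ x (A x) = fderiv ℝ Ψ x (A x) := by
  have h1 := fderiv_eq_zero_of_orbit hU (hΦ.sub hΨ) ϑ hO (fun y hy => sub_eq_zero.2 (h y hy)) hA hx
  have h2 : fderiv ℝ (fun y => Φ y - Ψ y) x = _ :=
    ((smooth_hasFDerivAt hU hΦ (hO hx)).sub (smooth_hasFDerivAt hU hΨ (hO hx))).fderiv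
  have h1 : fderiv ℝ (fun y => Φ y - Ψ y) x (A x) = 0 := h1
  rw [h2] at h1
  exact sub_eq_zero.1 h1

theorem besselOp_sub {U : Set V} (hU : IsOpen U) {Φ Ψ : V → ℂ} (hΦ : ContDiffOn ℝ ∞ Φ U)
    (hΨ : ContDiffOn ℝ ∞ Ψ U) (lam : ℝ) (v : V) {x : V} (hx : x ∈ U) :
    besselOp J ϑ lam v (fun y => Φ y - Ψ y) x =
      besselOp J ϑ lam v Φ x - besselOp J ϑ lam v Ψ x := by
  have h := besselOp_add ϑ hU (contDiffOn_const.mul hΨ : ContDiffOn ℝ ∞ (fun y => (-1 : ℂ) * Ψ y) U)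
    hΦ lam v hx
  rw [besselOp_const_mul ϑ hU hΨ _ _ _ hx] at h
  have e : (fun y => Φ y + -1 * Ψ y) = fun y => Φ y - Ψ y := by ext y; ring
  rw [e] at h
  rw [h]; ring

section Frame

variable {c : Fin (splitRank J ϑ) → V} (hc : IsJordanFrame J ϑ c)
include hc

theorem IsJordanFrame.besselOp_congr [Nontrivial V] (hs : (plus J ϑ).IsSimple) (i) {lam : ℝ}
    (hlam : 1 < splitRank J ϑ → lam = lam₁ J ϑ c) {U : Set V} (hU : IsOpen U)
    (hO : orbit J (c i) ⊆ U) {Φ Ψ : V → ℂ} (hΦ : ContDiffOn ℝ ∞ Φ U) (hΨ : ContDiffOn ℝ ∞ Ψ U)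
    (h : ∀ y ∈ orbit J (c i), Φ y = Ψ y) (v : V) {x : V} (hx : x ∈ orbit J (c i)) :
    besselOp J ϑ lam v Φ x = besselOp J ϑ lam v Ψ x := by
  have := hc.besselOp_eq_zero hs i hlam hU hO (hΦ.sub hΨ)
    (fun y hy => sub_eq_zero.2 (h y hy)) v hx
  rw [← sub_eq_zero, ← besselOp_sub hU hΦ hΨ lam v (hO hx)]
  exact this

/-- If the Bessel operators map `W₀` into the space generated by `W₀`, they preserve that space. -/
theorem Gen.besselOp (i) {lam : ℝ} {U : Set V} (hU : IsOpen U)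
    (hO : orbit J (c i) ⊆ U) {W₀ : Set (V → ℂ)} (hW : ∀ Ψ ∈ W₀, ContDiffOn ℝ ∞ Ψ U)
    (hB : ∀ Ψ ∈ W₀, ∀ v, ∃ Φ, Gen J W₀ Φ ∧ ∀ x ∈ orbit J (c i), besselOp J ϑ lam v Ψ x = Φ x)
    {Ψ : V → ℂ} (h : Gen J W₀ Ψ) (v : V) :
    ∃ Φ, Gen J W₀ Φ ∧ ∀ x ∈ orbit J (c i), besselOp J ϑ lam v Ψ x = Φ x := by
  induction h generalizing v with
  | base h => exact hB _ h v
  | zero =>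
    refine ⟨_, Gen.zero, fun x _ => ?_⟩
    rw [besselOp_eq]
    simp [hess]
  | add h h' ih ih' =>
    obtain ⟨Φ, hΦ, e⟩ := ih v
    obtain ⟨Φ', hΦ', e'⟩ := ih' v
    refine ⟨_, hΦ.add hΦ', fun x hx => ?_⟩
    rw [besselOp_add ϑ hU (h'.smooth hU hW) (h.smooth hU hW) lam v (hO hx), e x hx, e' x hx]
  | const_mul z h ih =>
    obtain ⟨Φ, hΦ, e⟩ := ih v
    refine ⟨_, hΦ.const_mul z, fun x hx => ?_⟩
    rw [besselOp_const_mul ϑ hU (h.smooth hU hW) z lam v (hO hx), e x hx]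
  | inner_mul u h ih =>
    obtain ⟨Φ, hΦ, e⟩ := ih v
    refine ⟨_, ((hΦ.inner_mul u).add ((h.deriv (A := LinearMap.toContinuousLinearMap
      (J.box (ϑ.toFun u) (ϑ.toFun v))) (J.isStrLie_box _ _)).const_mul 2)).add
      (h.const_mul ((lam : ℂ) * ((⟪ϑ.toFun v, u⟫_ℝ : ℝ) : ℂ))), fun x hx => ?_⟩
    rw [besselOp_inner_mul ϑ hU (h.smooth hU hW) lam u v (hO hx), e x hx]
    rfl
  | @deriv A hA Ψ h ih =>
    obtain ⟨Φ, hΦ, e⟩ := ih v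
    obtain ⟨Φ', hΦ', e'⟩ := ih (ϑ.toFun (A (ϑ.toFun v)))
    refine ⟨_, (hΦ.deriv hA).add hΦ', fun x hx => ?_⟩
    -- The induction gives the Bessel derivative only on the orbit, which is enough because `A` is
    -- tangent to it.
    rw [besselOp_D ϑ hU (h.smooth hU hW) lam v hA (hO hx), e' x hx,
      fderiv_congr_of_orbit ϑ hU hO (smooth_besselOp ϑ hU (h.smooth hU hW) lam v)
        (hΦ.smooth hU hW) e hA hx]

theorem IsJordanFrame.c₁_eq [Nontrivial V] : c₁ J ϑ c = c ⟨0, hc.splitRank_pos⟩ := by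
  rw [c₁, dif_pos hc.splitRank_pos]

/-- The representation space is contained in the space of restrictions of functions generated
by `W₀`. -/
theorem IsJordanFrame.W_le [Nontrivial V] (hs : (plus J ϑ).IsSimple) {lam : ℝ}
    (hlam : 1 < splitRank J ϑ → lam = lam₁ J ϑ c) {U : Set V} (hU : IsOpen U)
    (hO : 𝒪 J ϑ c ⊆ U) {W₀ : Set (V → ℂ)} (hW : ∀ Ψ ∈ W₀, ContDiffOn ℝ ∞ Ψ U)
    (hB : ∀ Ψ ∈ W₀, ∀ v, ∃ Φ, Gen J W₀ Φ ∧ ∀ x ∈ 𝒪 J ϑ c, besselOp J ϑ lam v Ψ x = Φ x)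
    (h0 : ∃ Φ, Gen J W₀ Φ ∧ ∀ x : 𝒪 J ϑ c, ψ₀ J ϑ c lam x = Φ x)
    {M : Submodule ℂ (𝒪 J ϑ c → ℂ)} (hM : ∀ Ψ ∈ W₀, (fun x : 𝒪 J ϑ c => Ψ x) ∈ M)
    (hMu : ∀ ψ ∈ M, ∀ u : V, (fun x : 𝒪 J ϑ c => ((⟪(x : V), u⟫_ℝ : ℝ) : ℂ) * ψ x) ∈ M)
    (hMA : ∀ ψ ∈ M, ∃ Ψ, IsSmoothExtension J ϑ c ψ Ψ ∧
      ∀ A : V →L[ℝ] V, J.IsStrLie (A : V →ₗ[ℝ] V) →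
        (fun x : 𝒪 J ϑ c => fderiv ℝ Ψ x (A x)) ∈ M) : W J ϑ c lam ≤ M := by
  have hc1 := hc.c₁_eq
  unfold 𝒪 at hO hB
  rw [hc1] at hO hB
  have hx : ∀ x : 𝒪 J ϑ c, (x : V) ∈ orbit J (c ⟨0, hc.splitRank_pos⟩) := fun x => by
    rw [← hc1]; exact x.2
  have hx' : ∀ x ∈ orbit J (c ⟨0, hc.splitRank_pos⟩), x ∈ 𝒪 J ϑ c := fun x hx => by
    rw [𝒪, hc1]; exact hx
  -- Restrictions of generated functions. `N ≤ M` uses the stability of `M`; `W ≤ N` follows because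
  -- `N` contains `ψ₀` and is stable under the action.
  let N : Submodule ℂ (𝒪 J ϑ c → ℂ) :=
    { carrier := {ψ | ∃ Φ, Gen J W₀ Φ ∧ ∀ x : 𝒪 J ϑ c, ψ x = Φ x}
      zero_mem' := ⟨_, Gen.zero, fun x => rfl⟩
      add_mem' := by
        rintro _ _ ⟨Φ, h, e⟩ ⟨Φ', h', e'⟩
        exact ⟨_, h.add h', fun x => by rw [Pi.add_apply, e, e']⟩
      smul_mem' := by
        rintro z _ ⟨Φ, h, e⟩
        exact ⟨_, h.const_mul z, fun x => by rw [Pi.smul_apply, e, smul_eq_mul]⟩ }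
  have hNM : N ≤ M := by
    rintro ψ ⟨Φ, h, e⟩
    rw [show ψ = fun x : 𝒪 J ϑ c => Φ x from funext e]
    clear e
    induction h with
    | base h => exact hM _ h
    | zero => exact M.zero_mem
    | add _ _ h h' => exact M.add_mem h h'
    | const_mul z _ h => exact M.smul_mem z h
    | inner_mul u _ h => exact hMu _ h u
    | @deriv A hA Ψ h h' =>
      obtain ⟨Ψ', ⟨U', hU', hO', hs', he⟩, hD⟩ := hMA _ h'
      have := hD A hA
      -- The extension supplied for `M` may differ from `Ψ` off the orbit, but tangential
      -- derivatives agree.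
      convert this using 2 with x
      refine fderiv_congr_of_orbit ϑ (hU.inter hU') (fun y hy => ⟨hO hy, hO' (hx' y hy)⟩)
        ((h.smooth hU hW).mono Set.inter_subset_left) (hs'.mono Set.inter_subset_right)
        (fun y hy => (he ⟨y, hx' y hy⟩).symm) hA (hx x)
  refine le_trans (sInf_le ⟨h0, ?_⟩) hNM
  rintro ψ ⟨Φ, h, e⟩ Ψ ⟨U', hU', hO', hs', he⟩ u T hT v
  have hT' := (J.isStrLie_of_mem_strAlg hT).adjoint ϑ
  obtain ⟨Φ', h', e'⟩ := h.besselOp hc _ hU hO hW hB (-v)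
  let A : V →L[ℝ] V := LinearMap.toContinuousLinearMap (LinearMap.adjoint (T : V →ₗ[ℝ] V))
  have hA : J.IsStrLie (A : V →ₗ[ℝ] V) := hT'
  refine ⟨_, ((h.inner_mul u).const_mul Complex.I).add (((h.deriv hA).add (h.const_mul
    (((J.rank : ℝ) * lam / (2 * (finrank ℝ V : ℝ)) * LinearMap.trace ℝ V
      (LinearMap.adjoint (T : V →ₗ[ℝ] V)) : ℝ) : ℂ))).add (h'.const_mul (1 / Complex.I))),
    fun x => ?_⟩
  have hO2 : orbit J (c ⟨0, hc.splitRank_pos⟩) ⊆ U ∩ U' := fun y hy => ⟨hO hy, hO' (hx' y hy)⟩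
  have s1 := (h.smooth hU hW).mono (Set.inter_subset_left (t := U'))
  have s2 := hs'.mono (Set.inter_subset_right (s := U))
  have e2 : ∀ y ∈ orbit J (c ⟨0, hc.splitRank_pos⟩), Ψ y = Φ y := fun y hy => by
    rw [he ⟨y, hx' y hy⟩, e]
  have d1 := fderiv_congr_of_orbit ϑ (hU.inter hU') hO2 s2 s1 e2 hA (hx x)
  have d2 := hc.besselOp_congr hs _ hlam (hU.inter hU') hO2 s2 s1 e2 (-v) (hx x)
  change Complex.I * ((⟪(x : V), u⟫_ℝ : ℝ) : ℂ) * Ψ x + (fderiv ℝ Ψ x (A x) + _ * Ψ x) +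
    1 / Complex.I * JordanAlgebra.besselOp J ϑ lam (-v) Ψ x = _
  rw [d1, d2, e' x (hx x), e2 x (hx x)]
  ring

end Frame

end MinRep.JordanAlgebra

namespace MinRep.JordanAlgebra

/-! ### Estimates and recurrences for the `K`-Bessel function. -/

section BesselK

/-- Split `z cosh t ≥ z/2 + y` with `y = z eᵗ/4`, and bound `e^{-y}` by `(y/p)^{-p}`. -/
theorem exp_neg_cosh_le {p z : ℝ} (hp : 0 < p) (hz : 0 < z) (t : ℝ) :
    Real.exp (-z * Real.cosh t) ≤
      (4 * p) ^ p * z ^ (-p) * Real.exp (-(z / 2)) * Real.exp (-p * t) := by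
  have h1 : Real.exp t / 2 ≤ Real.cosh t := by
    rw [Real.cosh_eq]; have := Real.exp_pos (-t); linarith
  have h2 := Real.one_le_cosh t
  set y := z * Real.exp t / 4 with hy
  have hy0 : 0 < y := by positivity
  have h3 : (y / p) ^ p ≤ Real.exp y := by
    have h := Real.add_one_le_exp (y / p)
    calc (y / p) ^ p ≤ (Real.exp (y / p)) ^ p :=
          Real.rpow_le_rpow (by positivity) (by linarith) hp.le
      _ = Real.exp y := by rw [← Real.exp_mul, div_mul_cancel₀ _ hp.ne']
  have h4 : Real.exp (-y) ≤ (y / p) ^ (-p) := by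
    rw [Real.exp_neg, Real.rpow_neg (by positivity)]
    exact inv_anti₀ (by positivity) h3
  have h5 : (y / p) ^ (-p) = (4 * p) ^ p * z ^ (-p) * Real.exp (-p * t) := by
    have : y / p = z * Real.exp t * (4 * p)⁻¹ := by rw [hy]; field_simp
    rw [this, Real.mul_rpow (by positivity) (by positivity), Real.mul_rpow hz.le (by positivity),
      Real.inv_rpow (by positivity), Real.rpow_neg (by positivity : 0 ≤ 4 * p), inv_inv,
      ← Real.exp_mul]
    rw [show t * -p = -p * t by ring]
    ring
  calc Real.exp (-z * Real.cosh t) ≤ Real.exp (-(z / 2) + -y) := by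
        refine Real.exp_le_exp.2 ?_
        rw [hy]
        nlinarith
    _ = Real.exp (-(z / 2)) * Real.exp (-y) := Real.exp_add _ _
    _ ≤ Real.exp (-(z / 2)) * ((4 * p) ^ p * z ^ (-p) * Real.exp (-p * t)) := by
        rw [← h5]; exact mul_le_mul_of_nonneg_left h4 (Real.exp_pos _).le
    _ = _ := by ring

theorem cosh_mul_le (β : ℝ) {t : ℝ} (ht : 0 ≤ t) : Real.cosh (β * t) ≤ Real.exp (|β| * t) := by
  rw [← Real.cosh_abs, abs_mul, abs_of_nonneg ht, Real.cosh_eq]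
  have h0 : 0 ≤ |β| * t := by positivity
  have : Real.exp (-(|β| * t)) ≤ Real.exp (|β| * t) := Real.exp_le_exp.2 (by linarith)
  linarith

/-- The exponent `p = |β| + δ` absorbs the growth of `cosh(βt)` and leaves `e^{-δt}`, at the price
of an extra `z^{-δ}`. -/
theorem besselK_integrand_le (β : ℝ) {δ z t : ℝ} (hδ : 0 < δ) (hz : 0 < z) (ht : 0 ≤ t) :
    Real.exp (-z * Real.cosh t) * Real.cosh (β * t) ≤
      (4 * (|β| + δ)) ^ (|β| + δ) * z ^ (-(|β| + δ)) * Real.exp (-(z / 2)) * Real.exp (-δ * t) := by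
  have hp : 0 < |β| + δ := by positivity
  calc Real.exp (-z * Real.cosh t) * Real.cosh (β * t) ≤
      ((4 * (|β| + δ)) ^ (|β| + δ) * z ^ (-(|β| + δ)) * Real.exp (-(z / 2)) *
        Real.exp (-(|β| + δ) * t)) * Real.exp (|β| * t) :=
        mul_le_mul (exp_neg_cosh_le hp hz t) (cosh_mul_le β ht) (Real.cosh_pos _).le (by positivity)
    _ = _ := by
      rw [mul_assoc _ (Real.exp (-(|β| + δ) * t)), ← Real.exp_add]
      congr 2
      ring

theorem integrableOn_besselK (β : ℝ) {z : ℝ} (hz : 0 < z) :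
    IntegrableOn (fun t => Real.exp (-z * Real.cosh t) * Real.cosh (β * t)) (Set.Ioi 0) := by
  refine Integrable.mono' ((integrableOn_exp_mul_Ioi (a := -1) (by norm_num) 0).const_mul
    ((4 * (|β| + 1)) ^ (|β| + 1) * z ^ (-(|β| + 1)) * Real.exp (-(z / 2)))) ?_ ?_
  · exact Continuous.aestronglyMeasurable (by fun_prop)
  · refine (ae_restrict_iff' measurableSet_Ioi).2 (Filter.Eventually.of_forall fun t ht => ?_)
    rw [Real.norm_of_nonneg (mul_nonneg (Real.exp_pos _).le (Real.cosh_pos _).le)]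
    exact besselK_integrand_le β one_pos hz (le_of_lt ht)

/-- The Bessel function decays exponentially and has a power singularity at the origin. -/
theorem besselK_le (β : ℝ) {δ : ℝ} (hδ : 0 < δ) : ∃ C, 0 ≤ C ∧ ∀ z, 0 < z →
    besselK β z ≤ C * z ^ (-(|β| + δ)) * Real.exp (-(z / 2)) := by
  refine ⟨(4 * (|β| + δ)) ^ (|β| + δ) * (1 / δ), by positivity, fun z hz => ?_⟩
  have h := setIntegral_mono_on (integrableOn_besselK β hz)
    ((integrableOn_exp_mul_Ioi (a := -δ) (by linarith) 0).const_mul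
      ((4 * (|β| + δ)) ^ (|β| + δ) * z ^ (-(|β| + δ)) * Real.exp (-(z / 2))))
    measurableSet_Ioi (fun t ht => besselK_integrand_le β hδ hz (le_of_lt ht))
  rw [integral_const_mul, integral_exp_mul_Ioi (by linarith)] at h
  refine h.trans (le_of_eq ?_)
  rw [mul_zero, Real.exp_zero, neg_div_neg_eq]
  ring

theorem besselK_nonneg (β z : ℝ) : 0 ≤ besselK β z :=
  setIntegral_nonneg measurableSet_Ioi fun _ _ =>
    mul_nonneg (Real.exp_pos _).le (Real.cosh_pos _).le

/-- Keep only the unit interval starting at `-log z`: there `z cosh t ≤ e` and `cosh(αt) ≥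
z^{-α}/2`. -/
theorem le_besselK {α z : ℝ} (hα : 0 < α) (hz : 0 < z) (hz1 : z ≤ 1) :
    Real.exp (-Real.exp 1) / 2 * z ^ (-α) ≤ besselK α z := by
  set l := -Real.log z with hl
  have hl0 : 0 ≤ l := by have := Real.log_nonpos hz.le hz1; linarith
  have hsub : Set.Ioc l (l + 1) ⊆ Set.Ioi 0 := fun t ht => lt_of_le_of_lt hl0 ht.1
  have h1 := setIntegral_mono_set (integrableOn_besselK α hz)
    (Filter.Eventually.of_forall fun t =>
      mul_nonneg (Real.exp_pos _).le (Real.cosh_pos _).le) hsub.eventuallyLE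
  refine le_trans ?_ h1
  have h2 := setIntegral_mono_on (f := fun _ : ℝ => Real.exp (-Real.exp 1) / 2 * z ^ (-α))
    (s := Set.Ioc l (l + 1)) continuous_const.integrableOn_Ioc ((integrableOn_besselK α hz).mono_set hsub)
    measurableSet_Ioc (fun t ht => ?_)
  · simpa using h2
  have e1 : z * Real.cosh t ≤ Real.exp 1 := by
    have : Real.cosh t ≤ Real.exp t := by
      have := cosh_mul_le 1 (hl0.trans ht.1.le)
      simpa using this
    have h3 : Real.exp t ≤ Real.exp (l + 1) := Real.exp_le_exp.2 ht.2
    rw [Real.exp_add, hl, Real.exp_neg, Real.exp_log hz] at h3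
    calc z * Real.cosh t ≤ z * (z⁻¹ * Real.exp 1) :=
          mul_le_mul_of_nonneg_left (this.trans h3) hz.le
      _ = Real.exp 1 := by rw [← mul_assoc, mul_inv_cancel₀ hz.ne', _root_.one_mul]
  have e2 : z ^ (-α) / 2 ≤ Real.cosh (α * t) := by
    have h3 : z ^ (-α) ≤ Real.exp (α * t) := by
      rw [Real.rpow_def_of_pos hz]
      refine Real.exp_le_exp.2 ?_
      have := ht.1.le
      rw [hl] at this
      nlinarith
    rw [Real.cosh_eq]
    have := Real.exp_pos (-(α * t))
    linarith
  calc Real.exp (-Real.exp 1) / 2 * z ^ (-α) = Real.exp (-Real.exp 1) * (z ^ (-α) / 2) := by ring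
    _ ≤ _ := mul_le_mul (Real.exp_le_exp.2 (by linarith)) e2 (by positivity) (Real.exp_pos _).le

theorem cosh_mul_cosh (α t : ℝ) : Real.cosh t * Real.cosh (α * t) =
    (Real.cosh ((α + 1) * t) + Real.cosh ((α - 1) * t)) / 2 := by
  rw [add_mul, sub_mul, _root_.one_mul, Real.cosh_add, Real.cosh_sub]; ring

theorem sinh_mul_sinh (α t : ℝ) : Real.sinh t * Real.sinh (α * t) =
    (Real.cosh ((α + 1) * t) - Real.cosh ((α - 1) * t)) / 2 := by
  rw [add_mul, sub_mul, _root_.one_mul, Real.cosh_add, Real.cosh_sub]; ring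

theorem hasDerivAt_besselK (α : ℝ) {z : ℝ} (hz : 0 < z) :
    HasDerivAt (besselK α) (-(besselK (α + 1) z + besselK (α - 1) z) / 2) z := by
  have key := (hasDerivAt_integral_of_dominated_loc_of_deriv_le
    (μ := volume.restrict (Set.Ioi (0 : ℝ))) (x₀ := z) (s := Set.Ioi (z / 2))
    (F := fun z t => Real.exp (-z * Real.cosh t) * Real.cosh (α * t))
    (F' := fun z t => -Real.cosh t * Real.exp (-z * Real.cosh t) * Real.cosh (α * t))
    (bound := fun t => Real.exp (-(z / 2) * Real.cosh t) * Real.cosh ((α + 1) * t) / 2 +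
      Real.exp (-(z / 2) * Real.cosh t) * Real.cosh ((α - 1) * t) / 2)
    (Ioi_mem_nhds (by linarith)) (Filter.Eventually.of_forall fun x =>
      Continuous.aestronglyMeasurable (by fun_prop)) (integrableOn_besselK α hz)
    (Continuous.aestronglyMeasurable (by fun_prop)) (Filter.Eventually.of_forall fun t x hx => ?_)
    (((integrableOn_besselK (α + 1) (half_pos hz)).div_const 2).add
      ((integrableOn_besselK (α - 1) (half_pos hz)).div_const 2))
    (Filter.Eventually.of_forall fun t x _ => ?_)).2
  · refine key.congr_deriv ?_
    rw [besselK, besselK, ← integral_add (integrableOn_besselK _ hz) (integrableOn_besselK _ hz),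
      ← integral_neg, ← integral_div]
    refine integral_congr_ae (Filter.Eventually.of_forall fun t => ?_)
    have := cosh_mul_cosh α t
    simp only
    linear_combination -Real.exp (-z * Real.cosh t) * this
  · have e : Real.exp (-x * Real.cosh t) ≤ Real.exp (-(z / 2) * Real.cosh t) := by
      refine Real.exp_le_exp.2 ?_
      have := Real.cosh_pos t
      have hx : z / 2 < x := hx
      nlinarith
    rw [neg_mul, neg_mul, norm_neg, Real.norm_of_nonneg (by have := Real.cosh_pos t; have := Real.cosh_pos (α * t); positivity),
      ← add_div, ← mul_add, mul_div_assoc, ← cosh_mul_cosh, mul_right_comm, _root_.mul_comm]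
    exact mul_le_mul_of_nonneg_right e (mul_nonneg (Real.cosh_pos _).le (Real.cosh_pos _).le)
  · have := (((hasDerivAt_neg x).mul_const (Real.cosh t)).exp).mul_const (Real.cosh (α * t))
    refine this.congr_deriv ?_
    ring

/-- Integrate the derivative of `exp(-z cosh t) sinh(αt)`, which vanishes at both ends. -/
theorem besselK_rec (α : ℝ) {z : ℝ} (hz : 0 < z) :
    z * (besselK (α + 1) z - besselK (α - 1) z) = 2 * α * besselK α z := by
  have i0 := integrableOn_besselK α hz
  have i1 := integrableOn_besselK (α + 1) hz
  have i2 := integrableOn_besselK (α - 1) hz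
  have i3 : IntegrableOn (fun t => Real.exp (-z * Real.cosh t) * Real.cosh ((α + 1) * t) -
      Real.exp (-z * Real.cosh t) * Real.cosh ((α - 1) * t)) (Set.Ioi 0) := i1.sub i2
  have hF : ∀ t ∈ Set.Ici (0 : ℝ), HasDerivAt (fun t => Real.exp (-z * Real.cosh t) * Real.sinh (α * t))
      (α * (Real.exp (-z * Real.cosh t) * Real.cosh (α * t)) - z / 2 *
        (Real.exp (-z * Real.cosh t) * Real.cosh ((α + 1) * t) -
          Real.exp (-z * Real.cosh t) * Real.cosh ((α - 1) * t))) t := by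
    intro t _
    have h := (((Real.hasDerivAt_cosh t).const_mul (-z)).exp).mul
      ((Real.hasDerivAt_sinh (α * t)).comp t ((hasDerivAt_id t).const_mul α))
    refine HasDerivAt.congr_deriv h ?_
    have := sinh_mul_sinh α t
    simp only [Function.comp]
    linear_combination (-z * Real.exp (-z * Real.cosh t)) * this
  have hlim : Filter.Tendsto (fun t => Real.exp (-z * Real.cosh t) * Real.sinh (α * t))
      Filter.atTop (nhds 0) := by
    have hb : Filter.Tendsto (fun t => ((4 * (|α| + 1)) ^ (|α| + 1) * z ^ (-(|α| + 1)) *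
        Real.exp (-(z / 2))) * Real.exp (-1 * t)) Filter.atTop (nhds 0) := by
      rw [← mul_zero ((4 * (|α| + 1)) ^ (|α| + 1) * z ^ (-(|α| + 1)) * Real.exp (-(z / 2)))]
      refine Filter.Tendsto.const_mul _ ?_
      simp only [neg_mul, _root_.one_mul]
      exact Real.tendsto_exp_neg_atTop_nhds_zero
    refine squeeze_zero_norm' ?_ hb
    filter_upwards [Filter.eventually_ge_atTop 0] with t ht
    refine le_trans ?_ (besselK_integrand_le α one_pos hz ht)
    rw [norm_mul, Real.norm_of_nonneg (Real.exp_pos _).le]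
    refine mul_le_mul_of_nonneg_left ?_ (Real.exp_pos _).le
    rw [Real.norm_eq_abs]
    refine abs_le_of_sq_le_sq ?_ (Real.cosh_pos _).le
    have := Real.cosh_sq (α * t)
    linarith
  have h := integral_Ioi_of_hasDerivAt_of_tendsto' hF
    ((i0.const_mul α).sub (i3.const_mul (z / 2))) hlim
  rw [integral_sub (i0.const_mul α) (i3.const_mul (z / 2)), integral_const_mul,
    integral_const_mul, integral_sub i1 i2] at h
  simp only [mul_zero, Real.sinh_zero, sub_zero] at h
  unfold besselK
  linarith

theorem besselK_neg (α z : ℝ) : besselK (-α) z = besselK α z := by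
  simp only [besselK, neg_mul, Real.cosh_neg]

theorem hasDerivAt_besselKt (α : ℝ) {z : ℝ} (hz : 0 < z) :
    HasDerivAt (besselKt α) (-(z / 2) * besselKt (α + 1) z) z := by
  have h1 := ((hasDerivAt_id z).div_const 2).rpow_const (p := -α) (Or.inl (by simp [hz.ne']))
  have h := h1.mul (hasDerivAt_besselK α hz)
  refine HasDerivAt.congr_deriv h ?_
  have hr := besselK_rec α hz
  have hz2 : (0 : ℝ) < z / 2 := by positivity
  simp only [id]
  rw [besselKt, show -(α + 1) = -α - 1 by ring, Real.rpow_sub_one hz2.ne']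
  field_simp
  linear_combination hr

theorem besselKt_rec (α : ℝ) {z : ℝ} (hz : 0 < z) :
    z ^ 2 / 4 * besselKt (α + 1) z = α * besselKt α z + besselKt (α - 1) z := by
  have hr := besselK_rec α hz
  have hz2 : (0 : ℝ) < z / 2 := by positivity
  rw [besselKt, besselKt, besselKt, neg_add, ← sub_eq_add_neg, Real.rpow_sub_one hz2.ne',
    neg_sub', sub_neg_eq_add, Real.rpow_add_one hz2.ne']
  field_simp
  linear_combination 4 * hr

theorem besselKt_nonneg (α : ℝ) {z : ℝ} (hz : 0 ≤ z) : 0 ≤ besselKt α z :=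
  mul_nonneg (Real.rpow_nonneg (by positivity) _) (besselK_nonneg _ _)

/-- As `K_α` is even in `α`, the derivative formula closes up at `α = -1/2` to `f' = -f`. The value
of `C` is irrelevant. -/
theorem exists_besselKt_neg_half : ∃ C, ∀ z, 0 < z →
    besselKt (-(1 / 2)) z = C * Real.exp (-z) := by
  have hd : ∀ z, 0 < z → HasDerivAt (besselKt (-(1 / 2))) (-besselKt (-(1 / 2)) z) z := by
    intro z hz
    refine (hasDerivAt_besselKt _ hz).congr_deriv ?_
    have hz2 : (0 : ℝ) < z / 2 := by positivity
    rw [show (-(1 / 2) + 1 : ℝ) = 1 / 2 by norm_num, besselKt, besselKt, besselK_neg, neg_neg]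
    have : (z / 2) ^ (1 / 2 : ℝ) = z / 2 * (z / 2) ^ (-(1 / 2) : ℝ) := by
      rw [← Real.rpow_one_add' hz2.le (by norm_num)]
      norm_num
    rw [this]; ring
  have hg : ∀ z ∈ Set.Ioi (0 : ℝ), HasDerivAt (fun z => besselKt (-(1 / 2)) z * Real.exp z) 0 z := by
    intro z hz
    refine ((hd z hz).mul (Real.hasDerivAt_exp z)).congr_deriv ?_
    ring
  refine ⟨besselKt (-(1 / 2)) 1 * Real.exp 1, fun z hz => ?_⟩
  have := (convex_Ioi (0 : ℝ)).is_const_of_fderivWithin_eq_zero (𝕜 := ℝ)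
    (f := fun z => besselKt (-(1 / 2)) z * Real.exp z)
    (fun x hx => (hg x hx).differentiableAt.differentiableWithinAt)
    (fun x hx => by
      rw [fderivWithin_of_isOpen isOpen_Ioi hx]
      ext
      simpa using (hg x hx).deriv) hz (Set.mem_Ioi.2 one_pos)
  rw [← this, mul_assoc, ← Real.exp_add]
  simp

/-- The Bessel function `K̃_α` as a function of the square of its argument. -/
def besselSq (α s : ℝ) : ℝ := besselKt α (Real.sqrt s)

/-- In the variable `s = z²` the factor `z` disappears, so a derivative just raises the order;
smoothness of all orders follows by induction. -/
theorem hasDerivAt_besselSq (α : ℝ) {s : ℝ} (hs : 0 < s) :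
    HasDerivAt (besselSq α) (-(1 / 4) * besselSq (α + 1) s) s := by
  have h := HasDerivAt.comp s (hasDerivAt_besselKt α (Real.sqrt_pos.2 hs))
    (Real.hasDerivAt_sqrt hs.ne')
  refine HasDerivAt.congr_deriv h ?_
  have := Real.sqrt_pos.2 hs
  rw [besselSq]
  field_simp
  ring

theorem besselSq_rec (α : ℝ) {s : ℝ} (hs : 0 < s) :
    s / 4 * besselSq (α + 1) s = α * besselSq α s + besselSq (α - 1) s := by
  have := besselKt_rec α (Real.sqrt_pos.2 hs)
  rwa [Real.sq_sqrt hs.le] at this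

theorem smooth_besselSq (α : ℝ) : ContDiffOn ℝ ∞ (besselSq α) (Set.Ioi 0) := by
  have : ∀ (n : ℕ) (α : ℝ), ContDiffOn ℝ n (besselSq α) (Set.Ioi 0) := by
    intro n
    induction n with
    | zero =>
      intro α
      exact contDiffOn_zero.2 fun s hs =>
        (hasDerivAt_besselSq α hs).continuousAt.continuousWithinAt
    | succ n ih =>
      intro α
      rw [Nat.cast_add, Nat.cast_one, contDiffOn_succ_iff_deriv_of_isOpen isOpen_Ioi]
      refine ⟨fun s hs => (hasDerivAt_besselSq α hs).differentiableAt.differentiableWithinAt,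
        fun h => by simp at h, ?_⟩
      refine (contDiffOn_const.mul (ih (α + 1)) :
        ContDiffOn ℝ n (fun s => -(1 / 4) * besselSq (α + 1) s) _).congr fun s hs => ?_
      exact (hasDerivAt_besselSq α hs).deriv
  exact contDiffOn_infty.2 fun n => this n α

end BesselK

end MinRep.JordanAlgebra

namespace MinRep.JordanAlgebra

/-! ### Homogeneous polynomial functions. -/

section Polynomials

variable {V : Type*} [NormedAddCommGroup V] [InnerProductSpace ℝ V] [FiniteDimensional ℝ V]

/-- Homogeneous complex polynomial functions of degree `m` on a euclidean space. -/
inductive IsHomPoly : ℕ → (V → ℂ) → Prop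
  | const (z : ℂ) : IsHomPoly 0 fun _ => z
  | zero (m : ℕ) : IsHomPoly m fun _ => 0
  | add {m F G} (h : IsHomPoly m F) (h' : IsHomPoly m G) : IsHomPoly m fun x => F x + G x
  | inner_mul {m} (u : V) {F} (h : IsHomPoly m F) :
      IsHomPoly (m + 1) fun x => ((⟪x, u⟫_ℝ : ℝ) : ℂ) * F x

theorem IsHomPoly.smooth {m : ℕ} {F : V → ℂ} (h : IsHomPoly m F) (U : Set V) :
    ContDiffOn ℝ ∞ F U := by
  induction h with
  | const | zero => exact contDiffOn_const
  | add _ _ h h' => exact h.add h'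
  | inner_mul u _ h => exact (smooth_inner u U).mul h

theorem IsHomPoly.const_mul {m : ℕ} {F : V → ℂ} (h : IsHomPoly m F) (z : ℂ) :
    IsHomPoly m fun x => z * F x := by
  induction h with
  | const w => exact .const (z * w)
  | zero m => simpa using IsHomPoly.zero m
  | add _ _ h h' => simpa only [mul_add] using h.add h'
  | inner_mul u _ h => simpa only [mul_left_comm] using h.inner_mul u

theorem IsHomPoly.mul {m n : ℕ} {F G : V → ℂ} (h : IsHomPoly m F) (h' : IsHomPoly n G) :
    IsHomPoly (m + n) fun x => F x * G x := by
  induction h with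
  | const w => simpa using h'.const_mul w
  | zero m => simpa using IsHomPoly.zero (m + n)
  | add _ _ h h' => simpa only [add_mul] using h.add h'
  | inner_mul u _ h =>
    rw [Nat.add_right_comm]
    simpa only [mul_assoc] using h.inner_mul u

theorem IsHomPoly.sum {ι : Type*} (s : Finset ι) {m : ℕ} {F : ι → V → ℂ}
    (h : ∀ i ∈ s, IsHomPoly m (F i)) : IsHomPoly m fun x => ∑ i ∈ s, F i x := by
  classical
  induction s using Finset.induction_on with
  | empty => simpa using IsHomPoly.zero m
  | insert i s hi ih =>
    simp only [Finset.sum_insert hi]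
    exact (h i (Finset.mem_insert_self i s)).add
      (ih fun j hj => h j (Finset.mem_insert_of_mem hj))

theorem IsHomPoly.inner (u : V) : IsHomPoly 1 fun x : V => ((⟪x, u⟫_ℝ : ℝ) : ℂ) := by
  simpa using (IsHomPoly.const (V := V) 1).inner_mul u

theorem IsHomPoly.pow {m : ℕ} {F : V → ℂ} (h : IsHomPoly m F) (n : ℕ) :
    IsHomPoly (n * m) fun x => F x ^ n := by
  induction n with
  | zero => simpa using IsHomPoly.const (V := V) 1
  | succ n ih =>
    rw [Nat.succ_mul]
    simpa only [pow_succ] using ih.mul h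

theorem IsHomPoly.prod {ι : Type*} (s : Finset ι) {m : ι → ℕ} {F : ι → V → ℂ}
    (h : ∀ i ∈ s, IsHomPoly (m i) (F i)) :
    IsHomPoly (∑ i ∈ s, m i) fun x => ∏ i ∈ s, F i x := by
  classical
  induction s using Finset.induction_on with
  | empty => simpa using IsHomPoly.const (V := V) 1
  | insert i s hi ih =>
    simp only [Finset.prod_insert hi, Finset.sum_insert hi]
    exact (h i (Finset.mem_insert_self i s)).mul
      (ih fun j hj => h j (Finset.mem_insert_of_mem hj))

theorem IsHomPoly.quadratic (A : V →L[ℝ] V) :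
    IsHomPoly 2 fun x : V => ((⟪x, A x⟫_ℝ : ℝ) : ℂ) := by
  have e : ∀ x : V, ((⟪x, A x⟫_ℝ : ℝ) : ℂ) = ∑ i, ((⟪x, stdOrthonormalBasis ℝ V i⟫_ℝ : ℝ) : ℂ) *
      ((⟪x, LinearMap.adjoint (A : V →ₗ[ℝ] V) (stdOrthonormalBasis ℝ V i)⟫_ℝ : ℝ) : ℂ) := by
    intro x
    rw [← (stdOrthonormalBasis ℝ V).sum_inner_mul_inner x (A x)]
    push_cast
    refine Finset.sum_congr rfl fun i _ => ?_
    rw [LinearMap.adjoint_inner_right, ContinuousLinearMap.coe_coe,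
      real_inner_comm (A x) (stdOrthonormalBasis ℝ V i)]
  simp only [e]
  exact .sum _ fun i _ => (IsHomPoly.inner _).inner_mul _

theorem hasFDerivAt_inner (u x : V) : HasFDerivAt (fun y : V => ((⟪y, u⟫_ℝ : ℝ) : ℂ))
    (Complex.ofRealCLM.comp ((innerSL ℝ).flip u)) x :=
  (Complex.ofRealCLM.comp ((innerSL ℝ).flip u)).hasFDerivAt

theorem fderiv_inner_mul {F : V → ℂ} {x : V} (hF : DifferentiableAt ℝ F x) (u w : V) :
    fderiv ℝ (fun y => ((⟪y, u⟫_ℝ : ℝ) : ℂ) * F y) x w =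
      ((⟪x, u⟫_ℝ : ℝ) : ℂ) * fderiv ℝ F x w + ((⟪w, u⟫_ℝ : ℝ) : ℂ) * F x := by
  have h : fderiv ℝ (fun y => ((⟪y, u⟫_ℝ : ℝ) : ℂ) * F y) x = _ :=
    ((hasFDerivAt_inner u x).mul hF.hasFDerivAt).fderiv
  rw [h]
  simp only [add_apply, smul_apply, smul_eq_mul, ContinuousLinearMap.comp_apply,
    Complex.ofRealCLM_apply, ContinuousLinearMap.flip_apply, innerSL_apply_apply]
  ring

theorem IsHomPoly.differentiable {m : ℕ} {F : V → ℂ} (h : IsHomPoly m F) (x : V) :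
    DifferentiableAt ℝ F x :=
  ((h.smooth Set.univ).contDiffAt Filter.univ_mem).differentiableAt (by simp)

theorem IsHomPoly.deriv {m : ℕ} {F : V → ℂ} (h : IsHomPoly m F) (A : V →L[ℝ] V) :
    IsHomPoly m fun x => fderiv ℝ F x (A x) := by
  induction h with
  | const w => simpa using IsHomPoly.const (V := V) 0
  | zero m => simpa using IsHomPoly.zero (V := V) m
  | @add m F G hF hG h h' =>
    have e : ∀ x, fderiv ℝ (fun x => F x + G x) x (A x) =
        fderiv ℝ F x (A x) + fderiv ℝ G x (A x) := fun x => by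
      have : fderiv ℝ (fun x => F x + G x) x = _ :=
        ((hF.differentiable x).hasFDerivAt.add (hG.differentiable x).hasFDerivAt).fderiv
      rw [this, add_apply]
    simpa only [e] using h.add h'
  | @inner_mul m u F hF h =>
    have e : ∀ x, fderiv ℝ (fun x => ((⟪x, u⟫_ℝ : ℝ) : ℂ) * F x) x (A x) =
        ((⟪x, u⟫_ℝ : ℝ) : ℂ) * fderiv ℝ F x (A x) +
          ((⟪x, LinearMap.adjoint (A : V →ₗ[ℝ] V) u⟫_ℝ : ℝ) : ℂ) * F x := fun x => by
      rw [fderiv_inner_mul (hF.differentiable x), LinearMap.adjoint_inner_right]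
      rfl
    simpa only [e] using (h.inner_mul u).add (hF.inner_mul _)

theorem IsHomPoly.bound {m : ℕ} {F : V → ℂ} (h : IsHomPoly m F) :
    ∃ C, 0 ≤ C ∧ ∀ x, ‖F x‖ ≤ C * ‖x‖ ^ m := by
  induction h with
  | const w => exact ⟨‖w‖, norm_nonneg w, fun x => by simp⟩
  | zero m => exact ⟨0, le_rfl, fun x => by simp⟩
  | add _ _ h h' =>
    obtain ⟨C, hC, h⟩ := h
    obtain ⟨C', hC', h'⟩ := h'
    refine ⟨C + C', by positivity, fun x => (norm_add_le _ _).trans ?_⟩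
    rw [add_mul]
    exact add_le_add (h x) (h' x)
  | inner_mul u _ h =>
    obtain ⟨C, hC, h⟩ := h
    refine ⟨‖u‖ * C, by positivity, fun x => ?_⟩
    rw [norm_mul, Complex.norm_real]
    calc _ ≤ (‖x‖ * ‖u‖) * (C * ‖x‖ ^ _) :=
          mul_le_mul (norm_inner_le_norm x u) (h x) (norm_nonneg _) (by positivity)
      _ = _ := by ring

/-- The coordinates of a vector in the standard orthonormal basis. -/
def coords (x : V) (i : Fin (finrank ℝ V)) : ℂ := (((stdOrthonormalBasis ℝ V).repr x i : ℝ) : ℂ)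

theorem coords_eq (x : V) (i : Fin (finrank ℝ V)) :
    coords x i = ((⟪x, stdOrthonormalBasis ℝ V i⟫_ℝ : ℝ) : ℂ) := by
  rw [coords, OrthonormalBasis.repr_apply_apply, real_inner_comm]

theorem IsHomPoly.exists_poly {m : ℕ} {F : V → ℂ} (h : IsHomPoly m F) :
    ∃ p : MvPolynomial (Fin (finrank ℝ V)) ℂ, p.IsHomogeneous m ∧
      ∀ x, F x = MvPolynomial.eval (coords x) p := by
  induction h with
  | const w => exact ⟨MvPolynomial.C w, MvPolynomial.isHomogeneous_C _ w, fun x => by simp⟩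
  | zero m => exact ⟨0, MvPolynomial.isHomogeneous_zero _ _ m, fun x => by simp⟩
  | add _ _ h h' =>
    obtain ⟨p, hp, e⟩ := h
    obtain ⟨q, hq, e'⟩ := h'
    exact ⟨p + q, hp.add hq, fun x => by simp only [e, e', map_add]⟩
  | @inner_mul m u F _ h =>
    obtain ⟨p, hp, e⟩ := h
    refine ⟨(∑ i, MvPolynomial.C (coords u i) * MvPolynomial.X i) * p, ?_, fun x => ?_⟩
    · rw [_root_.add_comm m]
      refine MvPolynomial.IsHomogeneous.mul (MvPolynomial.IsHomogeneous.sum _ _ _ fun i _ => ?_) hp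
      simpa using (MvPolynomial.isHomogeneous_C _ (coords u i)).mul
        (MvPolynomial.isHomogeneous_X ℂ i)
    · simp only [e, map_mul, map_sum]
      congr 1
      rw [← (stdOrthonormalBasis ℝ V).sum_inner_mul_inner x u]
      push_cast
      refine Finset.sum_congr rfl fun i _ => ?_
      rw [MvPolynomial.eval_C, MvPolynomial.eval_X, coords_eq, coords_eq,
        _root_.mul_comm, real_inner_comm _ u]

theorem isHomPoly_eval {m : ℕ} {p : MvPolynomial (Fin (finrank ℝ V)) ℂ} (hp : p.IsHomogeneous m) :
    IsHomPoly m fun x : V => MvPolynomial.eval (coords x) p := by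
  simp only [MvPolynomial.eval_eq]
  refine .sum _ fun d hd => IsHomPoly.const_mul ?_ _
  have h := IsHomPoly.prod (V := V) d.support (m := d) (F := fun i x => coords x i ^ d i)
    fun i _ => by
      simp only [coords_eq]
      simpa using (IsHomPoly.inner (stdOrthonormalBasis ℝ V i)).pow (d i)
  have hd' := hp (MvPolynomial.mem_support_iff.1 hd)
  change Finsupp.weight (fun _ : Fin (finrank ℝ V) => 1) d = m at hd'
  rw [← Finsupp.degree_eq_weight_one, Finsupp.degree_apply] at hd'
  rwa [← hd']

end Polynomials

/-! ### Stability of the spaces of Bessel functions times polynomials. -/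

section Spaces

variable {V : Type*} [NormedAddCommGroup V] [InnerProductSpace ℝ V] [FiniteDimensional ℝ V]
variable (J : JordanAlgebra V) (ϑ : CartanInvolution J) (c : Fin (splitRank J ϑ) → V)

theorem polyGE_eq (k : ℕ) : polyGE J ϑ c k =
    Submodule.span ℂ {f | ∃ m, k ≤ m ∧ ∃ F : V → ℂ, IsHomPoly m F ∧
      f = fun x : 𝒪 J ϑ c => F x} := by
  refine congrArg _ (Set.ext fun f => ?_)
  constructor
  · rintro ⟨m, hm, p, hp, e⟩
    exact ⟨m, hm, _, isHomPoly_eval hp, funext e⟩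
  · rintro ⟨m, hm, F, hF, rfl⟩
    obtain ⟨p, hp, e⟩ := hF.exists_poly
    exact ⟨m, hm, p, hp, fun x => e x⟩

theorem KtPoly_eq (β : ℝ) (k : ℕ) : KtPoly J ϑ c β k =
    Submodule.span ℂ {ψ | ∃ m, k ≤ m ∧ ∃ F : V → ℂ, IsHomPoly m F ∧
      ψ = fun x : 𝒪 J ϑ c => radial J ϑ c β x * F x} := by
  rw [KtPoly, polyGE_eq, Submodule.map_span]
  refine congrArg _ (Set.ext fun ψ => ?_)
  constructor
  · rintro ⟨_, ⟨m, hm, F, hF, rfl⟩, rfl⟩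
    exact ⟨m, hm, F, hF, rfl⟩
  · rintro ⟨m, hm, F, hF, rfl⟩
    exact ⟨_, ⟨m, hm, F, hF, rfl⟩, rfl⟩

variable {J ϑ c}

theorem mem_KtPoly (β : ℝ) {k m : ℕ} (hm : k ≤ m) {F : V → ℂ} (hF : IsHomPoly m F) :
    (fun x : 𝒪 J ϑ c => radial J ϑ c β x * F x) ∈ KtPoly J ϑ c β k := by
  rw [KtPoly_eq]
  exact Submodule.subset_span ⟨m, hm, F, hF, rfl⟩

/-- The square of the constant relating `|x|` and `(x|x)^{1/2}`. -/
def scale (J : JordanAlgebra V) (ϑ : CartanInvolution J) : ℝ :=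
  (J.rank : ℝ) / (splitRank J ϑ : ℝ)

theorem radial_eq (β : ℝ) (x : 𝒪 J ϑ c) :
    radial J ϑ c β x = ((besselSq β (scale J ϑ * ‖(x : V)‖ ^ 2) : ℝ) : ℂ) := by
  rw [radial, besselSq, Real.sqrt_mul' _ (sq_nonneg _), Real.sqrt_sq (norm_nonneg _)]
  rfl

theorem IsJordanFrame.scale_pos [Nontrivial V] (hc : IsJordanFrame J ϑ c) : 0 < scale J ϑ := by
  have h1 := rank_pos ϑ
  have h2 := hc.splitRank_pos
  rw [scale]
  positivity

theorem IsJordanFrame.ne_zero_of_mem [Nontrivial V] (hc : IsJordanFrame J ϑ c) {x : V}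
    (hx : x ∈ 𝒪 J ϑ c) : x ≠ 0 := by
  obtain ⟨g, -, rfl⟩ := hx
  rw [hc.c₁_eq]
  intro h
  refine hc.ne_zero ⟨0, hc.splitRank_pos⟩ ?_
  rw [← inv_apply g (c _), h, map_zero]

/-- A smooth function of the square of the norm. -/
def radialExt (f : ℝ → ℝ) (a : ℝ) (x : V) : ℂ := ((f (a * ‖x‖ ^ 2) : ℝ) : ℂ)

theorem smooth_radialExt {f : ℝ → ℝ} {a : ℝ} (ha : 0 < a)
    (hf : ContDiffOn ℝ ∞ f (Set.Ioi 0)) :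
    ContDiffOn ℝ ∞ (radialExt f a : V → ℂ) {0}ᶜ := by
  refine Complex.ofRealCLM.contDiff.comp_contDiffOn (hf.comp
    ((contDiff_const.mul (contDiff_norm_sq ℝ)).contDiffOn) fun x hx => ?_)
  have := norm_pos_iff.2 (show x ≠ 0 from hx)
  simp only [Set.mem_Ioi]
  positivity

theorem hasFDerivAt_radialExt {f : ℝ → ℝ} {f' a : ℝ} {x : V}
    (hf : HasDerivAt f f' (a * ‖x‖ ^ 2)) : HasFDerivAt (radialExt f a : V → ℂ)
      (((2 * a * f' : ℝ) : ℂ) • Complex.ofRealCLM.comp (innerSL ℝ x)) x := by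
  have h1 : HasFDerivAt (fun y : V => a * ‖y‖ ^ 2) (a • (2 • innerSL ℝ x)) x :=
    (hasStrictFDerivAt_norm_sq x).hasFDerivAt.const_mul a
  have h2 := Complex.ofRealCLM.hasFDerivAt.comp x (hf.comp_hasFDerivAt x h1)
  refine h2.congr_fderiv ?_
  ext w
  simp only [ContinuousLinearMap.comp_apply, smul_apply, Complex.ofRealCLM_apply, smul_eq_mul,
    innerSL_apply_apply, nsmul_eq_mul]
  push_cast
  ring

theorem IsJordanFrame.scale_mul_pos [Nontrivial V] (hc : IsJordanFrame J ϑ c) {x : V}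
    (hx : x ≠ 0) : 0 < scale J ϑ * ‖x‖ ^ 2 :=
  mul_pos hc.scale_pos (pow_pos (norm_pos_iff.2 hx) 2)

/-- The sums of spaces `K̃_β ⊗ ℂ[𝒪]_{≥ m}` are stable under multiplication by linear forms. -/
theorem inner_mul_mem_iSup {ι : Type*} {β : ι → ℝ} {m : ι → ℕ} {ψ : 𝒪 J ϑ c → ℂ}
    (h : ψ ∈ ⨆ i, KtPoly J ϑ c (β i) (m i)) (u : V) :
    (fun x : 𝒪 J ϑ c => ((⟪(x : V), u⟫_ℝ : ℝ) : ℂ) * ψ x) ∈ ⨆ i, KtPoly J ϑ c (β i) (m i) := by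
  set M := ⨆ i, KtPoly J ϑ c (β i) (m i) with hM
  let T : (𝒪 J ϑ c → ℂ) →ₗ[ℂ] (𝒪 J ϑ c → ℂ) :=
    LinearMap.mulLeft ℂ fun x : 𝒪 J ϑ c => ((⟪(x : V), u⟫_ℝ : ℝ) : ℂ)
  have h' : M ≤ M.comap T := by
    conv_lhs => rw [hM]
    refine iSup_le fun i => ?_
    rw [KtPoly_eq]
    refine Submodule.span_le.2 ?_
    rintro _ ⟨n, hn, F, hF, rfl⟩
    have h1 := mem_KtPoly (J := J) (ϑ := ϑ) (c := c) (β i) (hn.trans (Nat.le_succ n))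
      (hF.inner_mul u)
    have h2 : T (fun x : 𝒪 J ϑ c => radial J ϑ c (β i) x * F x) =
        fun x : 𝒪 J ϑ c => radial J ϑ c (β i) x * (((⟪(x : V), u⟫_ℝ : ℝ) : ℂ) * F x) := by
      ext x
      simp only [T, LinearMap.mulLeft_apply, Pi.mul_apply]
      ring
    refine Submodule.mem_comap.2 ?_
    rw [h2]
    exact le_iSup (fun i => KtPoly J ϑ c (β i) (m i)) i h1
  exact Submodule.mem_comap.1 (h' h)

/-- The sums of spaces `K̃_β ⊗ ℂ[𝒪]_{≥ m}` are stable under the Lie algebra of the structure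
group. -/
theorem IsJordanFrame.deriv_mem_iSup [Nontrivial V] (hc : IsJordanFrame J ϑ c) {ι : Type*}
    {β : ι → ℝ} {m : ι → ℕ} (hι : ∀ i, ∃ j, β j = β i + 1 ∧ m j ≤ m i + 2) {ψ : 𝒪 J ϑ c → ℂ}
    (h : ψ ∈ ⨆ i, KtPoly J ϑ c (β i) (m i)) :
    ∃ Ψ, IsSmoothExtension J ϑ c ψ Ψ ∧ ∀ A : V →L[ℝ] V, J.IsStrLie (A : V →ₗ[ℝ] V) →
      (fun x : 𝒪 J ϑ c => fderiv ℝ Ψ x (A x)) ∈ ⨆ i, KtPoly J ϑ c (β i) (m i) := by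
  set M := ⨆ i, KtPoly J ϑ c (β i) (m i) with hM
  -- Functions with an extension, smooth off the origin, whose derivatives along all linear fields
  -- restrict to elements of `M`.
  let N : Submodule ℂ (𝒪 J ϑ c → ℂ) :=
    { carrier := {ψ | ∃ Ψ : V → ℂ, ContDiffOn ℝ ∞ Ψ {0}ᶜ ∧ (∀ x : 𝒪 J ϑ c, Ψ x = ψ x) ∧
        ∀ A : V →L[ℝ] V, (fun x : 𝒪 J ϑ c => fderiv ℝ Ψ x (A x)) ∈ M}
      zero_mem' := ⟨fun _ => 0, contDiffOn_const, fun _ => rfl, fun A => by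
        convert M.zero_mem using 1
        ext x
        simp⟩
      add_mem' := by
        rintro ψ φ ⟨Ψ, h1, h2, h3⟩ ⟨Φ, h1', h2', h3'⟩
        refine ⟨fun x => Ψ x + Φ x, h1.add h1', fun x => by simp only [h2, h2', Pi.add_apply],
          fun A => ?_⟩
        convert M.add_mem (h3 A) (h3' A) using 1
        ext x
        have hx := hc.ne_zero_of_mem x.2
        have : fderiv ℝ (fun x => Ψ x + Φ x) (x : V) = _ :=
          ((smooth_hasFDerivAt isOpen_compl_singleton h1 hx).add
            (smooth_hasFDerivAt isOpen_compl_singleton h1' hx)).fderiv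
        rw [this, add_apply, Pi.add_apply]
      smul_mem' := by
        rintro z ψ ⟨Ψ, h1, h2, h3⟩
        refine ⟨fun x => z * Ψ x, contDiffOn_const.mul h1, fun x => by
          simp only [h2, Pi.smul_apply, smul_eq_mul], fun A => ?_⟩
        convert M.smul_mem z (h3 A) using 1
        ext x
        have hx := hc.ne_zero_of_mem x.2
        have : fderiv ℝ (fun x => z * Ψ x) (x : V) = _ :=
          ((smooth_hasFDerivAt isOpen_compl_singleton h1 hx).const_mul z).fderiv
        rw [this, smul_apply, Pi.smul_apply] }
  suffices hN : M ≤ N by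
    obtain ⟨Ψ, h1, h2, h3⟩ := hN h
    exact ⟨Ψ, ⟨{0}ᶜ, isOpen_compl_singleton, fun x hx => hc.ne_zero_of_mem hx, h1, h2⟩,
      fun A _ => h3 A⟩
  refine iSup_le fun i => ?_
  rw [KtPoly_eq]
  refine Submodule.span_le.2 ?_
  rintro _ ⟨n, hn, F, hF, rfl⟩
  obtain ⟨j, hj1, hj2⟩ := hι i
  refine ⟨fun x => radialExt (besselSq (β i)) (scale J ϑ) x * F x,
    (smooth_radialExt hc.scale_pos (smooth_besselSq _)).mul (hF.smooth _),
    fun x => by simp only [radial_eq]; rfl, fun A => ?_⟩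
  -- Differentiating the Bessel factor raises its order by one and brings in the quadratic form `⟪x,
  -- Ax⟫`; the index `j` provides room for both.
  have e1 := mem_KtPoly (J := J) (ϑ := ϑ) (c := c) (β j) (k := m j) (by omega)
    (((IsHomPoly.quadratic A).mul hF).const_mul ((-(scale J ϑ) / 2 : ℝ) : ℂ))
  have e2 := mem_KtPoly (J := J) (ϑ := ϑ) (c := c) (β i) hn (hF.deriv A)
  convert M.add_mem (le_iSup (fun i => KtPoly J ϑ c (β i) (m i)) j e1)
    (le_iSup (fun i => KtPoly J ϑ c (β i) (m i)) i e2) using 1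
  ext x
  have hx := hc.ne_zero_of_mem x.2
  have : fderiv ℝ (fun x => radialExt (besselSq (β i)) (scale J ϑ) x * F x) (x : V) = _ :=
    ((hasFDerivAt_radialExt (hasDerivAt_besselSq (β i) (hc.scale_mul_pos hx))).mul
      (hF.differentiable x).hasFDerivAt).fderiv
  rw [this, Pi.add_apply, radial_eq, radial_eq, hj1]
  simp only [add_apply, smul_apply, ContinuousLinearMap.comp_apply, innerSL_apply_apply,
    Complex.ofRealCLM_apply, smul_eq_mul, radialExt]
  push_cast
  ring

end Spaces

end MinRep.JordanAlgebra

/-! ### The Bessel operator on radial functions when `d = 2 d₀`. -/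

namespace MinRep.JordanAlgebra

variable {V : Type*} [NormedAddCommGroup V] [InnerProductSpace ℝ V] [FiniteDimensional ℝ V]
variable {J : JordanAlgebra V} {ϑ : CartanInvolution J}

theorem fderiv_radialExt_besselSq {a : ℝ} (ha : 0 < a) (α : ℝ) {x : V} (hx : x ≠ 0) (b : V) :
    fderiv ℝ (radialExt (besselSq α) a) x b =
      ((-(a / 2) : ℝ) : ℂ) * (((⟪x, b⟫_ℝ : ℝ) : ℂ) * radialExt (besselSq (α + 1)) a x) := by
  have hs : 0 < a * ‖x‖ ^ 2 := mul_pos ha (pow_pos (norm_pos_iff.2 hx) 2)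
  rw [(hasFDerivAt_radialExt (hasDerivAt_besselSq α hs)).fderiv]
  simp only [smul_apply, ContinuousLinearMap.comp_apply, innerSL_apply_apply,
    Complex.ofRealCLM_apply, smul_eq_mul, radialExt]
  push_cast
  ring

theorem hess_radialExt_besselSq {a : ℝ} (ha : 0 < a) (α : ℝ) {x : V} (hx : x ≠ 0) (w b : V) :
    hess (radialExt (besselSq α) a) x w b =
      ((a ^ 2 / 4 * besselSq (α + 2) (a * ‖x‖ ^ 2) * (⟪x, w⟫_ℝ * ⟪x, b⟫_ℝ) -
        a / 2 * besselSq (α + 1) (a * ‖x‖ ^ 2) * ⟪w, b⟫_ℝ : ℝ) : ℂ) := by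
  have h1 : ∀ y ∈ ({0}ᶜ : Set V), HasFDerivAt (radialExt (besselSq α) a)
      (fderiv ℝ (radialExt (besselSq α) a) y) y := fun y hy =>
    smooth_hasFDerivAt isOpen_compl_singleton (smooth_radialExt ha (smooth_besselSq α)) hy
  have h2 : HasFDerivAt (radialExt (besselSq (α + 1)) a)
      (fderiv ℝ (radialExt (besselSq (α + 1)) a) x) x :=
    smooth_hasFDerivAt isOpen_compl_singleton (smooth_radialExt ha (smooth_besselSq (α + 1))) hx
  have h3 := ((hasFDerivAt_inner b x).mul h2).const_mul ((-(a / 2) : ℝ) : ℂ)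
  have h4 := h3.congr_of_eventuallyEq (f₁ := fun y => fderiv ℝ (radialExt (besselSq α) a) y b) (by
    filter_upwards [isOpen_compl_singleton.mem_nhds (show x ∈ ({0}ᶜ : Set V) from hx)] with y hy
    exact fderiv_radialExt_besselSq ha α hy b)
  rw [hess_eq_of_hasFDerivAt isOpen_compl_singleton h1 hx h4]
  simp only [smul_apply, add_apply, smul_eq_mul, fderiv_radialExt_besselSq ha _ hx,
    ContinuousLinearMap.comp_apply, Complex.ofRealCLM_apply, ContinuousLinearMap.flip_apply,
    innerSL_apply_apply, radialExt]
  rw [show α + 1 + 1 = α + 2 by ring]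
  push_cast
  ring

/-- The Bessel operator on radial functions. -/
theorem besselOp_radialExt {a : ℝ} (ha : 0 < a) (α lam : ℝ) (v : V) {x : V} (hx : x ≠ 0) :
    besselOp J ϑ lam v (radialExt (besselSq α) a) x =
      ((a ^ 2 / 4 * besselSq (α + 2) (a * ‖x‖ ^ 2) * ⟪J.P (ϑ.toFun x) x, v⟫_ℝ -
        a / 2 * besselSq (α + 1) (a * ‖x‖ ^ 2) *
          (LinearMap.trace ℝ V (symb ϑ x v) + lam * ⟪ϑ.toFun x, v⟫_ℝ) : ℝ) : ℂ) := by
  rw [besselOp_eq, fderiv_radialExt_besselSq ha α hx,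
    Finset.sum_congr rfl fun j _ => hess_radialExt_besselSq ha α hx _ _,
    LinearMap.trace_eq_sum_inner _ (stdOrthonormalBasis ℝ V), ← P₂_self, inner_P₂, ϑ.inner_left]
  have e : ⟪symb ϑ x v x, x⟫_ℝ = ∑ j, ⟪x, symb ϑ x v (stdOrthonormalBasis ℝ V j)⟫_ℝ *
      ⟪x, stdOrthonormalBasis ℝ V j⟫_ℝ := by
    rw [← (stdOrthonormalBasis ℝ V).sum_inner_mul_inner (symb ϑ x v x) x]
    refine Finset.sum_congr rfl fun j _ => ?_
    rw [symb_symm, real_inner_comm x]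
  rw [e, Finset.mul_sum, mul_add, Finset.mul_sum, ← Complex.ofReal_sum, radialExt]
  simp only [real_inner_comm (stdOrthonormalBasis ℝ V _)]
  rw [Finset.sum_sub_distrib]
  push_cast
  ring

namespace IsJordanFrame

variable {c : Fin (splitRank J ϑ) → V} (hc : IsJordanFrame J ϑ c)
include hc

theorem norm_sq_eq (hs : (plus J ϑ).IsSimple) [Nontrivial V] (i) : ‖c i‖ ^ 2 = scale J ϑ := by
  rw [hc.norm_sq, hc.tr_eq hs, scale]

/-- Both sides are equivariant under the admissible rotations and cubic in scaling, so it reduces to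
`P(c_i) c_i = c_i`. -/
theorem P_theta_self [Nontrivial V] (hs : (plus J ϑ).IsSimple) (i) {x : V}
    (hx : x ∈ orbit J (c i)) : J.P x (ϑ.toFun x) = (‖x‖ ^ 2 / scale J ϑ) • x := by
  obtain ⟨k, hk, t, ht, rfl⟩ := hc.exists_polar hs i hx
  rw [hk.2, ϑ.invol, inv_apply, hk.norm, map_smul ϑ.toFun, hc.theta, J.P_smul, smul_smul,
    hc.P_frame, map_smul (J.pOne _), pOne_of_one (hc.idem i), norm_smul, mul_pow, hc.norm_sq_eq hs, Real.norm_eq_abs,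
    sq_abs, mul_div_assoc, div_self hc.scale_pos.ne']
  simp only [map_smul, smul_smul]
  congr 1
  ring

/-- The trace is a `ϑ`-invariant linear form of `z`, and `V₁ ∩ V⁺ = ℝc_i`; so only `z = c_i`
matters, where it is the trace of `ϑ` on `V₁`, namely `1 - (dim V₁ - 1)`. -/
theorem trace_diag [Nontrivial V] (i) {z : V} (hz : J.mul (c i) z = z) :
    LinearMap.trace ℝ V (J.mul z ∘ₗ ϑ.toFun ∘ₗ J.pOne (c i)) =
      (2 - (finrank ℝ (peirce J ϑ c i i) : ℝ)) * (⟪z, c i⟫_ℝ / ‖c i‖ ^ 2) := by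
  let f : V →ₗ[ℝ] ℝ :=
    { toFun := fun z => LinearMap.trace ℝ V (J.mul z ∘ₗ ϑ.toFun ∘ₗ J.pOne (c i))
      map_add' := fun x y => by rw [map_add, LinearMap.add_comp, map_add]
      map_smul' := fun t x => by rw [map_smul, LinearMap.smul_comp, map_smul]; rfl }
  have hfθ : ∀ x, f (ϑ.toFun x) = f x := by
    intro x
    change LinearMap.trace ℝ V _ = LinearMap.trace ℝ V _
    have e : J.mul (ϑ.toFun x) ∘ₗ ϑ.toFun ∘ₗ J.pOne (c i) =
        (ϑ.toFun * (J.mul x ∘ₗ ϑ.toFun ∘ₗ J.pOne (c i))) * ϑ.toFun := by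
      ext y
      simp only [Module.End.mul_apply, LinearMap.comp_apply, ϑ.map_mul, hc.theta_pOne, ϑ.invol]
    rw [e, LinearMap.trace_mul_comm, ← mul_assoc]
    congr 1
    ext y
    simp only [Module.End.mul_apply, ϑ.invol]
  have hθz : J.mul (c i) (ϑ.toFun z) = ϑ.toFun z := by
    rw [← hc.theta i, ← ϑ.map_mul, hz]
  obtain ⟨s, hs⟩ := hc.line (i := i) (x := (1 / 2 : ℝ) • (z + ϑ.toFun z))
    (by rw [map_smul, map_add, hz, hθz]) (by rw [map_smul, theta_add])
  have h1 : f z = s * f (c i) := by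
    have := congrArg f hs
    rw [map_smul, map_add, hfθ, map_smul, smul_eq_mul, smul_eq_mul] at this
    linarith
  have hn : ‖c i‖ ^ 2 ≠ 0 := pow_ne_zero 2 (norm_ne_zero_iff.2 (hc.ne_zero i))
  have h2 : ⟪z, c i⟫_ℝ = s * ‖c i‖ ^ 2 := by
    have := congrArg (fun y => ⟪y, c i⟫_ℝ) hs
    simp only [real_inner_smul_left, inner_add_left, ϑ.inner_left, hc.theta,
      real_inner_self_eq_norm_sq] at this
    linarith
  have h3 : f (c i) = 2 - (finrank ℝ (peirce J ϑ c i i) : ℝ) := by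
    have h := hc.trace_theta_proj (hc.isProj_pOne i) (hc.peirce_theta i i)
    rw [hc.finrank_diag_plus] at h
    have e : J.mul (c i) ∘ₗ ϑ.toFun ∘ₗ J.pOne (c i) = ϑ.toFun ∘ₗ J.pOne (c i) := by
      ext y
      simp only [LinearMap.comp_apply, hc.theta_pOne, mul_pOne (hc.idem i)]
    change LinearMap.trace ℝ V _ = _
    rw [e, h]
    norm_num
  change f z = _
  rw [h1, h2, h3, mul_div_cancel_right₀ _ hn, _root_.mul_comm]

theorem pOne_symb (i) (v : V) {b : V} (hb : J.mul (c i) b = b) :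
    J.pOne (c i) (symb ϑ (c i) v b) = J.mul (J.pOne (c i) (ϑ.toFun v)) (ϑ.toFun b) := by
  have hb' : J.mul (c i) (ϑ.toFun b) = ϑ.toFun b := by
    rw [← hc.theta i, ← ϑ.map_mul, hb]
  set y := ϑ.toFun b
  set z := ϑ.toFun v
  have hi := hc.idem i
  have e : symb ϑ (c i) v b = J.P₂ (c i) (J.pOne (c i) z) y + J.P₂ (c i) (J.pHalf (c i) z) y +
      J.P₂ (c i) (J.pZero (c i) z) y := by
    rw [← P₂_add_right, ← P₂_add_right, p_sum]; rfl
  have h1 := one_mul_one hi (mul_pOne hi z) hb'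
  have h0 : J.mul (J.pZero (c i) z) y = 0 := by
    rw [J.mul_comm]; exact one_mul_zero hi hb' (mul_pZero hi z)
  have hh : J.mul (c i) (J.mul (J.pHalf (c i) z) y) =
      (1 / 2 : ℝ) • J.mul (J.pHalf (c i) z) y := by
    rw [J.mul_comm (J.pHalf (c i) z)]; exact one_mul_half hi hb' (mul_pHalf hi z)
  have e1 : J.P₂ (c i) (J.pOne (c i) z) y = J.mul (J.pOne (c i) z) y := by
    simp only [P₂, L, LinearMap.add_apply, LinearMap.sub_apply, LinearMap.comp_apply, hb',
      mul_pOne hi z, h1, add_sub_cancel_right]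
  have e0 : J.P₂ (c i) (J.pZero (c i) z) y = 0 := by
    simp [P₂, L, hb', mul_pZero hi z, h0]
  have e2 : J.pOne (c i) (J.P₂ (c i) (J.pHalf (c i) z) y) = 0 := by
    refine pOne_of_half ?_
    simp only [P₂, L, LinearMap.add_apply, LinearMap.sub_apply, LinearMap.comp_apply, hb',
      mul_pHalf hi z, map_smul, LinearMap.smul_apply, map_add, map_sub, hh]
    module
  rw [e, map_add, map_add, e1, e2, e0, map_zero, add_zero, add_zero,
    pOne_of_one (one_mul_one hi (mul_pOne hi z) hb')]

/-- The symbol vanishes on `V₀`. Its diagonal `V_{1/2}` block contributes the trace of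
`halfTrace_theta`, zero when `d = 2d₀`; the `V₁` block is `trace_diag`. -/
theorem trace_symb_base [Nontrivial V] (hs : (plus J ϑ).IsSimple)
    (hd : dConst J ϑ c = 2 * d₀Const J ϑ c) (i) (v : V) :
    LinearMap.trace ℝ V (symb ϑ (c i) v) =
      (2 - (finrank ℝ (peirce J ϑ c i i) : ℝ)) / scale J ϑ * ⟪c i, v⟫_ℝ := by
  have hi := hc.idem i
  set R := symb ϑ (c i) v with hR
  have e : R = R * J.pOne (c i) + R * J.pHalf (c i) := by
    ext x
    have h := congrArg R (J.p_sum (c i) x)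
    rw [map_add, hR, hc.symb_of_zero i v (mul_pZero hi x), add_zero, map_add] at h
    exact h.symm
  have hp : ∀ {p : V →ₗ[ℝ] V}, (∀ x, p (p x) = p x) →
      LinearMap.trace ℝ V (R * p) = LinearMap.trace ℝ V (p * (R * p)) := by
    intro p hp
    rw [LinearMap.trace_mul_comm ℝ p, mul_assoc]
    congr 2
    ext x
    exact (hp x).symm
  have t1 : J.pOne (c i) * (R * J.pOne (c i)) =
      J.mul (J.pOne (c i) (ϑ.toFun v)) ∘ₗ ϑ.toFun ∘ₗ J.pOne (c i) := by
    ext x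
    exact hc.pOne_symb i v (mul_pOne hi x)
  have t2 : J.pHalf (c i) * (R * J.pHalf (c i)) =
      ϑ.toFun ∘ₗ J.mul (ϑ.toFun (J.pZero (c i) (ϑ.toFun v))) ∘ₗ J.pHalf (c i) := by
    ext x
    simp only [Module.End.mul_apply, LinearMap.comp_apply, ϑ.map_mul, ϑ.invol]
    rw [hR, hc.pHalf_symb i v (mul_pHalf hi x), J.mul_comm]
  have h2 := hc.halfTrace_theta hs hd i (w := ϑ.toFun (J.pZero (c i) (ϑ.toFun v)))
    (by rw [← hc.theta i, ← ϑ.map_mul, hc.theta, mul_pZero hi, map_zero])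
  change LinearMap.trace ℝ V (ϑ.toFun ∘ₗ _ ∘ₗ _) = 0 at h2
  rw [e, map_add, hp fun x => pOne_of_one (mul_pOne hi x),
    hp fun x => pHalf_of_half (mul_pHalf hi x), t1, t2, h2, add_zero,
    hc.trace_diag i (mul_pOne hi _), hc.inner_pOne, pOne_of_one hi, ϑ.inner_left, hc.theta,
    hc.norm_sq_eq hs, real_inner_comm]
  ring

theorem trace_symb [Nontrivial V] (hs : (plus J ϑ).IsSimple)
    (hd : dConst J ϑ c = 2 * d₀Const J ϑ c) (i) (v : V) {x : V} (hx : x ∈ orbit J (c i)) :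
    LinearMap.trace ℝ V (symb ϑ x v) =
      (2 - (finrank ℝ (peirce J ϑ c i i) : ℝ)) / scale J ϑ * ⟪ϑ.toFun x, v⟫_ℝ := by
  obtain ⟨k, hk, t, ht, rfl⟩ := hc.exists_polar hs i hx
  set v' := ϑ.toFun (((k⁻¹ : (V →L[ℝ] V)ˣ) : V →L[ℝ] V) (ϑ.toFun v)) with hv'
  have e : symb ϑ ((k : V →L[ℝ] V) (t • c i)) v =
      ((k : V →L[ℝ] V) : V →ₗ[ℝ] V) * (t • symb ϑ (c i) v' *
        (((k⁻¹ : (V →L[ℝ] V)ˣ) : V →L[ℝ] V) : V →ₗ[ℝ] V)) := by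
    ext b
    simp only [Module.End.mul_apply, ContinuousLinearMap.coe_coe, LinearMap.smul_apply]
    rw [map_smul, map_smul, hk.map_symb, hv', ϑ.invol, apply_inv, ϑ.invol, apply_inv, ← symb_smul_left]
  have e2 : (((k⁻¹ : (V →L[ℝ] V)ˣ) : V →L[ℝ] V) : V →ₗ[ℝ] V) *
      ((k : V →L[ℝ] V) : V →ₗ[ℝ] V) = 1 := by
    ext b
    exact inv_apply k b
  rw [e, LinearMap.trace_mul_comm, mul_assoc, e2, mul_one, map_smul, smul_eq_mul,
    hc.trace_symb_base hs hd, ϑ.inner_left, hk.inner', hv', real_inner_smul_left,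
    ← ϑ.inner_left, hc.theta]
  ring

/-- The Bessel operator acts on `K̃_α(|x|)` as multiplication by `ϑ x`. -/
theorem besselOp_besselSq [Nontrivial V] (hs : (plus J ϑ).IsSimple)
    (hd : dConst J ϑ c = 2 * d₀Const J ϑ c) (i) {α lam : ℝ}
    (hα : 2 * α + 2 = lam * scale J ϑ + 2 - (finrank ℝ (peirce J ϑ c i i) : ℝ)) (v : V) {x : V}
    (hx : x ∈ orbit J (c i)) (hx0 : x ≠ 0) :
    besselOp J ϑ lam v (radialExt (besselSq α) (scale J ϑ)) x =
      ((⟪x, ϑ.toFun v⟫_ℝ : ℝ) : ℂ) * radialExt (besselSq α) (scale J ϑ) x := by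
  have ha := hc.scale_pos
  have e1 : J.P (ϑ.toFun x) x = (‖x‖ ^ 2 / scale J ϑ) • ϑ.toFun x := by
    have := congrArg ϑ.toFun (hc.P_theta_self hs i hx)
    rwa [ϑ.map_P, ϑ.invol, map_smul] at this
  -- The recurrence at `α + 1` removes order `α + 2`; the condition on `α` cancels order `α + 1` as
  -- well.
  have hr := besselSq_rec (α + 1) (hc.scale_mul_pos hx0)
  rw [show α + 1 + 1 = α + 2 by ring, add_sub_cancel_right] at hr
  rw [besselOp_radialExt ha _ _ _ hx0, e1, hc.trace_symb hs hd i v hx, radialExt, ← ϑ.inner_left,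
    ← Complex.ofReal_mul, real_inner_smul_left]
  congr 1
  set I := ⟪ϑ.toFun x, v⟫_ℝ
  set N : ℝ := (finrank ℝ (peirce J ϑ c i i) : ℝ)
  set k2 := besselSq (α + 2) (scale J ϑ * ‖x‖ ^ 2)
  set k1 := besselSq (α + 1) (scale J ϑ * ‖x‖ ^ 2)
  have e3 : scale J ϑ ^ 2 / 4 * k2 * (‖x‖ ^ 2 / scale J ϑ * I) =
      I * (scale J ϑ * ‖x‖ ^ 2 / 4 * k2) := by field_simp
  have e4 : scale J ϑ / 2 * k1 * ((2 - N) / scale J ϑ * I + lam * I) =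
      I * k1 * ((2 - N + lam * scale J ϑ) / 2) := by field_simp
  rw [e3, e4, hr, show 2 - N + lam * scale J ϑ = 2 * α + 2 by linarith]
  ring

end IsJordanFrame

end MinRep.JordanAlgebra

/-! ### Containment of `W` for radial generators. -/

namespace MinRep.JordanAlgebra

variable {V : Type*} [NormedAddCommGroup V] [InnerProductSpace ℝ V] [FiniteDimensional ℝ V]
variable {J : JordanAlgebra V} {ϑ : CartanInvolution J}

namespace IsJordanFrame

variable {c : Fin (splitRank J ϑ) → V} (hc : IsJordanFrame J ϑ c)
include hc

theorem mem_orbit [Nontrivial V] (x : 𝒪 J ϑ c) :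
    (x : V) ∈ orbit J (c ⟨0, hc.splitRank_pos⟩) := by
  have h : (x : V) ∈ orbit J (c₁ J ϑ c) := x.2
  rwa [hc.c₁_eq] at h

theorem eConst_eq [Nontrivial V] : eConst J ϑ c =
    (finrank ℝ (peirce J ϑ c ⟨0, hc.splitRank_pos⟩ ⟨0, hc.splitRank_pos⟩) : ℤ) - 1 := by
  rw [eConst, dif_pos hc.splitRank_pos]

theorem lam₁_mul_scale [Nontrivial V] : lam₁ J ϑ c * scale J ϑ = (dConst J ϑ c : ℝ) / 2 := by
  have h1 : (J.rank : ℝ) ≠ 0 := by exact_mod_cast (rank_pos ϑ).ne'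
  have h2 : (splitRank J ϑ : ℝ) ≠ 0 := by exact_mod_cast hc.splitRank_pos.ne'
  rw [lam₁, scale]
  field_simp

/-- If the Bessel operators act on the radial vector `ψ₀` by linear forms, the representation
space consists of Bessel functions times polynomials. -/
theorem W_le_of_radial [Nontrivial V] (hs : (plus J ϑ).IsSimple)
    (hd : dConst J ϑ c = 2 * d₀Const J ϑ c) {α lam : ℝ}
    (hlam : 1 < splitRank J ϑ → lam = lam₁ J ϑ c)
    (hα : 2 * α + 1 = lam * scale J ϑ - eConst J ϑ c)
    (hψ : ψ₀ J ϑ c lam = radial J ϑ c α) :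
    W J ϑ c lam ≤ ⨆ l : ℕ, KtPoly J ϑ c (α + l) (2 * l) := by
  have hx0 : ∀ x ∈ 𝒪 J ϑ c, x ≠ 0 := fun x hx => hc.ne_zero_of_mem hx
  have hb : Gen J {radialExt (besselSq α) (scale J ϑ)} (radialExt (besselSq α) (scale J ϑ)) :=
    Gen.base rfl
  refine hc.W_le hs hlam (U := {0}ᶜ) (W₀ := {radialExt (besselSq α) (scale J ϑ)})
    isOpen_compl_singleton hx0 ?_ ?_ ?_ ?_ (fun ψ hψ u => inner_mul_mem_iSup hψ u)
    (fun ψ hψ => hc.deriv_mem_iSup (fun l => ⟨l + 1, by push_cast; ring, by omega⟩) hψ)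
  · rintro _ rfl
    exact smooth_radialExt hc.scale_pos (smooth_besselSq α)
  · rintro _ rfl v
    refine ⟨_, hb.inner_mul (ϑ.toFun v), fun x hx => ?_⟩
    rw [hc.eConst_eq] at hα
    push_cast at hα
    exact hc.besselOp_besselSq hs hd _ (by linarith) v (hc.mem_orbit ⟨x, hx⟩) (hx0 x hx)
  · exact ⟨_, hb, fun x => by rw [hψ, radial_eq]; rfl⟩
  · rintro _ rfl
    have h := mem_KtPoly (J := J) (ϑ := ϑ) (c := c) α (k := 0) le_rfl (IsHomPoly.const 1)
    have h' := le_iSup (fun l : ℕ => KtPoly J ϑ c (α + l) (2 * l)) 0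
    simp only [Nat.cast_zero, add_zero, mul_zero] at h'
    convert h' h using 1
    ext x
    rw [radial_eq, mul_one]
    rfl

section Euclidean

variable (hθ : ∀ x, ϑ.toFun x = x)
include hθ

theorem finrank_diag_of_euclidean (i) : finrank ℝ (peirce J ϑ c i i) = 1 := by
  have : peirce J ϑ c i i ⊓ plusSpace J ϑ = peirce J ϑ c i i :=
    inf_eq_left.2 fun x _ => hθ x
  rw [← this, hc.finrank_diag_plus]

theorem ν_of_euclidean [Nontrivial V] : ν J ϑ c = -1 := by
  have h1 : dConst J ϑ c = d₀Const J ϑ c := by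
    unfold dConst d₀Const
    split_ifs with h
    · rw [inf_eq_left.2 fun x _ => hθ x]
    · rfl
  rw [ν, h1, hc.eConst_eq, hc.finrank_diag_of_euclidean hθ]
  have : min (d₀Const J ϑ c : ℤ) (2 * (d₀Const J ϑ c : ℤ)) = d₀Const J ϑ c :=
    min_eq_left (by omega)
  rw [this]
  push_cast
  ring

/-- Write `x² = P(x) e`. After rotation `P(c_i)` projects `k⁻¹e` onto `V₁ = ℝc_i`, so the square is
a multiple of `x`. -/
theorem mul_self_of_euclidean [Nontrivial V] (hs : (plus J ϑ).IsSimple) (i) {x : V}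
    (hx : x ∈ orbit J (c i)) : J.mul x x = (J.tr x / scale J ϑ) • x := by
  have hP : J.mul x x = J.P x J.one := by
    simp only [P, L, LinearMap.sub_apply, LinearMap.smul_apply, LinearMap.comp_apply, mul_one']
    module
  obtain ⟨k, hk, t, ht, rfl⟩ := hc.exists_polar hs i hx
  set u := ((k⁻¹ : (V →L[ℝ] V)ˣ) : V →L[ℝ] V) J.one with hu
  obtain ⟨s, hsu⟩ := hc.line (mul_pOne (hc.idem i) u) (hθ _)
  have e1 : s * scale J ϑ = ⟪c i, u⟫_ℝ := by
    rw [← hc.norm_sq_eq hs i, ← real_inner_self_eq_norm_sq, ← real_inner_smul_left, ← hsu,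
      hc.inner_pOne, pOne_of_one (hc.idem i), real_inner_comm]
  have e2 : J.tr ((k : V →L[ℝ] V) (t • c i)) = t * (s * scale J ϑ) := by
    rw [tr_eq_inner ϑ, real_inner_comm, hk.inner', ← hu, real_inner_smul_left, e1]
  rw [hP, hk.2, hθ, hθ, ← hu, J.P_smul, map_smul (J.P _), hc.P_frame, hsu, e2, ← mul_assoc,
    mul_div_cancel_right₀ _ hc.scale_pos.ne']
  simp only [map_smul, smul_smul]
  congr 1
  ring

theorem tr_sq_of_euclidean [Nontrivial V] (hs : (plus J ϑ).IsSimple) (i) {x : V}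
    (hx : x ∈ orbit J (c i)) : J.tr x ^ 2 = scale J ϑ * ‖x‖ ^ 2 := by
  have h := congrArg J.tr (hc.mul_self_of_euclidean hθ hs i hx)
  have h1 : J.tr (J.mul x x) = ‖x‖ ^ 2 := by
    rw [← real_inner_self_eq_norm_sq, ϑ.inner_eq, hθ]; rfl
  have := hc.scale_pos
  rw [h1, tr_smul] at h
  rw [h]
  field_simp

/-- The trace is positive at `c_i` and, by `tr_sq_of_euclidean`, never zero on the orbit of the
connected group. Together these give `|x| = tr x`. -/
theorem tr_pos_of_euclidean [Nontrivial V] (hs : (plus J ϑ).IsSimple) (i) {x : V}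
    (hx : x ∈ orbit J (c i)) : 0 < J.tr x := by
  have htr : ∀ y, J.tr y = ⟪J.one, y⟫_ℝ := tr_eq_inner ϑ
  have hL : IsPreconnected (Lgrp J : Set (V →L[ℝ] V)ˣ) :=
    isPreconnected_connectedComponent.image _ continuous_subtype_val.continuousOn
  have hcont : Continuous fun g : (V →L[ℝ] V)ˣ => ⟪J.one, (g : V →L[ℝ] V) (c i)⟫_ℝ :=
    continuous_const.inner (Units.continuous_val.clm_apply continuous_const)
  have hpre := (hL.image _ hcont.continuousOn).ordConnected
  obtain ⟨g, hg, rfl⟩ := hx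
  by_contra hneg
  push Not at hneg
  rw [htr] at hneg
  have hpos : 0 ≤ ⟪J.one, ((1 : (V →L[ℝ] V)ˣ) : V →L[ℝ] V) (c i)⟫_ℝ := by
    rw [← htr]; exact (hc.tr_pos i).le
  obtain ⟨g', hg', h0⟩ := hpre.out (Set.mem_image_of_mem _ hg) (Set.mem_image_of_mem _ (one_mem _))
    ⟨hneg, hpos⟩
  have h := hc.tr_sq_of_euclidean hθ hs i ⟨g', hg', rfl⟩
  have h0 : ⟪J.one, (g' : V →L[ℝ] V) (c i)⟫_ℝ = 0 := h0
  rw [htr, h0] at h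
  have hne : (g' : V →L[ℝ] V) (c i) ≠ 0 := fun h => hc.ne_zero i (by
    rw [← inv_apply g' (c i), h, map_zero])
  have := hc.scale_mul_pos hne
  simp only [ne_eq, OfNat.ofNat_ne_zero, not_false_eq_true, zero_pow] at h
  linarith

end Euclidean

end IsJordanFrame

/-- The Gaussian-type function `C e^{-tr x}`. -/
def expTr (J : JordanAlgebra V) (z : ℂ) (x : V) : ℂ := z * ((Real.exp (-⟪x, J.one⟫_ℝ) : ℝ) : ℂ)

theorem smooth_expTr (z : ℂ) : ContDiffOn ℝ ∞ (expTr J z) Set.univ :=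
  contDiffOn_const.mul (Complex.ofRealCLM.contDiff.comp
    (contDiff_id.inner ℝ contDiff_const).neg.exp).contDiffOn

theorem fderiv_expTr (z : ℂ) (x b : V) :
    fderiv ℝ (expTr J z) x b = -(((⟪b, J.one⟫_ℝ : ℝ) : ℂ) * expTr J z x) := by
  have h1 : HasFDerivAt (fun y : V => ⟪y, J.one⟫_ℝ) ((innerSL ℝ).flip J.one) x :=
    ((innerSL ℝ).flip J.one).hasFDerivAt
  have h1' : HasFDerivAt (fun y : V => -⟪y, J.one⟫_ℝ) (-(innerSL ℝ).flip J.one) x := h1.neg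
  have h2 := (Complex.ofRealCLM.hasFDerivAt.comp x h1'.exp).const_mul z
  have h3 : HasFDerivAt (expTr J z) _ x := h2
  rw [h3.fderiv]
  simp only [smul_apply, ContinuousLinearMap.comp_apply, neg_apply,
    ContinuousLinearMap.flip_apply, innerSL_apply_apply, Complex.ofRealCLM_apply, smul_eq_mul, expTr]
  push_cast
  ring

/-- The Hessian of the exponential is the rank-one form of the unit times the function, and `P(e) =
id` evaluates its contraction with the symbol as `⟪x, v⟫`. -/
theorem besselOp_expTr (z : ℂ) (lam : ℝ) (v x : V) :
    besselOp J ϑ lam v (expTr J z) x =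
      ((⟪x, v⟫_ℝ : ℝ) : ℂ) * expTr J z x + -(lam * ((⟪J.one, v⟫_ℝ : ℝ) : ℂ)) * expTr J z x := by
  have hh : ∀ a b, hess (expTr J z) x a b =
      ((⟪b, J.one⟫_ℝ * ⟪a, J.one⟫_ℝ : ℝ) : ℂ) * expTr J z x := by
    intro a b
    have : (fun y => fderiv ℝ (expTr J z) y b) =
        fun y => -((⟪b, J.one⟫_ℝ : ℝ) : ℂ) * expTr J z y :=
      funext fun y => by rw [fderiv_expTr, neg_mul]
    have hd := ((smooth_hasFDerivAt isOpen_univ (smooth_expTr (J := J) z)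
      (Set.mem_univ x)).const_mul (-((⟪b, J.one⟫_ℝ : ℝ) : ℂ))).fderiv
    rw [hess, this, hd, smul_apply, fderiv_expTr, smul_eq_mul]
    push_cast
    ring
  rw [besselOp_eq, fderiv_expTr, ϑ.inner_left, ϑ.map_one, real_inner_comm J.one v]
  simp only [hh]
  rw [← Finset.sum_mul, ← Complex.ofReal_sum]
  have e : ∑ j, ⟪stdOrthonormalBasis ℝ V j, J.one⟫_ℝ *
      ⟪symb ϑ x v (stdOrthonormalBasis ℝ V j), J.one⟫_ℝ = ⟪x, v⟫_ℝ := by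
    have h1 := (stdOrthonormalBasis ℝ V).sum_inner_mul_inner J.one (symb ϑ x v J.one)
    have h2 : ⟪J.one, symb ϑ x v J.one⟫_ℝ = ⟪x, v⟫_ℝ := by
      have := inner_P₂ ϑ x v J.one J.one
      rw [ϑ.map_one, P₂_self, P_one] at this
      rw [this, real_inner_comm]
    rw [← h2, ← h1]
    refine Finset.sum_congr rfl fun j _ => ?_
    rw [symb_symm, real_inner_comm J.one]
  rw [e]
  ring

namespace IsJordanFrame

variable {c : Fin (splitRank J ϑ) → V} (hc : IsJordanFrame J ϑ c)
include hc

/-- Now `ν/2 = -1/2`, so on the orbit `ψ₀` is a multiple of `e^{-tr x}`, whose Bessel derivatives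
are affine multiples of itself. -/
theorem W_le_of_euclidean [Nontrivial V] (hs : (plus J ϑ).IsSimple) (hθ : ∀ x, ϑ.toFun x = x)
    (h1 : 1 < splitRank J ϑ) : W J ϑ c (lam₁ J ϑ c) ≤
      ⨆ l : ℕ, KtPoly J ϑ c ((ν J ϑ c : ℝ) / 2 + l) (2 * l) := by
  obtain ⟨C, hC⟩ := exists_besselKt_neg_half
  have hν : (ν J ϑ c : ℝ) / 2 = -(1 / 2) := by rw [hc.ν_of_euclidean hθ]; norm_num
  have hrad : ∀ x : 𝒪 J ϑ c, radial J ϑ c ((ν J ϑ c : ℝ) / 2) x = expTr J C x := by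
    intro x
    have hx := hc.mem_orbit x
    have hp := hc.tr_pos_of_euclidean hθ hs _ hx
    rw [radial_eq, besselSq, ← hc.tr_sq_of_euclidean hθ hs _ hx, Real.sqrt_sq hp.le, hν, hC _ hp,
      expTr, tr_eq_inner ϑ, real_inner_comm]
    push_cast
    ring
  have hb : Gen J {expTr J (C : ℂ)} (expTr J (C : ℂ)) := Gen.base rfl
  refine hc.W_le hs (fun _ => rfl) (U := Set.univ) (W₀ := {expTr J (C : ℂ)})
    isOpen_univ (Set.subset_univ _) ?_ ?_ ?_ ?_ (fun ψ hψ u => inner_mul_mem_iSup hψ u)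
    (fun ψ hψ => hc.deriv_mem_iSup (fun l => ⟨l + 1, by push_cast; ring, by omega⟩) hψ)
  · rintro _ rfl
    exact smooth_expTr _
  · rintro _ rfl v
    exact ⟨_, (hb.inner_mul v).add (hb.const_mul _), fun x _ => besselOp_expTr _ _ v x⟩
  · refine ⟨_, hb, fun x => ?_⟩
    rw [ψ₀, if_pos h1, hrad]
  · rintro _ rfl
    have h := mem_KtPoly (J := J) (ϑ := ϑ) (c := c) ((ν J ϑ c : ℝ) / 2) (k := 0) le_rfl
      (IsHomPoly.const 1)
    have h' := le_iSup (fun l : ℕ => KtPoly J ϑ c ((ν J ϑ c : ℝ) / 2 + l) (2 * l)) 0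
    simp only [Nat.cast_zero, add_zero, mul_zero] at h'
    convert h' h using 1
    ext x
    rw [hrad, mul_one]

theorem W_le_of_three_le_rank (hV : Nontrivial V) (hs : (plus J ϑ).IsSimple) (hr : 3 ≤ J.rank) :
    W J ϑ c (lam₁ J ϑ c) ≤ ⨆ l : ℕ, KtPoly J ϑ c ((ν J ϑ c : ℝ) / 2 + l) (2 * l) := by
  obtain ⟨h1, hd | hθ⟩ := hc.dichotomy hs hV hr
  -- For `d = 2d₀` one has `ν = d₀ - e - 1`, and `λ₁ r/r₀ = d/2 = d₀`.
  · refine hc.W_le_of_radial hs hd (fun _ => rfl) ?_ (by rw [ψ₀, if_pos h1])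
    rw [hc.lam₁_mul_scale, ν, hd]
    push_cast
    rw [min_self]
    ring
  · exact hc.W_le_of_euclidean hs hθ h1

theorem d_of_splitRank_eq_one (h : splitRank J ϑ = 1) :
    dConst J ϑ c = 0 ∧ d₀Const J ϑ c = 0 := by
  have : ¬ 1 < splitRank J ϑ := by omega
  rw [dConst, dif_neg this, d₀Const, dif_neg this]
  exact ⟨rfl, rfl⟩

theorem W_le_of_splitRank_eq_one [Nontrivial V] (hs : (plus J ϑ).IsSimple)
    (h : splitRank J ϑ = 1) (lam : ℝ) : W J ϑ c lam ≤
      ⨆ l : ℕ, KtPoly J ϑ c (((ν J ϑ c : ℝ) + (J.rank : ℝ) * lam) / 2 + l) (2 * l) := by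
  obtain ⟨hd, hd0⟩ := hc.d_of_splitRank_eq_one h
  refine hc.W_le_of_radial hs (by rw [hd, hd0]) (fun h1 => by omega) ?_
    (by rw [ψ₀, if_neg (by omega)])
  rw [scale, h, ν, hd, hd0]
  push_cast
  simp
  ring

theorem ν_of_splitRank_eq_one [Nontrivial V] (h : splitRank J ϑ = 1) :
    ν J ϑ c = -(finrank ℝ V : ℤ) := by
  obtain ⟨hd, hd0⟩ := hc.d_of_splitRank_eq_one h
  have htop : peirce J ϑ c ⟨0, hc.splitRank_pos⟩ ⟨0, hc.splitRank_pos⟩ = ⊤ := by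
    refine eq_top_iff.2 fun x _ => ?_
    rw [hc.mem_peirce_self, hc.eq_one_of_splitRank h, J.one_mul]
  rw [ν, hd, hd0, hc.eConst_eq, htop, finrank_top]
  simp

end IsJordanFrame

end MinRep.JordanAlgebra

/-! ### Square integrability in polar coordinates. -/

namespace MinRep.JordanAlgebra

/-- The measure `t^s dt` on the positive half line. -/
def powMeasure (s : ℝ) : Measure (Set.Ioi (0 : ℝ)) :=
  (Measure.comap Subtype.val (volume : Measure ℝ)).withDensity
    fun t => ENNReal.ofReal ((t : ℝ) ^ s)

instance (s : ℝ) : SFinite (powMeasure s) := by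
  have : LocallyCompactSpace (Set.Ioi (0 : ℝ)) := isOpen_Ioi.locallyCompactSpace
  have : IsFiniteMeasureOnCompacts
      (Measure.comap (Subtype.val : Set.Ioi (0 : ℝ) → ℝ) (volume : Measure ℝ)) :=
    .comap' _ continuous_subtype_val (MeasurableEmbedding.subtype_coe measurableSet_Ioi)
  have : SigmaFinite (Measure.comap (Subtype.val : Set.Ioi (0 : ℝ) → ℝ) (volume : Measure ℝ)) :=
    inferInstance
  unfold powMeasure
  infer_instance

theorem memLp_powMeasure_iff (s : ℝ) {g : ℝ → ℝ} (hg : ContinuousOn g (Set.Ioi 0)) :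
    MemLp (fun t : Set.Ioi (0 : ℝ) => g t) 2 (powMeasure s) ↔
      IntegrableOn (fun t => g t ^ 2 * t ^ s) (Set.Ioi 0) := by
  have hc : Continuous fun t : Set.Ioi (0 : ℝ) => g t := continuousOn_iff_continuous_domRestrict.1 hg
  have hm : Measurable fun t : Set.Ioi (0 : ℝ) => ENNReal.ofReal ((t : ℝ) ^ s) :=
    (measurable_subtype_coe.pow_const s).ennreal_ofReal
  rw [memLp_two_iff_integrable_sq hc.aestronglyMeasurable, powMeasure,
    integrable_withDensity_iff hm (Filter.Eventually.of_forall fun _ => ENNReal.ofReal_lt_top),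
    integrableOn_iff_comap_subtypeVal measurableSet_Ioi]
  refine integrable_congr (Filter.Eventually.of_forall fun t => ?_)
  simp only [Function.comp]
  rw [ENNReal.toReal_ofReal (Real.rpow_nonneg (le_of_lt t.2) _)]

theorem continuousOn_besselKt (β : ℝ) : ContinuousOn (besselKt β) (Set.Ioi 0) :=
  fun _ hz => (hasDerivAt_besselKt β hz).continuousAt.continuousWithinAt

/-- Square integrability of `t^m K̃_β(a t)` with respect to `t^s dt`. -/
theorem integrableOn_besselKt_sq {β a s : ℝ} (m : ℕ) (ha : 0 < a)
    (h : 4 * max β 0 < 2 * m + s + 1) :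
    IntegrableOn (fun t => (t ^ m * besselKt β (a * t)) ^ 2 * t ^ s) (Set.Ioi 0) := by
  -- The strict inequality leaves room for the loss `δ` in the bound `besselK_le`.
  obtain ⟨δ, hδ, hδ'⟩ : ∃ δ : ℝ, 0 < δ ∧ 4 * max β 0 + 2 * δ < 2 * m + s + 1 :=
    ⟨(2 * m + s + 1 - 4 * max β 0) / 4, by linarith, by linarith⟩
  obtain ⟨C, hC, hK⟩ := besselK_le β hδ
  -- The singularity of `K_β` has exponent `|β|` and the renormalization adds `β`.
  have hmax : |β| + β = 2 * max β 0 := by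
    rcases le_total 0 β with h | h
    · rw [abs_of_nonneg h, max_eq_left h]; ring
    · rw [abs_of_nonpos h, max_eq_right h]; ring
  set q : ℝ := 2 * m + s - 4 * max β 0 - 2 * δ with hq
  have hi := (integrableOn_rpow_mul_exp_neg_mul_rpow (p := 1) (s := q) (b := a)
    (by linarith) one_pos ha).const_mul ((C * 2 ^ β * a ^ (-(2 * max β 0 + δ))) ^ 2)
  have hcont : ContinuousOn (fun t => (t ^ m * besselKt β (a * t)) ^ 2 * t ^ s) (Set.Ioi 0) := by
    refine ContinuousOn.mul (ContinuousOn.pow (ContinuousOn.mul (continuousOn_pow m) ?_) 2) ?_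
    · exact (continuousOn_besselKt β).comp (continuousOn_const.mul continuousOn_id)
        fun t ht => mul_pos ha ht
    · exact ContinuousOn.rpow_const continuousOn_id fun t ht => Or.inl (ne_of_gt ht)
  refine Integrable.mono' hi (hcont.aestronglyMeasurable measurableSet_Ioi)
    ((ae_restrict_iff' measurableSet_Ioi).2 (Filter.Eventually.of_forall fun t ht => ?_))
  have ht : 0 < t := ht
  have hat : 0 < a * t := mul_pos ha ht
  have h1 : besselKt β (a * t) ≤ C * 2 ^ β * a ^ (-(2 * max β 0 + δ)) *
      t ^ (-(2 * max β 0 + δ)) * Real.exp (-(a * t / 2)) := by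
    rw [besselKt, Real.rpow_neg (by positivity), Real.div_rpow hat.le zero_le_two, inv_div]
    calc 2 ^ β / (a * t) ^ β * besselK β (a * t) ≤ 2 ^ β / (a * t) ^ β *
          (C * (a * t) ^ (-(|β| + δ)) * Real.exp (-(a * t / 2))) :=
          mul_le_mul_of_nonneg_left (hK _ hat) (by positivity)
      _ = C * 2 ^ β * (a * t) ^ (-(|β| + δ) - β) * Real.exp (-(a * t / 2)) := by
          rw [Real.rpow_sub hat]; ring
      _ = _ := by
          rw [show -(|β| + δ) - β = -(2 * max β 0 + δ) by rw [← hmax]; ring,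
            Real.mul_rpow ha.le ht.le]
          ring
  have h0 := besselKt_nonneg β hat.le
  rw [Real.norm_of_nonneg (by positivity)]
  calc (t ^ m * besselKt β (a * t)) ^ 2 * t ^ s ≤
      (t ^ m * (C * 2 ^ β * a ^ (-(2 * max β 0 + δ)) *
        t ^ (-(2 * max β 0 + δ)) * Real.exp (-(a * t / 2)))) ^ 2 * t ^ s := by
        gcongr
    _ = (C * 2 ^ β * a ^ (-(2 * max β 0 + δ))) ^ 2 *
        (((t ^ m) ^ 2 * (t ^ (-(2 * max β 0 + δ))) ^ 2 * t ^ s) *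
          (Real.exp (-(a * t / 2))) ^ 2) := by ring
    _ = _ := by
      congr 2
      · rw [← Real.rpow_natCast, ← Real.rpow_natCast, ← Real.rpow_natCast, ← Real.rpow_mul ht.le,
          ← Real.rpow_mul ht.le, ← Real.rpow_add ht, ← Real.rpow_add ht, hq]
        congr 1
        push_cast
        ring
      · rw [← Real.exp_nat_mul, Real.rpow_one]
        congr 1
        push_cast
        ring

/-- Near zero the integrand dominates a multiple of `t^{s - 4β}`, whose exponent is at most `-1`. -/
theorem not_integrableOn_besselKt_sq {β a s : ℝ} (hβ : 0 < β) (ha : 0 < a) (h : s + 1 ≤ 4 * β) :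
    ¬ IntegrableOn (fun t => besselKt β (a * t) ^ 2 * t ^ s) (Set.Ioi 0) := by
  intro hi
  set C := Real.exp (-Real.exp 1) / 2 * 2 ^ β * a ^ (-(2 * β)) with hC
  have hC0 : 0 < C := by positivity
  have hsub : Set.Ioo 0 a⁻¹ ⊆ Set.Ioi 0 := fun t ht => ht.1
  have hi' : IntegrableOn (fun t => C ^ 2 * t ^ (s - 4 * β)) (Set.Ioo 0 a⁻¹) := by
    refine Integrable.mono' (hi.mono_set hsub) ?_
      ((ae_restrict_iff' measurableSet_Ioo).2 (Filter.Eventually.of_forall fun t ht => ?_))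
    · exact ContinuousOn.aestronglyMeasurable (continuousOn_const.mul
        (ContinuousOn.rpow_const continuousOn_id fun t ht => Or.inl (ne_of_gt ht.1)))
        measurableSet_Ioo
    have ht0 : 0 < t := ht.1
    have hat : 0 < a * t := mul_pos ha ht0
    have hat1 : a * t ≤ 1 := by
      have := mul_le_mul_of_nonneg_left ht.2.le ha.le
      rwa [mul_inv_cancel₀ ha.ne'] at this
    have h1 : C * t ^ (-(2 * β)) ≤ besselKt β (a * t) := by
      have h2 := mul_le_mul_of_nonneg_left (le_besselK hβ hat hat1)
        (Real.rpow_nonneg (half_pos hat).le (-β))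
      refine le_trans (le_of_eq ?_) h2
      rw [Real.rpow_neg (by positivity : 0 ≤ a * t / 2), Real.div_rpow hat.le zero_le_two, inv_div,
        hC, mul_assoc, ← Real.mul_rpow ha.le ht0.le, show -(2 * β) = -β - β by ring,
        Real.rpow_sub hat]
      ring
    rw [Real.norm_of_nonneg (by positivity)]
    calc C ^ 2 * t ^ (s - 4 * β) = (C * t ^ (-(2 * β))) ^ 2 * t ^ s := by
          have e : t ^ (s - 4 * β) = (t ^ (-(2 * β))) ^ 2 * t ^ s := by
            rw [← Real.rpow_natCast (t ^ (-(2 * β))), ← Real.rpow_mul ht0.le, ← Real.rpow_add ht0]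
            congr 1
            push_cast
            ring
          rw [e]
          ring
      _ ≤ _ := by gcongr
  have h3 : IntegrableOn (fun t => t ^ (s - 4 * β)) (Set.Ioo 0 a⁻¹) := by
    refine (hi'.const_mul ((C ^ 2)⁻¹)).congr (Filter.Eventually.of_forall fun t => ?_)
    simp only
    rw [← mul_assoc, inv_mul_cancel₀ (by positivity), _root_.one_mul]
  rw [intervalIntegral.integrableOn_Ioo_rpow_iff (by positivity)] at h3
  linarith

section Orbit

variable {V : Type*} [NormedAddCommGroup V] [InnerProductSpace ℝ V] [FiniteDimensional ℝ V]
variable {J : JordanAlgebra V} {ϑ : CartanInvolution J}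

instance : IsProbabilityMeasure (haarKL J) :=
  ⟨Measure.haarMeasure_self (G := KL J) (K₀ := ⊤)⟩

variable [MeasurableSpace V] [BorelSpace V]

namespace IsJordanFrame

variable {c : Fin (splitRank J ϑ) → V} (hc : IsJordanFrame J ϑ c)
include hc

theorem continuous_radial [Nontrivial V] (β : ℝ) : Continuous (radial J ϑ c β) := by
  have h := (smooth_radialExt (V := V) hc.scale_pos (smooth_besselSq β)).continuousOn
  have h2 := h.comp_continuous (f := fun x : 𝒪 J ϑ c => (x : V)) continuous_subtype_val
    fun x => hc.ne_zero_of_mem x.2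
  refine h2.congr fun x => ?_
  rw [radial_eq]
  rfl

/-- Rotations are isometries and `‖c₁‖² = r/r₀`, so `|·|` carries the constant twice under the root
and the norm once. -/
theorem absV_polar [Nontrivial V] (hs : (plus J ϑ).IsSimple) (u : KL J) (t : Set.Ioi (0 : ℝ)) :
    absV J ϑ (((u : (V →L[ℝ] V)ˣ) : V →L[ℝ] V) ((t : ℝ) • c₁ J ϑ c)) = scale J ϑ * t ∧
    ‖((u : (V →L[ℝ] V)ˣ) : V →L[ℝ] V) ((t : ℝ) • c₁ J ϑ c)‖ = Real.sqrt (scale J ϑ) * t := by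
  have h : ‖((u : (V →L[ℝ] V)ˣ) : V →L[ℝ] V) ((t : ℝ) • c₁ J ϑ c)‖ =
      Real.sqrt (scale J ϑ) * t := by
    have h1 : ‖((u : (V →L[ℝ] V)ˣ) : V →L[ℝ] V) ((t : ℝ) • c₁ J ϑ c)‖ =
        ‖(t : ℝ) • c₁ J ϑ c‖ := by
      rw [← sq_eq_sq₀ (norm_nonneg _) (norm_nonneg _), ← real_inner_self_eq_norm_sq,
        ← real_inner_self_eq_norm_sq, u.2.2]
    rw [h1, norm_smul, Real.norm_of_nonneg (le_of_lt t.2), hc.c₁_eq,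
      ← hc.norm_sq_eq hs ⟨0, hc.splitRank_pos⟩, Real.sqrt_sq (norm_nonneg _), _root_.mul_comm]
  refine ⟨?_, h⟩
  rw [absV, h, ← mul_assoc]
  congr 1
  exact Real.mul_self_sqrt hc.scale_pos.le

theorem memLp_iff [Nontrivial V] {lam : ℝ} {ψ : 𝒪 J ϑ c → ℂ} (hψ : Continuous ψ) :
    MemLp ψ 2 (μ J ϑ c lam) ↔ MemLp (fun z : KL J × Set.Ioi (0 : ℝ) =>
      ψ ⟨((z.1 : (V →L[ℝ] V)ˣ) : V →L[ℝ] V) ((z.2 : ℝ) • c₁ J ϑ c),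
        polar_mem_orbit J (c₁ J ϑ c) z.1 z.2⟩) 2
      ((haarKL J).prod (powMeasure (lam * (J.rank : ℝ) - 1))) := by
  have hm : Continuous fun z : KL J × Set.Ioi (0 : ℝ) =>
      (⟨((z.1 : (V →L[ℝ] V)ˣ) : V →L[ℝ] V) ((z.2 : ℝ) • c₁ J ϑ c),
        polar_mem_orbit J (c₁ J ϑ c) z.1 z.2⟩ : 𝒪 J ϑ c) := by
    refine Continuous.subtype_mk ?_ _
    exact (Units.continuous_val.comp (continuous_subtype_val.comp continuous_fst)).clm_apply
      ((continuous_subtype_val.comp continuous_snd).smul continuous_const)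
  exact memLp_map_measure_iff hψ.aestronglyMeasurable hm.measurable.aemeasurable

theorem memLp_snd_iff (s : ℝ) {g : ℝ → ℝ} (hg : ContinuousOn g (Set.Ioi 0)) :
    MemLp (fun z : KL J × Set.Ioi (0 : ℝ) => g z.2) 2 ((haarKL J).prod (powMeasure s)) ↔
      IntegrableOn (fun t => g t ^ 2 * t ^ s) (Set.Ioi 0) := by
  have hcont : Continuous fun t : Set.Ioi (0 : ℝ) => g t :=
    continuousOn_iff_continuous_domRestrict.1 hg
  have h := memLp_map_measure_iff (p := 2) (μ := (haarKL J).prod (powMeasure s))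
    (f := Prod.snd) (g := fun t : Set.Ioi (0 : ℝ) => g t)
    hcont.aestronglyMeasurable measurable_snd.aemeasurable
  rw [Measure.map_snd_prod, measure_univ, one_smul, memLp_powMeasure_iff s hg] at h
  exact h.symm

/-- A polynomial of degree `n ≥ m` is bounded by a multiple of `‖x‖ⁿ`, which reduces the claim to
the radial integral of `t^{2n} K̃_β²` against `t^{λr-1} dt`. -/
theorem subsetL2_iSup [Nontrivial V] (hs : (plus J ϑ).IsSimple) {ι : Type*} {β : ι → ℝ}
    {m : ι → ℕ} {lam : ℝ} (h : ∀ i, 4 * max (β i) 0 < lam * J.rank + 2 * m i) :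
    SubsetL2 J ϑ c lam (⨆ i, KtPoly J ϑ c (β i) (m i)) := by
  let N : Submodule ℂ (𝒪 J ϑ c → ℂ) :=
    { carrier := {ψ | MemLp ψ 2 (μ J ϑ c lam)}
      zero_mem' := MemLp.zero
      add_mem' := fun h h' => h.add h'
      smul_mem' := fun z _ h => h.const_smul z }
  suffices hN : (⨆ i, KtPoly J ϑ c (β i) (m i)) ≤ N from fun ψ hψ => hN hψ
  refine iSup_le fun i => ?_
  rw [KtPoly_eq]
  refine Submodule.span_le.2 ?_
  rintro _ ⟨n, hn, F, hF, rfl⟩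
  have ha := hc.scale_pos
  have hcont : Continuous fun x : 𝒪 J ϑ c => radial J ϑ c (β i) x * F x :=
    (hc.continuous_radial _).mul
      ((hF.smooth Set.univ).continuousOn.comp_continuous continuous_subtype_val fun _ => trivial)
  obtain ⟨C, hC, hb⟩ := hF.bound
  have hn' : (m i : ℝ) ≤ n := by exact_mod_cast hn
  have hg := (memLp_snd_iff hc (lam * J.rank - 1)
    (g := fun t => t ^ n * besselKt (β i) (scale J ϑ * t)) (by
      refine (continuousOn_pow n).mul ?_
      exact (continuousOn_besselKt _).comp (continuousOn_const.mul continuousOn_id)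
        fun t ht => mul_pos ha ht)).2
    (integrableOn_besselKt_sq n ha (by have := h i; linarith))
  refine (hc.memLp_iff hcont).2 ?_
  refine (hg.const_mul (C * Real.sqrt (scale J ϑ) ^ n)).of_le ?_
    (Filter.Eventually.of_forall fun z => ?_)
  · have hm : Continuous fun z : KL J × Set.Ioi (0 : ℝ) =>
        (⟨((z.1 : (V →L[ℝ] V)ˣ) : V →L[ℝ] V) ((z.2 : ℝ) • c₁ J ϑ c),
          polar_mem_orbit J (c₁ J ϑ c) z.1 z.2⟩ : 𝒪 J ϑ c) := by
      refine Continuous.subtype_mk ?_ _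
      exact (Units.continuous_val.comp (continuous_subtype_val.comp continuous_fst)).clm_apply
        ((continuous_subtype_val.comp continuous_snd).smul continuous_const)
    exact (hcont.comp hm).aestronglyMeasurable
  · obtain ⟨h1, h2⟩ := hc.absV_polar hs z.1 z.2
    have ht : (0 : ℝ) < z.2 := z.2.2
    have hK := besselKt_nonneg (β i) (mul_pos ha ht).le
    rw [norm_mul, radial, h1, Complex.norm_real, Real.norm_of_nonneg hK]
    refine le_trans (mul_le_mul_of_nonneg_left (hb _) hK) ?_
    rw [h2, Real.norm_of_nonneg (by positivity)]
    exact le_of_eq (by ring)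

theorem memLp_radial_iff [Nontrivial V] (hs : (plus J ϑ).IsSimple) (β lam : ℝ) :
    MemLp (radial J ϑ c β) 2 (μ J ϑ c lam) ↔ IntegrableOn
      (fun t => besselKt β (scale J ϑ * t) ^ 2 * t ^ (lam * (J.rank : ℝ) - 1)) (Set.Ioi 0) := by
  rw [hc.memLp_iff (hc.continuous_radial β), ← hc.memLp_snd_iff (J := J) _
    (g := fun t => besselKt β (scale J ϑ * t)) ((continuousOn_besselKt _).comp
      (continuousOn_const.mul continuousOn_id) fun t ht => mul_pos hc.scale_pos ht)]
  have e : ∀ z : KL J × Set.Ioi (0 : ℝ), radial J ϑ c β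
      ⟨((z.1 : (V →L[ℝ] V)ˣ) : V →L[ℝ] V) ((z.2 : ℝ) • c₁ J ϑ c),
        polar_mem_orbit J (c₁ J ϑ c) z.1 z.2⟩ = ((besselKt β (scale J ϑ * z.2) : ℝ) : ℂ) :=
    fun z => by rw [radial, (hc.absV_polar hs z.1 z.2).1]
  simp only [e]
  exact ⟨fun h => h.re, fun h => h.ofReal⟩

theorem ψ₀_mem_W (lam : ℝ) : ψ₀ J ϑ c lam ∈ W J ϑ c lam :=
  Submodule.mem_sInf.2 fun _ h => h.1

/-- The square integrability criterion for split rank one. -/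
theorem subsetL2_iff [Nontrivial V] (hs : (plus J ϑ).IsSimple) (h1 : splitRank J ϑ = 1) {lam : ℝ}
    (hlam : 0 < lam) : SubsetL2 J ϑ c lam (W J ϑ c lam) ↔
      (J.rank : ℝ) * lam ∈ Set.Ioo (0 : ℝ) (2 * (finrank ℝ V : ℝ)) := by
  have hr : (0 : ℝ) < J.rank := by exact_mod_cast rank_pos ϑ
  have hn : (0 : ℝ) < finrank ℝ V := by exact_mod_cast finrank_pos
  have hν : (ν J ϑ c : ℝ) = -(finrank ℝ V : ℝ) := by
    rw [hc.ν_of_splitRank_eq_one h1]; push_cast; rfl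
  constructor
  · intro h
    refine ⟨mul_pos hr hlam, ?_⟩
    by_contra hge
    push Not at hge
    -- For `σ ≥ 2 dim V` the generator fails: its order `β = (σ - dim V)/2` is positive and `4β ≥
    -- σ`.
    have h2 := h _ (hc.ψ₀_mem_W lam)
    rw [ψ₀, if_neg (by omega), hc.memLp_radial_iff hs] at h2
    exact not_integrableOn_besselKt_sq (by rw [hν]; linarith) hc.scale_pos
      (by rw [hν]; linarith) h2
  · rintro ⟨h2, h3⟩ ψ hψ
    refine hc.subsetL2_iSup hs (fun l => ?_) ψ (hc.W_le_of_splitRank_eq_one hs h1 lam hψ)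
    rw [hν]
    push_cast
    have hl : (0 : ℝ) ≤ l := Nat.cast_nonneg l
    rcases max_cases ((-(finrank ℝ V : ℝ) + J.rank * lam) / 2 + l) 0 with ⟨e, -⟩ | ⟨e, -⟩ <;>
      rw [e] <;> linarith

end IsJordanFrame

end Orbit

end MinRep.JordanAlgebra

namespace MinRep.JordanAlgebra

/-! ### Spin factors and `ℝ^{p,q}`. -/

section Spin

variable {V : Type*} [AddCommGroup V] [Module ℝ V]

/-- `J` is the Jordan algebra of a quadratic form, with normalized trace `t`. -/
structure IsSpin (J : JordanAlgebra V) (t : V →ₗ[ℝ] ℝ) : Prop where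
  one : t J.one = 1
  tr : ∀ x, J.tr x = J.rank * t x
  mul_eq : ∀ x y, J.mul x y = t x • y + t y • x + (t (J.mul x y) - 2 * (t x * t y)) • J.one

variable {J : JordanAlgebra V}

theorem IsRpq.finrank_eq {p q : ℕ} (h : J.IsRpq p q) : finrank ℝ V = p + q := by
  obtain ⟨hp, Φ, -⟩ := h
  rw [Φ.finrank_eq]
  simp
  omega

theorem IsRpq.finiteDimensional {p q : ℕ} (h : J.IsRpq p q) : FiniteDimensional ℝ V := by
  obtain ⟨-, Φ, -⟩ := h
  exact Φ.symm.finiteDimensional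

/-- The algebra `ℝ^{p,q}` is a spin factor, and its form `t(x²)` has signature `(q + 1, p - 1)`. -/
theorem IsRpq.exists_isSpin {p q : ℕ} (h : J.IsRpq p q) : ∃ t : V →ₗ[ℝ] ℝ, IsSpin J t ∧
    (∃ S : Submodule ℝ V, finrank ℝ S = q + 1 ∧ ∀ x ∈ S, t (J.mul x x) ≤ 0 → x = 0) ∧
    ∃ S : Submodule ℝ V, finrank ℝ S = p - 1 ∧ ∀ x ∈ S, 0 ≤ t (J.mul x x) → x = 0 := by
  have hfd := h.finiteDimensional
  have hn := h.finrank_eq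
  obtain ⟨hp, Φ, hΦ⟩ := h
  let E := ℝ × (Fin (p - 1) → ℝ) × (Fin q → ℝ)
  let t : V →ₗ[ℝ] ℝ := LinearMap.fst ℝ ℝ _ ∘ₗ Φ.toLinearMap
  have ht : ∀ x, t x = (Φ x).1 := fun _ => rfl
  have hone : Φ J.one = (1, 0, 0) := by
    have h1 := hΦ J.one (Φ.symm (1, 0, 0))
    rw [J.one_mul, Φ.apply_symm_apply] at h1
    refine Prod.ext ?_ ?_
    · have := congrArg Prod.fst h1
      simpa [rpqMul] using this.symm
    · change (Φ J.one).2 = 0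
      have := congrArg Prod.snd h1
      simpa [rpqMul] using this.symm
  have hmul : ∀ x y, J.mul x y = t x • y + t y • x + (t (J.mul x y) - 2 * (t x * t y)) • J.one := by
    intro x y
    apply Φ.injective
    rw [map_add, map_add, map_smul, map_smul, map_smul, hone, ht x, ht y, ht (J.mul x y), hΦ]
    refine Prod.ext ?_ ?_
    · simp only [rpqMul, Prod.fst_add, Prod.smul_fst, smul_eq_mul]
      ring
    · simp [rpqMul]
  have h1 : t J.one = 1 := by rw [ht, hone]
  -- The definite subspaces are the preimages of `ℝ × 0 × ℝ^q` and `0 × ℝ^{p-1} × 0`.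
  refine ⟨t, ⟨h1, fun x => ?_, hmul⟩, ⟨LinearMap.range (Φ.symm.toLinearMap ∘ₗ
      LinearMap.prodMap LinearMap.id (LinearMap.inr ℝ (Fin (p - 1) → ℝ) (Fin q → ℝ))), ?_, ?_⟩,
    ⟨LinearMap.range (Φ.symm.toLinearMap ∘ₗ LinearMap.inr ℝ ℝ _ ∘ₗ
      LinearMap.inl ℝ (Fin (p - 1) → ℝ) (Fin q → ℝ)), ?_, ?_⟩⟩
  · let g : V →ₗ[ℝ] ℝ := t ∘ₗ J.mul x - (2 * t x) • t
    have e : J.mul x = t x • LinearMap.id + t.smulRight x + g.smulRight J.one := by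
      ext y
      rw [hmul x y]
      simp only [g, LinearMap.add_apply, LinearMap.smul_apply, LinearMap.smulRight_apply,
        LinearMap.sub_apply, LinearMap.comp_apply, LinearMap.id_apply, smul_eq_mul]
      module
    have hn0 : (finrank ℝ V : ℝ) ≠ 0 := by
      rw [hn]
      exact_mod_cast (by omega : p + q ≠ 0)
    have htr : LinearMap.trace ℝ V (J.mul x) = finrank ℝ V * t x := by
      rw [e, map_add, map_add, map_smul, LinearMap.trace_id, LinearMap.trace_smulRight,
        LinearMap.trace_smulRight]
      simp only [g, LinearMap.sub_apply, LinearMap.comp_apply, LinearMap.smul_apply, h1,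
        J.mul_comm x, J.one_mul, smul_eq_mul]
      ring
    rw [JordanAlgebra.tr, L, htr]
    field_simp
  · rw [LinearMap.finrank_range_of_inj]
    · simp [_root_.add_comm]
    · intro a b hab
      simp only [LinearMap.comp_apply, LinearEquiv.coe_coe, EmbeddingLike.apply_eq_iff_eq] at hab
      simpa [Prod.ext_iff] using hab
  · rintro _ ⟨y, rfl⟩ hx
    rw [ht, hΦ] at hx
    simp only [LinearMap.comp_apply, LinearEquiv.coe_coe, LinearEquiv.apply_symm_apply, rpqMul,
      LinearMap.prodMap_apply, LinearMap.id_apply, LinearMap.inr_apply, Pi.zero_apply, mul_zero,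
      Finset.sum_const_zero, neg_zero, zero_add] at hx
    have hs : 0 ≤ ∑ j, y.2 j * y.2 j := Finset.sum_nonneg fun j _ => mul_self_nonneg _
    have h1 : y.1 = 0 := by nlinarith [mul_self_nonneg y.1]
    have h2 : ∑ j, y.2 j * y.2 j = 0 := by nlinarith [mul_self_nonneg y.1]
    rw [Finset.sum_eq_zero_iff_of_nonneg fun j _ => mul_self_nonneg _] at h2
    have h3 : y.2 = 0 := funext fun j => by simpa using h2 j (Finset.mem_univ j)
    rw [show y = 0 from Prod.ext h1 h3, map_zero]
  · rw [LinearMap.finrank_range_of_inj]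
    · simp
    · intro a b hab
      simp only [LinearMap.comp_apply, LinearEquiv.coe_coe, EmbeddingLike.apply_eq_iff_eq] at hab
      simpa [Prod.ext_iff] using hab
  · rintro _ ⟨y, rfl⟩ hx
    rw [ht, hΦ] at hx
    simp only [LinearMap.comp_apply, LinearEquiv.coe_coe, LinearEquiv.apply_symm_apply, rpqMul,
      LinearMap.inr_apply, LinearMap.inl_apply, Pi.zero_apply, mul_zero,
      Finset.sum_const_zero, zero_add, add_zero] at hx
    have h2 : ∑ j, y j * y j = 0 :=
      le_antisymm (by linarith) (Finset.sum_nonneg fun j _ => mul_self_nonneg _)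
    rw [Finset.sum_eq_zero_iff_of_nonneg fun j _ => mul_self_nonneg _] at h2
    rw [show y = 0 from funext fun j => by simpa using h2 j (Finset.mem_univ j), map_zero]

variable {t : V →ₗ[ℝ] ℝ} (h : IsSpin J t)
include h

namespace IsSpin

/-- The polarized quadratic representation of a spin factor. -/
theorem P₂_apply (a b z : V) : J.P₂ a b z = t (J.mul a z) • b + t (J.mul b z) • a -
    (2 * (t a * t b) - t (J.mul a b)) • ((2 * t z) • J.one - z) := by
  simp only [P₂, L, LinearMap.add_apply, LinearMap.sub_apply, LinearMap.comp_apply]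
  have e1 : J.mul a (J.mul b z) = t b • J.mul a z + t z • J.mul a b +
      (t (J.mul b z) - 2 * (t b * t z)) • a := by
    conv_lhs => rw [h.mul_eq b z]
    rw [map_add, map_add, map_smul, map_smul, map_smul, J.mul_comm a J.one, J.one_mul]
  have e2 : J.mul b (J.mul a z) = t a • J.mul b z + t z • J.mul a b +
      (t (J.mul a z) - 2 * (t a * t z)) • b := by
    conv_lhs => rw [h.mul_eq a z]
    rw [map_add, map_add, map_smul, map_smul, map_smul, J.mul_comm b J.one, J.one_mul,
      J.mul_comm b a]
  have e3 : J.mul (J.mul a b) z = t a • J.mul b z + t b • J.mul a z +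
      (t (J.mul a b) - 2 * (t a * t b)) • z := by
    conv_lhs => rw [h.mul_eq a b]
    simp only [map_add, map_smul, LinearMap.add_apply, LinearMap.smul_apply, J.one_mul]
  rw [e1, e2, e3]
  have e4 := h.mul_eq a b
  linear_combination (norm := module) (2 * t z) • e4

theorem mul_self (x : V) : ∃ a b : ℝ, J.mul x x = a • x + b • J.one :=
  ⟨2 * t x, t (J.mul x x) - 2 * (t x * t x), by
    conv_lhs => rw [h.mul_eq x x]
    module⟩

end IsSpin

end Spin

/-! ### The Bessel operator of a spin factor. -/

section SpinEuclid

variable {V : Type*} [NormedAddCommGroup V] [InnerProductSpace ℝ V] [FiniteDimensional ℝ V]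
variable {J : JordanAlgebra V} {ϑ : CartanInvolution J}

/-- A law-of-inertia count: `t(x²)` is nonnegative on `V⁺` and nonpositive on `V⁻`, so each meets
the subspace of opposite definiteness trivially. -/
theorem IsRpq.finrank_plusSpace [Nontrivial V] {p q : ℕ} (h : J.IsRpq p q)
    (ϑ : CartanInvolution J) : finrank ℝ (plusSpace J ϑ) = q + 1 ∧
      finrank ℝ (minusSpace J ϑ) + 1 = p := by
  obtain ⟨t, ht, ⟨S, hS, hS'⟩, ⟨S₁, hS₁, hS₁'⟩⟩ := h.exists_isSpin
  have hr := rank_pos ϑ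
  have hn := h.finrank_eq
  have h1 : Disjoint S (minusSpace J ϑ) := by
    rw [Submodule.disjoint_def]
    intro x hx hx'
    refine hS' x hx ?_
    have := ϑ.inner_eq x x
    rw [mem_minusSpace.1 hx', τ, map_neg, ht.tr, map_neg] at this
    have h0 := real_inner_self_nonneg (x := x)
    nlinarith
  have h2 : Disjoint S₁ (plusSpace J ϑ) := by
    rw [Submodule.disjoint_def]
    intro x hx hx'
    refine hS₁' x hx ?_
    have := ϑ.inner_eq x x
    rw [mem_plusSpace.1 hx', τ, ht.tr] at this
    have h0 := real_inner_self_nonneg (x := x)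
    rw [this] at h0
    exact nonneg_of_mul_nonneg_right h0 hr
  have h3 := Submodule.finrank_add_finrank_le_of_disjoint h1
  have h4 := Submodule.finrank_add_finrank_le_of_disjoint h2
  have h5 := finrank_plus_add_minus (ϑ := ϑ) (⊤ : Submodule ℝ V) (fun _ _ => trivial)
  rw [top_inf_eq, top_inf_eq, finrank_top] at h5
  have := h.1
  omega

namespace IsSpin

variable {t : V →ₗ[ℝ] ℝ} (h : IsSpin J t)
include h

theorem inner_eq (ϑ : CartanInvolution J) (x y : V) :
    ⟪x, y⟫_ℝ = J.rank * t (J.mul x (ϑ.toFun y)) := by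
  rw [ϑ.inner_eq, τ, h.tr]

theorem theta [Nontrivial V] (ϑ : CartanInvolution J) (x : V) : t (ϑ.toFun x) = t x := by
  have h1 := tr_theta ϑ x
  rw [h.tr, h.tr] at h1
  exact mul_left_cancel₀ (rank_pos ϑ).ne' h1

end IsSpin

/-- The isometric involution `x ↦ 2 t(x) e - ϑ x`. -/
def spinInv (ϑ : CartanInvolution J) (t : V →ₗ[ℝ] ℝ) : V →ₗ[ℝ] V :=
  (2 : ℝ) • t.smulRight J.one - ϑ.toFun

theorem spinInv_apply (t : V →ₗ[ℝ] ℝ) (x : V) :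
    spinInv ϑ t x = (2 * t x) • J.one - ϑ.toFun x := by
  simp [spinInv, smul_smul]

namespace IsSpin

variable {t : V →ₗ[ℝ] ℝ} (h : IsSpin J t)
include h

theorem spinInv_spinInv [Nontrivial V] (x : V) : spinInv ϑ t (spinInv ϑ t x) = x := by
  simp only [spinInv_apply, map_sub, map_smul, h.theta, h.one, CartanInvolution.map_one, ϑ.invol]
  module

theorem inner_spinInv [Nontrivial V] (x y : V) :
    ⟪x, spinInv ϑ t y⟫_ℝ = J.rank * (2 * (t x * t y) - t (J.mul x y)) := by
  rw [h.inner_eq ϑ, spinInv_apply, map_sub, map_smul, CartanInvolution.map_one, ϑ.invol, map_sub,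
    map_smul, J.mul_comm x J.one, J.one_mul, map_sub, map_smul, smul_eq_mul]
  ring

theorem spinInv_symm [Nontrivial V] (x y : V) :
    ⟪spinInv ϑ t x, y⟫_ℝ = ⟪x, spinInv ϑ t y⟫_ℝ := by
  rw [real_inner_comm, h.inner_spinInv, h.inner_spinInv, J.mul_comm]
  ring

/-- Up to two rank-one terms the symbol is a multiple of the involution, so the only Laplacian in
the Bessel operator is the one defined by `spinInv`. -/
theorem rank_smul_symb [Nontrivial V] (x v b : V) : (J.rank : ℝ) • symb ϑ x v b =
    ⟪x, b⟫_ℝ • ϑ.toFun v + ⟪ϑ.toFun v, b⟫_ℝ • x -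
      ⟪spinInv ϑ t x, ϑ.toFun v⟫_ℝ • spinInv ϑ t b := by
  rw [symb_apply, h.P₂_apply, h.inner_eq ϑ x b, h.inner_eq ϑ _ b, h.spinInv_symm,
    h.inner_spinInv, spinInv_apply, h.theta, h.theta]
  module

theorem trace_spinInv : LinearMap.trace ℝ V (spinInv ϑ t) = 2 - LinearMap.trace ℝ V ϑ.toFun := by
  rw [spinInv, map_sub, map_smul, LinearMap.trace_smulRight, h.one, smul_eq_mul, mul_one]

/-- The Bessel operator of a spin factor. -/
theorem rank_mul_besselOp [Nontrivial V] {U : Set V} (hU : IsOpen U) {Ψ : V → ℂ}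
    (hΨ : ContDiffOn ℝ ∞ Ψ U) (lam : ℝ) (v : V) {x : V} (hx : x ∈ U) :
    (J.rank : ℂ) * besselOp J ϑ lam v Ψ x = 2 * hess Ψ x x (ϑ.toFun v) -
      ((⟪spinInv ϑ t x, ϑ.toFun v⟫_ℝ : ℝ) : ℂ) * ∑ j, hess Ψ x
        (spinInv ϑ t (stdOrthonormalBasis ℝ V j)) (stdOrthonormalBasis ℝ V j) +
      ((J.rank * lam : ℝ) : ℂ) * fderiv ℝ Ψ x (ϑ.toFun v) := by
  have e : ∀ j, (J.rank : ℂ) * hess Ψ x (symb ϑ x v (stdOrthonormalBasis ℝ V j))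
      (stdOrthonormalBasis ℝ V j) =
      ((⟪x, stdOrthonormalBasis ℝ V j⟫_ℝ : ℝ) : ℂ) *
          fderiv ℝ (fderiv ℝ Ψ) x (ϑ.toFun v) (stdOrthonormalBasis ℝ V j) +
        ((⟪ϑ.toFun v, stdOrthonormalBasis ℝ V j⟫_ℝ : ℝ) : ℂ) *
          fderiv ℝ (fderiv ℝ Ψ) x x (stdOrthonormalBasis ℝ V j) -
        ((⟪spinInv ϑ t x, ϑ.toFun v⟫_ℝ : ℝ) : ℂ) * hess Ψ x
          (spinInv ϑ t (stdOrthonormalBasis ℝ V j)) (stdOrthonormalBasis ℝ V j) := by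
    intro j
    have h1 := congrArg (fun z => fderiv ℝ (fderiv ℝ Ψ) x z (stdOrthonormalBasis ℝ V j))
      (h.rank_smul_symb (ϑ := ϑ) x v (stdOrthonormalBasis ℝ V j))
    simp only [map_add, map_sub, map_smul, add_apply, sub_apply, smul_apply,
      Complex.real_smul] at h1
    rw [hess_eq hU hΨ hx, hess_eq hU hΨ hx, ← h1]
    norm_num
  rw [besselOp_eq, mul_add, Finset.mul_sum, Finset.sum_congr rfl fun j _ => e j,
    Finset.sum_sub_distrib, Finset.sum_add_distrib, ← Finset.mul_sum, sum_inner_mul,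
    sum_inner_mul, hess_eq hU hΨ hx, snd_symm hU hΨ hx (ϑ.toFun v) x]
  push_cast
  ring

end IsSpin

end SpinEuclid

end MinRep.JordanAlgebra

/-! ### The structure constants of `ℝ^{p,q}`. -/

namespace MinRep.JordanAlgebra

variable {V : Type*} [NormedAddCommGroup V] [InnerProductSpace ℝ V] [FiniteDimensional ℝ V]
variable {J : JordanAlgebra V} {ϑ : CartanInvolution J}

theorem IsSpin.splitRank_le_two {t : V →ₗ[ℝ] ℝ} (h : IsSpin J t) : splitRank J ϑ ≤ 2 := by
  refine rank_le_two fun x => ?_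
  obtain ⟨a, b, hab⟩ := h.mul_self x
  exact ⟨a, b, Subtype.ext hab⟩

namespace IsJordanFrame

variable {c : Fin (splitRank J ϑ) → V} (hc : IsJordanFrame J ϑ c)
include hc

theorem inner_eq_zero {i j} (hij : i ≠ j) : ⟪c i, c j⟫_ℝ = 0 := by
  rw [ϑ.inner_eq, hc.theta, τ, hc.orth i j hij, tr, L, map_zero, map_zero, mul_zero]

theorem linearIndependent : LinearIndependent ℝ c :=
  linearIndependent_of_ne_zero_of_inner_eq_zero hc.ne_zero fun _ _ hij => hc.inner_eq_zero hij

theorem span_le_plusSpace : Submodule.span ℝ (Set.range c) ≤ plusSpace J ϑ := by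
  rw [Submodule.span_le]
  rintro _ ⟨i, rfl⟩
  exact hc.mem i

theorem finrank_span : finrank ℝ (Submodule.span ℝ (Set.range c)) = splitRank J ϑ := by
  rw [finrank_span_eq_card hc.linearIndependent, Fintype.card_fin]

theorem splitRank_le_finrank : splitRank J ϑ ≤ finrank ℝ (plusSpace J ϑ) :=
  hc.finrank_span ▸ Submodule.finrank_mono hc.span_le_plusSpace

theorem finrank_plusSpace_of_splitRank (h : splitRank J ϑ = 1) :
    finrank ℝ (plusSpace J ϑ) = 1 := by
  have i : Fin (splitRank J ϑ) := ⟨0, by omega⟩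
  rw [← hc.finrank_diag_plus i, show peirce J ϑ c i i = ⊤ from eq_top_iff.2 fun x _ => by
    rw [hc.mem_peirce_self, hc.eq_one_of_splitRank h, J.one_mul], top_inf_eq]

section Spin

variable {t : V →ₗ[ℝ] ℝ} (h : IsSpin J t) (h2 : splitRank J ϑ = 2)
include h h2

theorem t_eq_half [Nontrivial V] (hs : (plus J ϑ).IsSimple) (i) : t (c i) = 1 / 2 := by
  have h1 := hc.tr_eq hs i
  have hr := rank_pos ϑ
  rw [h.tr, h2] at h1
  field_simp at h1 ⊢
  push_cast at h1
  linarith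

theorem finrank_diag_eq_one [Nontrivial V] (hs : (plus J ϑ).IsSimple) (i) :
    finrank ℝ (peirce J ϑ c i i) = 1 := by
  refine finrank_eq_one (⟨c i, hc.mem_peirce_self.2 (hc.idem i)⟩) ?_ ?_
  · exact fun h => hc.ne_zero i (congrArg Subtype.val h)
  · rintro ⟨x, hx⟩
    rw [hc.mem_peirce_self] at hx
    have h3 := h.mul_eq (c i) x
    rw [hx, hc.t_eq_half h h2 hs] at h3
    have h4 := congrArg (J.mul (c i)) h3
    simp only [map_add, map_smul, hx, hc.idem, J.mul_comm (c i) J.one, J.one_mul] at h4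
    refine ⟨2 * (t x + (t x - 2 * (1 / 2 * t x))), Subtype.ext ?_⟩
    change (2 * (t x + (t x - 2 * (1 / 2 * t x)))) • c i = x
    linear_combination (norm := module) (-2 : ℝ) • h4

/-- If `x` is orthogonal to both idempotents then `t(c_k x) = 0`, hence `t(x) = 0`, and the spin
product formula gives `c_k x = x/2`. -/
theorem peirce_eq_orthogonal [Nontrivial V] (hs : (plus J ϑ).IsSimple) {i j} (hij : i ≠ j) :
    peirce J ϑ c i j = (Submodule.span ℝ (Set.range c))ᗮ := by
  have hij' : ∀ k, k = i ∨ k = j := fun k => by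
    have : (i : ℕ) ≠ j := fun e => hij (Fin.ext e)
    have h3 := k.2
    have h4 := i.2
    have h5 := j.2
    rcases (by omega : (k : ℕ) = i ∨ (k : ℕ) = j) with e | e
    · exact Or.inl (Fin.ext e)
    · exact Or.inr (Fin.ext e)
  ext x
  have hmem : x ∈ (Submodule.span ℝ (Set.range c))ᗮ ↔ ∀ k, ⟪c k, x⟫_ℝ = 0 := by
    rw [Submodule.mem_orthogonal]
    refine ⟨fun hx k => hx _ (Submodule.subset_span ⟨k, rfl⟩), fun hx u hu => ?_⟩
    refine Submodule.span_induction (p := fun u _ => ⟪u, x⟫_ℝ = 0) ?_ ?_ ?_ ?_ hu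
    · rintro _ ⟨k, rfl⟩
      exact hx k
    · exact inner_zero_left x
    · intro a b _ _ ha hb
      rw [inner_add_left, ha, hb, add_zero]
    · intro s a _ ha
      rw [real_inner_smul_left, ha, mul_zero]
  rw [hmem, hc.mem_peirce_of_ne hij]
  constructor
  · rintro ⟨h3, h4⟩
    have key : ∀ k, J.mul (c k) x = (1 / 2 : ℝ) • x → ⟪c k, x⟫_ℝ = 0 := by
      intro k hk
      have h5 := inner_mul_of_plus (hc.theta k) (c k) x
      rw [hc.idem, hk, inner_smul_right] at h5
      linarith
    intro k
    rcases hij' k with rfl | rfl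
    exacts [key _ h3, key _ h4]
  · intro hx
    have hr := rank_pos ϑ
    have h3 : ∀ k, t (J.mul (c k) x) = 0 := by
      intro k
      have := hx k
      rw [real_inner_comm, h.inner_eq ϑ, hc.theta, J.mul_comm] at this
      exact (mul_eq_zero.1 this).resolve_left hr.ne'
    have h4 : t x = 0 := by
      rw [← hc.sum_mul x, map_sum]
      exact Finset.sum_eq_zero fun k _ => h3 k
    have h5 : ∀ k, J.mul (c k) x = (1 / 2 : ℝ) • x := fun k => by
      conv_lhs => rw [h.mul_eq (c k) x]
      rw [h3, h4, hc.t_eq_half h h2 hs]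
      module
    exact ⟨h5 i, h5 j⟩

theorem constants_of_isSpin [Nontrivial V] (hs : (plus J ϑ).IsSimple) :
    dConst J ϑ c + 2 = finrank ℝ V ∧ d₀Const J ϑ c + 2 = finrank ℝ (plusSpace J ϑ) ∧
      eConst J ϑ c = 0 := by
  have hlt : 1 < splitRank J ϑ := by omega
  have hne : (⟨0, Nat.lt_trans Nat.zero_lt_one hlt⟩ : Fin (splitRank J ϑ)) ≠ ⟨1, hlt⟩ :=
    fun e => by simpa using congrArg Fin.val e
  rw [dConst, dif_pos hlt, d₀Const, dif_pos hlt, hc.eConst_eq, hc.finrank_diag_eq_one h h2 hs,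
    hc.peirce_eq_orthogonal h h2 hs hne]
  refine ⟨?_, ?_, rfl⟩
  · rw [← Submodule.finrank_add_finrank_orthogonal (Submodule.span ℝ (Set.range c)),
      hc.finrank_span]
    omega
  · rw [← Submodule.finrank_add_inf_finrank_orthogonal hc.span_le_plusSpace,
      hc.finrank_span]
    omega

/-- The spin formula for `P(x)ϑx` contains the multiple `t(x²) - 2t(x)²` of `spinInv x`, which must
vanish by `P_theta_self`. Thus the orbit lies in the null cone of the involution. -/
theorem inner_spinInv_self [Nontrivial V] (hs : (plus J ϑ).IsSimple) {x : V}
    (hx : x ∈ 𝒪 J ϑ c) : ⟪x, spinInv ϑ t x⟫_ℝ = 0 := by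
  have hx0 := hc.ne_zero_of_mem hx
  have h3 := hc.P_theta_self hs _ (hc.mem_orbit ⟨x, hx⟩)
  have hr := rank_pos ϑ
  rw [← P₂_self, h.P₂_apply, scale, h2, h.theta, ← spinInv_apply, ← two_smul ℝ] at h3
  have h4 : t (J.mul x (ϑ.toFun x)) = ‖x‖ ^ 2 / J.rank := by
    rw [← real_inner_self_eq_norm_sq, h.inner_eq ϑ]
    field_simp
  rw [h4, smul_smul, show 2 * (‖x‖ ^ 2 / (J.rank : ℝ)) = ‖x‖ ^ 2 / (J.rank / (2 : ℕ)) by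
    push_cast; field_simp, sub_eq_self, smul_eq_zero] at h3
  rw [h.inner_spinInv]
  refine h3.elim (fun e => by rw [e, mul_zero]) fun e => absurd ?_ hx0
  rw [← h.spinInv_spinInv (ϑ := ϑ) x, e, map_zero]

end Spin

theorem splitRank_of_isRpq [Nontrivial V] {p q : ℕ} (h : J.IsRpq p q) :
    splitRank J ϑ = if q = 0 then 1 else 2 := by
  obtain ⟨t, ht, -⟩ := h.exists_isSpin
  have h1 := ht.splitRank_le_two (ϑ := ϑ)
  have h2 := (h.finrank_plusSpace ϑ).1
  have h3 := hc.splitRank_le_finrank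
  have h4 := hc.splitRank_pos
  have h5 := hc.finrank_plusSpace_of_splitRank
  split_ifs with hq
  · omega
  · rcases (by omega : splitRank J ϑ = 1 ∨ splitRank J ϑ = 2) with e | e
    · have := h5 e
      omega
    · exact e

/-- The constants of `ℝ^{p,q}`. -/
theorem ν_of_isRpq [Nontrivial V] (hs : (plus J ϑ).IsSimple) {p q : ℕ} (h : J.IsRpq p q)
    (hq : q ≠ 0) : (dConst J ϑ c : ℤ) = p + q - 2 ∧ ν J ϑ c = min (p : ℤ) q - 2 := by
  obtain ⟨t, ht, -⟩ := h.exists_isSpin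
  have h2 := hc.splitRank_of_isRpq h
  rw [if_neg hq] at h2
  obtain ⟨h3, h4, h5⟩ := hc.constants_of_isSpin ht h2 hs
  rw [h.finrank_eq] at h3
  rw [(h.finrank_plusSpace ϑ).1] at h4
  rw [ν, h5]
  omega

end IsJordanFrame

end MinRep.JordanAlgebra

namespace MinRep.JordanAlgebra

/-! ### Harmonic polynomials on the range of a projection. -/

section Harmonic

variable {V : Type*} [NormedAddCommGroup V] [InnerProductSpace ℝ V] [FiniteDimensional ℝ V]

theorem IsHomPoly.fderiv_aux {m : ℕ} {F : V → ℂ} (h : IsHomPoly m F) (a : V) :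
    (m = 0 → ∀ x, fderiv ℝ F x a = 0) ∧
      ∀ n, m = n + 1 → IsHomPoly n fun x => fderiv ℝ F x a := by
  induction h with
  | const z =>
    exact ⟨fun _ x => by simp, fun n hn => by omega⟩
  | zero m => exact ⟨fun _ x => by simp, fun n _ => by simpa using IsHomPoly.zero n⟩
  | @add m F G hF hG ihF ihG =>
    have e : ∀ x, fderiv ℝ (fun y => F y + G y) x a = fderiv ℝ F x a + fderiv ℝ G x a := fun x => by
      rw [fderiv_fun_add (hF.differentiable x) (hG.differentiable x)]; rfl
    refine ⟨fun hm x => ?_, fun n hn => ?_⟩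
    · rw [e, ihF.1 hm, ihG.1 hm, add_zero]
    · simp only [e]
      exact (ihF.2 n hn).add (ihG.2 n hn)
  | @inner_mul m u F hF ih =>
    have e : ∀ x, fderiv ℝ (fun y => ((⟪y, u⟫_ℝ : ℝ) : ℂ) * F y) x a =
        ((⟪x, u⟫_ℝ : ℝ) : ℂ) * fderiv ℝ F x a + ((⟪a, u⟫_ℝ : ℝ) : ℂ) * F x := fun x =>
      fderiv_inner_mul (hF.differentiable x) u a
    refine ⟨fun hm => by omega, fun n hn => ?_⟩
    obtain rfl : m = n := by omega
    simp only [e]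
    refine IsHomPoly.add ?_ (hF.const_mul _)
    rcases m with _ | m
    · simp only [ih.1 rfl, mul_zero]
      exact IsHomPoly.zero 0
    · exact (ih.2 m rfl).inner_mul u

theorem IsHomPoly.fderiv_succ {m : ℕ} {F : V → ℂ} (h : IsHomPoly (m + 1) F) (a : V) :
    IsHomPoly m fun x => fderiv ℝ F x a := (h.fderiv_aux a).2 m rfl

theorem IsHomPoly.fderiv_eq_zero {F : V → ℂ} (h : IsHomPoly 0 F) (x a : V) :
    fderiv ℝ F x a = 0 := (h.fderiv_aux a).1 rfl x

/-- Euler's identity. -/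
theorem IsHomPoly.euler {m : ℕ} {F : V → ℂ} (h : IsHomPoly m F) (x : V) :
    fderiv ℝ F x x = m * F x := by
  induction h with
  | const z => simp
  | zero m => simp
  | @add m F G hF hG ihF ihG =>
    rw [fderiv_fun_add (hF.differentiable x) (hG.differentiable x), add_apply, ihF, ihG]
    ring
  | @inner_mul m u F hF ih =>
    rw [fderiv_inner_mul (hF.differentiable x), ih]
    push_cast
    ring

/-- Differentiate Euler's identity. -/
theorem IsHomPoly.hess_self {m : ℕ} {F : V → ℂ} (h : IsHomPoly m F) (x a : V) :
    hess F x x a = (m - 1) * fderiv ℝ F x a := by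
  have hs := h.smooth Set.univ
  have h1 := hasFDerivAt_D isOpen_univ hs (ContinuousLinearMap.id ℝ V) (Set.mem_univ x)
  have h2 := ((h.differentiable x).hasFDerivAt.const_mul (m : ℂ))
  simp only [ContinuousLinearMap.id_apply, h.euler] at h1
  have h3 := congrArg (fun f : V →L[ℝ] ℂ => f a) (h1.unique h2)
  simp only [add_apply, smul_apply, ContinuousLinearMap.comp_apply, ContinuousLinearMap.id_apply,
    ContinuousLinearMap.flip_apply, smul_eq_mul] at h3
  rw [hess_symm isOpen_univ hs trivial, hess_eq isOpen_univ hs trivial]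
  linear_combination h3

/-- The Laplacian in the directions of the range of `π`. -/
def lap (π : V →L[ℝ] V) (Ψ : V → ℂ) (x : V) : ℂ :=
  ∑ j, hess Ψ x (π (stdOrthonormalBasis ℝ V j)) (π (stdOrthonormalBasis ℝ V j))

/-- Harmonic homogeneous polynomials on the range of `π`. -/
structure IsHarm (π : V →L[ℝ] V) (k : ℕ) (φ : V → ℂ) : Prop where
  poly : IsHomPoly k φ
  comp : ∀ x, φ (π x) = φ x
  lap : ∀ x, lap π φ x = 0

variable {π : V →L[ℝ] V}

theorem lap_mul {U : Set V} (hU : IsOpen U) {Φ Ψ : V → ℂ} (hΦ : ContDiffOn ℝ ∞ Φ U)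
    (hΨ : ContDiffOn ℝ ∞ Ψ U) {x : V} (hx : x ∈ U) :
    lap π (fun y => Φ y * Ψ y) x = Φ x * lap π Ψ x + lap π Φ x * Ψ x +
      2 * ∑ j, fderiv ℝ Φ x (π (stdOrthonormalBasis ℝ V j)) *
        fderiv ℝ Ψ x (π (stdOrthonormalBasis ℝ V j)) := by
  simp only [lap]
  rw [Finset.sum_congr rfl fun j _ => hess_mul hU hΨ hΦ hx _ _, Finset.sum_add_distrib,
    Finset.sum_add_distrib, Finset.sum_add_distrib, ← Finset.mul_sum, ← Finset.sum_mul]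
  ring

variable (hπ : ∀ x, π (π x) = π x) (hsymm : ∀ x y, ⟪π x, y⟫_ℝ = ⟪x, π y⟫_ℝ)

section Sums

include hπ hsymm

theorem sum_inner_proj_mul (f : V →L[ℝ] ℂ) (x : V) :
    ∑ j, ((⟪x, π (stdOrthonormalBasis ℝ V j)⟫_ℝ : ℝ) : ℂ) *
      f (π (stdOrthonormalBasis ℝ V j)) = f (π x) := by
  have h := sum_inner_mul (f.comp π) (π x)
  simp only [ContinuousLinearMap.comp_apply, hπ, hsymm] at h
  exact h

theorem sum_inner_proj_sq (x : V) :
    ∑ j, ⟪x, π (stdOrthonormalBasis ℝ V j)⟫_ℝ * ⟪x, π (stdOrthonormalBasis ℝ V j)⟫_ℝ =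
      ‖π x‖ ^ 2 := by
  have h := sum_inner_proj_mul hπ hsymm (Complex.ofRealCLM.comp (innerSL ℝ x)) x
  simp only [ContinuousLinearMap.comp_apply, Complex.ofRealCLM_apply, innerSL_apply_apply] at h
  rw [← real_inner_self_eq_norm_sq, hsymm, hπ]
  exact_mod_cast h

end Sums

theorem fderiv_inner (a x b : V) :
    fderiv ℝ (fun y : V => ((⟪y, a⟫_ℝ : ℝ) : ℂ)) x b = ((⟪b, a⟫_ℝ : ℝ) : ℂ) := by
  rw [(hasFDerivAt_inner a x).fderiv]
  rfl

theorem hess_inner (u x a b : V) :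
    hess (fun y : V => ((⟪y, u⟫_ℝ : ℝ) : ℂ)) x a b = 0 := by
  simp only [hess, fderiv_inner]
  simp

theorem hasFDerivAt_quadratic (π : V →L[ℝ] V) (hsymm : ∀ x y, ⟪π x, y⟫_ℝ = ⟪x, π y⟫_ℝ) (x : V) :
    HasFDerivAt (fun y : V => ((⟪y, π y⟫_ℝ : ℝ) : ℂ))
      (Complex.ofRealCLM.comp ((2 : ℝ) • innerSL ℝ (π x))) x := by
  have h1 : HasFDerivAt (fun y : V => ⟪y, π y⟫_ℝ) ((2 : ℝ) • innerSL ℝ (π x)) x := by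
    refine ((hasFDerivAt_id x).inner ℝ π.hasFDerivAt).congr_fderiv ?_
    ext b
    simp only [fderivInnerCLM_apply, ContinuousLinearMap.comp_apply, ContinuousLinearMap.prod_apply,
      smul_apply, innerSL_apply_apply, ContinuousLinearMap.id_apply, id, smul_eq_mul]
    rw [hsymm x b, ← hsymm b x, real_inner_comm x (π b)]
    ring
  exact Complex.ofRealCLM.hasFDerivAt.comp x h1

section Quadratic

include hπ hsymm

theorem fderiv_quadratic (x b : V) :
    fderiv ℝ (fun y : V => ((⟪y, π y⟫_ℝ : ℝ) : ℂ)) x (π b) =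
      2 * ((⟪x, π b⟫_ℝ : ℝ) : ℂ) := by
  rw [(hasFDerivAt_quadratic π hsymm x).fderiv]
  simp only [ContinuousLinearMap.comp_apply, smul_apply, innerSL_apply_apply,
    Complex.ofRealCLM_apply, smul_eq_mul]
  rw [hsymm, hπ]
  push_cast
  ring

theorem lap_quadratic (x : V) : lap π (fun y : V => ((⟪y, π y⟫_ℝ : ℝ) : ℂ)) x =
    2 * ((∑ j, ⟪stdOrthonormalBasis ℝ V j, π (stdOrthonormalBasis ℝ V j)⟫_ℝ : ℝ) : ℂ) := by
  simp only [lap, hess, fderiv_quadratic hπ hsymm]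
  rw [Complex.ofReal_sum, Finset.mul_sum]
  refine Finset.sum_congr rfl fun j _ => ?_
  have h := (hasFDerivAt_inner (π (stdOrthonormalBasis ℝ V j)) x).const_mul (2 : ℂ)
  rw [h.fderiv]
  simp only [smul_apply, ContinuousLinearMap.comp_apply, ContinuousLinearMap.flip_apply,
    innerSL_apply_apply, Complex.ofRealCLM_apply, smul_eq_mul]
  rw [hsymm, hπ]

end Quadratic

namespace IsHarm

variable {k : ℕ} {φ : V → ℂ}

theorem fderiv_proj (h : IsHarm π k φ) (x b : V) : fderiv ℝ φ x b = fderiv ℝ φ (π x) (π b) := by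
  have h1 := (h.poly.differentiable (π x)).hasFDerivAt.comp x π.hasFDerivAt
  have e : φ ∘ π = φ := funext h.comp
  rw [e] at h1
  rw [h1.fderiv]
  rfl

include hπ in
/-- Directional derivatives of harmonic polynomials are harmonic. -/
theorem fderiv_succ (h : IsHarm π (k + 1) φ) {a : V} (ha : π a = a) :
    IsHarm π k fun x => fderiv ℝ φ x a := by
  have hs := h.poly.smooth Set.univ
  have hd : ∀ b, ContDiffOn ℝ ∞ (fun y => fderiv ℝ φ y b) Set.univ := fun b =>
    (smooth_fderiv isOpen_univ hs).clm_apply contDiffOn_const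
  refine ⟨h.poly.fderiv_succ a, fun x => ?_, fun x => ?_⟩
  · rw [h.fderiv_proj x a, ha]
  · have e1 : ∀ b, hess (fun y => fderiv ℝ φ y a) x b b =
        fderiv ℝ (fun y => hess φ y b b) x a := by
      intro b
      have e2 : (fun y => fderiv ℝ (fun z => fderiv ℝ φ z a) y b) =
          fun y => fderiv ℝ (fun z => fderiv ℝ φ z b) y a :=
        funext fun y => hess_symm isOpen_univ hs trivial b a
      change fderiv ℝ (fun y => fderiv ℝ (fun z => fderiv ℝ φ z a) y b) x b = _
      rw [e2]
      exact hess_symm isOpen_univ (hd b) (Set.mem_univ x) b a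
    have e3 : ∀ b, DifferentiableAt ℝ (fun y => hess φ y b b) x := fun b =>
      (smooth_hasFDerivAt isOpen_univ ((smooth_fderiv isOpen_univ (hd b)).clm_apply
        contDiffOn_const) (Set.mem_univ x)).differentiableAt
    have e4 : JordanAlgebra.lap π φ = fun _ => 0 := funext h.lap
    have e5 := congrArg (fun f : V → ℂ => fderiv ℝ f x a) e4
    simp only [fderiv_fun_const, Pi.zero_apply, zero_apply] at e5
    rw [← e5]
    unfold JordanAlgebra.lap
    rw [fderiv_fun_sum fun j _ => e3 _, sum_apply]
    exact Finset.sum_congr rfl fun j _ => e1 _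

include hπ hsymm in
theorem lap_inner_mul (h : IsHarm π k φ) {a : V} (ha : π a = a) (x : V) :
    JordanAlgebra.lap π (fun y => ((⟪y, a⟫_ℝ : ℝ) : ℂ) * φ y) x = 2 * fderiv ℝ φ x a := by
  rw [lap_mul isOpen_univ (smooth_inner a _) (h.poly.smooth _) (Set.mem_univ x), h.lap]
  have e : JordanAlgebra.lap π (fun y : V => ((⟪y, a⟫_ℝ : ℝ) : ℂ)) x = 0 :=
    Finset.sum_eq_zero fun j _ => hess_inner _ _ _ _
  simp only [e, fderiv_inner]
  simp only [real_inner_comm a]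
  rw [sum_inner_proj_mul hπ hsymm, ha]
  ring

include hπ hsymm in
theorem lap_quadratic_mul (h : IsHarm π k φ) (x : V) :
    JordanAlgebra.lap π (fun y => ((⟪y, π y⟫_ℝ : ℝ) : ℂ) * φ y) x =
      (2 * ((∑ j, ⟪stdOrthonormalBasis ℝ V j, π (stdOrthonormalBasis ℝ V j)⟫_ℝ : ℝ) : ℂ) +
        4 * k) * φ x := by
  rw [lap_mul isOpen_univ ((IsHomPoly.quadratic π).smooth _) (h.poly.smooth _) (Set.mem_univ x),
    h.lap, lap_quadratic hπ hsymm]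
  simp only [fderiv_quadratic hπ hsymm, mul_assoc]
  rw [← Finset.mul_sum, sum_inner_proj_mul hπ hsymm, h.fderiv_proj, hπ, h.poly.euler, h.comp]
  ring

/-- The harmonic projection of `(x|a) φ(x)`. -/
def raise (π : V →L[ℝ] V) (φ : V → ℂ) (α : ℝ) (a x : V) : ℂ :=
  ((⟪x, a⟫_ℝ : ℝ) : ℂ) * φ x -
    ((1 / (2 * α) : ℝ) : ℂ) * (((⟪x, π x⟫_ℝ : ℝ) : ℂ) * fderiv ℝ φ x a)

include hπ hsymm in
-- The Laplacian of `(x|a)φ` is `2∂_aφ` and that of `‖πx‖² ∂_aφ` is `4α ∂_aφ`, which explains the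
-- coefficient `1/(2α)`. For `k = 0` the derivative is zero, so `α` may vanish.
theorem isHarm_raise (h : IsHarm π k φ) {a : V} (ha : π a = a) {α : ℝ}
    (hα : 2 * α = (∑ j, ⟪stdOrthonormalBasis ℝ V j, π (stdOrthonormalBasis ℝ V j)⟫_ℝ) - 2 + 2 * k)
    (hα0 : k ≠ 0 → α ≠ 0) : IsHarm π (k + 1) (raise π φ α a) := by
  have hone : ∀ x, ((⟪π x, a⟫_ℝ : ℝ) : ℂ) * φ (π x) = ((⟪x, a⟫_ℝ : ℝ) : ℂ) * φ x := fun x => by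
    rw [hsymm, ha, h.comp]
  rcases k with _ | k
  · have e : raise π φ α a = fun x => ((⟪x, a⟫_ℝ : ℝ) : ℂ) * φ x := by
      funext x
      rw [raise, h.poly.fderiv_eq_zero, mul_zero, mul_zero, sub_zero]
    rw [e]
    refine ⟨h.poly.inner_mul a, hone, fun x => ?_⟩
    rw [h.lap_inner_mul hπ hsymm ha, h.poly.fderiv_eq_zero, mul_zero]
  · have h' := h.fderiv_succ hπ ha
    have hp : IsHomPoly (k + 2) fun x => ((⟪x, π x⟫_ℝ : ℝ) : ℂ) * fderiv ℝ φ x a := by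
      rw [_root_.add_comm k 2]
      exact (IsHomPoly.quadratic π).mul h'.poly
    have e : raise π φ α a = fun x => ((⟪x, a⟫_ℝ : ℝ) : ℂ) * φ x +
        ((-(1 / (2 * α)) : ℝ) : ℂ) * (((⟪x, π x⟫_ℝ : ℝ) : ℂ) * fderiv ℝ φ x a) := by
      funext x
      rw [raise]
      push_cast
      ring
    rw [e]
    refine ⟨(h.poly.inner_mul a).add (hp.const_mul _), fun x => ?_, fun x => ?_⟩
    · rw [hone, h'.comp, hsymm, hπ, hπ]
    · have hα' := hα0 (Nat.succ_ne_zero k)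
      simp only [JordanAlgebra.lap]
      rw [Finset.sum_congr rfl fun j _ => hess_add isOpen_univ ((hp.const_mul _).smooth _)
        ((h.poly.inner_mul a).smooth _) (Set.mem_univ x) _ _,
        Finset.sum_add_distrib, Finset.sum_congr rfl fun j _ =>
          hess_const_mul isOpen_univ (hp.smooth _) _ (Set.mem_univ x) _ _, ← Finset.mul_sum]
      have e1 := h.lap_inner_mul hπ hsymm ha x
      have e2 := h'.lap_quadratic_mul hπ hsymm x
      simp only [JordanAlgebra.lap] at e1 e2
      rw [e1, e2]
      have e3 : (∑ j, ⟪stdOrthonormalBasis ℝ V j, π (stdOrthonormalBasis ℝ V j)⟫_ℝ) =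
          2 * α - 2 * k := by
        push_cast at hα
        linarith
      have e4 : (α : ℂ) ≠ 0 := by exact_mod_cast hα'
      rw [e3]
      push_cast
      field_simp
      ring

end IsHarm

end Harmonic

end MinRep.JordanAlgebra

namespace MinRep.JordanAlgebra

/-! ### Bessel functions times harmonic polynomials. -/

section RadialHarmonic

variable {V : Type*} [NormedAddCommGroup V] [InnerProductSpace ℝ V] [FiniteDimensional ℝ V]

/-- The product of a radial Bessel function and `φ`. -/
def besselMul (r α : ℝ) (φ : V → ℂ) (x : V) : ℂ := radialExt (besselSq α) r x * φ x

theorem besselSq_rec_ext {r : ℝ} (hr : 0 < r) (α : ℝ) {x : V} (hx : x ≠ 0) :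
    ((r * ‖x‖ ^ 2 : ℝ) : ℂ) / 4 * radialExt (besselSq (α + 1)) r x =
      α * radialExt (besselSq α) r x + radialExt (besselSq (α - 1)) r x := by
  have h := besselSq_rec α (mul_pos hr (pow_pos (norm_pos_iff.2 hx) 2))
  simp only [radialExt]
  exact_mod_cast h

variable {π : V →L[ℝ] V} {k : ℕ} {φ : V → ℂ} {r α : ℝ} (hr : 0 < r)

include hr

theorem smooth_besselMul (h : IsHomPoly k φ) :
    ContDiffOn ℝ ∞ (besselMul r α φ) {0}ᶜ :=
  (smooth_radialExt hr (smooth_besselSq α)).mul (h.smooth _)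

theorem fderiv_besselMul (h : IsHomPoly k φ) {x : V} (hx : x ≠ 0) (a : V) :
    fderiv ℝ (besselMul r α φ) x a = radialExt (besselSq α) r x * fderiv ℝ φ x a -
      (r : ℂ) / 2 * ((⟪x, a⟫_ℝ : ℝ) : ℂ) * radialExt (besselSq (α + 1)) r x * φ x := by
  have h1 := smooth_hasFDerivAt isOpen_compl_singleton (smooth_radialExt hr (smooth_besselSq α))
    (show x ∈ ({0}ᶜ : Set V) from hx)
  have h2 := h1.mul (h.differentiable x).hasFDerivAt
  have e : besselMul r α φ = radialExt (besselSq α) r * φ := rfl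
  rw [e, h2.fderiv]
  simp only [add_apply, smul_apply, smul_eq_mul, fderiv_radialExt_besselSq hr α hx]
  push_cast
  ring

theorem hess_besselMul (h : IsHomPoly k φ) {x : V} (hx : x ≠ 0) (a : V) :
    hess (besselMul r α φ) x x a =
      ((r : ℂ) * (((r * ‖x‖ ^ 2 : ℝ) : ℂ) / 4) * radialExt (besselSq (α + 2)) r x -
        (r : ℂ) / 2 * (1 + k) * radialExt (besselSq (α + 1)) r x) *
          ((⟪x, a⟫_ℝ : ℝ) : ℂ) * φ x +
      ((k - 1) * radialExt (besselSq α) r x -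
        ((r * ‖x‖ ^ 2 : ℝ) : ℂ) / 2 * radialExt (besselSq (α + 1)) r x) * fderiv ℝ φ x a := by
  have e : besselMul r α φ = fun y => radialExt (besselSq α) r y * φ y := rfl
  rw [e, hess_mul isOpen_compl_singleton (h.smooth _) (smooth_radialExt hr (smooth_besselSq α))
    (show x ∈ ({0}ᶜ : Set V) from hx), h.hess_self, h.euler, hess_radialExt_besselSq hr α hx,
    fderiv_radialExt_besselSq hr α hx, fderiv_radialExt_besselSq hr α hx,
    real_inner_self_eq_norm_sq]
  simp only [radialExt]
  push_cast
  ring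

/-- With `2α = m - 2 + 2k`, `m` the rank of `π`, the radial equation is the modified Bessel
equation, in the form of the recurrence at `α + 1`. -/
theorem lap_besselMul (hπ : ∀ x, π (π x) = π x) (hsymm : ∀ x y, ⟪π x, y⟫_ℝ = ⟪x, π y⟫_ℝ)
    (h : IsHarm π k φ)
    (hα : 2 * α = (∑ j, ⟪stdOrthonormalBasis ℝ V j, π (stdOrthonormalBasis ℝ V j)⟫_ℝ) - 2 + 2 * k)
    {x : V} (hx : x ≠ 0) (hπx : π x = x) :
    lap π (besselMul r α φ) x = r * besselMul r α φ x := by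
  have e : besselMul r α φ = fun y => radialExt (besselSq α) r y * φ y := rfl
  have h1 : ∑ j, fderiv ℝ (radialExt (besselSq α) r) x (π (stdOrthonormalBasis ℝ V j)) *
      fderiv ℝ φ x (π (stdOrthonormalBasis ℝ V j)) =
      ((-(r / 2) : ℝ) : ℂ) * radialExt (besselSq (α + 1)) r x * (k * φ x) := by
    have h0 := sum_inner_proj_mul hπ hsymm (fderiv ℝ φ x) x
    rw [hπx] at h0
    rw [← h.poly.euler x, ← h0, Finset.mul_sum]
    refine Finset.sum_congr rfl fun j _ => ?_
    rw [fderiv_radialExt_besselSq hr α hx]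
    ring
  have h2 : lap π (radialExt (besselSq α) r) x =
      ((r ^ 2 / 4 * besselSq (α + 2) (r * ‖x‖ ^ 2) * ‖x‖ ^ 2 -
        r / 2 * besselSq (α + 1) (r * ‖x‖ ^ 2) * (2 * α + 2 - 2 * k) : ℝ) : ℂ) := by
    have e3 : ∀ j, ⟪π (stdOrthonormalBasis ℝ V j), π (stdOrthonormalBasis ℝ V j)⟫_ℝ =
        ⟪stdOrthonormalBasis ℝ V j, π (stdOrthonormalBasis ℝ V j)⟫_ℝ := fun j => by
      rw [hsymm, hπ]
    have e4 := sum_inner_proj_sq hπ hsymm x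
    rw [hπx] at e4
    simp only [lap]
    rw [Finset.sum_congr rfl fun j _ => hess_radialExt_besselSq hr α hx _ _, ← Complex.ofReal_sum,
      Finset.sum_sub_distrib, ← Finset.mul_sum, ← Finset.mul_sum, e4,
      Finset.sum_congr rfl fun j _ => e3 j, hα]
    congr 1
    ring
  have h3 := besselSq_rec_ext hr (α + 1) hx
  rw [show α + 1 + 1 = α + 2 by ring, add_sub_cancel_right] at h3
  rw [e, lap_mul isOpen_compl_singleton (smooth_radialExt hr (smooth_besselSq α))
    (h.poly.smooth _) (show x ∈ ({0}ᶜ : Set V) from hx), h.lap, h1, h2]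
  simp only [radialExt] at h3 ⊢
  push_cast at h3 ⊢
  linear_combination (r : ℂ) * φ x * h3

/-- The combination of derivatives appearing in the Bessel operator of a spin factor. -/
theorem bracket_besselMul (hπ : ∀ x, π (π x) = π x)
    (hsymm : ∀ x y, ⟪π x, y⟫_ℝ = ⟪x, π y⟫_ℝ) (h : IsHarm π k φ)
    (hα : 2 * α = (∑ j, ⟪stdOrthonormalBasis ℝ V j, π (stdOrthonormalBasis ℝ V j)⟫_ℝ) - 2 + 2 * k)
    (hα0 : k ≠ 0 → α ≠ 0) {x : V} (hx : x ≠ 0) (hπx : π x = x) (a : V) (y δ : ℝ) :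
    2 * hess (besselMul r α φ) x x a -
        ((2 * ⟪x, a⟫_ℝ - y : ℝ) : ℂ) * lap π (besselMul r α φ) x +
        ((4 * α + 2 - 2 * k + δ : ℝ) : ℂ) * fderiv ℝ (besselMul r α φ) x a =
      r * (y * besselMul r α φ x) +
        ((-(r * δ / 2) : ℝ) : ℂ) * besselMul r (α + 1) (IsHarm.raise π φ α a) x +
        ((-(4 + δ / α) : ℝ) : ℂ) * besselMul r (α - 1) (fun y => fderiv ℝ φ y a) x := by
  rw [lap_besselMul hr hπ hsymm h hα hx hπx, hess_besselMul hr h.poly hx,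
    fderiv_besselMul hr h.poly hx]
  have h3 := besselSq_rec_ext hr (α + 1) hx
  rw [show α + 1 + 1 = α + 2 by ring, add_sub_cancel_right] at h3
  have h4 := besselSq_rec_ext hr α hx
  simp only [besselMul, IsHarm.raise, hπx, real_inner_self_eq_norm_sq]
  rcases eq_or_ne k 0 with rfl | hk
  -- In degree zero every term containing a derivative of `φ` drops out, including the one with the
  -- possibly meaningless `δ/α`.
  · rw [h.poly.fderiv_eq_zero]
    push_cast at h3 ⊢
    linear_combination 2 * (r : ℂ) * ((⟪x, a⟫_ℝ : ℝ) : ℂ) * φ x * h3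
  · have hα1 : (α : ℂ) ≠ 0 := by exact_mod_cast hα0 hk
    push_cast at h3 h4 ⊢
    have e : ((1 : ℂ) / (2 * α)) = (α : ℂ)⁻¹ / 2 := by field_simp
    have e' : (δ : ℂ) / α = δ * (α : ℂ)⁻¹ := rfl
    have e'' : (α : ℂ) * (α : ℂ)⁻¹ = 1 := mul_inv_cancel₀ hα1
    rw [e, e']
    linear_combination 2 * (r : ℂ) * ((⟪x, a⟫_ℝ : ℝ) : ℂ) * φ x * h3 -
      (4 + δ * (α : ℂ)⁻¹) * fderiv ℝ φ x a * h4 -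
      δ * radialExt (besselSq α) r x * fderiv ℝ φ x a * e''

end RadialHarmonic

section Spin

variable {V : Type*} [NormedAddCommGroup V] [InnerProductSpace ℝ V] [FiniteDimensional ℝ V]
variable {J : JordanAlgebra V} {ϑ : CartanInvolution J} {t : V →ₗ[ℝ] ℝ}

/-- The Bessel operator of a spin factor on products of Bessel functions and harmonic
polynomials. -/
theorem IsSpin.besselOp_besselMul [Nontrivial V] (h : IsSpin J t) {π : V →L[ℝ] V}
    (hπ : ∀ x, π (π x) = π x) (hsymm : ∀ x y, ⟪π x, y⟫_ℝ = ⟪x, π y⟫_ℝ) {ε : ℝ} (hε : ε * ε = 1)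
    (hS : ∀ x, spinInv ϑ t x = ε • ((2 : ℝ) • π x - x)) {k : ℕ} {φ : V → ℂ} (hφ : IsHarm π k φ)
    {α δ lam : ℝ}
    (hα : 2 * α = (∑ j, ⟪stdOrthonormalBasis ℝ V j, π (stdOrthonormalBasis ℝ V j)⟫_ℝ) - 2 + 2 * k)
    (hα0 : k ≠ 0 → α ≠ 0) (hlam : J.rank * lam = 4 * α + 2 - 2 * k + δ) (v : V) {x : V}
    (hx : π x ≠ 0) :
    besselOp J ϑ lam v (fun y => besselMul J.rank α φ (π y)) x =
      ((⟪x, ϑ.toFun v⟫_ℝ : ℝ) : ℂ) * besselMul J.rank α φ (π x) +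
        ((-(δ / 2) : ℝ) : ℂ) *
          besselMul J.rank (α + 1) (IsHarm.raise π φ α (π (ϑ.toFun v))) (π x) +
        ((-((4 + δ / α) / J.rank) : ℝ) : ℂ) *
          besselMul J.rank (α - 1) (fun y => fderiv ℝ φ y (π (ϑ.toFun v))) (π x) := by
  have hr := rank_pos ϑ
  have hr' : ((J.rank : ℝ) : ℂ) ≠ 0 := by exact_mod_cast hr.ne'
  have hF := smooth_besselMul (α := α) hr hφ.poly
  have hU : IsOpen {y : V | π y ≠ 0} := isOpen_compl_singleton.preimage π.continuous
  have hΨ : ContDiffOn ℝ ∞ (fun y => besselMul J.rank α φ (π y)) {y : V | π y ≠ 0} :=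
    hF.comp π.contDiff.contDiffOn fun y hy => hy
  have hd : ∀ b, fderiv ℝ (fun y => besselMul J.rank α φ (π y)) x b =
      fderiv ℝ (besselMul J.rank α φ) (π x) (π b) := fun b => by
    have := (smooth_hasFDerivAt isOpen_compl_singleton hF hx).comp x π.hasFDerivAt
    rw [show (fun y => besselMul (J.rank : ℝ) α φ (π y)) = besselMul (J.rank : ℝ) α φ ∘ π from rfl,
      this.fderiv]
    rfl
  have hh : ∀ a b, hess (fun y => besselMul J.rank α φ (π y)) x a b =
      hess (besselMul J.rank α φ) (π x) (π a) (π b) := fun a b =>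
    hess_comp isOpen_compl_singleton hF π hx a b
  have hsum : ∑ j, hess (fun y => besselMul J.rank α φ (π y)) x
      (spinInv ϑ t (stdOrthonormalBasis ℝ V j)) (stdOrthonormalBasis ℝ V j) =
      ε * lap π (besselMul J.rank α φ) (π x) := by
    rw [lap, Finset.mul_sum]
    refine Finset.sum_congr rfl fun j _ => ?_
    -- The involution is the scalar `ε` on the range of `π`, so its Laplacian becomes `ε` times the
    -- ordinary one there.
    have e : π (spinInv ϑ t (stdOrthonormalBasis ℝ V j)) = ε • π (stdOrthonormalBasis ℝ V j) := by
      rw [hS, map_smul, map_sub, map_smul, hπ]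
      module
    rw [hh, e, hess_eq isOpen_compl_singleton hF hx, hess_eq isOpen_compl_singleton hF hx,
      map_smul, smul_apply, Complex.real_smul]
  have h1 := h.rank_mul_besselOp (ϑ := ϑ) hU hΨ lam v hx
  rw [hsum, hh, hd, hS, real_inner_smul_left, inner_sub_left, real_inner_smul_left, hlam] at h1
  have h2 := bracket_besselMul hr hπ hsymm hφ hα hα0 hx (hπ x) (π (ϑ.toFun v))
    ⟪x, ϑ.toFun v⟫_ℝ δ
  rw [← hsymm (π x), hπ] at h2
  have hε' : (ε : ℂ) * ε = 1 := by exact_mod_cast hε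
  apply mul_left_cancel₀ hr'
  push_cast at h1 h2 ⊢
  have h3 : (J.rank : ℂ) ≠ 0 := by exact_mod_cast hr.ne'
  have e : ∀ z : ℂ, (J.rank : ℂ) * (-(z / J.rank)) = -z := fun z => by field_simp
  rw [mul_add, mul_add, ← mul_assoc (J.rank : ℂ) (-((4 + (δ : ℂ) / α) / J.rank)), e]
  linear_combination h1 + h2 - (2 * ((⟪π x, ϑ.toFun v⟫_ℝ : ℝ) : ℂ) - ((⟪x, ϑ.toFun v⟫_ℝ : ℝ) : ℂ)) *
    lap π (besselMul J.rank α φ) (π x) * hε'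

end Spin

end MinRep.JordanAlgebra

/-! ### The algebras `ℝ^{p,q}` and the rank-three integrability bound. -/

namespace MinRep.JordanAlgebra

variable {V : Type*} [NormedAddCommGroup V] [InnerProductSpace ℝ V] [FiniteDimensional ℝ V]
variable {J : JordanAlgebra V} {ϑ : CartanInvolution J}

theorem IsHarm.one (π : V →L[ℝ] V) : IsHarm π 0 fun _ => 1 := by
  refine ⟨IsHomPoly.const 1, fun _ => rfl, fun x => Finset.sum_eq_zero fun j _ => ?_⟩
  simp [hess]

/-- The orthogonal projection onto an eigenspace of the isometric involution. -/
theorem IsSpin.exists_proj [Nontrivial V] {t : V →ₗ[ℝ] ℝ} (h : IsSpin J t)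
    (ϑ : CartanInvolution J) {ε : ℝ} (hε : ε * ε = 1) : ∃ π : V →L[ℝ] V,
    (∀ x, π (π x) = π x) ∧ (∀ x y, ⟪π x, y⟫_ℝ = ⟪x, π y⟫_ℝ) ∧
    (∀ x, spinInv ϑ t x = ε • ((2 : ℝ) • π x - x)) ∧
    2 * ∑ j, ⟪stdOrthonormalBasis ℝ V j, π (stdOrthonormalBasis ℝ V j)⟫_ℝ =
      finrank ℝ V + ε * (2 - LinearMap.trace ℝ V ϑ.toFun) := by
  let P : V →ₗ[ℝ] V := (1 / 2 : ℝ) • (LinearMap.id + ε • spinInv ϑ t)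
  have hP : ∀ x, P x = (1 / 2 : ℝ) • (x + ε • spinInv ϑ t x) := fun _ => rfl
  refine ⟨LinearMap.toContinuousLinearMap P, fun x => ?_, fun x y => ?_, fun x => ?_, ?_⟩
  · change P (P x) = P x
    rw [hP (P x), hP x]
    simp only [map_add, map_smul, h.spinInv_spinInv]
    have e : (1 / 2 : ℝ) • ((1 / 2 : ℝ) • (x + ε • spinInv ϑ t x) +
        ε • (1 / 2 : ℝ) • (spinInv ϑ t x + ε • x)) =
        (1 / 4 + ε * ε / 4) • x + (1 / 2 * ε) • spinInv ϑ t x := by module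
    rw [e, hε]
    module
  · change ⟪P x, y⟫_ℝ = ⟪x, P y⟫_ℝ
    simp only [hP, real_inner_smul_left, inner_smul_right, inner_add_left, inner_add_right,
      h.spinInv_symm]
  · change _ = ε • ((2 : ℝ) • P x - x)
    rw [hP]
    have e : ε • ((2 : ℝ) • (1 / 2 : ℝ) • (x + ε • spinInv ϑ t x) - x) =
        (ε * ε) • spinInv ϑ t x := by module
    rw [e, hε, one_smul]
  · change 2 * ∑ j, ⟪stdOrthonormalBasis ℝ V j, P (stdOrthonormalBasis ℝ V j)⟫_ℝ = _
    rw [← LinearMap.trace_eq_sum_inner, map_smul, map_add, map_smul, h.trace_spinInv,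
      LinearMap.trace_id, smul_eq_mul, smul_eq_mul]
    ring

namespace IsJordanFrame

variable {c : Fin (splitRank J ϑ) → V} (hc : IsJordanFrame J ϑ c)
include hc

theorem trace_theta : LinearMap.trace ℝ V ϑ.toFun =
    2 * (finrank ℝ (plusSpace J ϑ) : ℝ) - finrank ℝ V := by
  have h := hc.trace_theta_proj (S := ⊤) (p := LinearMap.id)
    ⟨fun _ => trivial, fun _ _ => rfl⟩ fun _ _ => trivial
  rw [LinearMap.comp_id, top_inf_eq, finrank_top] at h
  exact h

/-- For `ℝ^{p,q}` the form `x ↦ |x|²` is on `𝒪` a multiple of a form on the smaller factor. -/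
theorem exists_proj_of_isRpq [Nontrivial V] {p q : ℕ} (h : J.IsRpq p q) :
    ∃ t : V →ₗ[ℝ] ℝ, IsSpin J t ∧ ∃ (ε : ℝ) (π : V →L[ℝ] V), ε * ε = 1 ∧
      (∀ x, π (π x) = π x) ∧ (∀ x y, ⟪π x, y⟫_ℝ = ⟪x, π y⟫_ℝ) ∧
      (∀ x, spinInv ϑ t x = ε • ((2 : ℝ) • π x - x)) ∧
      ∑ j, ⟪stdOrthonormalBasis ℝ V j, π (stdOrthonormalBasis ℝ V j)⟫_ℝ = (min p q : ℕ) := by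
  obtain ⟨t, ht, -⟩ := h.exists_isSpin
  have e2 := hc.trace_theta
  rw [(h.finrank_plusSpace ϑ).1, h.finrank_eq] at e2
  push_cast at e2
  -- The eigenspaces of the involution for `1` and `-1` have dimensions `p` and `q`; the smaller one
  -- is chosen.
  refine ⟨t, ht, if p ≤ q then 1 else -1, ?_⟩
  have hε : (if p ≤ q then (1 : ℝ) else -1) * (if p ≤ q then 1 else -1) = 1 := by
    split_ifs <;> norm_num
  obtain ⟨π, h1, h2, h3, h4⟩ := ht.exists_proj ϑ hε
  refine ⟨π, hε, h1, h2, h3, ?_⟩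
  have e3 : (finrank ℝ V : ℝ) = p + q := by exact_mod_cast h.finrank_eq
  rw [e2, e3] at h4
  split_ifs at h4 with hpq
  · rw [min_eq_left hpq]
    linarith
  · rw [min_eq_right (by omega)]
    linarith

/-- The radial vector alone does not suffice here: its Bessel derivatives involve harmonic factors.
Degrees up to `|p-q|/2` form a closed system, since raising from the top degree has coefficient
zero. -/
theorem W_le_of_isRpq [Nontrivial V] (hs : (plus J ϑ).IsSimple) {p q : ℕ} (h : J.IsRpq p q)
    (hp : 2 ≤ p) (hq : 2 ≤ q) (hpq : Even (p + q)) :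
    W J ϑ c (lam₁ J ϑ c) ≤ ⨆ i : ℕ × {k : ℕ // 2 * k ≤ ((p : ℤ) - (q : ℤ)).natAbs},
      KtPoly J ϑ c ((ν J ϑ c : ℝ) / 2 + (i.2 : ℕ) + i.1) ((i.2 : ℕ) + 2 * i.1) := by
  obtain ⟨t, ht, ε, π, hε, hπ, hsymm, hS, hm⟩ := hc.exists_proj_of_isRpq h
  obtain ⟨hd, hν⟩ := hc.ν_of_isRpq hs h (by omega)
  have h2 := hc.splitRank_of_isRpq h
  rw [if_neg (by omega)] at h2
  have hr := rank_pos ϑ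
  set N := ((p : ℤ) - (q : ℤ)).natAbs with hN
  have hνN : (ν J ϑ c : ℝ) = (min p q : ℕ) - 2 := by
    rw [hν]; push_cast; rfl
  have hν0 : (0 : ℝ) ≤ ν J ϑ c := by
    have : 0 ≤ ν J ϑ c := by omega
    exact_mod_cast this
  -- From `r₀ = 2` one gets `rλ₁ = d = p + q - 2`, while `ν = min(p,q) - 2`. For the order `α = ν/2
  -- + k` this makes the defect `δ` of `besselOp_besselMul` equal to `N - 2k`.
  have hlam : J.rank * lam₁ J ϑ c = 2 * (ν J ϑ c : ℝ) + 2 + N := by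
    have e1 : J.rank * lam₁ J ϑ c = dConst J ϑ c := by
      rw [lam₁, h2]
      push_cast
      field_simp
    have e2 : (dConst J ϑ c : ℤ) = 2 * ν J ϑ c + 2 + N := by omega
    rw [e1]
    exact_mod_cast e2
  -- On the null cone the two eigencomponents of `x` have equal length.
  have hnorm : ∀ x ∈ 𝒪 J ϑ c, scale J ϑ * ‖x‖ ^ 2 = J.rank * ‖π x‖ ^ 2 := by
    intro x hx
    have e1 := hc.inner_spinInv_self ht h2 hs hx
    rw [hS, inner_smul_right, inner_sub_right, inner_smul_right, real_inner_self_eq_norm_sq,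
      ← hπ, ← hsymm, real_inner_self_eq_norm_sq] at e1
    have e2 : ε ≠ 0 := fun h0 => by rw [h0] at hε; norm_num at hε
    have e3 := (mul_eq_zero.1 e1).resolve_left e2
    rw [scale, h2]
    push_cast
    linear_combination (-(J.rank : ℝ) / 2) * e3
  have hne : ∀ x ∈ 𝒪 J ϑ c, π x ≠ 0 := by
    intro x hx h0
    have e1 := hc.scale_mul_pos (hc.ne_zero_of_mem hx)
    rw [hnorm x hx, h0] at e1
    simp at e1
  let W₀ : Set (V → ℂ) := {Ψ | ∃ k : ℕ, 2 * k ≤ N ∧ ∃ φ, IsHarm π k φ ∧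
    Ψ = fun y => besselMul J.rank ((ν J ϑ c : ℝ) / 2 + k) φ (π y)}
  have hW : ∀ k, 2 * k ≤ N → ∀ φ, IsHarm π k φ →
      Gen J W₀ fun y => besselMul J.rank ((ν J ϑ c : ℝ) / 2 + k) φ (π y) :=
    fun k hk φ hφ => Gen.base ⟨k, hk, φ, hφ, rfl⟩
  have hval : ∀ (α : ℝ) (φ : V → ℂ) (x : 𝒪 J ϑ c), φ (π x) = φ x →
      besselMul J.rank α φ (π x) = radial J ϑ c α x * φ x := by
    intro α φ x hφ
    rw [besselMul, hφ, radial_eq, hnorm x x.2, radialExt]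
  refine hc.W_le hs (fun _ => rfl) (U := {y | π y ≠ 0}) (W₀ := W₀)
    (isOpen_compl_singleton.preimage π.continuous) hne ?_ ?_ ?_ ?_
    (fun ψ hψ u => inner_mul_mem_iSup hψ u)
    (fun ψ hψ => hc.deriv_mem_iSup
      (fun i => ⟨(i.1 + 1, i.2), by push_cast; ring, by dsimp only; omega⟩) hψ)
  · rintro _ ⟨k, -, φ, hφ, rfl⟩
    exact (smooth_besselMul hr hφ.poly).comp π.contDiff.contDiffOn fun y hy => hy
  · rintro _ ⟨k, hk, φ, hφ, rfl⟩ v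
    set α : ℝ := (ν J ϑ c : ℝ) / 2 + k with hα
    set a := π (ϑ.toFun v) with ha
    have hα1 : 2 * α = (∑ j, ⟪stdOrthonormalBasis ℝ V j, π (stdOrthonormalBasis ℝ V j)⟫_ℝ) - 2 +
        2 * k := by
      rw [hm, hα, hνN]
      ring
    have hα0 : k ≠ 0 → α ≠ 0 := fun hk0 => by
      have : (0 : ℝ) < k := by exact_mod_cast Nat.pos_of_ne_zero hk0
      positivity
    have h1 : ∃ Φ, Gen J W₀ Φ ∧ ∀ x, ((-(((N : ℝ) - 2 * k) / 2) : ℝ) : ℂ) *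
        besselMul J.rank (α + 1) (IsHarm.raise π φ α a) (π x) = Φ x := by
      -- At the top degree the raising coefficient is zero. Below it, parity of `p + q` makes `N`
      -- even, so `k + 1` is still admissible.
      by_cases hkN : 2 * k = N
      · refine ⟨_, Gen.zero, fun x => ?_⟩
        rw [← hkN]
        push_cast
        ring
      · have hk' : 2 * (k + 1) ≤ N := by
          obtain ⟨s, hs⟩ := hpq
          omega
        refine ⟨_, (hW (k + 1) hk' _
          (hφ.isHarm_raise hπ hsymm (hπ (ϑ.toFun v)) hα1 hα0)).const_mul
          ((-(((N : ℝ) - 2 * k) / 2) : ℝ) : ℂ), fun x => ?_⟩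
        rw [show (ν J ϑ c : ℝ) / 2 + (k + 1 : ℕ) = α + 1 by rw [hα]; push_cast; ring]
    have h2 : ∃ Φ, Gen J W₀ Φ ∧ ∀ x, ((-((4 + ((N : ℝ) - 2 * k) / α) / J.rank) : ℝ) : ℂ) *
        besselMul J.rank (α - 1) (fun y => fderiv ℝ φ y a) (π x) = Φ x := by
      rcases k with _ | k
      · refine ⟨_, Gen.zero, fun x => ?_⟩
        rw [besselMul, hφ.poly.fderiv_eq_zero, mul_zero, mul_zero]
      · refine ⟨_, (hW k (by omega) _ (hφ.fderiv_succ hπ (hπ (ϑ.toFun v)))).const_mul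
          ((-((4 + ((N : ℝ) - 2 * (k + 1 : ℕ)) / α) / J.rank) : ℝ) : ℂ), fun x => ?_⟩
        rw [show (ν J ϑ c : ℝ) / 2 + k = α - 1 by rw [hα]; push_cast; ring]
    obtain ⟨Φ₁, hΦ₁, e1⟩ := h1
    obtain ⟨Φ₂, hΦ₂, e2⟩ := h2
    refine ⟨_, (((hW k hk φ hφ).inner_mul (ϑ.toFun v)).add hΦ₁).add hΦ₂,
      fun x hx => ?_⟩
    rw [← e1, ← e2]
    exact ht.besselOp_besselMul hπ hsymm hε hS hφ hα1 hα0 (by rw [hlam, hα]; ring) v (hne x hx)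
  · refine ⟨_, hW 0 (Nat.zero_le _) _ (IsHarm.one π), fun x => ?_⟩
    rw [ψ₀, if_pos (by omega)]
    exact ((hval _ _ x rfl).trans (by rw [mul_one, Nat.cast_zero, add_zero])).symm
  · rintro _ ⟨k, hk, φ, hφ, rfl⟩
    have h3 := mem_KtPoly (J := J) (ϑ := ϑ) (c := c) ((ν J ϑ c : ℝ) / 2 + k) le_rfl hφ.poly
    have h4 := le_iSup (fun i : ℕ × {k : ℕ // 2 * k ≤ N} =>
      KtPoly J ϑ c ((ν J ϑ c : ℝ) / 2 + (i.2 : ℕ) + i.1) ((i.2 : ℕ) + 2 * i.1)) (0, ⟨k, hk⟩)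
    simp only [Nat.cast_zero, add_zero, mul_zero] at h4
    convert h4 h3 using 1
    ext x
    exact hval _ _ x (hφ.comp x)

section L2

variable [MeasurableSpace V] [BorelSpace V]

theorem subsetL2_of_isRpq [Nontrivial V] (hs : (plus J ϑ).IsSimple) {p q : ℕ} (h : J.IsRpq p q)
    (hp : 2 ≤ p) (hq : 2 ≤ q) : SubsetL2 J ϑ c (lam₁ J ϑ c)
      (⨆ i : ℕ × {k : ℕ // 2 * k ≤ ((p : ℤ) - (q : ℤ)).natAbs},
        KtPoly J ϑ c ((ν J ϑ c : ℝ) / 2 + (i.2 : ℕ) + i.1) ((i.2 : ℕ) + 2 * i.1)) := by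
  obtain ⟨hd, hν⟩ := hc.ν_of_isRpq hs h (by omega)
  have h2 := hc.splitRank_of_isRpq h
  rw [if_neg (by omega)] at h2
  have hr := rank_pos ϑ
  have hlam : lam₁ J ϑ c * J.rank = dConst J ϑ c := by
    rw [lam₁, h2]
    push_cast
    field_simp
  refine hc.subsetL2_iSup hs fun ⟨l, k, hk⟩ => ?_
  -- The `l` terms cancel in the integrability condition, leaving `2ν + 2k < 2ν + 2 + |p-q|`.
  have e1 : 2 * ν J ϑ c + 2 * (k : ℤ) < dConst J ϑ c := by omega
  have e2 : 0 ≤ ν J ϑ c := by omega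
  have e1' : 2 * (ν J ϑ c : ℝ) + 2 * k < dConst J ϑ c := by exact_mod_cast e1
  have e2' : (0 : ℝ) ≤ ν J ϑ c := by exact_mod_cast e2
  rw [hlam, max_eq_left (by positivity)]
  push_cast
  linarith

theorem subsetL2_of_three_le_rank (hV : Nontrivial V) (hs : (plus J ϑ).IsSimple)
    (hr : 3 ≤ J.rank) : SubsetL2 J ϑ c (lam₁ J ϑ c)
      (⨆ l : ℕ, KtPoly J ϑ c ((ν J ϑ c : ℝ) / 2 + l) (2 * l)) := by
  have h1 := (hc.dichotomy hs hV hr).1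
  have hr := rank_pos ϑ
  have hd0 := d₀Const_pos hc hs h1
  have hd := hc.d₀Const_le c
  have he : 0 ≤ eConst J ϑ c := by
    have e1 := hc.finrank_diag_plus ⟨0, hc.splitRank_pos⟩
    have e2 := Submodule.finrank_mono (inf_le_left : peirce J ϑ c ⟨0, hc.splitRank_pos⟩
      ⟨0, hc.splitRank_pos⟩ ⊓ plusSpace J ϑ ≤ _)
    rw [hc.eConst_eq]
    omega
  -- Use `2 min(d, 2d₀) ≤ d + 2d₀`; the right side of the integrability condition contains `λ₁ r =
  -- r₀ d/2 ≥ d`.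
  have hν : 2 * ν J ϑ c < dConst J ϑ c := by
    rw [ν]
    omega
  have hlam : (dConst J ϑ c : ℝ) ≤ lam₁ J ϑ c * J.rank := by
    have e1 : lam₁ J ϑ c * J.rank = dConst J ϑ c + (splitRank J ϑ - 2) * dConst J ϑ c / 2 := by
      rw [lam₁]
      field_simp
      ring
    have e2 : (2 : ℝ) ≤ splitRank J ϑ := by exact_mod_cast h1
    have e3 : 0 ≤ ((splitRank J ϑ : ℝ) - 2) * dConst J ϑ c / 2 :=
      div_nonneg (mul_nonneg (by linarith) (Nat.cast_nonneg _)) zero_le_two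
    linarith
  refine hc.subsetL2_iSup hs fun l => ?_
  have hν' : 2 * (ν J ϑ c : ℝ) < dConst J ϑ c := by exact_mod_cast hν
  have hd' : (0 : ℝ) < dConst J ϑ c := by
    have : 0 < dConst J ϑ c := by omega
    exact_mod_cast this
  have hl : (0 : ℝ) ≤ l := Nat.cast_nonneg l
  push_cast
  rcases max_cases ((ν J ϑ c : ℝ) / 2 + l) 0 with ⟨e, -⟩ | ⟨e, -⟩ <;> rw [e] <;> linarith

end L2

end IsJordanFrame

end MinRep.JordanAlgebra

end

/-! ### Assembly of the four statements. -/

theorem mainTheorem9 {V : Type*} [NormedAddCommGroup V] [InnerProductSpace ℝ V]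
    [FiniteDimensional ℝ V] [MeasurableSpace V] [BorelSpace V]
    (J : MinRep.JordanAlgebra V) (ϑ : J.CartanInvolution)
    (hV : J.IsSimple) (hVplus : (J.plus ϑ).IsSimple)
    (c : Fin (J.splitRank ϑ) → V) (hc : J.IsJordanFrame ϑ c) :
    (3 ≤ J.rank →
      J.W ϑ c (J.lam₁ ϑ c) ≤ ⨆ l : ℕ, J.KtPoly ϑ c ((J.ν ϑ c : ℝ) / 2 + l) (2 * l) ∧
      J.SubsetL2 ϑ c (J.lam₁ ϑ c)
        (⨆ l : ℕ, J.KtPoly ϑ c ((J.ν ϑ c : ℝ) / 2 + l) (2 * l))) ∧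
    (∀ p q : ℕ, 2 ≤ p → 2 ≤ q → Even (p + q) → J.IsRpq p q →
      J.W ϑ c (J.lam₁ ϑ c) ≤
        ⨆ l : ℕ, ⨆ k : ℕ, ⨆ _ : 2 * k ≤ ((p : ℤ) - (q : ℤ)).natAbs,
          J.KtPoly ϑ c ((J.ν ϑ c : ℝ) / 2 + k + l) (k + 2 * l) ∧
      J.SubsetL2 ϑ c (J.lam₁ ϑ c)
        (⨆ l : ℕ, ⨆ k : ℕ, ⨆ _ : 2 * k ≤ ((p : ℤ) - (q : ℤ)).natAbs,
          J.KtPoly ϑ c ((J.ν ϑ c : ℝ) / 2 + k + l) (k + 2 * l))) ∧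
    (∀ k : ℕ, 1 ≤ k → J.IsRpq k 0 →
      J.ν ϑ c = -(k : ℤ) ∧
      ∀ lam σ : ℝ, 0 < lam → σ = (J.rank : ℝ) * lam →
        J.W ϑ c lam ≤ ⨆ l : ℕ, J.KtPoly ϑ c (((J.ν ϑ c : ℝ) + σ) / 2 + l) (2 * l) ∧
        (J.SubsetL2 ϑ c lam (J.W ϑ c lam) ↔ σ ∈ Set.Ioo (0 : ℝ) (2 * k))) ∧
    (J.splitRank ϑ = 1 → ∀ lam σ : ℝ, 0 < lam → σ = (J.rank : ℝ) * lam →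
      (J.SubsetL2 ϑ c lam (J.W ϑ c lam) ↔ σ ∈ Set.Ioo (0 : ℝ) (-2 * (J.ν ϑ c : ℝ)))) := by
  have hN : Nontrivial V := hV.1
  refine ⟨fun hr => ⟨hc.W_le_of_three_le_rank hN hVplus hr,
    hc.subsetL2_of_three_le_rank hN hVplus hr⟩, fun p q hp hq hpq h => ?_, fun k _ h => ?_,
    fun h1 lam σ hlam hσ => ?_⟩
  -- The nested suprema are merged into one indexed family, the form required by the stability
  -- lemmas.
  · have e : (⨆ l : ℕ, ⨆ k : ℕ, ⨆ _ : 2 * k ≤ ((p : ℤ) - (q : ℤ)).natAbs,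
        J.KtPoly ϑ c ((J.ν ϑ c : ℝ) / 2 + k + l) (k + 2 * l)) =
        ⨆ i : ℕ × {k : ℕ // 2 * k ≤ ((p : ℤ) - (q : ℤ)).natAbs},
          J.KtPoly ϑ c ((J.ν ϑ c : ℝ) / 2 + (i.2 : ℕ) + i.1) ((i.2 : ℕ) + 2 * i.1) := by
      rw [iSup_prod]
      exact iSup_congr fun l => iSup_subtype'
    rw [e]
    exact ⟨hc.W_le_of_isRpq hVplus h hp hq hpq, hc.subsetL2_of_isRpq hVplus h hp hq⟩
  · have h1 := hc.splitRank_of_isRpq h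
    rw [if_pos rfl] at h1
    have hn : finrank ℝ V = k := by rw [h.finrank_eq, add_zero]
    refine ⟨by rw [hc.ν_of_splitRank_eq_one h1, hn], ?_⟩
    rintro lam _ hlam rfl
    refine ⟨hc.W_le_of_splitRank_eq_one hVplus h1 lam, ?_⟩
    rw [hc.subsetL2_iff hVplus h1 hlam, hn]
  · rw [hc.subsetL2_iff hVplus h1 hlam, hσ, hc.ν_of_splitRank_eq_one h1]
    push_cast
    rw [neg_mul_neg]
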